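/- Work over $\mathbb{Q}$ and let $n\ge 2$. **The complex.** A generator of $J^\star_{0,n}$ is a finite, possibly disconnected, simple graph whose vertices are either internal (of valence at least $3$) or external (of valence $1$); each external vertex is decorated by an element of $\{\epsilon,\omega,1,\dots,n\}$, where each of $1,\dots,n$ and $\omega$ is used exactly once and $\epsilon$ any number of times, such that: (a) the graph obtained by identifying all external vertices decorated by $\epsilon$ or $\omega$ is connected of genus (first Betti number) $0$; (b) no connected component is an edge joining an $\epsilon$ to an $\omega$; (c) the connected components without $\omega$-decoration have no internal vertices and contain, all together, at most one of the decorations $1,\dots,n$; (d) the component containing $\omega$ has a further decoration in $\{\epsilon,1,\dots,n\}$. An edge is structural if it contains no external vertex decorated by one of $1,\dots,n$. Each generator carries a total ordering of its structural edges; isomorphic generators are identified, and permuting the structural edges is multiplication by the sign of the permutation. The degree of a generator is the number of its structural edges plus one. The differential is $\delta=\delta_{split}+\delta_{join}$. Here $\delta_{split}$ is the sum over all internal vertices $v$ and all ways to split $v$ into two vertices of valence at least $3$ joined by a new edge. The map $\delta_{join}$ is the sum over all sets $S$ of at least two $\epsilon$- or $\omega$-decorated external vertices, where one glues the vertices of $S$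 to one internal vertex and attaches there a new edge to a new external vertex, which is decorated by $\omega$ if $S$ contains the $\omega$-vertex and by $\epsilon$ otherwise (graphs with loops or double edges are zero). In both cases the new edge is put first in the ordering. The symmetric group $\mathbb{S}_n$ acts by permuting the decorations $1,\dots,n$. **The free Lie algebra.** For $I\subset\{1,\dots,n\}$ let $\mathsf{Lie}(x_i: i\in I)$ be the part of the free Lie algebra on the generators $x_i$, $i\in I$, spanned by the bracket words in which each $x_i$, $i\in I$, appears exactly once. The group $\mathbb{S}_n$ acts on $\bigoplus_{j=1}^n\mathsf{Lie}(x_1,\dots,\hat x_j,\dots,x_n)$ by $x_i\mapsto x_{\pi(i)}$, where $\pi$ maps the $j$-th summand to the $\pi(j)$-th. **Proposition.** One has $\delta^2=0$ on $J^\star_{0,n}$. The cohomology $H(J^\star_{0,n},\delta)$ vanishes in all degrees other than $n-1$, and $\dim H^{n-1}(J^\star_{0,n},\delta)=(n-2)!$. Moreover there is an $\mathbb{S}_n$-equivariant isomorphism $$H^{n-1}(J^\star_{0,n},\delta)\otimes\mathrm{sgn}_n\;\cong\;\ker\Big(\bigoplus_{j=1}^n\mathsf{Lie}(x_1,\dots,\hat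 x_j,\dots,x_n)\to\mathsf{Lie}(x_1,\dots,x_n),\ (F_j)_j\mapsto\sum_{j=1}^n[x_j,F_j]\Big).$$ -/

import Mathlib

noncomputable section

/-! ### Graphs with decorated external vertices -/

/-- The decorations of external vertices: `ε`, `ω`, or one of the `n` numbers. -/
inductive JLabel (n : ℕ) : Type
  | eps : JLabel n
  | omega : JLabel n
  | num (j : Fin n) : JLabel n

/-- A simple graph on the vertex set `V`; `label v = none` says that `v` is internal, and
`label v = some a` that `v` is external with decoration `a`. -/
structure MarkedGraph (n : ℕ) (V : Type) where
  graph : SimpleGraph V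
  label : V → Option (JLabel n)

/-- The action of permutations of the numbers on decorations. -/
def JLabel.perm {n : ℕ} (π : Equiv.Perm (Fin n)) : JLabel n → JLabel n
  | .eps => .eps
  | .omega => .omega
  | .num j => .num (π j)

namespace MarkedGraph

variable {n : ℕ} {V W : Type}

/-- External vertices decorated by `ε` or `ω`. -/
def IsSpecial (Γ : MarkedGraph n V) (v : V) : Prop :=
  Γ.label v = some JLabel.eps ∨ Γ.label v = some JLabel.omega

/-- The edges that do not contain an external vertex decorated by a number. -/
def structuralEdges (Γ : MarkedGraph n V) : Set (Sym2 V) :=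
  {e | e ∈ Γ.graph.edgeSet ∧ ∀ v ∈ e, ∀ j : Fin n, Γ.label v ≠ some (JLabel.num j)}

/-- `v` lies in a connected component that has an `ω`-decoration. -/
def InOmegaComponent (Γ : MarkedGraph n V) (v : V) : Prop :=
  ∃ w, Γ.label w = some JLabel.omega ∧ Γ.graph.Reachable v w

/-- The graphs that generate `J^⋆_{g,n}`. -/
structure IsGenerator (g : ℕ) (Γ : MarkedGraph n V) : Prop where
  /-- Internal vertices are at least trivalent. -/
  internal : ∀ v, Γ.label v = none → 3 ≤ (Γ.graph.neighborSet v).ncard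
  /-- External vertices are univalent. -/
  external : ∀ v, Γ.label v ≠ none → (Γ.graph.neighborSet v).ncard = 1
  /-- Each of the numbers decorates exactly one external vertex. -/
  num_once : ∀ j : Fin n, ∃! v, Γ.label v = some (JLabel.num j)
  /-- There is exactly one `ω`-decoration. -/
  omega_once : ∃! v, Γ.label v = some JLabel.omega
  /-- The graph obtained by joining all `ε`- and `ω`-vertices to one vertex is connected. -/
  connected : ∀ v, ∃ s, Γ.IsSpecial s ∧ Γ.graph.Reachable v s
  /-- The joined graph has genus `g`. If `k` vertices are joined, it has `|V| - k + 1` vertices and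
  `|E|` edges, so its first Betti number is `|E| - |V| + k`. -/
  genus : Γ.graph.edgeSet.ncard + {v | Γ.IsSpecial v}.ncard = g + Nat.card V
  /-- No connected component is an `(ε, ω)`-edge. -/
  no_eps_omega : ∀ v w, Γ.graph.Adj v w → Γ.label v = some JLabel.eps →
    Γ.label w ≠ some JLabel.omega
  /-- The components without `ω`-decoration have no internal vertices. -/
  eps_internal : ∀ v, Γ.label v = none → Γ.InOmegaComponent v
  /-- The components without `ω`-decoration contain, all together, at most one number. -/
  eps_num : ∀ v w i j, Γ.label v = some (JLabel.num i) → Γ.label w = some (JLabel.num j) →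
    ¬ Γ.InOmegaComponent v → ¬ Γ.InOmegaComponent w → i = j
  /-- The component of `ω` is not isolated: it has another decoration `ε` or a number. -/
  nonisolated : ∃ v, Γ.InOmegaComponent v ∧
    (Γ.label v = some JLabel.eps ∨ ∃ j, Γ.label v = some (JLabel.num j))

/-- `o` is a total ordering of the structural edges. -/
def IsOrdering {e : ℕ} (Γ : MarkedGraph n V) (o : Fin e → Sym2 V) : Prop :=
  Function.Injective o ∧ Set.range o = Γ.structuralEdges

/-- `f` is an isomorphism of graphs with decorations. -/
def IsIso (f : V ≃ W) (Γ : MarkedGraph n V) (Γ' : MarkedGraph n W) : Prop :=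
  (∀ u v, Γ'.graph.Adj (f u) (f v) ↔ Γ.graph.Adj u v) ∧ ∀ v, Γ'.label (f v) = Γ.label v

/-- Permuting the numbers. -/
def relabel (π : Equiv.Perm (Fin n)) (Γ : MarkedGraph n V) : MarkedGraph n V where
  graph := Γ.graph
  label v := (Γ.label v).map (JLabel.perm π)

/-- Where the half-edge at `u` of an edge from `u` to `w` is attached after splitting `v`: the
vertex `v` becomes two vertices `some v` and `none`, and the half-edges at `v` that lead to a
vertex in `A` are attached to `none`. -/
def splitEnd (v : V) (A : Finset V) (u w : V) : Option V :=
  open scoped Classical in if u = v ∧ w ∈ A then none else some u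

/-- What becomes of an edge when `v` is split. -/
def splitEdge (v : V) (A : Finset V) : Sym2 V → Sym2 (Option V) :=
  Sym2.lift ⟨fun u w => s(splitEnd v A u w, splitEnd v A w u), fun _ _ => Sym2.eq_swap⟩

/-- The graph obtained by splitting `v` into two vertices, joined by a new edge; the edges from `v`
to the vertices in `A` are moved to the second vertex. -/
def split (Γ : MarkedGraph n V) (v : V) (A : Finset V) : MarkedGraph n (Option V) where
  graph := SimpleGraph.fromEdgeSet
    (insert s(some v, none) (splitEdge v A '' Γ.graph.edgeSet))
  label u := u.elim none Γ.label

/-- `v` is internal, `A` is a set of neighbours of `v`, and both vertices that arise by splitting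
are at least trivalent. -/
def SplitAdmissible (Γ : MarkedGraph n V) (v : V) (A : Finset V) : Prop :=
  Γ.label v = none ∧ (∀ u ∈ A, Γ.graph.Adj v u) ∧ 2 ≤ A.card ∧
    A.card + 2 ≤ (Γ.graph.neighborSet v).ncard

/-- The vertices after joining `S`: those not in `S`, the new internal vertex `inr false` to which
the vertices in `S` are glued, and the new external vertex `inr true`. -/
abbrev JoinVertex (S : Finset V) : Type := {v : V // v ∉ S} ⊕ Bool

/-- The map that glues the vertices in `S`. -/
def glue (S : Finset V) (u : V) : JoinVertex S :=
  open scoped Classical in if h : u ∈ S then Sum.inr false else Sum.inl ⟨u, h⟩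

/-- The graph obtained by gluing the vertices in `S` to one internal vertex, and attaching a new
edge to a new external vertex there; the new external vertex is decorated by `ω` if `S` has an
`ω`-decorated vertex, and by `ε` otherwise. (If this creates a loop or a double edge, the result
counts as zero, see `cls`.) -/
def join (Γ : MarkedGraph n V) (S : Finset V) : MarkedGraph n (JoinVertex S) where
  graph := SimpleGraph.fromEdgeSet
    (insert s(Sum.inr false, Sum.inr true) (Sym2.map (glue S) '' Γ.graph.edgeSet))
  label := Sum.elim (fun v => Γ.label v) (fun b => open scoped Classical in
    if b = true then
      (if ∃ u ∈ S, Γ.label u = some JLabel.omega then some JLabel.omega else some JLabel.eps)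
    else none)

/-- `S` is a set of at least two `ε`- or `ω`-decorated vertices. (As there is only one
`ω`-decoration, `S` contains at most one.) -/
def JoinAdmissible (Γ : MarkedGraph n V) (S : Finset V) : Prop :=
  (∀ u ∈ S, Γ.IsSpecial u) ∧ 2 ≤ S.card

/-! Compatibility of these notions with isomorphisms and with permutations of the numbers. -/

theorem sym2_map_surjective (f : V ≃ W) : Function.Surjective (Sym2.map f) := fun e =>
  ⟨Sym2.map f.symm e, by rw [Sym2.map_map]; simp⟩

theorem sym2_map_mem_image_iff (f : V ≃ W) (T : Set (Sym2 V)) (a b : V) :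
    s(f a, f b) ∈ Sym2.map f '' T ↔ s(a, b) ∈ T := by
  rw [← Sym2.map_mk]
  exact (Sym2.map.injective f.injective).mem_set_image

theorem fromEdgeSet_adj_iff (f : V ≃ W) {T : Set (Sym2 V)} {T' : Set (Sym2 W)}
    (h : T' = Sym2.map f '' T) (a b : V) :
    (SimpleGraph.fromEdgeSet T').Adj (f a) (f b) ↔ (SimpleGraph.fromEdgeSet T).Adj a b := by
  subst h
  simp only [SimpleGraph.fromEdgeSet_adj, sym2_map_mem_image_iff, ne_eq, f.injective.eq_iff]

namespace IsIso

variable {f : V ≃ W} {Γ : MarkedGraph n V} {Γ' : MarkedGraph n W}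

theorem symm (h : IsIso f Γ Γ') : IsIso f.symm Γ' Γ := by
  refine ⟨fun u v => ?_, fun v => ?_⟩
  · rw [← h.1]; simp
  · rw [← h.2]; simp

theorem refl (Γ : MarkedGraph n V) : IsIso (Equiv.refl V) Γ Γ := ⟨fun _ _ => Iff.rfl, fun _ => rfl⟩

/-- The underlying isomorphism of graphs. -/
def toIso (h : IsIso f Γ Γ') : Γ.graph ≃g Γ'.graph := ⟨f, fun {u v} => h.1 u v⟩

theorem neighborSet (h : IsIso f Γ Γ') (v : V) :
    Γ'.graph.neighborSet (f v) = f '' Γ.graph.neighborSet v := by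
  ext w
  obtain ⟨w, rfl⟩ := f.surjective w
  simp [h.1]

theorem ncard_neighborSet (h : IsIso f Γ Γ') (v : V) :
    (Γ'.graph.neighborSet (f v)).ncard = (Γ.graph.neighborSet v).ncard := by
  rw [h.neighborSet, Set.ncard_image_of_injective _ f.injective]

theorem edgeSet (h : IsIso f Γ Γ') : Γ'.graph.edgeSet = Sym2.map f '' Γ.graph.edgeSet := by
  ext e
  obtain ⟨e, rfl⟩ := sym2_map_surjective f e
  rw [(Sym2.map.injective f.injective).mem_set_image]
  induction e with | _ a b => exact h.1 a b

theorem structuralEdges (h : IsIso f Γ Γ') :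
    Γ'.structuralEdges = Sym2.map f '' Γ.structuralEdges := by
  ext e
  obtain ⟨e, rfl⟩ := sym2_map_surjective f e
  rw [(Sym2.map.injective f.injective).mem_set_image]
  simp only [MarkedGraph.structuralEdges, Set.mem_ofPred_eq, h.edgeSet,
    (Sym2.map.injective f.injective).mem_set_image, Sym2.mem_map]
  refine and_congr_right fun _ => ⟨fun H v hv j => ?_, ?_⟩
  · rw [← h.2]; exact H _ ⟨v, hv, rfl⟩ j
  · rintro H _ ⟨v, hv, rfl⟩ j
    rw [h.2]; exact H v hv j

theorem isSpecial (h : IsIso f Γ Γ') (v : V) : Γ'.IsSpecial (f v) ↔ Γ.IsSpecial v := by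
  simp [IsSpecial, h.2]

theorem reachable (h : IsIso f Γ Γ') (u v : V) :
    Γ'.graph.Reachable (f u) (f v) ↔ Γ.graph.Reachable u v :=
  SimpleGraph.Iso.reachable_iff (φ := h.toIso)

theorem inOmegaComponent (h : IsIso f Γ Γ') (v : V) :
    Γ'.InOmegaComponent (f v) ↔ Γ.InOmegaComponent v := by
  simp only [InOmegaComponent, f.surjective.exists, h.2, h.reachable]

theorem isGenerator {g : ℕ} (h : IsIso f Γ Γ') (H : Γ.IsGenerator g) : Γ'.IsGenerator g where
  internal := by simpa only [f.surjective.forall, h.2, h.ncard_neighborSet] using H.internal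
  external := by simpa only [f.surjective.forall, h.2, h.ncard_neighborSet] using H.external
  num_once j := by
    obtain ⟨v, hv, hu⟩ := H.num_once j
    refine ⟨f v, by simpa [h.2] using hv, ?_⟩
    simpa only [f.surjective.forall, h.2, f.injective.eq_iff] using hu
  omega_once := by
    obtain ⟨v, hv, hu⟩ := H.omega_once
    refine ⟨f v, by simpa [h.2] using hv, ?_⟩
    simpa only [f.surjective.forall, h.2, f.injective.eq_iff] using hu
  connected := by
    simpa only [f.surjective.forall, f.surjective.exists, h.isSpecial, h.reachable]
      using H.connected
  genus := by
    have h1 : {w | Γ'.IsSpecial w} = f '' {v | Γ.IsSpecial v} := by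
      ext w
      obtain ⟨w, rfl⟩ := f.surjective w
      simp [h.isSpecial]
    rw [h.edgeSet, Set.ncard_image_of_injective _ (Sym2.map.injective f.injective), h1,
      Set.ncard_image_of_injective _ f.injective, ← Nat.card_congr f]
    exact H.genus
  no_eps_omega := by
    simpa only [f.surjective.forall, h.1, h.2] using H.no_eps_omega
  eps_internal := by
    simpa only [f.surjective.forall, h.2, h.inOmegaComponent] using H.eps_internal
  eps_num := by
    simpa only [f.surjective.forall, h.2, h.inOmegaComponent] using H.eps_num
  nonisolated := by
    simpa only [f.surjective.exists, h.2, h.inOmegaComponent] using H.nonisolated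

theorem isGenerator_iff {g : ℕ} (h : IsIso f Γ Γ') : Γ'.IsGenerator g ↔ Γ.IsGenerator g :=
  ⟨h.symm.isGenerator, h.isGenerator⟩

theorem isOrdering {e : ℕ} {o : Fin e → Sym2 V} {o' : Fin e → Sym2 W} (h : IsIso f Γ Γ')
    (σ : Equiv.Perm (Fin e)) (ho : ∀ i, o' i = Sym2.map f (o (σ i))) :
    Γ'.IsOrdering o' ↔ Γ.IsOrdering o := by
  have h1 : o' = Sym2.map f ∘ o ∘ σ := funext ho
  have hi := Sym2.map.injective f.injective
  rw [IsOrdering, IsOrdering, h.structuralEdges, h1, hi.of_comp_iff, σ.injective_comp, Set.range_comp,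
    hi.image_injective.eq_iff, σ.surjective.range_comp]

theorem splitAdmissible (h : IsIso f Γ Γ') (v : V) (A : Finset V) :
    Γ'.SplitAdmissible (f v) (f.finsetCongr A) ↔ Γ.SplitAdmissible v A := by
  simp only [SplitAdmissible, h.2, h.ncard_neighborSet, f.surjective.forall, h.1,
    Equiv.finsetCongr_apply, Finset.mem_map_equiv, Equiv.symm_apply_apply, Finset.card_map]

theorem map_splitEdge (f : V ≃ W) (v : V) (A : Finset V) (e : Sym2 V) :
    splitEdge (f v) (f.finsetCongr A) (Sym2.map f e) =
      Sym2.map (Equiv.optionCongr f) (splitEdge v A e) := by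
  have key : ∀ a b : V, splitEnd (f v) (f.finsetCongr A) (f a) (f b) =
      Equiv.optionCongr f (splitEnd v A a b) := by
    intro a b
    have hc : (f a = f v ∧ f b ∈ f.finsetCongr A) ↔ (a = v ∧ b ∈ A) := by simp
    by_cases h : a = v ∧ b ∈ A
    · rw [splitEnd, splitEnd, if_pos h, if_pos (hc.2 h)]; rfl
    · rw [splitEnd, splitEnd, if_neg h, if_neg (mt hc.1 h)]; rfl
  induction e with | _ a b => simp only [splitEdge, Sym2.map_mk, Sym2.lift_mk, key]

theorem split (h : IsIso f Γ Γ') (v : V) (A : Finset V) :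
    IsIso (Equiv.optionCongr f) (Γ.split v A) (Γ'.split (f v) (f.finsetCongr A)) := by
  refine ⟨fun a b => fromEdgeSet_adj_iff _ ?_ a b, fun a => ?_⟩
  · rw [Set.image_insert_eq, h.edgeSet, Set.image_image, Set.image_image]
    congr 1
    exact Set.image_congr fun e _ => map_splitEdge f v A e
  · cases a <;> simp [MarkedGraph.split, h.2]

theorem joinAdmissible (h : IsIso f Γ Γ') (S : Finset V) :
    Γ'.JoinAdmissible (f.finsetCongr S) ↔ Γ.JoinAdmissible S := by
  simp only [JoinAdmissible, f.surjective.forall, h.isSpecial,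
    Equiv.finsetCongr_apply, Finset.mem_map_equiv, Equiv.symm_apply_apply, Finset.card_map]

/-- The bijection of vertices after joining. -/
def joinEquiv (f : V ≃ W) (S : Finset V) : JoinVertex S ≃ JoinVertex (f.finsetCongr S) :=
  Equiv.sumCongr (f.subtypeEquiv fun a => by simp) (Equiv.refl Bool)

theorem joinEquiv_glue (f : V ≃ W) (S : Finset V) (a : V) :
    glue (f.finsetCongr S) (f a) = joinEquiv f S (glue S a) := by
  have hc : f a ∈ f.finsetCongr S ↔ a ∈ S := by simp
  by_cases ha : a ∈ S
  · rw [glue, glue, dif_pos ha, dif_pos (hc.2 ha)]; rfl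
  · rw [glue, glue, dif_neg ha, dif_neg (mt hc.1 ha)]; rfl

theorem map_glue (f : V ≃ W) (S : Finset V) (e : Sym2 V) :
    Sym2.map (glue (f.finsetCongr S)) (Sym2.map f e) =
      Sym2.map (joinEquiv f S) (Sym2.map (glue S) e) := by
  rw [Sym2.map_map, Sym2.map_map]
  exact Sym2.map_congr fun a _ => joinEquiv_glue f S a

theorem join (h : IsIso f Γ Γ') (S : Finset V) :
    IsIso (joinEquiv f S) (Γ.join S) (Γ'.join (f.finsetCongr S)) := by
  refine ⟨fun a b => fromEdgeSet_adj_iff _ ?_ a b, fun a => ?_⟩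
  · rw [Set.image_insert_eq, h.edgeSet, Set.image_image, Set.image_image]
    congr 1
    exact Set.image_congr fun e _ => map_glue f S e
  · have hS : (∃ w ∈ f.finsetCongr S, Γ'.label w = some JLabel.omega) ↔
        ∃ u ∈ S, Γ.label u = some JLabel.omega := by
      simp [f.surjective.exists, h.2]
    rcases a with a | b
    · exact h.2 a
    · cases b
      · rfl
      · by_cases hc : ∃ u ∈ S, Γ.label u = some JLabel.omega
        · exact (if_pos (hS.2 hc)).trans (if_pos hc).symm
        · exact (if_neg (mt hS.1 hc)).trans (if_neg hc).symm

theorem relabel (π : Equiv.Perm (Fin n)) (h : IsIso f Γ Γ') :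
    IsIso f (Γ.relabel π) (Γ'.relabel π) :=
  ⟨h.1, fun v => by simp [MarkedGraph.relabel, h.2]⟩

end IsIso

section Relabel

variable (π : Equiv.Perm (Fin n)) (Γ : MarkedGraph n V)

theorem relabel_label_eps (v : V) :
    (Γ.relabel π).label v = some JLabel.eps ↔ Γ.label v = some JLabel.eps := by
  simp only [relabel]
  rcases Γ.label v with _ | (_ | _ | j) <;> simp [JLabel.perm]

theorem relabel_label_omega (v : V) :
    (Γ.relabel π).label v = some JLabel.omega ↔ Γ.label v = some JLabel.omega := by
  simp only [relabel]
  rcases Γ.label v with _ | (_ | _ | j) <;> simp [JLabel.perm]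

theorem relabel_label_num (v : V) (j : Fin n) :
    (Γ.relabel π).label v = some (JLabel.num (π j)) ↔ Γ.label v = some (JLabel.num j) := by
  simp only [relabel]
  rcases Γ.label v with _ | (_ | _ | j) <;> simp [JLabel.perm]

theorem relabel_label_none (v : V) : (Γ.relabel π).label v = none ↔ Γ.label v = none := by
  simp [relabel]

theorem relabel_isSpecial (v : V) : (Γ.relabel π).IsSpecial v ↔ Γ.IsSpecial v := by
  simp only [IsSpecial, relabel_label_eps, relabel_label_omega]

theorem relabel_inOmegaComponent (v : V) :
    (Γ.relabel π).InOmegaComponent v ↔ Γ.InOmegaComponent v := by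
  simp only [InOmegaComponent, relabel_label_omega]
  rfl

theorem relabel_graph : (Γ.relabel π).graph = Γ.graph := rfl

theorem relabel_structuralEdges : (Γ.relabel π).structuralEdges = Γ.structuralEdges := by
  ext e
  refine and_congr_right fun _ => forall_congr' fun v => imp_congr_right fun _ => ?_
  rw [← π.forall_congr_right]
  simp only [ne_eq, relabel_label_num]

theorem relabel_isOrdering {e : ℕ} (o : Fin e → Sym2 V) :
    (Γ.relabel π).IsOrdering o ↔ Γ.IsOrdering o := by
  rw [IsOrdering, IsOrdering, relabel_structuralEdges]

theorem relabel_isGenerator_of {g : ℕ} (H : Γ.IsGenerator g) :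
    (Γ.relabel π).IsGenerator g where
  internal := by simpa only [relabel_graph, relabel_label_none] using H.internal
  external := by simpa only [relabel_graph, relabel_label_none, ne_eq] using H.external
  num_once j := by
    obtain ⟨j, rfl⟩ := π.surjective j
    simpa only [relabel_label_num] using H.num_once j
  omega_once := by simpa only [relabel_label_omega] using H.omega_once
  connected := by simpa only [relabel_graph, relabel_isSpecial] using H.connected
  genus := by simpa only [relabel_graph, relabel_isSpecial] using H.genus
  no_eps_omega := by
    simpa only [relabel_graph, relabel_label_eps, relabel_label_omega, ne_eq] using H.no_eps_omega
  eps_internal := by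
    simpa only [relabel_label_none, relabel_inOmegaComponent] using H.eps_internal
  eps_num v w i j := by
    obtain ⟨i, rfl⟩ := π.surjective i
    obtain ⟨j, rfl⟩ := π.surjective j
    simpa only [relabel_label_num, relabel_inOmegaComponent, π.injective.eq_iff]
      using H.eps_num v w i j
  nonisolated := by
    obtain ⟨v, hv, h⟩ := H.nonisolated
    refine ⟨v, (relabel_inOmegaComponent π Γ v).2 hv, ?_⟩
    rcases h with h | ⟨j, h⟩
    · exact Or.inl ((relabel_label_eps π Γ v).2 h)
    · exact Or.inr ⟨π j, (relabel_label_num π Γ v j).2 h⟩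

theorem relabel_isGenerator {g : ℕ} : (Γ.relabel π).IsGenerator g ↔ Γ.IsGenerator g := by
  refine ⟨fun H => ?_, relabel_isGenerator_of π Γ⟩
  have h : (Γ.relabel π).relabel π.symm = Γ := by
    cases Γ with
    | mk G l =>
      simp only [relabel, mk.injEq, true_and]
      funext v
      rcases l v with _ | (_ | _ | j) <;> simp [JLabel.perm]
  rw [← h]
  exact relabel_isGenerator_of π.symm _ H

theorem relabel_split (v : V) (A : Finset V) :
    (Γ.relabel π).split v A = (Γ.split v A).relabel π := by
  simp only [split, relabel, mk.injEq, true_and]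
  funext u
  cases u <;> rfl

theorem relabel_join (S : Finset V) : (Γ.relabel π).join S = (Γ.join S).relabel π := by
  have h : (∃ u ∈ S, (Γ.relabel π).label u = some JLabel.omega) ↔
      ∃ u ∈ S, Γ.label u = some JLabel.omega := by simp only [relabel_label_omega]
  rw [join, relabel, mk.injEq]
  refine ⟨rfl, ?_⟩
  funext u
  rcases u with u | (_ | _)
  · rfl
  · rfl
  · by_cases hc : ∃ u ∈ S, Γ.label u = some JLabel.omega
    · have h1 : (Γ.join S).label (Sum.inr true) = some JLabel.omega := if_pos hc
      exact (if_pos (h.2 hc)).trans (congrArg (Option.map (JLabel.perm π)) h1).symm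
    · have h1 : (Γ.join S).label (Sum.inr true) = some JLabel.eps := if_neg hc
      exact (if_neg (mt h.1 hc)).trans (congrArg (Option.map (JLabel.perm π)) h1).symm

theorem relabel_splitAdmissible (v : V) (A : Finset V) :
    (Γ.relabel π).SplitAdmissible v A ↔ Γ.SplitAdmissible v A := by
  simp only [SplitAdmissible, relabel_label_none]
  rfl

theorem relabel_joinAdmissible (S : Finset V) :
    (Γ.relabel π).JoinAdmissible S ↔ Γ.JoinAdmissible S := by
  simp only [JoinAdmissible, relabel_isSpecial]

end Relabel

end MarkedGraph

/-! ### The graph complex `J^⋆_{g,n}` -/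

/-- Generators of `J^⋆_{g,n}` with `e` structural edges, with a total ordering of these edges. -/
structure JGen (g n e : ℕ) : Type 1 where
  V : Type
  finite : Finite V
  Γ : MarkedGraph n V
  order : Fin e → Sym2 V
  isGenerator : Γ.IsGenerator g
  isOrdering : Γ.IsOrdering order

/-- The relations: isomorphic graphs are identified, and permuting the structural edges is
multiplication by the sign of the permutation. -/
def jRelations (g n e : ℕ) : Submodule ℚ (JGen g n e →₀ ℚ) :=
  Submodule.span ℚ {r | ∃ (x y : JGen g n e) (f : x.V ≃ y.V) (σ : Equiv.Perm (Fin e)),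
    MarkedGraph.IsIso f x.Γ y.Γ ∧ (∀ i, y.order i = Sym2.map f (x.order (σ i))) ∧
    r = Finsupp.single y 1 - (Equiv.Perm.sign σ : ℚ) • Finsupp.single x 1}

/-- The part of `J^⋆_{g,n}` spanned by the graphs with `e` structural edges, that is, the part of
degree `e + 1`. -/
abbrev JComplex (g n e : ℕ) : Type 1 := (JGen g n e →₀ ℚ) ⧸ jRelations g n e

namespace JComplex

open MarkedGraph

/-- The element of the complex given by a graph `Γ` and a list `o` of its structural edges. It is
`0` if `Γ` is not a generator, or if `o` is not an ordering of the structural edges of `Γ`; the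
latter happens if gluing has created a loop or a double edge, and such graphs count as zero. -/
def cls (g : ℕ) {n e : ℕ} {V : Type} [Finite V] (Γ : MarkedGraph n V)
    (o : Fin e → Sym2 V) : JComplex g n e :=
  open scoped Classical in
  if h : Γ.IsGenerator g ∧ Γ.IsOrdering o then
    (jRelations g n e).mkQ (Finsupp.single ⟨V, inferInstance, Γ, o, h.1, h.2⟩ 1)
  else 0

theorem cls_iso {g n e : ℕ} {V W : Type} [Finite V] [Finite W]
    {Γ : MarkedGraph n V} {Γ' : MarkedGraph n W} {o : Fin e → Sym2 V} {o' : Fin e → Sym2 W}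
    (f : V ≃ W) (h : IsIso f Γ Γ') (σ : Equiv.Perm (Fin e))
    (ho : ∀ i, o' i = Sym2.map f (o (σ i))) :
    cls g Γ' o' = (Equiv.Perm.sign σ : ℚ) • cls g Γ o := by
  by_cases hc : Γ.IsGenerator g ∧ Γ.IsOrdering o
  · have hc' : Γ'.IsGenerator g ∧ Γ'.IsOrdering o' :=
      ⟨h.isGenerator hc.1, (h.isOrdering σ ho).2 hc.2⟩
    rw [cls, cls, dif_pos hc, dif_pos hc', ← map_smul, ← sub_eq_zero, ← map_sub,
      Submodule.mkQ_apply, Submodule.Quotient.mk_eq_zero]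
    exact Submodule.subset_span ⟨_, _, f, σ, h, ho, rfl⟩
  · have hc' : ¬ (Γ'.IsGenerator g ∧ Γ'.IsOrdering o') := fun H =>
      hc ⟨h.isGenerator_iff.1 H.1, (h.isOrdering σ ho).1 H.2⟩
    rw [cls, cls, dif_neg hc, dif_neg hc', smul_zero]

/-- The sum of all graphs obtained from a generator by splitting an internal vertex. The new edge
comes first in the ordering. Each splitting of a vertex is counted twice in the sum over `A`, hence
the factor `1 / 2`. -/
def splitGen {g n e : ℕ} (x : JGen g n e) : JComplex g n (e + 1) :=
  open scoped Classical in
  haveI := x.finite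
  letI := Fintype.ofFinite x.V
  (1 / 2 : ℚ) • ∑ v : x.V, ∑ A : Finset x.V,
    if x.Γ.SplitAdmissible v A then
      cls g (x.Γ.split v A)
        (Fin.cons s(some v, none) (fun i => splitEdge v A (x.order i)))
    else 0

/-- The sum of all graphs obtained from a generator by joining a set of `ε`- and `ω`-decorated
vertices. The new edge comes first in the ordering. -/
def joinGen {g n e : ℕ} (x : JGen g n e) : JComplex g n (e + 1) :=
  open scoped Classical in
  haveI := x.finite
  letI := Fintype.ofFinite x.V
  ∑ S : Finset x.V,
    if x.Γ.JoinAdmissible S then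
      cls g (x.Γ.join S)
        (Fin.cons s(Sum.inr false, Sum.inr true) (fun i => Sym2.map (glue S) (x.order i)))
    else 0

/-- The permutation of `0, …, e` that fixes `0` and permutes `1, …, e` by `σ`. -/
theorem exists_consPerm {e : ℕ} (σ : Equiv.Perm (Fin e)) :
    ∃ τ : Equiv.Perm (Fin (e + 1)), Equiv.Perm.sign τ = Equiv.Perm.sign σ ∧ τ 0 = 0 ∧
      ∀ i : Fin e, τ i.succ = (σ i).succ :=
  ⟨Equiv.Perm.decomposeFin.symm (0, σ), by simp, by simp, fun i => by simp⟩

theorem splitGen_rel {g n e : ℕ} (x y : JGen g n e) (f : x.V ≃ y.V) (σ : Equiv.Perm (Fin e))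
    (h : IsIso f x.Γ y.Γ) (ho : ∀ i, y.order i = Sym2.map f (x.order (σ i))) :
    splitGen y = (Equiv.Perm.sign σ : ℚ) • splitGen x := by
  classical
  have := x.finite
  have := y.finite
  let := Fintype.ofFinite x.V
  let := Fintype.ofFinite y.V
  obtain ⟨τ, hτ, h0, hs⟩ := exists_consPerm σ
  rw [splitGen, splitGen, smul_comm]
  congr 1
  rw [Finset.smul_sum]
  refine (Equiv.sum_comp f _).symm.trans (Finset.sum_congr rfl fun v _ => ?_)
  rw [Finset.smul_sum]
  refine (Equiv.sum_comp f.finsetCongr _).symm.trans ?_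
  refine Finset.sum_congr rfl fun A _ => ?_
  simp only [h.splitAdmissible]
  split_ifs
  · rw [← hτ]
    refine cls_iso (Equiv.optionCongr f) (h.split v A) τ fun i => ?_
    refine Fin.cases ?_ (fun i => ?_) i
    · simp [h0]
    · simp only [Fin.cons_succ, hs, ho, IsIso.map_splitEdge]
  · simp

theorem joinGen_rel {g n e : ℕ} (x y : JGen g n e) (f : x.V ≃ y.V) (σ : Equiv.Perm (Fin e))
    (h : IsIso f x.Γ y.Γ) (ho : ∀ i, y.order i = Sym2.map f (x.order (σ i))) :
    joinGen y = (Equiv.Perm.sign σ : ℚ) • joinGen x := by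
  classical
  have := x.finite
  have := y.finite
  let := Fintype.ofFinite x.V
  let := Fintype.ofFinite y.V
  obtain ⟨τ, hτ, h0, hs⟩ := exists_consPerm σ
  rw [joinGen, joinGen, ← Equiv.sum_comp f.finsetCongr, Finset.smul_sum]
  refine Finset.sum_congr rfl fun S _ => ?_
  simp only [h.joinAdmissible]
  split_ifs
  · rw [← hτ]
    refine cls_iso (IsIso.joinEquiv f S) (h.join S) τ fun i => ?_
    refine Fin.cases ?_ (fun i => ?_) i
    · rw [h0, Fin.cons_zero, Fin.cons_zero]
      rfl
    · simp only [Fin.cons_succ, hs, ho, IsIso.map_glue]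
  · simp

/-- The differential `δ = δ_split + δ_join`, from degree `e + 1` to degree `e + 2`. -/
def differential (g n e : ℕ) : JComplex g n e →ₗ[ℚ] JComplex g n (e + 1) :=
  (jRelations g n e).liftQ (Finsupp.linearCombination ℚ fun x => splitGen x + joinGen x) <| by
    rw [jRelations, Submodule.span_le]
    rintro _ ⟨x, y, f, σ, h, ho, rfl⟩
    simp [splitGen_rel x y f σ h ho, joinGen_rel x y f σ h ho]

/-- The permutation `π` of the numbers, applied to a generator. -/
def permGen {g n e : ℕ} (π : Equiv.Perm (Fin n)) (x : JGen g n e) : JGen g n e where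
  V := x.V
  finite := x.finite
  Γ := x.Γ.relabel π
  order := x.order
  isGenerator := (relabel_isGenerator π x.Γ).2 x.isGenerator
  isOrdering := (relabel_isOrdering π x.Γ x.order).2 x.isOrdering

/-- The action of the symmetric group on `J^⋆_{g,n}` by permutation of the numbers. -/
def perm (g : ℕ) {n : ℕ} (e : ℕ) (π : Equiv.Perm (Fin n)) :
    JComplex g n e →ₗ[ℚ] JComplex g n e :=
  (jRelations g n e).mapQ (jRelations g n e) (Finsupp.lmapDomain ℚ ℚ (permGen π)) <| by
    rw [jRelations, Submodule.span_le]
    rintro _ ⟨x, y, f, σ, h, ho, rfl⟩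
    refine Submodule.subset_span ⟨permGen π x, permGen π y, f, σ, h.relabel π, ho, ?_⟩
    rw [map_sub, map_smul, Finsupp.lmapDomain_apply, Finsupp.lmapDomain_apply,
      Finsupp.mapDomain_single, Finsupp.mapDomain_single]

theorem perm_cls (g : ℕ) {n e : ℕ} (π : Equiv.Perm (Fin n)) {V : Type} [Finite V]
    (Γ : MarkedGraph n V) (o : Fin e → Sym2 V) :
    perm g e π (cls g Γ o) = cls g (Γ.relabel π) o := by
  by_cases h : Γ.IsGenerator g ∧ Γ.IsOrdering o
  · have h' : (Γ.relabel π).IsGenerator g ∧ (Γ.relabel π).IsOrdering o := by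
      rwa [relabel_isGenerator, relabel_isOrdering]
    rw [cls, cls, dif_pos h, dif_pos h']
    simp [perm, Finsupp.mapDomain_single, permGen]
  · have h' : ¬ ((Γ.relabel π).IsGenerator g ∧ (Γ.relabel π).IsOrdering o) := by
      rwa [relabel_isGenerator, relabel_isOrdering]
    rw [cls, cls, dif_neg h, dif_neg h', map_zero]

theorem splitGen_permGen {g n e : ℕ} (π : Equiv.Perm (Fin n)) (x : JGen g n e) :
    splitGen (permGen π x) = perm g (e + 1) π (splitGen x) := by
  classical
  have := x.finite
  have := (permGen π x).finite
  let := Fintype.ofFinite x.V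
  rw [splitGen, splitGen, map_smul, map_sum]
  congr 1
  refine Finset.sum_congr rfl fun v _ => ?_
  rw [map_sum]
  refine Finset.sum_congr rfl fun A _ => ?_
  rw [apply_ite (perm g (e + 1) π), perm_cls, map_zero]
  exact if_congr (relabel_splitAdmissible π x.Γ v A) (congrArg (fun G => cls g G _) (relabel_split π x.Γ v A)) rfl

theorem joinGen_permGen {g n e : ℕ} (π : Equiv.Perm (Fin n)) (x : JGen g n e) :
    joinGen (permGen π x) = perm g (e + 1) π (joinGen x) := by
  classical
  have := x.finite
  have := (permGen π x).finite
  let := Fintype.ofFinite x.V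
  rw [joinGen, joinGen, map_sum]
  refine Finset.sum_congr rfl fun S _ => ?_
  rw [apply_ite (perm g (e + 1) π), perm_cls, map_zero]
  exact if_congr (relabel_joinAdmissible π x.Γ S) (congrArg (fun G => cls g G _) (relabel_join π x.Γ S)) rfl

theorem differential_perm (g : ℕ) {n : ℕ} (e : ℕ) (π : Equiv.Perm (Fin n))
    (c : JComplex g n e) :
    differential g n e (perm g e π c) = perm g (e + 1) π (differential g n e c) := by
  obtain ⟨c, rfl⟩ := (jRelations g n e).mkQ_surjective c
  induction c using Finsupp.induction_linear with
  | zero => simp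
  | add c d hc hd => simp only [map_add, hc, hd]
  | single x q =>
    simp [differential, perm, Finsupp.mapDomain_single, splitGen_permGen, joinGen_permGen]

/-- The coboundaries among the cochains with `e` structural edges. -/
def coboundaries (g n : ℕ) : (e : ℕ) → Submodule ℚ (JComplex g n e)
  | 0 => ⊥
  | e + 1 => LinearMap.range (differential g n e)

/-- The cocycles with `e` structural edges. -/
abbrev cocycles (g n e : ℕ) : Submodule ℚ (JComplex g n e) :=
  LinearMap.ker (differential g n e)

/-- The cohomology of `J^⋆_{g,n}` in degree `e + 1`: cocycles modulo coboundaries. -/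
abbrev cohomology (g n e : ℕ) : Type 1 :=
  cocycles g n e ⧸ (coboundaries g n e).submoduleOf (cocycles g n e)

/-- The action of the symmetric group on cocycles. -/
def permCocycles (g : ℕ) {n : ℕ} (e : ℕ) (π : Equiv.Perm (Fin n)) :
    cocycles g n e →ₗ[ℚ] cocycles g n e :=
  (perm g e π).restrict fun c hc => by
    rw [LinearMap.mem_ker] at hc ⊢
    rw [differential_perm, hc, map_zero]

/-- The action of the symmetric group on the cohomology. -/
def permCohomology (g : ℕ) {n : ℕ} (e : ℕ) (π : Equiv.Perm (Fin n)) :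
    cohomology g n e →ₗ[ℚ] cohomology g n e :=
  Submodule.mapQ _ _ (permCocycles g e π) <| by
    rintro ⟨c, hc⟩ h
    change perm g e π c ∈ coboundaries g n e
    replace h : c ∈ coboundaries g n e := h
    cases e with
    | zero =>
      rw [coboundaries, Submodule.mem_bot] at h ⊢
      rw [h, map_zero]
    | succ e =>
      obtain ⟨b, rfl⟩ := h
      exact ⟨perm g e π b, differential_perm g e π b⟩

end JComplex

/-! ### The multilinear part of the free Lie algebra -/

/-- The value of a bracket word in the free Lie algebra. -/
def lieWord {n : ℕ} : FreeMagma (Fin n) → FreeLieAlgebra ℚ (Fin n)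
  | .of i => FreeLieAlgebra.of ℚ i
  | .mul a b => ⁅lieWord a, lieWord b⁆

/-- The letters of a bracket word, with multiplicity. -/
def wordLetters {n : ℕ} : FreeMagma (Fin n) → Multiset (Fin n)
  | .of i => {i}
  | .mul a b => wordLetters a + wordLetters b

/-- The part of the free Lie algebra with generators `x_i`, `i ∈ I`, for which each generator
appears exactly once. -/
def lieMultilinear {n : ℕ} (I : Finset (Fin n)) : Submodule ℚ (FreeLieAlgebra ℚ (Fin n)) :=
  Submodule.span ℚ {F | ∃ w : FreeMagma (Fin n), wordLetters w = I.val ∧ F = lieWord w}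

theorem lie_mem_lieMultilinear {n : ℕ} (j : Fin n) {F : FreeLieAlgebra ℚ (Fin n)}
    (hF : F ∈ lieMultilinear (Finset.univ.erase j)) :
    ⁅FreeLieAlgebra.of ℚ j, F⁆ ∈ lieMultilinear (Finset.univ : Finset (Fin n)) := by
  induction hF using Submodule.span_induction with
  | mem F h =>
    obtain ⟨w, hw, rfl⟩ := h
    refine Submodule.subset_span ⟨.mul (.of j) w, ?_, rfl⟩
    rw [wordLetters, wordLetters, hw, Finset.erase_val, Multiset.singleton_add,
      Multiset.cons_erase (Finset.mem_univ_val j)]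
  | zero => rw [lie_zero]; exact Submodule.zero_mem _
  | add F G _ _ hF hG => rw [lie_add]; exact Submodule.add_mem _ hF hG
  | smul c F _ hF => rw [lie_smul]; exact Submodule.smul_mem _ _ hF

/-- The map `⨁_j Lie(x_1, …, x̂_j, …, x_n) → Lie(x_1, …, x_n)`, `(F_j) ↦ ∑_j [x_j, F_j]`. -/
def lieSumMap (n : ℕ) : ((j : Fin n) → lieMultilinear (Finset.univ.erase j)) →ₗ[ℚ]
    lieMultilinear (Finset.univ : Finset (Fin n)) where
  toFun F := ∑ j, ⟨⁅FreeLieAlgebra.of ℚ j, (F j : FreeLieAlgebra ℚ (Fin n))⁆,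
    lie_mem_lieMultilinear j (F j).2⟩
  map_add' F G := by
    rw [← Finset.sum_add_distrib]
    exact Finset.sum_congr rfl fun j _ => Subtype.ext (by simp)
  map_smul' c F := by
    rw [Finset.smul_sum]
    exact Finset.sum_congr rfl fun j _ => Subtype.ext (by simp)

/-- The automorphism of the free Lie algebra that permutes the generators, `x_i ↦ x_{π i}`. -/
def liePerm {n : ℕ} (π : Equiv.Perm (Fin n)) :
    FreeLieAlgebra ℚ (Fin n) →ₗ⁅ℚ⁆ FreeLieAlgebra ℚ (Fin n) :=
  FreeLieAlgebra.lift ℚ fun i => FreeLieAlgebra.of ℚ (π i)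

end

/-! Genus zero and condition (c) leave few graphs. Every component is a tree with exactly one
special vertex, so a generator is a tree rooted at ω whose leaves are either all the numbers, or all
but one number `j` that sits on a separate edge to the only ε. Internal vertices correspond to
structural edges, and such an edge is known by its cluster, the set of numbers that it cuts off from
the root. A generator with an ordering is therefore the same as an element `τ : Option (Fin n)`
together with a tuple of pairwise nested or disjoint clusters (`exists_isIso`,
`JGen.exists_realizes`), and the complex consists of the alternating functions of such tuples
(`exists_lift`, `hom_ext`). In this language δ_split adds one more cluster in all possible ways, and
δ_join turns `some j` into `none` and adds the cluster of all numbers (`differential_tree`). Both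
put the new cluster first, so δ² = 0 is antisymmetry in the two added clusters.

The complex is thus the cone of the join map, from the sum over `j` of the tree complexes on the
leaves other than `j` to the tree complex on all leaves. Each tree complex is treated by a
contraction in the style of discrete Morse theory: fix a leaf `s`; the clusters through `s` form a
chain that divides the other leaves into blocks, and a block with several leaves can be inserted as
a cluster or removed. Only combs with `s` at the end survive. They have the largest possible number
of clusters, so up to coboundaries of δ_split every cocycle is a combination of combs
(`exists_sub_splitMap_mem_crit`).

Combs are detected by functionals `ev`, one for each word `σ`. On a tree all of whose clusters are
intervals of `σ`, the value is the determinant of the incidence matrix between clusters and gaps of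
`σ`; on other trees it is zero. These functionals kill the image of δ_split, because a planar tree
with one quadrivalent vertex has exactly two planar resolutions, and their determinants are opposite
(`sum_gapDet_cons`). On a comb the value is, up to the signs of the two words, the coefficient of
`σ` in a right-normed bracket (`wordSign_mul_gapDet_comb`). Hence top cocycles are elements of the
free Lie algebra, twisted by the sign.

Evaluating a join at `σ` strips the first or the last letter (`ev_joinMap`), which is the rule for
the coefficients of `x_j F - F x_j`. So the join map becomes `(F_j) ↦ ∑ [x_j, F_j]`. This map is
surjective, so the cohomology of the cone is its kernel, in degree `n - 1` only, and the dimension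
is `n (n-2)! - (n-1)! = (n-2)!`. -/

namespace MarkedGraph

variable {n : ℕ} {V W : Type}

/-! ### Cuts and rootings of genus zero graphs -/

section Cuts

variable {Γ : MarkedGraph n V}

/-- A set of vertices that is closed under adjacency and has no special vertex is empty. -/
theorem eq_empty_of_closed (hΓ : ∀ v, ∃ s, Γ.IsSpecial s ∧ Γ.graph.Reachable v s) {Y : Set V}
    (hs : ∀ v ∈ Y, ¬ Γ.IsSpecial v) (hc : ∀ a b, Γ.graph.Adj a b → a ∈ Y → b ∈ Y) : Y = ∅ := by
  refine Set.eq_empty_iff_forall_notMem.2 fun v hv => ?_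
  obtain ⟨s, hs', ⟨p⟩⟩ := hΓ v
  refine hs s ?_ hs'
  clear hs'
  induction p with
  | nil => exact hv
  | cons h _ ih => exact ih (hc _ _ h hv)

theorem mem_of_reachable {Y : Set V} (hc : ∀ a b, Γ.graph.Adj a b → a ∈ Y → b ∈ Y) {a b : V}
    (h : Γ.graph.Reachable a b) (ha : a ∈ Y) : b ∈ Y := by
  obtain ⟨p⟩ := h
  induction p with
  | nil => exact ha
  | cons h _ ih => exact ih (hc _ _ h ha)

/-- In a genus zero graph each set of edges is the boundary of a set of non-special vertices. -/
theorem exists_cut [Finite V] (hΓ : ∀ v, ∃ s, Γ.IsSpecial s ∧ Γ.graph.Reachable v s)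
    (hg : Γ.graph.edgeSet.ncard + {v | Γ.IsSpecial v}.ncard = Nat.card V) (T : Set (Sym2 V)) :
    ∃ X : Set V, (∀ v ∈ X, ¬ Γ.IsSpecial v) ∧
      ∀ a b, Γ.graph.Adj a b → ((a ∈ X ↔ b ∈ X) ↔ s(a, b) ∉ T) := by
  classical
  let N := {v : V // ¬ Γ.IsSpecial v}
  have : Fintype V := Fintype.ofFinite V
  have : Fintype Γ.graph.edgeSet := Fintype.ofFinite _
  -- `φ` is the coboundary map over the field with two elements, on functions of the non-special
  -- vertices extended by zero. Connectedness makes it injective, the genus condition equates the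
  -- two dimensions, and so it hits the indicator function of `T`.
  let x : (N → ZMod 2) → V → ZMod 2 := fun f v => if h : ¬ Γ.IsSpecial v then f ⟨v, h⟩ else 0
  let φ : (N → ZMod 2) →ₗ[ZMod 2] (Γ.graph.edgeSet → ZMod 2) :=
    { toFun := fun f e => Sym2.lift ⟨fun a b => x f a + x f b, fun _ _ => add_comm _ _⟩ e.1
      map_add' := by
        intro f g
        funext ⟨e, he⟩
        induction e with | _ a b =>
        simp only [Sym2.lift_mk, Pi.add_apply, x]
        split_ifs <;> ring
      map_smul' := by
        intro c f
        funext ⟨e, he⟩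
        induction e with | _ a b =>
        simp only [Sym2.lift_mk, Pi.smul_apply, x, RingHom.id_apply]
        split_ifs <;> simp [mul_add] }
  have hφ : ∀ f a b (h : Γ.graph.Adj a b), φ f ⟨s(a, b), h⟩ = x f a + x f b := fun _ _ _ _ => rfl
  have two : ∀ a b : ZMod 2, a + b = 0 ↔ (a ≠ 0 ↔ b ≠ 0) := by decide
  have hinj : Function.Injective φ := by
    refine (injective_iff_map_eq_zero φ).2 fun f hf => ?_
    have hY : {v | x f v ≠ 0} = ∅ := by
      refine eq_empty_of_closed hΓ (fun v hv hs => hv (dif_neg (not_not.2 hs))) fun a b hab => ?_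
      have h1 := hφ f a b hab
      rw [hf] at h1
      exact ((two _ _).1 h1.symm).1
    funext v
    have h2 : ¬ x f v.1 ≠ 0 := fun h => (Set.eq_empty_iff_forall_notMem.1 hY) v.1 h
    have h3 : x f v.1 = f v := dif_pos v.2
    rw [← h3]
    exact not_not.1 h2
  have hcard : Module.finrank (ZMod 2) (N → ZMod 2) =
      Module.finrank (ZMod 2) (Γ.graph.edgeSet → ZMod 2) := by
    rw [Module.finrank_fintype_fun_eq_card, Module.finrank_fintype_fun_eq_card,
      ← Nat.card_eq_fintype_card, ← Nat.card_eq_fintype_card, Nat.card_coe_set_eq]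
    have h1 := Set.ncard_add_ncard_compl {v | Γ.IsSpecial v}
    have h2 : Nat.card N = ({v | Γ.IsSpecial v}ᶜ : Set V).ncard := (Nat.card_coe_set_eq _)
    omega
  obtain ⟨f, hf⟩ := (LinearMap.injective_iff_surjective_of_finrank_eq_finrank hcard).1 hinj
    (fun e => if e.1 ∈ T then 1 else 0)
  refine ⟨{v | x f v ≠ 0}, fun v hv hs => hv (dif_neg (not_not.2 hs)), fun a b hab => ?_⟩
  have h1 := hφ f a b hab
  rw [hf] at h1
  refine (two (x f a) (x f b)).symm.trans ?_
  rw [← h1]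
  simp

/-- `X` is a set of non-special vertices with boundary `e`. -/
def IsCut (Γ : MarkedGraph n V) (e : Sym2 V) (X : Set V) : Prop :=
  (∀ v ∈ X, ¬ Γ.IsSpecial v) ∧ ∀ a b, Γ.graph.Adj a b → ((a ∈ X ↔ b ∈ X) ↔ s(a, b) ≠ e)

/-- The symmetric difference of two cuts with the same boundary is closed under adjacency and
contains no special vertex. -/
theorem IsCut.unique (hΓ : ∀ v, ∃ s, Γ.IsSpecial s ∧ Γ.graph.Reachable v s) {e : Sym2 V}
    {X Y : Set V} (hX : Γ.IsCut e X) (hY : Γ.IsCut e Y) : X = Y := by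
  have h : {v | ¬ (v ∈ X ↔ v ∈ Y)} = ∅ := by
    refine eq_empty_of_closed hΓ (fun v hv => ?_) fun a b hab ha hb => ha ?_
    · by_cases h : v ∈ X
      · exact hX.1 v h
      · exact hY.1 v (by simp only [Set.mem_ofPred_eq] at hv; tauto)
    · have h1 := hX.2 a b hab
      have h2 := hY.2 a b hab
      tauto
  ext v
  by_contra hv
  exact Set.eq_empty_iff_forall_notMem.1 h v hv

open scoped Classical in
/-- The numbers that are cut off from the special vertices by the edge `e`. -/
noncomputable def cluster (Γ : MarkedGraph n V) (e : Sym2 V) : Finset (Fin n) :=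
  Finset.univ.filter fun j => ∃ X, Γ.IsCut e X ∧ ∃ v ∈ X, Γ.label v = some (JLabel.num j)

theorem IsCut.mem_cluster (hΓ : ∀ v, ∃ s, Γ.IsSpecial s ∧ Γ.graph.Reachable v s) {e : Sym2 V}
    {X : Set V} (hX : Γ.IsCut e X) (j : Fin n) :
    j ∈ Γ.cluster e ↔ ∃ v ∈ X, Γ.label v = some (JLabel.num j) := by
  simp only [cluster, Finset.mem_filter, Finset.mem_univ, true_and]
  constructor
  · rintro ⟨Y, hY, h⟩
    rwa [hX.unique hΓ hY]
  · exact fun h => ⟨X, hX, h⟩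

/-- A rooting of a graph: `par v` is the next vertex on the way from a non-special vertex `v` to
the special vertices, and `D v` is the set of vertices that are cut off by the edge from `v`
to `par v`. -/
structure Rooting (Γ : MarkedGraph n V) (par : V → V) (D : V → Set V) : Prop where
  conn : ∀ v, ∃ s, Γ.IsSpecial s ∧ Γ.graph.Reachable v s
  adj : ∀ {v}, ¬ Γ.IsSpecial v → Γ.graph.Adj v (par v)
  self : ∀ {v}, ¬ Γ.IsSpecial v → v ∈ D v
  par_notMem : ∀ {v}, ¬ Γ.IsSpecial v → par v ∉ D v
  nonspecial : ∀ {v u}, ¬ Γ.IsSpecial v → u ∈ D v → ¬ Γ.IsSpecial u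
  cross : ∀ {v a b}, ¬ Γ.IsSpecial v → Γ.graph.Adj a b → a ∈ D v → b ∉ D v → a = v ∧ b = par v
  adj_par : ∀ {a b}, Γ.graph.Adj a b →
    (¬ Γ.IsSpecial a ∧ b = par a) ∨ (¬ Γ.IsSpecial b ∧ a = par b)

/-- Each edge has a cut that contains exactly one of its ends; orient the edge away from that end.
What has to be shown is that a non-special vertex has exactly one outgoing edge. -/
theorem exists_rooting [Finite V] (hΓ : ∀ v, ∃ s, Γ.IsSpecial s ∧ Γ.graph.Reachable v s)
    (hg : Γ.graph.edgeSet.ncard + {v | Γ.IsSpecial v}.ncard = Nat.card V) :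
    ∃ par D, Γ.Rooting par D := by
  have hX : ∀ e : Sym2 V, ∃ X, Γ.IsCut e X := fun e => by
    obtain ⟨X, h1, h2⟩ := exists_cut hΓ hg {e}
    exact ⟨X, h1, by simpa using h2⟩
  choose X hX using hX
  have hcross : ∀ {e a b}, Γ.graph.Adj a b → a ∈ X e → b ∉ X e → s(a, b) = e := by
    intro e a b hab ha hb
    by_contra h
    exact hb ((((hX e).2 a b hab).2 h).1 ha)
  have hor : ∀ {a b}, Γ.graph.Adj a b →
      (a ∈ X s(a, b) ∧ b ∉ X s(a, b)) ∨ (b ∈ X s(a, b) ∧ a ∉ X s(a, b)) := by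
    intro a b hab
    have := (hX s(a, b)).2 a b hab
    tauto
  have hpar : ∀ v, ∃ u, ¬ Γ.IsSpecial v → Γ.graph.Adj v u ∧ v ∈ X s(v, u) ∧ u ∉ X s(v, u) := by
    intro v
    by_cases hv : Γ.IsSpecial v
    · exact ⟨v, fun h => absurd hv h⟩
    by_contra hno
    push Not at hno
    have hno' : ∀ u, Γ.graph.Adj v u → u ∈ X s(v, u) ∧ v ∉ X s(v, u) := by
      intro u hu
      rcases hor hu with h | h
      · exact absurd ((hno u).2 hu h.1) h.2
      · exact h
    -- If all edges at `v` came in, then `v` and the cuts of these edges would together be closed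
    -- under adjacency, without reaching a special vertex.
    have hY : {w | w = v ∨ ∃ u, Γ.graph.Adj v u ∧ w ∈ X s(v, u)} = ∅ := by
      refine eq_empty_of_closed hΓ ?_ ?_
      · rintro w (rfl | ⟨u, _, h⟩)
        · exact hv
        · exact (hX _).1 w h
      · rintro a b hab (rfl | ⟨u, hu, h⟩)
        · exact Or.inr ⟨b, hab, (hno' b hab).1⟩
        · by_cases hb : b ∈ X s(v, u)
          · exact Or.inr ⟨u, hu, hb⟩
          · have h1 := hcross hab h hb
            rcases Sym2.eq_iff.1 h1 with ⟨rfl, rfl⟩ | ⟨rfl, rfl⟩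
            · exact absurd h (hno' b hu).2
            · exact Or.inl rfl
    exact Set.eq_empty_iff_forall_notMem.1 hY v (Or.inl rfl)
  choose par hpar using hpar
  refine ⟨par, fun v => X s(v, par v), ⟨hΓ, fun {v} h => (hpar v h).1, fun {v} h => (hpar v h).2.1,
    fun {v} h => (hpar v h).2.2, fun {v u} _ hu => (hX _).1 u hu, ?_, ?_⟩⟩
  · intro v a b hv hab ha hb
    rcases Sym2.eq_iff.1 (hcross hab ha hb) with ⟨rfl, rfl⟩ | ⟨rfl, rfl⟩
    · exact ⟨rfl, rfl⟩
    · exact absurd ha (hpar _ hv).2.2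
  · have key : ∀ {a b}, Γ.graph.Adj a b → a ∈ X s(a, b) → b ∉ X s(a, b) →
        ¬ Γ.IsSpecial a ∧ b = par a := by
      intro a b hab h1 h2
      have ha := (hX _).1 a h1
      refine ⟨ha, ?_⟩
      by_contra hne
      obtain ⟨g1, g2, g3⟩ := hpar a ha
      have hbX : b ∈ X s(a, par a) := by
        by_contra hb
        rcases Sym2.eq_iff.1 (hcross hab g2 hb) with h | h
        · exact hne h.2
        · exact hab.ne h.2.symm
      have hpX : par a ∈ X s(a, b) := by
        by_contra hb
        rcases Sym2.eq_iff.1 (hcross g1 h1 hb) with h | h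
        · exact hne h.2.symm
        · exact hab.ne h.1
      -- With two outgoing edges at `a`, the only edge leaving either cut ends in the other cut, so
      -- their union is closed.
      have hY : X s(a, b) ∪ X s(a, par a) = ∅ := by
        refine eq_empty_of_closed hΓ ?_ ?_
        · rintro w (h | h)
          · exact (hX _).1 w h
          · exact (hX _).1 w h
        · intro x y hxy hx
          by_contra hy
          simp only [Set.mem_union, not_or] at hy
          rcases hx with hx | hx
          · rcases Sym2.eq_iff.1 (hcross hxy hx hy.1) with h | h
            · exact hy.2 (h.2 ▸ hbX)
            · exact h2 (h.1 ▸ hx)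
          · rcases Sym2.eq_iff.1 (hcross hxy hx hy.2) with h | h
            · exact hy.1 (h.2 ▸ hpX)
            · exact g3 (h.1 ▸ hx)
      exact Set.eq_empty_iff_forall_notMem.1 hY a (Or.inl h1)
    intro a b hab
    rcases hor hab with h | h
    · exact Or.inl (key hab h.1 h.2)
    · rw [Sym2.eq_swap] at h
      exact Or.inr (key hab.symm h.1 h.2)

end Cuts

end MarkedGraph

/-! ### Subtrees of a rooted generator and the numbers in them -/

namespace MarkedGraph

variable {n : ℕ} {V W : Type}

open scoped Classical in
/-- The numbers that decorate the vertices in `X`. -/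
noncomputable def nums (Γ : MarkedGraph n V) (X : Set V) : Finset (Fin n) :=
  Finset.univ.filter fun j => ∃ v ∈ X, Γ.label v = some (JLabel.num j)

theorem mem_nums {Γ : MarkedGraph n V} {X : Set V} {j : Fin n} :
    j ∈ Γ.nums X ↔ ∃ v ∈ X, Γ.label v = some (JLabel.num j) := by
  simp [nums]

theorem nums_mono {Γ : MarkedGraph n V} {X Y : Set V} (h : X ⊆ Y) : Γ.nums X ⊆ Γ.nums Y :=
  fun _ hj => mem_nums.2 (let ⟨v, hv, h'⟩ := mem_nums.1 hj; ⟨v, h hv, h'⟩)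

theorem IsCut.cluster_eq {Γ : MarkedGraph n V}
    (hΓ : ∀ v, ∃ s, Γ.IsSpecial s ∧ Γ.graph.Reachable v s) {e : Sym2 V}
    {X : Set V} (hX : Γ.IsCut e X) : Γ.cluster e = Γ.nums X := by
  ext j
  rw [hX.mem_cluster hΓ, mem_nums]

theorem not_isSpecial_iff {Γ : MarkedGraph n V} {v : V} :
    ¬ Γ.IsSpecial v ↔ Γ.label v = none ∨ ∃ j, Γ.label v = some (JLabel.num j) := by
  unfold IsSpecial
  rcases Γ.label v with _ | (_ | _ | j) <;> simp

theorem not_isSpecial_of_none {Γ : MarkedGraph n V} {v : V} (h : Γ.label v = none) :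
    ¬ Γ.IsSpecial v := not_isSpecial_iff.2 (Or.inl h)

theorem not_isSpecial_of_num {Γ : MarkedGraph n V} {v : V} {j : Fin n}
    (h : Γ.label v = some (JLabel.num j)) : ¬ Γ.IsSpecial v := not_isSpecial_iff.2 (Or.inr ⟨j, h⟩)

namespace Rooting

variable {Γ : MarkedGraph n V} {par : V → V} {D : V → Set V}

theorem empty_of_closed (R : Γ.Rooting par D) {Y : Set V}
    (hs : ∀ v ∈ Y, ¬ Γ.IsSpecial v) (hc : ∀ a b, Γ.graph.Adj a b → a ∈ Y → b ∈ Y) (v : V) :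
    v ∉ Y := Set.eq_empty_iff_forall_notMem.1 (eq_empty_of_closed R.conn hs hc) v

theorem isCut (R : Γ.Rooting par D) {v : V} (hv : ¬ Γ.IsSpecial v) :
    Γ.IsCut s(v, par v) (D v) := by
  refine ⟨fun u hu => R.nonspecial hv hu, fun a b hab => ?_⟩
  constructor
  · rintro h he
    rcases Sym2.eq_iff.1 he with ⟨rfl, rfl⟩ | ⟨rfl, rfl⟩
    · exact R.par_notMem hv (h.1 (R.self hv))
    · exact R.par_notMem hv (h.2 (R.self hv))
  · intro h
    by_contra hne
    by_cases ha : a ∈ D v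
    · have hb : b ∉ D v := fun hb => hne (iff_of_true ha hb)
      obtain ⟨rfl, rfl⟩ := R.cross hv hab ha hb
      exact h rfl
    · have hb : b ∈ D v := by
        by_contra hb
        exact hne (iff_of_false ha hb)
      obtain ⟨rfl, rfl⟩ := R.cross hv hab.symm hb ha
      exact h Sym2.eq_swap

theorem cluster_eq (R : Γ.Rooting par D) {v : V} (hv : ¬ Γ.IsSpecial v) :
    Γ.cluster s(v, par v) = Γ.nums (D v) := (R.isCut hv).cluster_eq R.conn

/-- If this failed, a closed set without special vertices would exist: `D x ∪ D u` when the exit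
`par u` of `D u` lies in `D x`, and `D x \ D u` when it does not. -/
theorem sub_of_mem (R : Γ.Rooting par D) {u x : V} (hu : ¬ Γ.IsSpecial u) (hx : x ∈ D u) :
    D x ⊆ D u := by
  have hxs := R.nonspecial hu hx
  rcases eq_or_ne x u with rfl | hne
  · exact subset_rfl
  intro y hy
  by_contra hyu
  by_cases hp : par u ∈ D x
  · refine R.empty_of_closed (Y := D x ∪ D u) ?_ ?_ y (Or.inl hy)
    · rintro w (h | h)
      · exact R.nonspecial hxs h
      · exact R.nonspecial hu h
    · intro a b hab ha
      by_contra hb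
      rw [Set.mem_union, not_or] at hb
      rcases ha with ha | ha
      · obtain ⟨rfl, rfl⟩ := R.cross hxs hab ha hb.1
        exact hne (R.cross hu hab hx hb.2).1
      · obtain ⟨rfl, rfl⟩ := R.cross hu hab ha hb.2
        exact hb.1 hp
  · refine R.empty_of_closed (Y := D x \ D u) ?_ ?_ y ⟨hy, hyu⟩
    · exact fun w h => R.nonspecial hxs h.1
    · intro a b hab ha
      have hb : b ∈ D x := by
        by_contra hb
        obtain ⟨rfl, rfl⟩ := R.cross hxs hab ha.1 hb
        exact ha.2 hx
      refine ⟨hb, fun hbu => ?_⟩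
      obtain ⟨rfl, rfl⟩ := R.cross hu hab.symm hbu ha.2
      exact hp ha.1

theorem par_mem (R : Γ.Rooting par D) {u v : V} (hu : ¬ Γ.IsSpecial u) (hv : v ∈ D u)
    (hne : v ≠ u) : par v ∈ D u := by
  by_contra h
  exact hne (R.cross hu (R.adj (R.nonspecial hu hv)) hv h).1

/-- Otherwise the edge between `v` and `par v` would also be the exit of `D (par v)`, and the union
of the two subtrees would be closed. -/
theorem mem_D_par (R : Γ.Rooting par D) {v : V} (hv : ¬ Γ.IsSpecial v)
    (hp : ¬ Γ.IsSpecial (par v)) : v ∈ D (par v) := by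
  by_contra h
  have h1 := (R.cross hp (R.adj hv).symm (R.self hp) h).2
  refine R.empty_of_closed (Y := D v ∪ D (par v)) ?_ ?_ v (Or.inl (R.self hv))
  · rintro w (h | h)
    · exact R.nonspecial hv h
    · exact R.nonspecial hp h
  · intro a b hab ha
    by_contra hb
    rw [Set.mem_union, not_or] at hb
    rcases ha with ha | ha
    · obtain ⟨rfl, rfl⟩ := R.cross hv hab ha hb.1
      exact hb.2 (R.self hp)
    · obtain ⟨rfl, rfl⟩ := R.cross hp hab ha hb.2
      rw [← h1] at hb
      exact hb.1 (R.self hv)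

theorem D_subset_D_par (R : Γ.Rooting par D) {v : V} (hv : ¬ Γ.IsSpecial v)
    (hp : ¬ Γ.IsSpecial (par v)) : D v ⊆ D (par v) := R.sub_of_mem hp (R.mem_D_par hv hp)

theorem eq_of_D_eq (R : Γ.Rooting par D) {u v : V} (hu : ¬ Γ.IsSpecial u)
    (hv : ¬ Γ.IsSpecial v) (h : D u = D v) : u = v := by
  by_contra hne
  exact R.par_notMem hu (h ▸ R.par_mem hv (h ▸ R.self hu) hne)

/-- If neither inclusion holds, no edge leaves `D u ∩ D v`: an exit through `u` would put `u` into
`D v`, and likewise for `v`. -/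
theorem nested (R : Γ.Rooting par D) {u v x : V} (hu : ¬ Γ.IsSpecial u)
    (hv : ¬ Γ.IsSpecial v) (hxu : x ∈ D u) (hxv : x ∈ D v) : D u ⊆ D v ∨ D v ⊆ D u := by
  by_contra h
  rw [not_or] at h
  refine R.empty_of_closed (Y := D u ∩ D v) (fun w hw => R.nonspecial hu hw.1) ?_ x ⟨hxu, hxv⟩
  intro a b hab ha
  constructor
  · by_contra hb
    obtain ⟨rfl, rfl⟩ := R.cross hu hab ha.1 hb
    exact h.1 (R.sub_of_mem hv ha.2)
  · by_contra hb
    obtain ⟨rfl, rfl⟩ := R.cross hv hab ha.2 hb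
    exact h.2 (R.sub_of_mem hu ha.1)

/-- The part of `D v` outside `v` and the subtrees of its children is closed under adjacency. -/
theorem eq_or_mem_child (R : Γ.Rooting par D) {v x : V} (hv : ¬ Γ.IsSpecial v) (hx : x ∈ D v) :
    x = v ∨ ∃ w, ¬ Γ.IsSpecial w ∧ par w = v ∧ x ∈ D w := by
  by_contra hno
  refine R.empty_of_closed (Y := {x | x ∈ D v ∧ ¬ (x = v ∨ ∃ w, ¬ Γ.IsSpecial w ∧ par w = v ∧
    x ∈ D w)}) (fun w hw => R.nonspecial hv hw.1) ?_ x ⟨hx, hno⟩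
  rintro a b hab ⟨ha, ha'⟩
  rw [not_or] at ha'
  have hb : b ∈ D v := by
    by_contra hb
    exact ha'.1 (R.cross hv hab ha hb).1
  refine ⟨hb, ?_⟩
  rintro (rfl | ⟨w, hw, rfl, hbw⟩)
  · rcases R.adj_par hab with ⟨h, h'⟩ | ⟨_, rfl⟩
    · exact ha'.2 ⟨a, h, h'.symm, R.self h⟩
    · exact R.par_notMem hv ha
  · have haw : a ∉ D w := fun h => ha'.2 ⟨w, hw, rfl, h⟩
    exact ha'.1 (R.cross hw hab.symm hbw haw).2

theorem disjoint_children (R : Γ.Rooting par D) {w w' : V} (hw : ¬ Γ.IsSpecial w)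
    (hw' : ¬ Γ.IsSpecial w') (h : par w = par w') (hne : w ≠ w') {x : V} (hx : x ∈ D w) :
    x ∉ D w' := by
  intro hx'
  rcases R.nested hw hw' hx hx' with hs | hs
  · have := R.par_mem hw' (hs (R.self hw)) hne
    rw [h] at this
    exact R.par_notMem hw' this
  · have := R.par_mem hw (hs (R.self hw')) hne.symm
    rw [← h] at this
    exact R.par_notMem hw this

end Rooting

namespace IsGenerator

variable {Γ : MarkedGraph n V} {par : V → V} {D : V → Set V} {g : ℕ}

theorem exists_rooting [Finite V] (H : Γ.IsGenerator 0) : ∃ par D, Γ.Rooting par D :=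
  MarkedGraph.exists_rooting H.connected (by simpa using H.genus)

theorem eq_of_adj (H : Γ.IsGenerator g) {v a b : V} (hv : Γ.label v ≠ none)
    (ha : Γ.graph.Adj v a) (hb : Γ.graph.Adj v b) : a = b := by
  obtain ⟨c, hc⟩ := Set.ncard_eq_one.1 (H.external v hv)
  have h1 : a ∈ Γ.graph.neighborSet v := ha
  have h2 : b ∈ Γ.graph.neighborSet v := hb
  rw [hc, Set.mem_singleton_iff] at h1 h2
  rw [h1, h2]

theorem exists_adj (H : Γ.IsGenerator g) {v : V} (hv : Γ.label v ≠ none) :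
    ∃ a, Γ.graph.Adj v a := by
  obtain ⟨c, hc⟩ := Set.ncard_eq_one.1 (H.external v hv)
  have h1 : c ∈ Γ.graph.neighborSet v := by simp [hc]
  exact ⟨c, h1⟩

/-- Each component has only one special vertex. -/
theorem _root_.MarkedGraph.special_unique [Finite V]
    (hΓ : ∀ v, ∃ s, Γ.IsSpecial s ∧ Γ.graph.Reachable v s)
    (hg : Γ.graph.edgeSet.ncard + {v | Γ.IsSpecial v}.ncard = Nat.card V) {s s' : V}
    (hs : Γ.IsSpecial s) (hs' : Γ.IsSpecial s') (h : Γ.graph.Reachable s s') : s = s' := by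
  -- The boundary of `X` is the whole star of `s`. All neighbours of `s` then lie in `X`, and `X`
  -- together with `s` is closed, so it contains the component of `s`.
  obtain ⟨X, h1, h2⟩ := exists_cut hΓ hg {e | s ∈ e}
  have key : s' ∈ insert s X := by
    refine mem_of_reachable (Γ := Γ) ?_ h (Set.mem_insert _ _)
    rintro a b hab (rfl | ha)
    · right
      have := h2 a b hab
      simp only [Set.mem_ofPred_eq, Sym2.mem_iff, true_or, not_true_eq_false, iff_false] at this
      by_contra hb
      exact this (iff_of_false (fun ha => h1 _ ha hs) hb)
    · rcases eq_or_ne b s with rfl | hb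
      · exact Or.inl rfl
      · have := h2 a b hab
        right
        refine (this.2 ?_).1 ha
        have hne : s ≠ a := by rintro rfl; exact h1 _ ha hs
        simp [Sym2.mem_iff, hne, hb.symm]
  rcases key with rfl | h'
  · rfl
  · exact absurd hs' (h1 _ h')

theorem special_unique [Finite V] (H : Γ.IsGenerator 0) {s s' : V} (hs : Γ.IsSpecial s)
    (hs' : Γ.IsSpecial s') (h : Γ.graph.Reachable s s') : s = s' :=
  MarkedGraph.special_unique H.connected (by simpa using H.genus) hs hs' h

theorem not_isSpecial_of_adj [Finite V] (H : Γ.IsGenerator 0) {s v : V} (hs : Γ.IsSpecial s)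
    (h : Γ.graph.Adj s v) : ¬ Γ.IsSpecial v := fun hv =>
  h.ne (H.special_unique hs hv h.reachable)

/-- Of the at least three edges at `v` only one leads to the parent. -/
theorem exists_two_children (H : Γ.IsGenerator g) (R : Γ.Rooting par D) {v : V}
    (hv : Γ.label v = none) : ∃ w w', w ≠ w' ∧ ¬ Γ.IsSpecial w ∧ ¬ Γ.IsSpecial w' ∧
      par w = v ∧ par w' = v := by
  have h3 := H.internal v hv
  have hfin : (Γ.graph.neighborSet v).Finite := Set.finite_of_ncard_pos (by omega)
  have h2 : 1 < (Γ.graph.neighborSet v \ {par v}).ncard := by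
    have := Set.ncard_le_ncard_sdiff_add_ncard (Γ.graph.neighborSet v) {par v}
      (Set.finite_singleton _)
    rw [Set.ncard_singleton] at this
    omega
  obtain ⟨w, hw, w', hw', hne⟩ := (Set.one_lt_ncard (hfin.subset Set.sdiff_subset)).1 h2
  have key : ∀ w ∈ Γ.graph.neighborSet v \ {par v}, ¬ Γ.IsSpecial w ∧ par w = v := by
    rintro w ⟨hw, hw'⟩
    rcases R.adj_par hw with h | h
    · exact absurd h.2 hw'
    · exact ⟨h.1, h.2.symm⟩
  exact ⟨w, w', hne, (key w hw).1, (key w' hw').1, (key w hw).2, (key w' hw').2⟩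

/-- The only edge at an external vertex already leads to its parent, so there is none left for a
child. -/
theorem D_external (H : Γ.IsGenerator g) (R : Γ.Rooting par D) {v : V}
    (hv : ¬ Γ.IsSpecial v) (hv' : Γ.label v ≠ none) {x : V} (hx : x ∈ D v) : x = v := by
  rcases R.eq_or_mem_child hv hx with h | ⟨w, hw, rfl, _⟩
  · exact h
  · have h1 := H.eq_of_adj hv' (R.adj hw).symm (R.adj hv)
    have h2 := R.mem_D_par hw hv
    rw [h1] at h2
    exact absurd (h1 ▸ h2) (R.par_notMem hv)

/-- Descending from an internal vertex to a child makes the subtree smaller, so a numbered leaf is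
reached. -/
theorem nums_nonempty [Finite V] (H : Γ.IsGenerator g) (R : Γ.Rooting par D) {v : V}
    (hv : ¬ Γ.IsSpecial v) : (Γ.nums (D v)).Nonempty := by
  induction hk : (D v).ncard using Nat.strong_induction_on generalizing v with
  | _ k ih =>
    subst hk
    rcases not_isSpecial_iff.1 hv with h | ⟨j, h⟩
    · obtain ⟨w, w', hne, hw, hw', rfl, h'⟩ := H.exists_two_children R h
      have hs := R.D_subset_D_par hw hv
      refine (ih _ (Set.ncard_lt_ncard ⟨hs, fun hs' => ?_⟩) hw rfl).mono (nums_mono hs)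
      exact R.par_notMem hw (hs' (R.self hv))
    · exact ⟨j, mem_nums.2 ⟨v, R.self hv, h⟩⟩

theorem label_par (H : Γ.IsGenerator g) (R : Γ.Rooting par D) {v : V}
    (hv : ¬ Γ.IsSpecial v) (j : Fin n) : Γ.label (par v) ≠ some (JLabel.num j) := by
  intro h
  have hp := not_isSpecial_of_num h
  exact (R.adj hv).ne (H.D_external R hp (by simp [h]) (R.mem_D_par hv hp))

/-- A proper subtree of `D v` lies inside the subtree of one child, and the other child contributes
numbers of its own. This is where trivalence makes clusters determine vertices. -/
theorem eq_of_nums_subset [Finite V] (H : Γ.IsGenerator g) (R : Γ.Rooting par D) {u v : V}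
    (hu : ¬ Γ.IsSpecial u) (hv : ¬ Γ.IsSpecial v) (hs : D u ⊆ D v)
    (h : Γ.nums (D v) ⊆ Γ.nums (D u)) : u = v := by
  by_contra hne
  have huv := hs (R.self hu)
  have hv' : Γ.label v = none := by
    by_contra h'
    exact hne (H.D_external R hv h' huv)
  obtain ⟨w, w', hww, hw, hw', hpw, hpw'⟩ := H.exists_two_children R hv'
  have hmeet : ∀ w, ¬ Γ.IsSpecial w → par w = v → ∃ x, x ∈ D w ∧ x ∈ D u := by
    rintro w hw rfl
    obtain ⟨j, hj⟩ := H.nums_nonempty R hw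
    obtain ⟨x, hx, hxj⟩ := mem_nums.1 hj
    obtain ⟨y, hy, hyj⟩ := mem_nums.1 (h (nums_mono (R.D_subset_D_par hw hv) hj))
    exact ⟨x, hx, (H.num_once j).unique hyj hxj ▸ hy⟩
  rcases R.eq_or_mem_child hv huv with h' | ⟨c, hc, hpc, huc⟩
  · exact hne h'
  have hsub := R.sub_of_mem hc huc
  have : ∀ w, ¬ Γ.IsSpecial w → par w = v → w = c := by
    intro w hw hpw
    by_contra hwc
    obtain ⟨x, hx, hx'⟩ := hmeet w hw hpw
    exact R.disjoint_children hw hc (hpw.trans hpc.symm) hwc hx (hsub hx')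
  exact hww ((this w hw hpw).trans (this w' hw' hpw').symm)

theorem nested_of_nums [Finite V] (H : Γ.IsGenerator g) (R : Γ.Rooting par D) {u v : V}
    (hu : ¬ Γ.IsSpecial u) (hv : ¬ Γ.IsSpecial v) {j : Fin n} (h : j ∈ Γ.nums (D u))
    (h' : j ∈ Γ.nums (D v)) : D u ⊆ D v ∨ D v ⊆ D u := by
  obtain ⟨x, hx, hxj⟩ := mem_nums.1 h
  obtain ⟨y, hy, hyj⟩ := mem_nums.1 h'
  exact R.nested hu hv hx ((H.num_once j).unique hyj hxj ▸ hy)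

theorem nums_subset_iff [Finite V] (H : Γ.IsGenerator g) (R : Γ.Rooting par D) {u v : V}
    (hu : ¬ Γ.IsSpecial u) (hv : ¬ Γ.IsSpecial v) : Γ.nums (D u) ⊆ Γ.nums (D v) ↔ D u ⊆ D v := by
  refine ⟨fun h => ?_, nums_mono⟩
  obtain ⟨j, hj⟩ := H.nums_nonempty R hu
  rcases H.nested_of_nums R hu hv hj (h hj) with h' | h'
  · exact h'
  · rw [H.eq_of_nums_subset R hv hu h' h]

theorem nums_injective [Finite V] (H : Γ.IsGenerator g) (R : Γ.Rooting par D) {u v : V}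
    (hu : ¬ Γ.IsSpecial u) (hv : ¬ Γ.IsSpecial v) (h : Γ.nums (D u) = Γ.nums (D v)) : u = v :=
  R.eq_of_D_eq hu hv (Set.Subset.antisymm ((H.nums_subset_iff R hu hv).1 h.le)
    ((H.nums_subset_iff R hv hu).1 h.ge))

theorem nums_num (H : Γ.IsGenerator g) (R : Γ.Rooting par D) {v : V} {j : Fin n}
    (h : Γ.label v = some (JLabel.num j)) : Γ.nums (D v) = {j} := by
  have hv := not_isSpecial_of_num h
  ext i
  rw [mem_nums, Finset.mem_singleton]
  constructor
  · rintro ⟨x, hx, hi⟩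
    rw [H.D_external R hv (by simp [h]) hx, h] at hi
    simpa using hi.symm
  · rintro rfl
    exact ⟨v, R.self hv, h⟩

theorem two_le_card_nums [Finite V] (H : Γ.IsGenerator g) (R : Γ.Rooting par D) {v : V}
    (h : Γ.label v = none) : 2 ≤ (Γ.nums (D v)).card := by
  have hv := not_isSpecial_of_none h
  obtain ⟨w, w', hne, hw, hw', rfl, h'⟩ := H.exists_two_children R h
  obtain ⟨i, hi⟩ := H.nums_nonempty R hw
  obtain ⟨j, hj⟩ := H.nums_nonempty R hw'
  refine Finset.one_lt_card.2 ⟨i, nums_mono (R.D_subset_D_par hw hv) hi, j,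
    nums_mono (h' ▸ R.D_subset_D_par hw' (h' ▸ hv)) hj, ?_⟩
  rintro rfl
  obtain ⟨x, hx, hxi⟩ := mem_nums.1 hi
  obtain ⟨y, hy, hyi⟩ := mem_nums.1 hj
  rw [(H.num_once i).unique hyi hxi] at hy
  exact R.disjoint_children hw hw' h'.symm hne hx hy

/-- Every edge joins a non-special vertex to its parent, and a numbered vertex is never a parent, so
the edge is structural exactly when its lower end is internal. -/
theorem mem_structuralEdges_iff (H : Γ.IsGenerator g) (R : Γ.Rooting par D) {e : Sym2 V} :
    e ∈ Γ.structuralEdges ↔ ∃ v, Γ.label v = none ∧ e = s(v, par v) := by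
  constructor
  · rintro ⟨he, hn⟩
    have key : ∀ a, ¬ Γ.IsSpecial a → a ∈ e → Γ.label a = none := fun a ha hae =>
      (not_isSpecial_iff.1 ha).resolve_right fun ⟨j, hj⟩ => hn a hae j hj
    induction e with | _ a b =>
    have hab : Γ.graph.Adj a b := he
    rcases R.adj_par hab with ⟨h, rfl⟩ | ⟨h, rfl⟩
    · exact ⟨a, key a h (by simp), rfl⟩
    · exact ⟨b, key b h (by simp), Sym2.eq_swap⟩
  · rintro ⟨v, hv, rfl⟩
    have hs := not_isSpecial_of_none hv
    refine ⟨R.adj hs, fun u hu j => ?_⟩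
    rcases Sym2.mem_iff.1 hu with rfl | rfl
    · simp [hv]
    · exact H.label_par R hs j

end IsGenerator

end MarkedGraph

/-! ### Generators are determined by their clusters -/

/-- The clusters of a tree with leaves `L`: distinct subsets of `L` with at least two elements that
are pairwise nested or disjoint, and that include `L` itself unless the tree has no vertex. -/
structure ValidTuple {n e : ℕ} (L : Finset (Fin n)) (t : Fin e → Finset (Fin n)) : Prop where
  inj : Function.Injective t
  sub : ∀ i, t i ⊆ L
  two_le : ∀ i, 2 ≤ (t i).card
  nested : ∀ i j, t i ⊆ t j ∨ t j ⊆ t i ∨ Disjoint (t i) (t j)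
  top : 2 ≤ L.card → ∃ i, t i = L

/-- All numbers, with the exception of the number joined to an `ε`. -/
def topSet {n : ℕ} (τ : Option (Fin n)) : Finset (Fin n) := τ.elim Finset.univ Finset.univ.erase

theorem mem_topSet {n : ℕ} {τ : Option (Fin n)} {j : Fin n} : j ∈ topSet τ ↔ τ ≠ some j := by
  cases τ <;> simp [topSet, eq_comm]

namespace MarkedGraph

variable {n : ℕ} {V W : Type}

/-- The number `j` is joined to an `ε`. -/
def EpsEdge (Γ : MarkedGraph n V) (j : Fin n) : Prop :=
  ∃ s u, Γ.label s = some JLabel.eps ∧ Γ.label u = some (JLabel.num j) ∧ Γ.graph.Adj s u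

open scoped Classical in
/-- The number joined to an `ε`, if there is one. -/
noncomputable def epsNum (Γ : MarkedGraph n V) : Option (Fin n) :=
  if h : ∃ j, Γ.EpsEdge j then some h.choose else none

namespace IsGenerator

variable {Γ : MarkedGraph n V} {par : V → V} {D : V → Set V}

theorem not_inOmega_of_adj_eps [Finite V] (H : Γ.IsGenerator 0) {s u : V}
    (hs : Γ.label s = some JLabel.eps) (h : Γ.graph.Adj s u) : ¬ Γ.InOmegaComponent u := by
  rintro ⟨w, hw, hr⟩
  rw [H.special_unique (Or.inl hs) (Or.inr hw) (h.reachable.trans hr), hw] at hs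
  simp at hs

/-- The neighbour of an ε is not special, because a component has only one special vertex, and it is
not internal, because internal vertices belong to the component of ω. -/
theorem exists_num_of_eps [Finite V] (H : Γ.IsGenerator 0) {s : V}
    (hs : Γ.label s = some JLabel.eps) :
    ∃ j u, Γ.label u = some (JLabel.num j) ∧ Γ.graph.Adj s u := by
  obtain ⟨u, hu⟩ := H.exists_adj (v := s) (by simp [hs])
  rcases not_isSpecial_iff.1 (H.not_isSpecial_of_adj (Or.inl hs) hu) with h | ⟨j, h⟩
  · exact absurd (H.eps_internal u h) (H.not_inOmega_of_adj_eps hs hu)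
  · exact ⟨j, u, h, hu⟩

theorem epsEdge_unique [Finite V] (H : Γ.IsGenerator 0) {i j : Fin n} (hi : Γ.EpsEdge i)
    (hj : Γ.EpsEdge j) : i = j := by
  obtain ⟨s, u, h1, h2, h3⟩ := hi
  obtain ⟨s', u', h1', h2', h3'⟩ := hj
  exact H.eps_num u u' i j h2 h2' (H.not_inOmega_of_adj_eps h1 h3)
    (H.not_inOmega_of_adj_eps h1' h3')

/-- Every ε is joined to a number, and all components away from ω together have at most one number,
which is univalent. -/
theorem eps_unique [Finite V] (H : Γ.IsGenerator 0) {s s' : V}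
    (hs : Γ.label s = some JLabel.eps) (hs' : Γ.label s' = some JLabel.eps) : s = s' := by
  obtain ⟨i, u, h1, h2⟩ := H.exists_num_of_eps hs
  obtain ⟨j, u', h1', h2'⟩ := H.exists_num_of_eps hs'
  obtain rfl := H.epsEdge_unique ⟨s, u, hs, h1, h2⟩ ⟨s', u', hs', h1', h2'⟩
  obtain rfl := (H.num_once i).unique h1 h1'
  exact H.eq_of_adj (by simp [h1]) h2.symm h2'.symm

theorem epsNum_eq_some_iff [Finite V] (H : Γ.IsGenerator 0) {j : Fin n} :
    Γ.epsNum = some j ↔ Γ.EpsEdge j := by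
  unfold epsNum
  split_ifs with h
  · rw [Option.some_inj]
    exact ⟨fun h' => h' ▸ h.choose_spec, fun h' => H.epsEdge_unique h.choose_spec h'⟩
  · simpa using fun h' => h ⟨j, h'⟩

theorem mem_topSet_iff [Finite V] (H : Γ.IsGenerator 0) {j : Fin n} :
    j ∈ topSet Γ.epsNum ↔ ¬ Γ.EpsEdge j := by
  rw [mem_topSet, ne_eq, H.epsNum_eq_some_iff]

theorem epsEdge_or_inOmega [Finite V] (H : Γ.IsGenerator 0) {i : Fin n} {u : V}
    (hu : Γ.label u = some (JLabel.num i)) : Γ.EpsEdge i ∨ Γ.InOmegaComponent u := by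
  obtain ⟨s, hs, hr⟩ := H.connected u
  rcases hs with hs | hs
  · left
    obtain ⟨j, w, hw, hsw⟩ := H.exists_num_of_eps hs
    have : u ∈ ({s, w} : Set V) := by
      refine mem_of_reachable (Γ := Γ) ?_ hr.symm (Or.inl rfl)
      rintro a b hab (rfl | rfl)
      · exact Or.inr (H.eq_of_adj (by simp [hs]) hab hsw)
      · exact Or.inl (H.eq_of_adj (by simp [hw]) hab hsw.symm)
    rcases this with rfl | rfl
    · simp [hs] at hu
    · rw [hu] at hw
      exact ⟨s, u, hs, hu, hsw⟩
  · exact Or.inr ⟨s, hs, hr⟩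

theorem label_par_eq_eps_iff [Finite V] (H : Γ.IsGenerator 0) (R : Γ.Rooting par D) {v : V}
    (hv : ¬ Γ.IsSpecial v) : Γ.label (par v) = some JLabel.eps ↔
      ∃ j, Γ.label v = some (JLabel.num j) ∧ Γ.EpsEdge j := by
  constructor
  · intro h
    obtain ⟨j, u, hu, hs⟩ := H.exists_num_of_eps h
    have := H.eq_of_adj (by simp [h]) (R.adj hv).symm hs
    subst this
    exact ⟨j, hu, _, _, h, hu, hs⟩
  · rintro ⟨j, hj, s, u, hs, hu, hsu⟩
    obtain rfl := (H.num_once j).unique hj hu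
    rwa [H.eq_of_adj (by simp [hj]) (R.adj hv) hsu.symm]

/-- `r` is the neighbour of ω. Its subtree is the component of ω without ω itself, and a number is
missing from it exactly when it is joined to an ε. -/
theorem exists_root [Finite V] (H : Γ.IsGenerator 0) (R : Γ.Rooting par D) :
    ∃ r, ¬ Γ.IsSpecial r ∧ Γ.label (par r) = some JLabel.omega ∧
      (∀ u, ¬ Γ.IsSpecial u → Γ.InOmegaComponent u → u ∈ D r) ∧
      Γ.nums (D r) = topSet Γ.epsNum := by
  obtain ⟨w, hw, hwu⟩ := H.omega_once
  obtain ⟨r, hr⟩ := H.exists_adj (v := w) (by simp [hw])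
  have hrs := H.not_isSpecial_of_adj (Or.inr hw) hr
  have hpr : par r = w := by
    rcases R.adj_par hr with h | h
    · exact absurd (Or.inr hw) h.1
    · exact h.2.symm
  have hmem : ∀ u, ¬ Γ.IsSpecial u → Γ.InOmegaComponent u → u ∈ D r := by
    rintro u hu ⟨w', hw', hr'⟩
    obtain rfl := hwu w' hw'
    have : u ∈ insert w' (D r) := by
      refine mem_of_reachable (Γ := Γ) ?_ hr'.symm (Or.inl rfl)
      rintro a b hab (rfl | ha)
      · right
        rw [H.eq_of_adj (by simp [hw]) hab hr]
        exact R.self hrs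
      · by_cases hb : b ∈ D r
        · exact Or.inr hb
        · exact Or.inl ((R.cross hrs hab ha hb).2.trans hpr)
    rcases this with rfl | h
    · exact absurd (Or.inr hw) hu
    · exact h
  refine ⟨r, hrs, hpr ▸ hw, hmem, ?_⟩
  ext j
  rw [H.mem_topSet_iff, mem_nums]
  constructor
  · rintro ⟨u, hu, huj⟩ ⟨s, u', hs, hu', hsu⟩
    obtain rfl := (H.num_once j).unique huj hu'
    have := (R.cross hrs hsu.symm hu (fun h => R.nonspecial hrs h (Or.inl hs))).2
    rw [this, hpr, hw] at hs
    simp at hs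
  · intro h
    obtain ⟨u, hu, -⟩ := H.num_once j
    exact ⟨u, hmem u (not_isSpecial_of_num hu) ((H.epsEdge_or_inOmega hu).resolve_left h), hu⟩

/-- The clusters of a generator. -/
theorem validTuple [Finite V] (H : Γ.IsGenerator 0) {e : ℕ} {o : Fin e → Sym2 V}
    (ho : Γ.IsOrdering o) : ValidTuple (topSet Γ.epsNum) fun i => Γ.cluster (o i) := by
  obtain ⟨par, D, R⟩ := H.exists_rooting
  have key : ∀ i, ∃ v, Γ.label v = none ∧ o i = s(v, par v) := fun i =>
    (H.mem_structuralEdges_iff R).1 (ho.2 ▸ Set.mem_range_self i)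
  choose v hv hov using key
  have hs : ∀ i, ¬ Γ.IsSpecial (v i) := fun i => not_isSpecial_of_none (hv i)
  have hc : ∀ i, Γ.cluster (o i) = Γ.nums (D (v i)) := fun i => by
    rw [hov i, R.cluster_eq (hs i)]
  obtain ⟨r, hr, hpr, hmem, htop⟩ := H.exists_root R
  refine ⟨fun i j h => ho.1 ?_, fun i => ?_, fun i => ?_, fun i j => ?_, fun h2 => ?_⟩
  · simp only [hc] at h
    rw [hov, hov, H.nums_injective R (hs i) (hs j) h]
  · rw [hc, ← htop]
    exact nums_mono (R.sub_of_mem hr (hmem _ (hs i) (H.eps_internal _ (hv i))))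
  · rw [hc]
    exact H.two_le_card_nums R (hv i)
  · rw [hc, hc]
    by_cases h : ∃ k, k ∈ Γ.nums (D (v i)) ∧ k ∈ Γ.nums (D (v j))
    · obtain ⟨k, h1, h2⟩ := h
      rcases H.nested_of_nums R (hs i) (hs j) h1 h2 with h | h
      · exact Or.inl (nums_mono h)
      · exact Or.inr (Or.inl (nums_mono h))
    · push Not at h
      exact Or.inr (Or.inr (Finset.disjoint_left.2 h))
  · have hrl : Γ.label r = none := by
      refine (not_isSpecial_iff.1 hr).resolve_right fun ⟨j, hj⟩ => ?_
      rw [← htop, H.nums_num R hj, Finset.card_singleton] at h2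
      omega
    have : s(r, par r) ∈ Set.range o := by
      rw [ho.2, H.mem_structuralEdges_iff R]
      exact ⟨r, hrl, rfl⟩
    obtain ⟨i, hi⟩ := this
    exact ⟨i, by rw [hi, R.cluster_eq hr, htop]⟩

/-- This describes the parent by clusters alone: its cluster is the smallest one strictly above that
of `v`. It is the device for transporting parents from one graph to another. -/
theorem nums_ssubset_iff [Finite V] (H : Γ.IsGenerator 0) (R : Γ.Rooting par D) {v u : V}
    (hv : ¬ Γ.IsSpecial v) (hu : ¬ Γ.IsSpecial u) : Γ.nums (D v) ⊂ Γ.nums (D u) ↔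
      ¬ Γ.IsSpecial (par v) ∧ Γ.nums (D (par v)) ⊆ Γ.nums (D u) := by
  constructor
  · intro h
    have hsub := (H.nums_subset_iff R hv hu).1 h.1
    have hne : v ≠ u := by
      rintro rfl
      exact h.2 subset_rfl
    have hp := R.par_mem hu (hsub (R.self hv)) hne
    exact ⟨R.nonspecial hu hp, nums_mono (R.sub_of_mem hu hp)⟩
  · rintro ⟨hp, h⟩
    refine ⟨(nums_mono (R.D_subset_D_par hv hp)).trans h, fun h' => ?_⟩
    have h1 := (H.nums_subset_iff R hp hv).1 (h.trans h')
    exact R.par_notMem hv (h1 (R.self hp))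

end IsGenerator

/-- Vertices of two graphs with the same decoration or the same cluster. -/
def Match (Γ : MarkedGraph n V) (D : V → Set V) (Γ' : MarkedGraph n W) (D' : W → Set W)
    (v : V) (w : W) : Prop :=
  (Γ.IsSpecial v ∧ Γ'.IsSpecial w ∧ Γ'.label w = Γ.label v) ∨
    (¬ Γ.IsSpecial v ∧ ¬ Γ'.IsSpecial w ∧ Γ'.nums (D' w) = Γ.nums (D v))

section Match

variable {Γ : MarkedGraph n V} {Γ' : MarkedGraph n W} {par : V → V} {D : V → Set V}
  {par' : W → W} {D' : W → Set W}

theorem Match.symm {v : V} {w : W} (h : Match Γ D Γ' D' v w) : Match Γ' D' Γ D w v := by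
  rcases h with ⟨h1, h2, h3⟩ | ⟨h1, h2, h3⟩
  · exact Or.inl ⟨h2, h1, h3.symm⟩
  · exact Or.inr ⟨h2, h1, h3.symm⟩

theorem Match.unique [Finite W] (H' : Γ'.IsGenerator 0) (R' : Γ'.Rooting par' D') {v : V}
    {w w' : W} (h : Match Γ D Γ' D' v w) (h' : Match Γ D Γ' D' v w') : w = w' := by
  rcases h with ⟨h1, h2, h3⟩ | ⟨h1, h2, h3⟩ <;> rcases h' with ⟨g1, g2, g3⟩ | ⟨g1, g2, g3⟩
  · rcases h1 with h1 | h1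
    · exact H'.eps_unique (h3.trans h1) (g3.trans h1)
    · exact H'.omega_once.unique (h3.trans h1) (g3.trans h1)
  · exact absurd h1 g1
  · exact absurd g1 h1
  · exact H'.nums_injective R' h2 g2 (h3.trans g3.symm)

theorem Match.label_eq [Finite V] [Finite W] (H : Γ.IsGenerator 0) (R : Γ.Rooting par D)
    (H' : Γ'.IsGenerator 0) (R' : Γ'.Rooting par' D') {v : V} {w : W}
    (h : Match Γ D Γ' D' v w) : Γ'.label w = Γ.label v := by
  rcases h with ⟨_, _, h⟩ | ⟨h1, h2, h3⟩
  · exact h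
  · rcases not_isSpecial_iff.1 h1 with hv | ⟨i, hv⟩ <;>
      rcases not_isSpecial_iff.1 h2 with hw | ⟨j, hw⟩
    · rw [hv, hw]
    · have := H.two_le_card_nums R hv
      rw [← h3, H'.nums_num R' hw, Finset.card_singleton] at this
      omega
    · have := H'.two_le_card_nums R' hw
      rw [h3, H.nums_num R hv, Finset.card_singleton] at this
      omega
    · rw [H.nums_num R hv, H'.nums_num R' hw, Finset.singleton_inj] at h3
      rw [hv, hw, h3]

/-- Special vertices and numbered leaves are found by their decorations, internal vertices by the
structural edge to the parent, whose cluster occurs in the other graph as well. -/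
theorem exists_match [Finite V] [Finite W] (H : Γ.IsGenerator 0) (R : Γ.Rooting par D)
    (H' : Γ'.IsGenerator 0) (R' : Γ'.Rooting par' D') {e : ℕ} {o : Fin e → Sym2 V}
    {o' : Fin e → Sym2 W} (ho : Γ.IsOrdering o) (ho' : Γ'.IsOrdering o')
    (hτ : Γ'.epsNum = Γ.epsNum) (σ : Equiv.Perm (Fin e))
    (hσ : ∀ i, Γ'.cluster (o' i) = Γ.cluster (o (σ i))) (v : V) :
    ∃ w, Match Γ D Γ' D' v w := by
  by_cases hv : Γ.IsSpecial v
  · have : ∃ w, Γ'.label w = Γ.label v := by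
      rcases hv with hv | hv
      · obtain ⟨j, u, hu, hvu⟩ := H.exists_num_of_eps hv
        have := H.epsNum_eq_some_iff.2 ⟨v, u, hv, hu, hvu⟩
        rw [← hτ, H'.epsNum_eq_some_iff] at this
        obtain ⟨w, _, hw, _⟩ := this
        exact ⟨w, hw.trans hv.symm⟩
      · obtain ⟨w, hw, _⟩ := H'.omega_once
        exact ⟨w, hw.trans hv.symm⟩
    obtain ⟨w, hw⟩ := this
    exact ⟨w, Or.inl ⟨hv, by rwa [IsSpecial, hw], hw⟩⟩
  · rcases not_isSpecial_iff.1 hv with h | ⟨j, h⟩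
    · have : s(v, par v) ∈ Set.range o := by
        rw [ho.2, H.mem_structuralEdges_iff R]
        exact ⟨v, h, rfl⟩
      obtain ⟨k, hk⟩ := this
      have hk' : o' (σ.symm k) ∈ Γ'.structuralEdges := ho'.2 ▸ Set.mem_range_self _
      obtain ⟨w, hw, hkw⟩ := (H'.mem_structuralEdges_iff R').1 hk'
      have := hσ (σ.symm k)
      have hws := not_isSpecial_of_none hw
      rw [hkw, σ.apply_symm_apply, hk, R.cluster_eq hv, R'.cluster_eq hws] at this
      exact ⟨w, Or.inr ⟨hv, hws, this⟩⟩
    · obtain ⟨w, hw, _⟩ := H'.num_once j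
      exact ⟨w, Or.inr ⟨hv, not_isSpecial_of_num hw, by
        rw [H.nums_num R h, H'.nums_num R' hw]⟩⟩

/-- If the parents are not special, each of the two clusters is the least one above the common
cluster, so they agree. If they are special, the parent is ε precisely for the number recorded by
`epsNum`. -/
theorem Match.map_par [Finite V] [Finite W] (H : Γ.IsGenerator 0) (R : Γ.Rooting par D)
    (H' : Γ'.IsGenerator 0) (R' : Γ'.Rooting par' D') (hτ : Γ'.epsNum = Γ.epsNum)
    (h1 : ∀ v, ∃ w, Match Γ D Γ' D' v w) (h2 : ∀ w, ∃ v, Match Γ D Γ' D' v w) {v : V} {w : W}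
    (hv : ¬ Γ.IsSpecial v) (hw : ¬ Γ'.IsSpecial w) (h : Match Γ D Γ' D' v w) :
    Match Γ D Γ' D' (par v) (par' w) := by
  have hl := h.label_eq H R H' R'
  have hvw : Γ'.nums (D' w) = Γ.nums (D v) := by
    rcases h with h | h
    · exact absurd h.1 hv
    · exact h.2.2
  obtain ⟨p, hp⟩ := h1 (par v)
  obtain ⟨q, hq⟩ := h2 (par' w)
  have hps : ¬ Γ.IsSpecial (par v) → ¬ Γ'.IsSpecial (par' w) ∧
      Γ'.nums (D' (par' w)) ⊆ Γ.nums (D (par v)) := by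
    intro hn
    rcases hp with hp | ⟨_, hp1, hp2⟩
    · exact absurd hp.1 hn
    · rw [← hp2]
      refine (H'.nums_ssubset_iff R' hw hp1).1 ?_
      rw [hvw, hp2]
      exact (H.nums_ssubset_iff R hv hn).2 ⟨hn, subset_rfl⟩
  have hqs : ¬ Γ'.IsSpecial (par' w) → ¬ Γ.IsSpecial (par v) ∧
      Γ.nums (D (par v)) ⊆ Γ'.nums (D' (par' w)) := by
    intro hn
    rcases hq with hq | ⟨hq1, _, hq2⟩
    · exact absurd hq.2.1 hn
    · rw [hq2]
      refine (H.nums_ssubset_iff R hv hq1).1 ?_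
      rw [← hvw, ← hq2]
      exact (H'.nums_ssubset_iff R' hw hn).2 ⟨hn, subset_rfl⟩
  by_cases hn : Γ.IsSpecial (par v)
  · have hn' : Γ'.IsSpecial (par' w) := by
      by_contra hn'
      exact (hqs hn').1 hn
    refine Or.inl ⟨hn, hn', ?_⟩
    have heps : Γ'.label (par' w) = some JLabel.eps ↔ Γ.label (par v) = some JLabel.eps := by
      rw [H.label_par_eq_eps_iff R hv, H'.label_par_eq_eps_iff R' hw]
      simp only [hl, ← H.epsNum_eq_some_iff, ← H'.epsNum_eq_some_iff, hτ]
    rcases hn with hn | hn <;> rcases hn' with hn' | hn'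
    · rw [hn, hn']
    · rw [heps.2 hn] at hn'
      simp at hn'
    · rw [heps.1 hn'] at hn
      simp at hn
    · rw [hn, hn']
  · exact Or.inr ⟨hn, (hps hn).1, Finset.Subset.antisymm (hps hn).2 (hqs (hps hn).1).2⟩

/-- A generator is determined by its clusters and the number joined to an `ε`. -/
theorem exists_isIso [Finite V] [Finite W] (H : Γ.IsGenerator 0)
    (H' : Γ'.IsGenerator 0) {e : ℕ} {o : Fin e → Sym2 V}
    {o' : Fin e → Sym2 W} (ho : Γ.IsOrdering o) (ho' : Γ'.IsOrdering o')
    (hτ : Γ'.epsNum = Γ.epsNum) (σ : Equiv.Perm (Fin e))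
    (hσ : ∀ i, Γ'.cluster (o' i) = Γ.cluster (o (σ i))) :
    ∃ f : V ≃ W, IsIso f Γ Γ' ∧ ∀ i, o' i = Sym2.map f (o (σ i)) := by
  obtain ⟨par, D, R⟩ := H.exists_rooting
  obtain ⟨par', D', R'⟩ := H'.exists_rooting
  have h1 := exists_match H R H' R' ho ho' hτ σ hσ
  have h2 : ∀ w, ∃ v, Match Γ D Γ' D' v w := fun w => by
    obtain ⟨v, hv⟩ := exists_match H' R' H R ho' ho hτ.symm σ.symm
      (fun i => by rw [hσ, σ.apply_symm_apply]) w
    exact ⟨v, hv.symm⟩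
  choose f hf using h1
  choose f' hf' using h2
  let F : V ≃ W := ⟨f, f', fun v => ((hf' (f v)).symm.unique H R (hf v).symm),
    fun w => (hf (f' w)).unique H' R' (hf' w)⟩
  have hlab : ∀ v, Γ'.label (F v) = Γ.label v := fun v => (hf v).label_eq H R H' R'
  have hsp : ∀ v, Γ'.IsSpecial (F v) ↔ Γ.IsSpecial v := fun v => by
    rw [IsSpecial, IsSpecial, hlab]
  have hpar : ∀ v, ¬ Γ.IsSpecial v → F (par v) = par' (F v) := fun v hv =>
    (hf (par v)).unique H' R' ((hf v).map_par H R H' R' hτ (fun v => ⟨_, hf v⟩) (fun w => ⟨_, hf' w⟩)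
      hv (mt (hsp v).1 hv))
  refine ⟨F, ⟨fun u v => ?_, hlab⟩, fun i => ?_⟩
  · constructor
    · intro h
      rcases R'.adj_par h with ⟨hu, h⟩ | ⟨hv, h⟩
      · have hu' := mt (hsp u).2 hu
        rw [← hpar u hu', F.injective.eq_iff] at h
        exact h ▸ R.adj hu'
      · have hv' := mt (hsp v).2 hv
        rw [← hpar v hv', F.injective.eq_iff] at h
        exact h ▸ (R.adj hv').symm
    · intro h
      rcases R.adj_par h with ⟨hu, rfl⟩ | ⟨hv, rfl⟩
      · rw [hpar u hu]
        exact R'.adj (mt (hsp u).1 hu)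
      · rw [hpar v hv]
        exact (R'.adj (mt (hsp v).1 hv)).symm
  · obtain ⟨v, hv, hov⟩ := (H.mem_structuralEdges_iff R).1 (ho.2 ▸ Set.mem_range_self (σ i))
    obtain ⟨w, hw, how⟩ := (H'.mem_structuralEdges_iff R').1 (ho'.2 ▸ Set.mem_range_self i)
    have hvs := not_isSpecial_of_none hv
    have hws := not_isSpecial_of_none hw
    have := hσ i
    rw [hov, how, R.cluster_eq hvs, R'.cluster_eq hws] at this
    have hfv : F v = w := (hf v).unique H' R' (Or.inr ⟨hvs, hws, this⟩)
    rw [hov, how, Sym2.map_mk, hpar v hvs, hfv]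

end Match

end MarkedGraph

/-! ### Splitting an internal vertex -/

namespace MarkedGraph

variable {n : ℕ} {V W : Type}

section Split

variable {Γ : MarkedGraph n V} {v : V} {A : Finset V}

/-- The map `Option.getD · v` contracts the new edge. It is the left inverse through which edges,
components, decorations and cuts of the split graph are compared with those of the original one. -/
theorem getD_splitEnd (v : V) (A : Finset V) (u w : V) : (splitEnd v A u w).getD v = u := by
  unfold splitEnd
  split_ifs with h
  · exact h.1.symm
  · rfl

theorem splitEnd_of_ne {u : V} (h : u ≠ v) (A : Finset V) (w : V) : splitEnd v A u w = some u :=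
  if_neg fun h' => h h'.1

theorem map_getD_splitEdge (v : V) (A : Finset V) (e : Sym2 V) :
    Sym2.map (fun u : Option V => u.getD v) (splitEdge v A e) = e := by
  induction e with | _ a b =>
  simp only [splitEdge, Sym2.lift_mk, Sym2.map_mk, getD_splitEnd]

theorem splitEdge_injective (v : V) (A : Finset V) : Function.Injective (splitEdge v A) :=
  Function.LeftInverse.injective (map_getD_splitEdge v A)

theorem splitEdge_ne (v : V) (A : Finset V) {e : Sym2 V} (he : ¬ e.IsDiag) :
    s(some v, none) ≠ splitEdge v A e := by
  intro h
  apply he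
  rw [← map_getD_splitEdge v A e, ← h]
  simp

theorem split_edgeSet (Γ : MarkedGraph n V) (v : V) (A : Finset V) : (Γ.split v A).graph.edgeSet =
    insert s(some v, none) (splitEdge v A '' Γ.graph.edgeSet) := by
  rw [split, SimpleGraph.edgeSet_fromEdgeSet]
  refine sdiff_eq_left.2 (Set.disjoint_left.2 ?_)
  rintro e (rfl | ⟨e, he, rfl⟩) hd
  · simp at hd
  · have h1 : (Sym2.map (fun u : Option V => u.getD v) (splitEdge v A e)).IsDiag :=
      hd.map
    rw [map_getD_splitEdge] at h1
    exact Γ.graph.not_isDiag_of_mem_edgeSet he h1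

theorem split_adj_iff {a b : Option V} : (Γ.split v A).graph.Adj a b ↔
    s(a, b) = s(some v, none) ∨
      ∃ x y, Γ.graph.Adj x y ∧ a = splitEnd v A x y ∧ b = splitEnd v A y x := by
  rw [← SimpleGraph.mem_edgeSet, split_edgeSet, Set.mem_insert_iff]
  refine or_congr_right ⟨?_, ?_⟩
  · rintro ⟨e, he, h⟩
    induction e with | _ x y =>
    rcases Sym2.eq_iff.1 h with ⟨h1, h2⟩ | ⟨h1, h2⟩
    · exact ⟨x, y, he, h1.symm, h2.symm⟩
    · exact ⟨y, x, SimpleGraph.Adj.symm he, h2.symm, h1.symm⟩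
  · rintro ⟨x, y, h, rfl, rfl⟩
    exact ⟨s(x, y), h, rfl⟩

theorem split_adj_new : (Γ.split v A).graph.Adj (some v) none := split_adj_iff.2 (Or.inl rfl)

theorem split_adj_old {x y : V} (h : Γ.graph.Adj x y) :
    (Γ.split v A).graph.Adj (splitEnd v A x y) (splitEnd v A y x) :=
  split_adj_iff.2 (Or.inr ⟨x, y, h, rfl, rfl⟩)

theorem split_neighborSet_none (hA : ∀ u ∈ A, Γ.graph.Adj v u) :
    (Γ.split v A).graph.neighborSet none = insert (some v) (some '' (A : Set V)) := by
  ext b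
  rw [SimpleGraph.mem_neighborSet, split_adj_iff]
  constructor
  · rintro (h | ⟨x, y, hxy, h1, h2⟩)
    · left
      simpa [Sym2.eq_iff] using h
    · right
      have hx : x = v := by
        have := congrArg (fun u : Option V => u.getD v) h1
        simpa [getD_splitEnd] using this.symm
      subst hx
      have hy : y ∈ A := by
        by_contra hy
        rw [splitEnd, if_neg (by simp [hy])] at h1
        simp at h1
      rw [splitEnd_of_ne hxy.ne'] at h2
      exact ⟨y, hy, h2.symm⟩
  · rintro (rfl | ⟨y, hy, rfl⟩)
    · left
      simp
    · right
      have hvy := hA y hy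
      refine ⟨v, y, hvy, ?_, (splitEnd_of_ne hvy.ne' _ _).symm⟩
      exact (if_pos ⟨rfl, hy⟩).symm

theorem split_neighborSet_self : (Γ.split v A).graph.neighborSet (some v) =
    insert none (some '' (Γ.graph.neighborSet v \ A)) := by
  ext b
  rw [SimpleGraph.mem_neighborSet, split_adj_iff]
  constructor
  · rintro (h | ⟨x, y, hxy, h1, h2⟩)
    · left
      simpa [Sym2.eq_iff] using h
    · right
      have hx : x = v := by
        have := congrArg (fun u : Option V => u.getD v) h1
        simpa [getD_splitEnd] using this.symm
      subst hx
      have hy : y ∉ A := by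
        intro hy
        rw [splitEnd, if_pos ⟨rfl, hy⟩] at h1
        simp at h1
      rw [splitEnd_of_ne hxy.ne'] at h2
      exact ⟨y, ⟨hxy, hy⟩, h2.symm⟩
  · rintro (rfl | ⟨y, ⟨hvy, hy⟩, rfl⟩)
    · left
      rfl
    · right
      refine ⟨v, y, hvy, ?_, (splitEnd_of_ne (SimpleGraph.Adj.ne' hvy) _ _).symm⟩
      exact (if_neg fun h => hy h.2).symm

theorem split_neighborSet_of_ne {u : V} (hu : u ≠ v) : (Γ.split v A).graph.neighborSet (some u) =
    (fun w => splitEnd v A w u) '' Γ.graph.neighborSet u := by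
  ext b
  rw [SimpleGraph.mem_neighborSet, split_adj_iff]
  constructor
  · rintro (h | ⟨x, y, hxy, h1, rfl⟩)
    · simp [hu] at h
    · have hx : u = x := by
        have := congrArg (fun u : Option V => u.getD v) h1
        simpa [getD_splitEnd] using this
      subst hx
      exact ⟨y, hxy, rfl⟩
  · rintro ⟨y, hy, rfl⟩
    exact Or.inr ⟨u, y, hy, (splitEnd_of_ne hu _ _).symm, rfl⟩

theorem split_reachable_iff {a b : Option V} : (Γ.split v A).graph.Reachable a b ↔
    Γ.graph.Reachable (a.getD v) (b.getD v) := by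
  have hself : ∀ a : Option V, (Γ.split v A).graph.Reachable a (some (a.getD v)) := by
    rintro (_ | a)
    · exact split_adj_new.symm.reachable
    · exact SimpleGraph.Reachable.rfl
  constructor
  · rintro ⟨p⟩
    induction p with
    | nil => exact SimpleGraph.Reachable.rfl
    | cons h _ ih =>
      refine SimpleGraph.Reachable.trans ?_ ih
      rcases split_adj_iff.1 h with h | ⟨x, y, hxy, rfl, rfl⟩
      · rcases Sym2.eq_iff.1 h with ⟨rfl, rfl⟩ | ⟨rfl, rfl⟩ <;> exact SimpleGraph.Reachable.rfl
      · rw [getD_splitEnd, getD_splitEnd]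
        exact hxy.reachable
  · rintro ⟨p⟩
    refine (hself a).trans (SimpleGraph.Reachable.trans ?_ (hself b).symm)
    generalize a.getD v = x at p
    generalize b.getD v = y at p
    induction p with
    | nil => exact SimpleGraph.Reachable.rfl
    | @cons x y z h _ ih =>
      refine SimpleGraph.Reachable.trans ?_ ih
      have h1 := hself (splitEnd v A x y)
      have h2 := (split_adj_old (A := A) (v := v) h).reachable
      have h3 := h1.symm.trans (h2.trans (hself _))
      rwa [getD_splitEnd, getD_splitEnd] at h3

theorem split_isSpecial_iff (hv : Γ.label v = none) {a : Option V} :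
    (Γ.split v A).IsSpecial a ↔ Γ.IsSpecial (a.getD v) := by
  cases a
  · simp [IsSpecial, split, hv]
  · rfl

theorem split_label {a : Option V} {l : JLabel n} :
    (Γ.split v A).label a = some l ↔ ∃ u, a = some u ∧ Γ.label u = some l := by
  cases a <;> simp [split]

theorem split_label_getD (hv : Γ.label v = none) {a : Option V} :
    (Γ.split v A).label a = Γ.label (a.getD v) := by
  cases a
  · simp [split, hv]
  · rfl

theorem split_inOmega_iff {a : Option V} :
    (Γ.split v A).InOmegaComponent a ↔ Γ.InOmegaComponent (a.getD v) := by
  constructor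
  · rintro ⟨w, hw, hr⟩
    obtain ⟨u, rfl, hu⟩ := split_label.1 hw
    exact ⟨u, hu, split_reachable_iff.1 hr⟩
  · rintro ⟨u, hu, hr⟩
    exact ⟨some u, hu, split_reachable_iff.2 hr⟩

theorem split_existsUnique {l : JLabel n} (h : ∃! u, Γ.label u = some l) :
    ∃! a, (Γ.split v A).label a = some l := by
  obtain ⟨u, hu, huu⟩ := h
  refine ⟨some u, hu, fun a ha => ?_⟩
  obtain ⟨w, rfl, hw⟩ := split_label.1 ha
  rw [huu w hw]

theorem split_isGenerator [Finite V] {g : ℕ} (H : Γ.IsGenerator g) (hA : Γ.SplitAdmissible v A) :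
    (Γ.split v A).IsGenerator g := by
  obtain ⟨hv, hAv, h2, h3⟩ := hA
  have hdeg : ∀ {u}, u ≠ v → ((Γ.split v A).graph.neighborSet (some u)).ncard =
      (Γ.graph.neighborSet u).ncard := by
    intro u hu
    rw [split_neighborSet_of_ne hu]
    refine Set.ncard_image_of_injective _ fun x y hxy => ?_
    have := congrArg (fun u : Option V => u.getD v) hxy
    simpa [getD_splitEnd] using this
  have hnone : ((Γ.split v A).graph.neighborSet none).ncard = A.card + 1 := by
    rw [split_neighborSet_none hAv, Set.ncard_insert_of_notMem, Set.ncard_image_of_injective _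
      (Option.some_injective V), Set.ncard_coe_finset]
    rintro ⟨u, hu, h⟩
    exact (hAv u hu).ne' (Option.some_injective _ h)
  have hself : ((Γ.split v A).graph.neighborSet (some v)).ncard + A.card =
      (Γ.graph.neighborSet v).ncard + 1 := by
    rw [split_neighborSet_self, Set.ncard_insert_of_notMem (by simp), Set.ncard_image_of_injective _
      (Option.some_injective V)]
    have := Set.ncard_sdiff_add_ncard_of_subset (s := (A : Set V)) (t := Γ.graph.neighborSet v)
      (fun u hu => hAv u hu)
    rw [Set.ncard_coe_finset] at this
    omega
  refine ⟨?_, ?_, fun j => split_existsUnique (H.num_once j), split_existsUnique H.omega_once,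
    ?_, ?_, ?_, ?_, ?_, ?_⟩
  · rintro (_ | u) hu
    · omega
    · by_cases h : u = v
      · subst h
        omega
      · rw [hdeg h]
        exact H.internal u hu
  · rintro (_ | u) hu
    · exact absurd rfl hu
    · have h : u ≠ v := by
        rintro rfl
        exact hu hv
      rw [hdeg h]
      exact H.external u hu
  · intro a
    obtain ⟨s, hs, hr⟩ := H.connected (a.getD v)
    exact ⟨some s, hs, split_reachable_iff.2 hr⟩
  · have h1 : {a | (Γ.split v A).IsSpecial a} = some '' {u | Γ.IsSpecial u} := by
      ext a
      cases a
      · simp [IsSpecial, split]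
      · simp [IsSpecial, split]
    have h2 := H.genus
    rw [split_edgeSet, Set.ncard_insert_of_notMem, h1, Set.ncard_image_of_injective _
      (splitEdge_injective v A), Set.ncard_image_of_injective _ (Option.some_injective V),
      Finite.card_option]
    · omega
    · rintro ⟨e, he, h⟩
      exact splitEdge_ne v A (Γ.graph.not_isDiag_of_mem_edgeSet he) h.symm
  · intro a b hab ha hb
    obtain ⟨x, rfl, hx⟩ := split_label.1 ha
    obtain ⟨y, rfl, hy⟩ := split_label.1 hb
    rcases split_adj_iff.1 hab with h | ⟨x', y', h, h1, h2⟩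
    · simp at h
    · have h1' := congrArg (fun u : Option V => u.getD v) h1
      have h2' := congrArg (fun u : Option V => u.getD v) h2
      simp only [getD_splitEnd, Option.getD_some] at h1' h2'
      subst h1' h2'
      exact H.no_eps_omega _ _ h hx hy
  · intro a ha
    rw [split_inOmega_iff]
    exact H.eps_internal _ (split_label_getD hv ▸ ha)
  · intro a b i j ha hb
    rw [split_inOmega_iff, split_inOmega_iff]
    rw [split_label_getD hv] at ha hb
    exact H.eps_num _ _ i j ha hb
  · obtain ⟨u, hu, h⟩ := H.nonisolated
    exact ⟨some u, split_inOmega_iff.2 hu, h⟩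

theorem split_structuralEdges (hv : Γ.label v = none) : (Γ.split v A).structuralEdges =
    insert s(some v, none) (splitEdge v A '' Γ.structuralEdges) := by
  have key : ∀ e, (∀ a ∈ splitEdge v A e, ∀ j, (Γ.split v A).label a ≠ some (JLabel.num j)) ↔
      ∀ u ∈ e, ∀ j, Γ.label u ≠ some (JLabel.num j) := by
    intro e
    induction e with | _ x y =>
    simp only [splitEdge, Sym2.lift_mk, Sym2.mem_iff, forall_eq_or_imp, forall_eq,
      split_label_getD hv, getD_splitEnd]
  ext e
  simp only [structuralEdges, split_edgeSet, Set.mem_ofPred_eq, Set.mem_insert_iff]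
  constructor
  · rintro ⟨rfl | ⟨e, he, rfl⟩, h⟩
    · exact Or.inl rfl
    · exact Or.inr ⟨e, ⟨he, (key e).1 h⟩, rfl⟩
  · rintro (rfl | ⟨e, ⟨he, h⟩, rfl⟩)
    · refine ⟨Or.inl rfl, fun a ha j => ?_⟩
      rw [split_label_getD hv]
      rcases Sym2.mem_iff.1 ha with rfl | rfl <;> simp [hv]
    · exact ⟨Or.inr ⟨e, he, rfl⟩, (key e).2 h⟩

theorem split_isOrdering {e : ℕ} {o : Fin e → Sym2 V} (ho : Γ.IsOrdering o)
    (hv : Γ.label v = none) : (Γ.split v A).IsOrdering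
      (Fin.cons s(some v, none) fun i => splitEdge v A (o i) : Fin (e + 1) → _) := by
  constructor
  · refine Fin.cons_injective_iff.2 ⟨?_, (splitEdge_injective v A).comp ho.1⟩
    rintro ⟨i, hi⟩
    have : o i ∈ Γ.structuralEdges := ho.2 ▸ Set.mem_range_self i
    exact splitEdge_ne v A (Γ.graph.not_isDiag_of_mem_edgeSet this.1) hi.symm
  · rw [Fin.range_cons, split_structuralEdges hv, ← ho.2, ← Set.range_comp]
    rfl

theorem split_epsNum [Finite V] (H : Γ.IsGenerator 0) (hA : Γ.SplitAdmissible v A) :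
    (Γ.split v A).epsNum = Γ.epsNum := by
  ext j
  rw [(split_isGenerator H hA).epsNum_eq_some_iff, H.epsNum_eq_some_iff]
  constructor
  · rintro ⟨a, b, ha, hb, hab⟩
    obtain ⟨x, rfl, hx⟩ := split_label.1 ha
    obtain ⟨y, rfl, hy⟩ := split_label.1 hb
    refine ⟨x, y, hx, hy, ?_⟩
    rcases split_adj_iff.1 hab with h | ⟨x', y', h, h1, h2⟩
    · simp at h
    · have h1' := congrArg (fun u : Option V => u.getD v) h1
      have h2' := congrArg (fun u : Option V => u.getD v) h2
      simp only [getD_splitEnd, Option.getD_some] at h1' h2'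
      subst h1' h2'
      exact h
  · rintro ⟨x, y, hx, hy, hxy⟩
    have hv := hA.1
    have hxv : x ≠ v := by rintro rfl; simp [hx] at hv
    have hyv : y ≠ v := by rintro rfl; simp [hy] at hv
    refine ⟨some x, some y, hx, hy, ?_⟩
    simpa [splitEnd_of_ne hxv, splitEnd_of_ne hyv] using split_adj_old (v := v) (A := A) hxy

theorem IsCut.split (hv : Γ.label v = none) {e : Sym2 V} (he : ¬ e.IsDiag) {X : Set V}
    (hX : Γ.IsCut e X) :
    (Γ.split v A).IsCut (splitEdge v A e) ((fun u : Option V => u.getD v) ⁻¹' X) := by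
  constructor
  · intro a ha
    rw [split_isSpecial_iff hv]
    exact hX.1 _ ha
  · intro a b hab
    simp only [Set.mem_preimage]
    rcases split_adj_iff.1 hab with h | ⟨x, y, hxy, rfl, rfl⟩
    · rw [h]
      refine iff_of_true ?_ (splitEdge_ne v A he)
      rcases Sym2.eq_iff.1 h with ⟨rfl, rfl⟩ | ⟨rfl, rfl⟩ <;> rfl
    · rw [getD_splitEnd, getD_splitEnd, hX.2 x y hxy]
      exact not_congr (splitEdge_injective v A).eq_iff.symm

theorem nums_preimage_getD (hv : Γ.label v = none) (X : Set V) :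
    (Γ.split v A).nums ((fun u : Option V => u.getD v) ⁻¹' X) = Γ.nums X := by
  ext j
  rw [mem_nums, mem_nums]
  constructor
  · rintro ⟨a, ha, hj⟩
    exact ⟨_, ha, split_label_getD hv ▸ hj⟩
  · rintro ⟨u, hu, hj⟩
    exact ⟨some u, hu, hj⟩

theorem IsGenerator.exists_isCut [Finite V] (H : Γ.IsGenerator 0) (e : Sym2 V) :
    ∃ X, Γ.IsCut e X := by
  obtain ⟨X, h1, h2⟩ := exists_cut H.connected (by simpa using H.genus) {e}
  exact ⟨X, h1, by simpa using h2⟩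

theorem cluster_splitEdge [Finite V] (H : Γ.IsGenerator 0) (hA : Γ.SplitAdmissible v A)
    {e : Sym2 V} (he : ¬ e.IsDiag) : (Γ.split v A).cluster (splitEdge v A e) = Γ.cluster e := by
  obtain ⟨X, hX⟩ := H.exists_isCut e
  rw [hX.cluster_eq H.connected, (hX.split hA.1 he).cluster_eq (split_isGenerator H hA).connected,
    nums_preimage_getD hA.1]

variable {par : V → V} {D : V → Set V}

/-- Here `z` is the half of `v` away from the root, `z'` the half that keeps the edge to the parent,
and `B` the set of children attached to `z`. Keeping `z` and `z'` as variables treats both namings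
of the two halves at once. -/
theorem isCut_split_new (R : Γ.Rooting par D) (hv : Γ.label v = none) {B : Set V} {z z' : Option V}
    (hz : s(z, z') = s(some v, none)) (hB : ∀ u ∈ B, ¬ Γ.IsSpecial u ∧ par u = v)
    (hB' : ∀ u ∈ B, splitEnd v A v u = z)
    (hN : ∀ b, (Γ.split v A).graph.Adj z b → b = z' ∨ ∃ u ∈ B, b = some u) :
    (Γ.split v A).IsCut s(some v, none) (insert z (some '' ⋃ u ∈ B, D u)) := by
  have hvs := not_isSpecial_of_none hv
  have hzv : z.getD v = v ∧ z'.getD v = v := by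
    rcases Sym2.eq_iff.1 hz with ⟨rfl, rfl⟩ | ⟨rfl, rfl⟩ <;> exact ⟨rfl, rfl⟩
  have hzz : z' ≠ z := by
    rcases Sym2.eq_iff.1 hz with ⟨rfl, rfl⟩ | ⟨rfl, rfl⟩ <;> simp
  have hvD : ∀ u ∈ B, v ∉ D u := by
    intro u hu h
    obtain ⟨h1, rfl⟩ := hB u hu
    exact R.par_notMem h1 h
  have hz' : z' ∉ insert z (some '' ⋃ u ∈ B, D u) := by
    rintro (h | ⟨x, hx, rfl⟩)
    · exact hzz h
    · obtain rfl : x = v := hzv.2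
      simp only [Set.mem_iUnion] at hx
      obtain ⟨u, hu, hx⟩ := hx
      exact hvD u hu hx
  have hcross : ∀ a b, (Γ.split v A).graph.Adj a b → a ∈ insert z (some '' ⋃ u ∈ B, D u) →
      b ∉ insert z (some '' ⋃ u ∈ B, D u) → s(a, b) = s(some v, none) := by
    rintro a b hab (rfl | ⟨x, hx, rfl⟩) hb
    · rcases hN b hab with rfl | ⟨u, hu, rfl⟩
      · exact hz
      · refine absurd (Or.inr ⟨u, ?_, rfl⟩) hb
        simp only [Set.mem_iUnion]
        exact ⟨u, hu, R.self (hB u hu).1⟩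
    · simp only [Set.mem_iUnion] at hx
      obtain ⟨u, hu, hx⟩ := hx
      have hxv : x ≠ v := by
        rintro rfl
        exact hvD u hu hx
      rcases split_adj_iff.1 hab with h | ⟨x', w, hxw, h1, rfl⟩
      · exact h
      · exfalso
        have h1' := congrArg (fun u : Option V => u.getD v) h1
        simp only [getD_splitEnd, Option.getD_some] at h1'
        subst h1'
        apply hb
        by_cases hw : w ∈ D u
        · have hwv : w ≠ v := by
            rintro rfl
            exact hvD u hu hw
          rw [splitEnd_of_ne hwv]
          refine Or.inr ⟨w, ?_, rfl⟩
          simp only [Set.mem_iUnion]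
          exact ⟨u, hu, hw⟩
        · obtain ⟨rfl, rfl⟩ := R.cross (hB u hu).1 hxw hx hw
          left
          rw [(hB x hu).2]
          exact hB' x hu
  constructor
  · rintro a (rfl | ⟨x, hx, rfl⟩)
    · rw [split_isSpecial_iff hv, hzv.1]
      exact hvs
    · simp only [Set.mem_iUnion] at hx
      obtain ⟨u, hu, hx⟩ := hx
      exact R.nonspecial (hB u hu).1 hx
  · intro a b hab
    constructor
    · rintro h h'
      rw [← hz] at h'
      rcases Sym2.eq_iff.1 h' with ⟨rfl, rfl⟩ | ⟨rfl, rfl⟩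
      · exact hz' (h.1 (Or.inl rfl))
      · exact hz' (h.2 (Or.inl rfl))
    · intro h
      by_contra hne
      by_cases ha : a ∈ insert z (some '' ⋃ u ∈ B, D u)
      · exact h (hcross a b hab ha fun hb => hne (iff_of_true ha hb))
      · refine h (Sym2.eq_swap.trans (hcross b a hab.symm ?_ ha))
        by_contra hb
        exact hne (iff_of_false ha hb)

theorem mem_cluster_split_new [Finite V] (H : Γ.IsGenerator 0) (R : Γ.Rooting par D)
    (hA : Γ.SplitAdmissible v A) {B : Set V} {z z' : Option V}
    (hz : s(z, z') = s(some v, none)) (hB : ∀ u ∈ B, ¬ Γ.IsSpecial u ∧ par u = v)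
    (hB' : ∀ u ∈ B, splitEnd v A v u = z)
    (hN : ∀ b, (Γ.split v A).graph.Adj z b → b = z' ∨ ∃ u ∈ B, b = some u) {j : Fin n} :
    j ∈ (Γ.split v A).cluster s(some v, none) ↔ ∃ u ∈ B, j ∈ Γ.nums (D u) := by
  rw [(isCut_split_new R hA.1 hz hB hB' hN).mem_cluster (split_isGenerator H hA).connected]
  constructor
  · rintro ⟨a, rfl | ⟨x, hx, rfl⟩, hj⟩
    · exfalso
      rw [split_label_getD hA.1] at hj
      rcases Sym2.eq_iff.1 hz with ⟨rfl, rfl⟩ | ⟨rfl, rfl⟩ <;> simp [hA.1] at hj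
    · simp only [Set.mem_iUnion] at hx
      obtain ⟨u, hu, hx⟩ := hx
      exact ⟨u, hu, mem_nums.2 ⟨x, hx, hj⟩⟩
  · rintro ⟨u, hu, hj⟩
    obtain ⟨x, hx, hxj⟩ := mem_nums.1 hj
    refine ⟨some x, Or.inr ⟨x, ?_, rfl⟩, hxj⟩
    simp only [Set.mem_iUnion]
    exact ⟨u, hu, hx⟩

theorem Rooting.par_eq_of_adj (R : Γ.Rooting par D) {u : V}
    (h : Γ.graph.Adj v u) (hne : u ≠ par v) : ¬ Γ.IsSpecial u ∧ par u = v := by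
  rcases R.adj_par h with h' | h'
  · exact absurd h'.2 hne
  · exact ⟨h'.1, h'.2.symm⟩

/-- If the parent edge is not moved, the half `none` is the lower one and its children are the
elements of `A`. In the opposite case, treated next, the lower half is `some v` with the neighbours
outside `A`. -/
theorem mem_cluster_split_of_notMem [Finite V] (H : Γ.IsGenerator 0) (R : Γ.Rooting par D)
    (hA : Γ.SplitAdmissible v A) (hp : par v ∉ A) {j : Fin n} :
    j ∈ (Γ.split v A).cluster s(some v, none) ↔ ∃ u ∈ A, j ∈ Γ.nums (D u) := by
  refine mem_cluster_split_new H R hA (B := (A : Set V)) (z := none) (z' := some v) Sym2.eq_swap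
    (fun u hu => R.par_eq_of_adj (hA.2.1 u hu) fun h => hp (h ▸ hu))
    (fun u hu => if_pos ⟨rfl, hu⟩) fun b hb => ?_
  rw [← SimpleGraph.mem_neighborSet, split_neighborSet_none hA.2.1] at hb
  rcases hb with h | ⟨u, hu, rfl⟩
  · exact Or.inl h
  · exact Or.inr ⟨u, hu, rfl⟩

theorem mem_cluster_split_of_mem [Finite V] (H : Γ.IsGenerator 0) (R : Γ.Rooting par D)
    (hA : Γ.SplitAdmissible v A) (hp : par v ∈ A) {j : Fin n} :
    j ∈ (Γ.split v A).cluster s(some v, none) ↔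
      ∃ u, Γ.graph.Adj v u ∧ u ∉ A ∧ j ∈ Γ.nums (D u) := by
  rw [mem_cluster_split_new H R hA (B := Γ.graph.neighborSet v \ A) (z := some v) (z' := none) rfl
    (fun u hu => R.par_eq_of_adj hu.1 fun h => hu.2 (h ▸ hp))
    (fun u hu => if_neg fun h => hu.2 h.2) fun b hb => ?_]
  · simp [and_assoc]
  · rw [← SimpleGraph.mem_neighborSet, split_neighborSet_self] at hb
    rcases hb with h | ⟨u, hu, rfl⟩
    · exact Or.inl h
    · exact Or.inr ⟨u, hu, rfl⟩

end Split

end MarkedGraph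

/-! ### Counting the splittings that add a given cluster -/

namespace MarkedGraph

variable {n : ℕ} {V : Type} {Γ : MarkedGraph n V} {par : V → V} {D : V → Set V}

open scoped Classical in
/-- The neighbours of `v` that are not in `A`. -/
noncomputable def coNeighbors [Finite V] (Γ : MarkedGraph n V) (v : V) (A : Finset V) : Finset V :=
  (Set.toFinite (Γ.graph.neighborSet v)).toFinset \ A

theorem mem_coNeighbors [Finite V] {v u : V} {A : Finset V} :
    u ∈ Γ.coNeighbors v A ↔ Γ.graph.Adj v u ∧ u ∉ A := by
  simp [coNeighbors]

theorem coNeighbors_coNeighbors [Finite V] {v : V} {A : Finset V}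
    (hA : ∀ u ∈ A, Γ.graph.Adj v u) : Γ.coNeighbors v (Γ.coNeighbors v A) = A := by
  ext u
  rw [mem_coNeighbors, mem_coNeighbors]
  have := hA u
  tauto

theorem SplitAdmissible.coNeighbors [Finite V] {v : V} {A : Finset V}
    (hA : Γ.SplitAdmissible v A) : Γ.SplitAdmissible v (Γ.coNeighbors v A) := by
  classical
  obtain ⟨h1, h2, h3, h4⟩ := hA
  have hsub : A ⊆ (Set.toFinite (Γ.graph.neighborSet v)).toFinset := fun u hu => by
    simpa using h2 u hu
  have hc : (Γ.coNeighbors v A).card + A.card = (Γ.graph.neighborSet v).ncard := by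
    rw [MarkedGraph.coNeighbors, Set.ncard_eq_toFinset_card _ (Set.toFinite _)]
    exact Finset.card_sdiff_add_card_eq_card hsub
  exact ⟨h1, fun u hu => (mem_coNeighbors.1 hu).1, by omega, by omega⟩

/-- Passing from `A` to the complementary set of neighbours only exchanges the names of the two
halves; the half that is cut off from the root stays the same. This is the source of the factor 2
that cancels the 1/2 in `splitGen`. -/
theorem cluster_split_coNeighbors [Finite V] (H : Γ.IsGenerator 0) {v : V} {A : Finset V}
    (hA : Γ.SplitAdmissible v A) : (Γ.split v (Γ.coNeighbors v A)).cluster s(some v, none) =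
      (Γ.split v A).cluster s(some v, none) := by
  obtain ⟨par, D, R⟩ := H.exists_rooting
  have hp := R.adj (not_isSpecial_of_none hA.1)
  have hA' := hA.coNeighbors
  ext j
  by_cases h : par v ∈ A
  · rw [mem_cluster_split_of_mem H R hA h, mem_cluster_split_of_notMem H R hA'
      (fun h' => (mem_coNeighbors.1 h').2 h)]
    simp only [mem_coNeighbors, and_assoc]
  · rw [mem_cluster_split_of_notMem H R hA h, mem_cluster_split_of_mem H R hA'
      (mem_coNeighbors.2 ⟨hp, h⟩)]
    simp only [mem_coNeighbors]
    refine exists_congr fun u => ?_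
    have := hA.2.1 u
    tauto

/-- Splitting a vertex adds a cluster. -/
theorem validTuple_split [Finite V] (H : Γ.IsGenerator 0) {e : ℕ} {o : Fin e → Sym2 V}
    (ho : Γ.IsOrdering o) {v : V} {A : Finset V} (hA : Γ.SplitAdmissible v A) :
    ValidTuple (topSet Γ.epsNum) (Fin.cons ((Γ.split v A).cluster s(some v, none))
      (fun i => Γ.cluster (o i)) : Fin (e + 1) → _) := by
  have h := (split_isGenerator H hA).validTuple (split_isOrdering ho hA.1)
  rw [split_epsNum H hA] at h
  convert h using 1
  funext i
  refine Fin.cases rfl (fun i => ?_) i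
  have hi : o i ∈ Γ.structuralEdges := ho.2 ▸ Set.mem_range_self i
  simp only [Fin.cons_succ]
  rw [cluster_splitEdge H hA (Γ.graph.not_isDiag_of_mem_edgeSet hi.1)]

theorem Rooting.eq_of_mem_nums (R : Γ.Rooting par D) (H : Γ.IsGenerator 0) {u u' : V}
    (hu : ¬ Γ.IsSpecial u) (hu' : ¬ Γ.IsSpecial u') (h : par u = par u') {j : Fin n}
    (hj : j ∈ Γ.nums (D u)) (hj' : j ∈ Γ.nums (D u')) : u = u' := by
  by_contra hne
  obtain ⟨x, hx, hxj⟩ := mem_nums.1 hj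
  obtain ⟨y, hy, hyj⟩ := mem_nums.1 hj'
  obtain rfl := (H.num_once j).unique hxj hyj
  exact R.disjoint_children hu hu' h hne hx hy

/-- The vertex to split is the lowest one whose subtree contains `C`. By nestedness the cluster of
each of its children is contained in `C` or disjoint from it, and the former children are pulled
off. The condition `par v ∉ A` selects one of the two complementary splittings. -/
theorem exists_split [Finite V] (H : Γ.IsGenerator 0) (R : Γ.Rooting par D) {e : ℕ}
    {o : Fin e → Sym2 V} (ho : Γ.IsOrdering o) {C : Finset (Fin n)}
    (hC : ValidTuple (topSet Γ.epsNum)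
      (Fin.cons C (fun i => Γ.cluster (o i)) : Fin (e + 1) → _)) :
    ∃ v A, Γ.SplitAdmissible v A ∧ par v ∉ A ∧ ∀ j, j ∈ C ↔ ∃ u ∈ A, j ∈ Γ.nums (D u) := by
  classical
  have := Fintype.ofFinite V
  have hedge : ∀ v, Γ.label v = none → ∃ i, Γ.cluster (o i) = Γ.nums (D v) := by
    intro v hv
    have : s(v, par v) ∈ Set.range o := by
      rw [ho.2, H.mem_structuralEdges_iff R]
      exact ⟨v, hv, rfl⟩
    obtain ⟨i, hi⟩ := this
    exact ⟨i, by rw [hi, R.cluster_eq (not_isSpecial_of_none hv)]⟩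
  have hC2 : 2 ≤ C.card := hC.two_le 0
  have hCL : C ⊆ topSet Γ.epsNum := hC.sub 0
  have hCne : ∀ v, Γ.label v = none → C ≠ Γ.nums (D v) := by
    intro v hv h
    obtain ⟨i, hi⟩ := hedge v hv
    have := hC.inj (a₁ := 0) (a₂ := i.succ) (by simp [h, hi])
    exact absurd this (Fin.succ_ne_zero i).symm
  obtain ⟨r, hr, -, -, hrtop⟩ := H.exists_root R
  -- The neighbour of the root has all of `topSet` below it, so there is a candidate to start from.
  obtain ⟨v, hv, hmin⟩ := Finset.exists_min_image
    (Finset.univ.filter fun v => ¬ Γ.IsSpecial v ∧ C ⊆ Γ.nums (D v))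
    (fun v => (Γ.nums (D v)).card) ⟨r, by simp [hr, hrtop, hCL]⟩
  simp only [Finset.mem_filter, Finset.mem_univ, true_and, and_imp] at hv hmin
  obtain ⟨hvs, hCv⟩ := hv
  have hvl : Γ.label v = none := by
    refine (not_isSpecial_iff.1 hvs).resolve_right fun ⟨j, hj⟩ => ?_
    have := Finset.card_le_card hCv
    rw [H.nums_num R hj, Finset.card_singleton] at this
    omega
  have hchild : ∀ u, ¬ Γ.IsSpecial u → par u = v →
      ¬ C ⊆ Γ.nums (D u) ∧ (∀ j ∈ C, j ∈ Γ.nums (D u) → Γ.nums (D u) ⊆ C) := by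
    rintro u hu rfl
    have hnot : ¬ C ⊆ Γ.nums (D u) := fun h => by
      have hlt := Finset.card_lt_card ((H.nums_ssubset_iff R hu hvs).2 ⟨hvs, subset_rfl⟩)
      exact absurd (hmin u hu h) (by omega)
    refine ⟨hnot, fun j hjC hju => ?_⟩
    rcases not_isSpecial_iff.1 hu with h | ⟨i, h⟩
    · obtain ⟨k, hk⟩ := hedge u h
      have := hC.nested 0 k.succ
      simp only [Fin.cons_zero, Fin.cons_succ, hk] at this
      rcases this with h | h | h
      · exact absurd h hnot
      · exact h
      · exact absurd hju (Finset.disjoint_left.1 h hjC)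
    · rw [H.nums_num R h, Finset.mem_singleton] at hju
      rw [H.nums_num R h, Finset.singleton_subset_iff, ← hju]
      exact hjC
  have hcover : ∀ j ∈ Γ.nums (D v), ∃ u, ¬ Γ.IsSpecial u ∧ par u = v ∧ j ∈ Γ.nums (D u) := by
    intro j hj
    obtain ⟨x, hx, hxj⟩ := mem_nums.1 hj
    rcases R.eq_or_mem_child hvs hx with rfl | ⟨u, hu, hpu, hxu⟩
    · simp [hvl] at hxj
    · exact ⟨u, hu, hpu, mem_nums.2 ⟨x, hxu, hxj⟩⟩
  let A : Finset V := Finset.univ.filter fun u =>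
    ¬ Γ.IsSpecial u ∧ par u = v ∧ Γ.nums (D u) ⊆ C
  have hA : ∀ u, u ∈ A ↔ ¬ Γ.IsSpecial u ∧ par u = v ∧ Γ.nums (D u) ⊆ C := fun u => by simp [A]
  have hmem : ∀ j, j ∈ C ↔ ∃ u ∈ A, j ∈ Γ.nums (D u) := by
    intro j
    constructor
    · intro hj
      obtain ⟨u, hu, hpu, hju⟩ := hcover j (hCv hj)
      exact ⟨u, (hA u).2 ⟨hu, hpu, (hchild u hu hpu).2 j hj hju⟩, hju⟩
    · rintro ⟨u, hu, hju⟩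
      exact ((hA u).1 hu).2.2 hju
  have hpA : par v ∉ A := fun h => by
    obtain ⟨h1, h2, -⟩ := (hA _).1 h
    have := R.D_subset_D_par h1 (h2.symm ▸ hvs)
    rw [h2] at this
    exact R.par_notMem hvs (this (R.self h1))
  refine ⟨v, A, ⟨hvl, fun u hu => ?_, ?_, ?_⟩, hpA, hmem⟩
  · obtain ⟨h1, rfl, -⟩ := (hA u).1 hu
    exact (R.adj h1).symm
  · obtain ⟨j, hj⟩ : C.Nonempty := Finset.card_pos.1 (by omega)
    obtain ⟨u, hu, hju⟩ := (hmem j).1 hj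
    obtain ⟨h1, h2, h3⟩ := (hA u).1 hu
    obtain ⟨i, hi, hiu⟩ := Finset.not_subset.1 (hchild u h1 h2).1
    obtain ⟨u', hu', hiu'⟩ := (hmem i).1 hi
    exact Finset.one_lt_card.2 ⟨u, hu, u', hu', fun h => hiu (h ▸ hiu')⟩
  · obtain ⟨j, hj, hjC⟩ : ∃ j ∈ Γ.nums (D v), j ∉ C := by
      by_contra hno
      push Not at hno
      exact hCne v hvl (Finset.Subset.antisymm hCv hno)
    obtain ⟨u, hu, rfl, hju⟩ := hcover j hj
    have huA : u ∉ A := fun h => hjC ((hmem j).2 ⟨u, h, hju⟩)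
    have hup : u ≠ par (par u) := by
      rintro h
      exact R.par_notMem hvs (h ▸ R.mem_D_par hu hvs)
    -- The vertex keeps two neighbours outside `A`: its parent, and a child `u` with a number that
    -- is not in `C`, which exists because `C` is a new cluster.
    have hsub : ((insert u (insert (par (par u)) A) : Finset V) : Set V) ⊆
        Γ.graph.neighborSet (par u) := by
      intro w hw
      simp only [Finset.coe_insert, Set.mem_insert_iff, Finset.mem_coe] at hw
      rcases hw with rfl | rfl | hw
      · exact (R.adj hu).symm
      · exact R.adj hvs
      · obtain ⟨h1, h2, -⟩ := (hA w).1 hw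
        exact h2 ▸ (R.adj h1).symm
    have := Set.ncard_le_ncard hsub (Set.toFinite _)
    rwa [Set.ncard_coe_finset, Finset.card_insert_of_notMem, Finset.card_insert_of_notMem hpA]
      at this
    simp [huA, hup]

/-- If the two vertices differed, one would lie under a child of the other, so `C` would be
contained in the cluster of that child; but the set attached to the upper vertex has a second child,
with numbers in `C`. For equal vertices, `A` is read off from the children whose numbers lie in `C`.
-/
theorem split_unique [Finite V] (H : Γ.IsGenerator 0) (R : Γ.Rooting par D)
    {C : Finset (Fin n)} {v v' : V} {A A' : Finset V}
    (hA : Γ.SplitAdmissible v A) (hp : par v ∉ A) (hC : ∀ j, j ∈ C ↔ ∃ u ∈ A, j ∈ Γ.nums (D u))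
    (hA' : Γ.SplitAdmissible v' A') (hp' : par v' ∉ A')
    (hC' : ∀ j, j ∈ C ↔ ∃ u ∈ A', j ∈ Γ.nums (D u)) : v = v' ∧ A = A' := by
  have hv := not_isSpecial_of_none hA.1
  have hv' := not_isSpecial_of_none hA'.1
  have hch : ∀ {v A}, Γ.SplitAdmissible v A → par v ∉ A → ∀ u ∈ A,
      ¬ Γ.IsSpecial u ∧ par u = v := fun hA hp u hu =>
    R.par_eq_of_adj (hA.2.1 u hu) fun h => hp (h ▸ hu)
  have hsub : ∀ {v A}, Γ.SplitAdmissible v A → par v ∉ A →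
      (∀ j, j ∈ C ↔ ∃ u ∈ A, j ∈ Γ.nums (D u)) → ∀ j ∈ C, j ∈ Γ.nums (D v) := by
    intro v A hA hp hC j hj
    obtain ⟨u, hu, hju⟩ := (hC j).1 hj
    obtain ⟨h1, rfl⟩ := hch hA hp u hu
    exact nums_mono (R.D_subset_D_par h1 (not_isSpecial_of_none hA.1)) hju
  have key : ∀ {v v' A A'}, Γ.SplitAdmissible v A → par v ∉ A →
      (∀ j, j ∈ C ↔ ∃ u ∈ A, j ∈ Γ.nums (D u)) → Γ.SplitAdmissible v' A' → par v' ∉ A' →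
      (∀ j, j ∈ C ↔ ∃ u ∈ A', j ∈ Γ.nums (D u)) → D v ⊆ D v' → v = v' := by
    intro v v' A A' hA hp hC hA' hp' hC' hs
    have hv := not_isSpecial_of_none hA.1
    have hv' := not_isSpecial_of_none hA'.1
    by_contra hne
    rcases R.eq_or_mem_child hv' (hs (R.self hv)) with h | ⟨u, hu, hpu, hvu⟩
    · exact hne h
    obtain ⟨u', hu', hne'⟩ := Finset.exists_mem_ne (s := A') (by have := hA'.2.2.1; omega) u
    obtain ⟨h1, h2⟩ := hch hA' hp' u' hu'
    obtain ⟨j, hj⟩ := H.nums_nonempty R h1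
    have hju := nums_mono (R.sub_of_mem hu hvu) (hsub hA hp hC j ((hC' j).2 ⟨u', hu', hj⟩))
    exact hne' (R.eq_of_mem_nums H h1 hu (h2.trans hpu.symm) hj hju)
  have hvv : v = v' := by
    obtain ⟨u, hu⟩ : A.Nonempty := Finset.card_pos.1 (by have := hA.2.2.1; omega)
    obtain ⟨j, hj⟩ := H.nums_nonempty R (hch hA hp u hu).1
    have hjC := (hC j).2 ⟨u, hu, hj⟩
    rcases H.nested_of_nums R hv hv' (hsub hA hp hC j hjC) (hsub hA' hp' hC' j hjC) with h | h
    · exact key hA hp hC hA' hp' hC' h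
    · exact (key hA' hp' hC' hA hp hC h).symm
  subst hvv
  have key2 : ∀ {A A'}, Γ.SplitAdmissible v A → par v ∉ A →
      (∀ j, j ∈ C ↔ ∃ u ∈ A, j ∈ Γ.nums (D u)) → Γ.SplitAdmissible v A' → par v ∉ A' →
      (∀ j, j ∈ C ↔ ∃ u ∈ A', j ∈ Γ.nums (D u)) → A ⊆ A' := by
    intro A A' hA hp hC hA' hp' hC' u hu
    obtain ⟨h1, h2⟩ := hch hA hp u hu
    obtain ⟨j, hj⟩ := H.nums_nonempty R h1
    obtain ⟨u', hu', hj'⟩ := (hC' j).1 ((hC j).2 ⟨u, hu, hj⟩)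
    obtain ⟨h1', h2'⟩ := hch hA' hp' u' hu'
    rwa [R.eq_of_mem_nums H h1 h1' (h2.trans h2'.symm) hj hj']
  exact ⟨rfl, Finset.Subset.antisymm (key2 hA hp hC hA' hp' hC') (key2 hA' hp' hC' hA hp hC)⟩

open scoped Classical in
/-- Each admissible new cluster arises from exactly two splittings. -/
theorem card_split [Fintype V] (H : Γ.IsGenerator 0) {e : ℕ}
    {o : Fin e → Sym2 V} (ho : Γ.IsOrdering o) (C : Finset (Fin n)) :
    (Finset.univ.filter fun p : V × Finset V => Γ.SplitAdmissible p.1 p.2 ∧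
      (Γ.split p.1 p.2).cluster s(some p.1, none) = C).card =
    if ValidTuple (topSet Γ.epsNum) (Fin.cons C (fun i => Γ.cluster (o i)) : Fin (e + 1) → _)
      then 2 else 0 := by
  split_ifs with hC
  · obtain ⟨par, D, R⟩ := H.exists_rooting
    obtain ⟨v, A, hA, hp, hm⟩ := exists_split H R ho hC
    have hcl : (Γ.split v A).cluster s(some v, none) = C := by
      ext j
      rw [mem_cluster_split_of_notMem H R hA hp, hm]
    have hA' := hA.coNeighbors
    have hpar := R.adj (not_isSpecial_of_none hA.1)
    rw [show (Finset.univ.filter fun p : V × Finset V => Γ.SplitAdmissible p.1 p.2 ∧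
      (Γ.split p.1 p.2).cluster s(some p.1, none) = C) = {(v, A), (v, Γ.coNeighbors v A)} from ?_]
    · refine Finset.card_pair fun h => hp ?_
      rw [(Prod.mk.inj h).2]
      exact mem_coNeighbors.2 ⟨hpar, hp⟩
    · have key : ∀ v' A', Γ.SplitAdmissible v' A' → par v' ∉ A' →
          (Γ.split v' A').cluster s(some v', none) = C → v' = v ∧ A' = A := by
        intro v' A' h1 h2 h3
        refine split_unique H R h1 h2 (fun j => ?_) hA hp hm
        rw [← h3, mem_cluster_split_of_notMem H R h1 h2]
      ext ⟨v', A'⟩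
      simp only [Finset.mem_filter, Finset.mem_univ, true_and, Finset.mem_insert,
        Finset.mem_singleton, Prod.mk.injEq]
      constructor
      · rintro ⟨h1, h2⟩
        by_cases h3 : par v' ∈ A'
        · obtain ⟨rfl, h4⟩ := key v' _ h1.coNeighbors (fun h => (mem_coNeighbors.1 h).2 h3)
            ((cluster_split_coNeighbors H h1).trans h2)
          right
          exact ⟨rfl, by rw [← h4, coNeighbors_coNeighbors h1.2.1]⟩
        · exact Or.inl (key v' A' h1 h3 h2)
      · rintro (⟨rfl, rfl⟩ | ⟨rfl, rfl⟩)
        · exact ⟨hA, hcl⟩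
        · exact ⟨hA', (cluster_split_coNeighbors H hA).trans hcl⟩
  · rw [Finset.card_eq_zero, Finset.filter_eq_empty_iff]
    rintro ⟨v, A⟩ - ⟨hA, rfl⟩
    exact hC (validTuple_split H ho hA)

end MarkedGraph

/-! ### Joining ε and ω -/

namespace MarkedGraph

variable {n : ℕ} {V : Type} {Γ : MarkedGraph n V} {S : Finset V}

section Glue

theorem glue_of_mem {u : V} (h : u ∈ S) : glue S u = Sum.inr false := dif_pos h

theorem glue_of_notMem {u : V} (h : u ∉ S) : glue S u = Sum.inl ⟨u, h⟩ := dif_neg h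

theorem glue_ne_true (u : V) : glue S u ≠ Sum.inr true := by
  by_cases h : u ∈ S
  · simp [glue_of_mem h]
  · simp [glue_of_notMem h]

theorem glue_eq_false_iff {u : V} : glue S u = Sum.inr false ↔ u ∈ S := by
  by_cases h : u ∈ S
  · simp [glue_of_mem h, h]
  · simp [glue_of_notMem h, h]

theorem eq_of_glue_eq {u w : V} (hu : u ∉ S) (h : glue S u = glue S w) : u = w := by
  have hw : w ∉ S := fun hw => hu (glue_eq_false_iff.1 (h.trans (glue_of_mem hw)))
  rw [glue_of_notMem hu, glue_of_notMem hw] at h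
  simpa using h

theorem eq_glue_of_ne_true {a : JoinVertex S} (h : a ≠ Sum.inr true) (hS : S.Nonempty) :
    ∃ u, a = glue S u := by
  rcases a with ⟨u, hu⟩ | _ | _
  · exact ⟨u, (glue_of_notMem hu).symm⟩
  · obtain ⟨u, hu⟩ := hS
    exact ⟨u, (glue_of_mem hu).symm⟩
  · exact absurd rfl h

end Glue

/-- There is at most one ε and exactly one ω, so a set of two or more special vertices can only
consist of these two. -/
theorem IsGenerator.joinAdmissible_iff [Finite V] (H : Γ.IsGenerator 0) :
    Γ.JoinAdmissible S ↔ ∃ s w, Γ.label s = some JLabel.eps ∧ Γ.label w = some JLabel.omega ∧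
      ∀ u, u ∈ S ↔ u = s ∨ u = w := by
  constructor
  · rintro ⟨h1, h2⟩
    obtain ⟨a, ha, b, hb, hab⟩ := Finset.one_lt_card.1 h2
    have key : ∀ {s w}, s ∈ S → w ∈ S → Γ.label s = some JLabel.eps →
        Γ.label w = some JLabel.omega → ∀ u, u ∈ S ↔ u = s ∨ u = w := by
      intro s w hs hw hs' hw' u
      constructor
      · intro hu
        rcases h1 u hu with h | h
        · exact Or.inl (H.eps_unique h hs')
        · exact Or.inr (H.omega_once.unique h hw')
      · rintro (rfl | rfl) <;> assumption
    rcases h1 a ha with h | h <;> rcases h1 b hb with h' | h'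
    · exact absurd (H.eps_unique h h') hab
    · exact ⟨a, b, h, h', key ha hb h h'⟩
    · exact ⟨b, a, h', h, key hb ha h' h⟩
    · exact absurd (H.omega_once.unique h h') hab
  · rintro ⟨s, w, hs, hw, h⟩
    refine ⟨fun u hu => ?_, ?_⟩
    · rcases (h u).1 hu with rfl | rfl
      · exact Or.inl hs
      · exact Or.inr hw
    · refine Finset.one_lt_card.2 ⟨s, (h s).2 (Or.inl rfl), w, (h w).2 (Or.inr rfl), ?_⟩
      rintro rfl
      simp [hs] at hw

section Join

variable [Finite V]

theorem mem_of_isSpecial (H : Γ.IsGenerator 0) (hS : Γ.JoinAdmissible S) {u : V} :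
    u ∈ S ↔ Γ.IsSpecial u := by
  refine ⟨hS.1 u, fun h => ?_⟩
  obtain ⟨s, w, hs, hw, h'⟩ := H.joinAdmissible_iff.1 hS
  rw [h']
  rcases h with h | h
  · exact Or.inl (H.eps_unique h hs)
  · exact Or.inr (H.omega_once.unique h hw)

theorem join_edgeSet (H : Γ.IsGenerator 0) (hS : Γ.JoinAdmissible S) :
    (Γ.join S).graph.edgeSet =
      insert s(Sum.inr false, Sum.inr true) (Sym2.map (glue S) '' Γ.graph.edgeSet) := by
  rw [join, SimpleGraph.edgeSet_fromEdgeSet]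
  refine sdiff_eq_left.2 (Set.disjoint_left.2 ?_)
  rintro e (rfl | ⟨e, he, rfl⟩) hd
  · simp at hd
  · induction e with | _ a b =>
    have hab : Γ.graph.Adj a b := he
    have h : glue S a = glue S b := by simpa using hd
    by_cases ha : a ∈ S
    · have hb : b ∈ S := glue_eq_false_iff.1 (h.symm.trans (glue_of_mem ha))
      exact H.not_isSpecial_of_adj (hS.1 a ha) hab (hS.1 b hb)
    · exact hab.ne (eq_of_glue_eq ha h)

theorem join_adj_iff (H : Γ.IsGenerator 0) (hS : Γ.JoinAdmissible S) {a b : JoinVertex S} :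
    (Γ.join S).graph.Adj a b ↔ s(a, b) = s(Sum.inr false, Sum.inr true) ∨
      ∃ x y, Γ.graph.Adj x y ∧ a = glue S x ∧ b = glue S y := by
  rw [← SimpleGraph.mem_edgeSet, join_edgeSet H hS, Set.mem_insert_iff]
  refine or_congr_right ⟨?_, ?_⟩
  · rintro ⟨e, he, h⟩
    induction e with | _ x y =>
    rcases Sym2.eq_iff.1 h with ⟨h1, h2⟩ | ⟨h1, h2⟩
    · exact ⟨x, y, he, h1.symm, h2.symm⟩
    · exact ⟨y, x, SimpleGraph.Adj.symm he, h2.symm, h1.symm⟩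
  · rintro ⟨x, y, h, rfl, rfl⟩
    exact ⟨s(x, y), h, rfl⟩

theorem join_adj_new (H : Γ.IsGenerator 0) (hS : Γ.JoinAdmissible S) :
    (Γ.join S).graph.Adj (Sum.inr false) (Sum.inr true) := (join_adj_iff H hS).2 (Or.inl rfl)

theorem join_adj_old (H : Γ.IsGenerator 0) (hS : Γ.JoinAdmissible S) {x y : V}
    (h : Γ.graph.Adj x y) : (Γ.join S).graph.Adj (glue S x) (glue S y) :=
  (join_adj_iff H hS).2 (Or.inr ⟨x, y, h, rfl, rfl⟩)

/-- Gluing is injective on non-special vertices, and every edge has a non-special lower end that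
determines it. In particular no double edge arises. -/
theorem map_glue_injOn (H : Γ.IsGenerator 0) (hS : Γ.JoinAdmissible S) :
    Set.InjOn (Sym2.map (glue S)) Γ.graph.edgeSet := by
  obtain ⟨par, D, R⟩ := H.exists_rooting
  have hns : ∀ {u}, ¬ Γ.IsSpecial u → u ∉ S := fun hu h => hu (hS.1 _ h)
  have key : ∀ e ∈ Γ.graph.edgeSet, ∃ a, ¬ Γ.IsSpecial a ∧ e = s(a, par a) := by
    intro e he
    induction e with | _ a b =>
    have hab : Γ.graph.Adj a b := he
    rcases R.adj_par hab with ⟨h, rfl⟩ | ⟨h, rfl⟩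
    · exact ⟨a, h, rfl⟩
    · exact ⟨b, h, Sym2.eq_swap⟩
  intro e he e' he' h
  obtain ⟨a, ha, rfl⟩ := key e he
  obtain ⟨b, hb, rfl⟩ := key e' he'
  rcases Sym2.eq_iff.1 h with ⟨h1, -⟩ | ⟨h1, h2⟩
  · rw [eq_of_glue_eq (hns ha) h1]
  · exact Sym2.eq_iff.2 (Or.inr ⟨eq_of_glue_eq (hns ha) h1, (eq_of_glue_eq (hns hb) h2.symm).symm⟩)

theorem join_label_true (H : Γ.IsGenerator 0) (hS : Γ.JoinAdmissible S) :
    (Γ.join S).label (Sum.inr true) = some JLabel.omega := by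
  obtain ⟨s, w, -, hw, h⟩ := H.joinAdmissible_iff.1 hS
  exact if_pos ⟨w, (h w).2 (Or.inr rfl), hw⟩

theorem join_label_num_iff (H : Γ.IsGenerator 0) (hS : Γ.JoinAdmissible S) {a : JoinVertex S}
    {j : Fin n} : (Γ.join S).label a = some (JLabel.num j) ↔
      ∃ u, a = glue S u ∧ Γ.label u = some (JLabel.num j) := by
  have hns : ∀ {u}, Γ.label u = some (JLabel.num j) → u ∉ S := fun hu h =>
    not_isSpecial_of_num hu (hS.1 _ h)
  constructor
  · rcases a with ⟨u, hu⟩ | _ | _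
    · exact fun h => ⟨u, (glue_of_notMem hu).symm, h⟩
    · intro h
      simp [join] at h
    · rw [join_label_true H hS]
      intro h
      simp at h
  · rintro ⟨u, rfl, hu⟩
    rw [glue_of_notMem (hns hu)]
    exact hu

theorem join_isSpecial_iff (H : Γ.IsGenerator 0) (hS : Γ.JoinAdmissible S) {a : JoinVertex S} :
    (Γ.join S).IsSpecial a ↔ a = Sum.inr true := by
  constructor
  · rcases a with ⟨u, hu⟩ | _ | _
    · exact fun h => absurd ((mem_of_isSpecial H hS).2 h) hu
    · intro h
      simp [IsSpecial, join] at h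
    · exact fun _ => rfl
  · rintro rfl
    exact Or.inr (join_label_true H hS)

theorem join_reachable (H : Γ.IsGenerator 0) (hS : Γ.JoinAdmissible S) {x y : V}
    (h : Γ.graph.Reachable x y) : (Γ.join S).graph.Reachable (glue S x) (glue S y) := by
  obtain ⟨p⟩ := h
  induction p with
  | nil => exact SimpleGraph.Reachable.rfl
  | cons h _ ih => exact (join_adj_old H hS h).reachable.trans ih

theorem join_reachable_true (H : Γ.IsGenerator 0) (hS : Γ.JoinAdmissible S) (a : JoinVertex S) :
    (Γ.join S).graph.Reachable a (Sum.inr true) := by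
  by_cases ha : a = Sum.inr true
  · rw [ha]
  · obtain ⟨u, rfl⟩ := eq_glue_of_ne_true ha (Finset.card_pos.1 (by have := hS.2; omega))
    obtain ⟨s, hs, hr⟩ := H.connected u
    have := join_reachable H hS hr
    rw [glue_of_mem ((mem_of_isSpecial H hS).2 hs)] at this
    exact this.trans (join_adj_new H hS).reachable

theorem join_inOmega (H : Γ.IsGenerator 0) (hS : Γ.JoinAdmissible S) (a : JoinVertex S) :
    (Γ.join S).InOmegaComponent a :=
  ⟨_, join_label_true H hS, join_reachable_true H hS a⟩

theorem join_neighborSet_true (H : Γ.IsGenerator 0) (hS : Γ.JoinAdmissible S) :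
    (Γ.join S).graph.neighborSet (Sum.inr true) = {Sum.inr false} := by
  ext a
  rw [SimpleGraph.mem_neighborSet, join_adj_iff H hS, Set.mem_singleton_iff]
  constructor
  · rintro (h | ⟨x, y, _, h, _⟩)
    · simpa [Sym2.eq_iff] using h
    · exact absurd h.symm (glue_ne_true x)
  · rintro rfl
    exact Or.inl Sym2.eq_swap

theorem join_neighborSet_inl (H : Γ.IsGenerator 0) (hS : Γ.JoinAdmissible S) (u : {u // u ∉ S}) :
    (Γ.join S).graph.neighborSet (Sum.inl u) = glue S '' Γ.graph.neighborSet u := by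
  ext a
  rw [SimpleGraph.mem_neighborSet, join_adj_iff H hS]
  constructor
  · rintro (h | ⟨x, y, hxy, h, rfl⟩)
    · simp at h
    · have := eq_of_glue_eq u.2 ((glue_of_notMem u.2).trans h)
      exact ⟨y, this ▸ hxy, rfl⟩
  · rintro ⟨y, hy, rfl⟩
    exact Or.inr ⟨u, y, hy, (glue_of_notMem u.2).symm, rfl⟩

theorem join_ncard_inl (H : Γ.IsGenerator 0) (hS : Γ.JoinAdmissible S) (u : {u // u ∉ S}) :
    ((Γ.join S).graph.neighborSet (Sum.inl u)).ncard = (Γ.graph.neighborSet u).ncard := by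
  rw [join_neighborSet_inl H hS]
  refine Set.InjOn.ncard_image fun x hx y hy hxy => ?_
  by_cases h : x ∈ S
  · have hy' : y ∈ S := glue_eq_false_iff.1 (hxy.symm.trans (glue_of_mem h))
    exact H.special_unique (hS.1 x h) (hS.1 y hy')
      ((SimpleGraph.Adj.reachable hx).symm.trans (SimpleGraph.Adj.reachable hy))
  · exact eq_of_glue_eq h hxy

/-- The three neighbours are the new ω and the former neighbours of ε and of ω. The last two are
distinct because they come from different components. -/
theorem join_ncard_false (H : Γ.IsGenerator 0) (hS : Γ.JoinAdmissible S) :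
    3 ≤ ((Γ.join S).graph.neighborSet (Sum.inr false)).ncard := by
  obtain ⟨s, w, hs, hw, h⟩ := H.joinAdmissible_iff.1 hS
  obtain ⟨a, ha⟩ := H.exists_adj (v := s) (by simp [hs])
  obtain ⟨b, hb⟩ := H.exists_adj (v := w) (by simp [hw])
  have hsS := (h s).2 (Or.inl rfl)
  have hwS := (h w).2 (Or.inr rfl)
  have hsw : s ≠ w := by
    rintro rfl
    simp [hs] at hw
  have hab : a ≠ b := by
    rintro rfl
    exact hsw (H.special_unique (Or.inl hs) (Or.inr hw) (ha.reachable.trans hb.reachable.symm))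
  have haS : a ∉ S := fun h => H.not_isSpecial_of_adj (Or.inl hs) ha (hS.1 a h)
  have hg : glue S a ≠ glue S b := fun h => hab (eq_of_glue_eq haS h)
  have hsub : {Sum.inr true, glue S a, glue S b} ⊆
      (Γ.join S).graph.neighborSet (Sum.inr false) := by
    rintro x (rfl | rfl | rfl)
    · exact join_adj_new H hS
    · have := join_adj_old H hS ha
      rwa [glue_of_mem hsS] at this
    · have := join_adj_old H hS hb
      rwa [glue_of_mem hwS] at this
  have h3 := Set.ncard_le_ncard hsub (Set.toFinite _)
  rwa [Set.ncard_insert_of_notMem, Set.ncard_pair hg] at h3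
  rintro (h | h)
  · exact glue_ne_true _ h.symm
  · exact glue_ne_true _ (Set.mem_singleton_iff.1 h).symm

theorem join_isGenerator (H : Γ.IsGenerator 0) (hS : Γ.JoinAdmissible S) :
    (Γ.join S).IsGenerator 0 where
  internal := by
    rintro (u | _ | _) hu
    · rw [join_ncard_inl H hS]
      exact H.internal u hu
    · exact join_ncard_false H hS
    · rw [join_label_true H hS] at hu
      simp at hu
  external := by
    rintro (u | _ | _) hu
    · rw [join_ncard_inl H hS]
      exact H.external u hu
    · exact absurd rfl hu
    · rw [join_neighborSet_true H hS, Set.ncard_singleton]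
  num_once j := by
    obtain ⟨u, hu, huu⟩ := H.num_once j
    refine ⟨glue S u, (join_label_num_iff H hS).2 ⟨u, rfl, hu⟩, fun a ha => ?_⟩
    obtain ⟨u', rfl, hu'⟩ := (join_label_num_iff H hS).1 ha
    rw [huu u' hu']
  omega_once := ⟨_, join_label_true H hS, fun _ ha => (join_isSpecial_iff H hS).1 (Or.inr ha)⟩
  connected a := ⟨_, Or.inr (join_label_true H hS), join_reachable_true H hS a⟩
  genus := by
    have h1 : {a | (Γ.join S).IsSpecial a} = {Sum.inr true} := by
      ext a
      simp [join_isSpecial_iff H hS]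
    have h2 : {u | Γ.IsSpecial u} = S := by
      ext u
      simp [mem_of_isSpecial H hS]
    have h3 := H.genus
    -- The two glued vertices are replaced by two new ones, there is one more edge, and two special
    -- vertices become one; so the genus count is unchanged.
    have h4 : S.card = 2 := by
      classical
      obtain ⟨s, w, hs, hw, h⟩ := H.joinAdmissible_iff.1 hS
      have hsw : s ≠ w := by
        rintro rfl
        simp [hs] at hw
      rw [show S = {s, w} by ext u; simp [h], Finset.card_pair hsw]
    have h5 := Set.ncard_add_ncard_compl (S : Set V)
    have h6 : Nat.card {u // u ∉ S} = ((S : Set V)ᶜ).ncard := Nat.card_coe_set_eq _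
    rw [h2, Set.ncard_coe_finset] at h3
    rw [Set.ncard_coe_finset] at h5
    rw [join_edgeSet H hS, h1, Set.ncard_insert_of_notMem, (map_glue_injOn H hS).ncard_image,
      Set.ncard_singleton, Nat.card_sum, Nat.card_eq_fintype_card (α := Bool), Fintype.card_bool]
    · omega
    · rintro ⟨e, he, h⟩
      induction e with | _ x y =>
      rcases Sym2.eq_iff.1 h with ⟨_, h⟩ | ⟨h, _⟩ <;> exact glue_ne_true _ h
  no_eps_omega a b _ ha := by
    rw [(join_isSpecial_iff H hS).1 (Or.inl ha), join_label_true H hS] at ha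
    simp at ha
  eps_internal a _ := join_inOmega H hS a
  eps_num a _ _ _ _ _ h := absurd (join_inOmega H hS a) h
  nonisolated := by
    obtain ⟨s, w, hs, hw, h⟩ := H.joinAdmissible_iff.1 hS
    obtain ⟨j, u, hu, -⟩ := H.exists_num_of_eps hs
    exact ⟨glue S u, join_inOmega H hS _, Or.inr ⟨j, (join_label_num_iff H hS).2 ⟨u, rfl, hu⟩⟩⟩

theorem join_structuralEdges (H : Γ.IsGenerator 0) (hS : Γ.JoinAdmissible S) :
    (Γ.join S).structuralEdges =
      insert s(Sum.inr false, Sum.inr true) (Sym2.map (glue S) '' Γ.structuralEdges) := by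
  have key0 : ∀ x j, (Γ.join S).label (glue S x) = some (JLabel.num j) ↔
      Γ.label x = some (JLabel.num j) := by
    intro x j
    rw [join_label_num_iff H hS]
    constructor
    · rintro ⟨u, h, hu⟩
      have hus : u ∉ S := fun h => not_isSpecial_of_num hu (hS.1 _ h)
      rwa [← eq_of_glue_eq hus h.symm]
    · exact fun h => ⟨x, rfl, h⟩
  have key : ∀ e, (∀ a ∈ Sym2.map (glue S) e, ∀ j, (Γ.join S).label a ≠ some (JLabel.num j)) ↔
      ∀ u ∈ e, ∀ j, Γ.label u ≠ some (JLabel.num j) := by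
    intro e
    induction e with | _ x y =>
    simp only [Sym2.map_mk, Sym2.mem_iff, forall_eq_or_imp, forall_eq, ne_eq, key0]
  ext e
  simp only [structuralEdges, join_edgeSet H hS, Set.mem_ofPred_eq, Set.mem_insert_iff]
  constructor
  · rintro ⟨rfl | ⟨e, he, rfl⟩, h⟩
    · exact Or.inl rfl
    · exact Or.inr ⟨e, ⟨he, (key e).1 h⟩, rfl⟩
  · rintro (rfl | ⟨e, ⟨he, h⟩, rfl⟩)
    · refine ⟨Or.inl rfl, fun a ha j => ?_⟩
      rcases Sym2.mem_iff.1 ha with rfl | rfl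
      · simp [join]
      · simp [join_label_true H hS]
    · exact ⟨Or.inr ⟨e, he, rfl⟩, (key e).2 h⟩

theorem join_isOrdering (H : Γ.IsGenerator 0) (hS : Γ.JoinAdmissible S) {e : ℕ}
    {o : Fin e → Sym2 V} (ho : Γ.IsOrdering o) : (Γ.join S).IsOrdering
      (Fin.cons s(Sum.inr false, Sum.inr true) fun i => Sym2.map (glue S) (o i) :
        Fin (e + 1) → _) := by
  have hmem : ∀ i, o i ∈ Γ.graph.edgeSet := fun i => by
    have : o i ∈ Γ.structuralEdges := ho.2 ▸ Set.mem_range_self i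
    exact this.1
  constructor
  · refine Fin.cons_injective_iff.2 ⟨?_, fun i j hij => ho.1 (map_glue_injOn H hS (hmem i) (hmem j) hij)⟩
    rintro ⟨i, hi⟩
    dsimp only at hi
    generalize o i = e at hi
    induction e with | _ x y =>
    rcases Sym2.eq_iff.1 hi with ⟨_, h⟩ | ⟨h, _⟩ <;> exact glue_ne_true _ h
  · rw [Fin.range_cons, join_structuralEdges H hS, ← ho.2, ← Set.range_comp]
    rfl

theorem join_epsNum (H : Γ.IsGenerator 0) (hS : Γ.JoinAdmissible S) : (Γ.join S).epsNum = none := by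
  refine Option.eq_none_iff_forall_ne_some.2 fun j => ?_
  rw [ne_eq, (join_isGenerator H hS).epsNum_eq_some_iff]
  rintro ⟨a, _, ha, _⟩
  rw [(join_isSpecial_iff H hS).1 (Or.inl ha), join_label_true H hS] at ha
  simp at ha

/-- The set of all vertices other than the new ω is a cut for the new edge. -/
theorem cluster_join_new (H : Γ.IsGenerator 0) (hS : Γ.JoinAdmissible S) :
    (Γ.join S).cluster s(Sum.inr false, Sum.inr true) = Finset.univ := by
  have hcut : (Γ.join S).IsCut s(Sum.inr false, Sum.inr true) {a | a ≠ Sum.inr true} := by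
    refine ⟨fun a ha h => ha ((join_isSpecial_iff H hS).1 h), fun a b hab => ?_⟩
    rcases (join_adj_iff H hS).1 hab with h | ⟨x, y, hxy, rfl, rfl⟩
    · refine iff_of_false ?_ (not_not.2 h)
      rcases Sym2.eq_iff.1 h with ⟨rfl, rfl⟩ | ⟨rfl, rfl⟩ <;> simp
    · refine iff_of_true (iff_of_true (glue_ne_true x) (glue_ne_true y)) fun h => ?_
      rcases Sym2.eq_iff.1 h with ⟨_, h⟩ | ⟨h, _⟩ <;> exact glue_ne_true _ h
  refine Finset.eq_univ_of_forall fun j => ?_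
  obtain ⟨a, ha, -⟩ := (join_isGenerator H hS).num_once j
  refine (hcut.mem_cluster (join_isGenerator H hS).connected j).2 ⟨a, ?_, ha⟩
  rintro rfl
  rw [join_label_true H hS] at ha
  simp at ha

/-- A cut contains no special vertices, so gluing does not touch it and its image is a cut for the
image of the edge. -/
theorem cluster_map_glue (H : Γ.IsGenerator 0) (hS : Γ.JoinAdmissible S) {e : Sym2 V}
    (he : e ∈ Γ.graph.edgeSet) : (Γ.join S).cluster (Sym2.map (glue S) e) = Γ.cluster e := by
  obtain ⟨X, hX⟩ := H.exists_isCut e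
  have hXS : ∀ x ∈ X, x ∉ S := fun x hx h => hX.1 x hx (hS.1 x h)
  have hmem : ∀ x, glue S x ∈ glue S '' X ↔ x ∈ X := by
    intro x
    refine ⟨?_, fun h => ⟨x, h, rfl⟩⟩
    rintro ⟨y, hy, h⟩
    rwa [← eq_of_glue_eq (hXS y hy) h]
  have hnot : ∀ {b}, (Sum.inr b : JoinVertex S) ∉ glue S '' X := by
    rintro b ⟨y, hy, h⟩
    rw [glue_of_notMem (hXS y hy)] at h
    simp at h
  have hcut : (Γ.join S).IsCut (Sym2.map (glue S) e) (glue S '' X) := by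
    constructor
    · rintro a ha h
      rw [join_isSpecial_iff H hS] at h
      exact hnot (h ▸ ha)
    · intro a b hab
      rcases (join_adj_iff H hS).1 hab with h | ⟨x, y, hxy, rfl, rfl⟩
      · rw [h]
        refine iff_of_true ?_ ?_
        · rcases Sym2.eq_iff.1 h with ⟨rfl, rfl⟩ | ⟨rfl, rfl⟩ <;>
            exact iff_of_false hnot hnot
        · intro h
          induction e with | _ x y =>
          rcases Sym2.eq_iff.1 h with ⟨_, h⟩ | ⟨_, h⟩ <;> exact glue_ne_true _ h.symm
      · rw [hmem, hmem, hX.2 x y hxy, ← Sym2.map_mk]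
        exact not_congr ((map_glue_injOn H hS).eq_iff hxy he).symm
  ext j
  rw [hX.mem_cluster H.connected, hcut.mem_cluster (join_isGenerator H hS).connected]
  constructor
  · rintro ⟨_, ⟨x, hx, rfl⟩, hj⟩
    obtain ⟨y, h, hy⟩ := (join_label_num_iff H hS).1 hj
    rw [← eq_of_glue_eq (hXS x hx) h] at hy
    exact ⟨x, hx, hy⟩
  · rintro ⟨x, hx, hj⟩
    exact ⟨_, (hmem x).2 hx, (join_label_num_iff H hS).2 ⟨x, rfl, hj⟩⟩

end Join

end MarkedGraph

/-! ### Every valid tuple of clusters comes from a generator -/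

theorem ValidTuple.tail {n e : ℕ} {L C : Finset (Fin n)} {t : Fin e → Finset (Fin n)}
    (h : ValidTuple L (Fin.cons C t : Fin (e + 1) → _)) (hC : C ≠ L) : ValidTuple L t where
  inj := fun i j hij => Fin.succ_injective _ (h.inj (by simpa using hij))
  sub i := h.sub i.succ
  two_le i := h.two_le i.succ
  nested i j := h.nested i.succ j.succ
  top hL := by
    obtain ⟨i, hi⟩ := h.top hL
    induction i using Fin.cases with
    | zero => exact absurd hi hC
    | succ i => exact ⟨i, hi⟩

theorem ValidTuple.comp {n e : ℕ} {L : Finset (Fin n)} {t : Fin e → Finset (Fin n)}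
    (h : ValidTuple L t) (σ : Equiv.Perm (Fin e)) : ValidTuple L (t ∘ σ) where
  inj := h.inj.comp σ.injective
  sub i := h.sub _
  two_le i := h.two_le _
  nested i j := h.nested _ _
  top hL := by
    obtain ⟨i, hi⟩ := h.top hL
    exact ⟨σ.symm i, by simp [hi]⟩

theorem validTuple_comp_iff {n e : ℕ} {L : Finset (Fin n)} {t : Fin e → Finset (Fin n)}
    (σ : Equiv.Perm (Fin e)) : ValidTuple L (t ∘ σ) ↔ ValidTuple L t := by
  refine ⟨fun h => ?_, fun h => h.comp σ⟩
  have := h.comp σ⁻¹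
  rwa [show (t ∘ σ) ∘ ⇑σ⁻¹ = t from funext fun i => by simp] at this

namespace MarkedGraph

variable {n : ℕ}

instance instFiniteJLabel : Finite (JLabel n) := by
  let f : JLabel n → Option (Option (Fin n))
    | .eps => none
    | .omega => some none
    | .num j => some (some j)
  refine Finite.of_injective f fun a b h => ?_
  rcases a with _ | _ | a <;> rcases b with _ | _ | b <;> simp_all [f]

/-- The edges of a tree with at most one internal vertex `Sum.inr ()`, directed towards the special
vertices. -/
inductive CorollaPar (τ : Option (Fin n)) : JLabel n ⊕ Unit → JLabel n ⊕ Unit → Prop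
  | eps (j : Fin n) : τ = some j → CorollaPar τ (Sum.inl (.num j)) (Sum.inl .eps)
  | leaf (j : Fin n) : τ ≠ some j → 2 ≤ (topSet τ).card →
      CorollaPar τ (Sum.inl (.num j)) (Sum.inr ())
  | bare (j : Fin n) : τ ≠ some j → ¬ 2 ≤ (topSet τ).card →
      CorollaPar τ (Sum.inl (.num j)) (Sum.inl .omega)
  | root : 2 ≤ (topSet τ).card → CorollaPar τ (Sum.inr ()) (Sum.inl .omega)

/-- The vertices of a tree with at most one internal vertex. -/
abbrev CorollaVertex (τ : Option (Fin n)) : Type :=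
  {x : JLabel n ⊕ Unit // (x = Sum.inl .eps → τ ≠ none) ∧ (x = Sum.inr () → 2 ≤ (topSet τ).card)}

/-- The tree with at most one internal vertex. -/
def corolla (τ : Option (Fin n)) : MarkedGraph n (CorollaVertex τ) where
  graph :=
    { Adj := fun a b => CorollaPar τ a.1 b.1 ∨ CorollaPar τ b.1 a.1
      symm := ⟨fun _ _ h => h.symm⟩
      loopless := ⟨fun a h => by
        have : ∀ x : JLabel n ⊕ Unit, ¬ CorollaPar τ x x := by rintro _ ⟨⟩
        exact this _ (or_self_iff.1 h)⟩ }
  label a := a.1.elim some fun _ => none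

section Corolla

variable {τ : Option (Fin n)}

theorem corolla_adj {a b : CorollaVertex τ} : (corolla τ).graph.Adj a b ↔
    CorollaPar τ a.1 b.1 ∨ CorollaPar τ b.1 a.1 := Iff.rfl

theorem corolla_label {a : CorollaVertex τ} {l : JLabel n} :
    (corolla τ).label a = some l ↔ a.1 = Sum.inl l := by
  rcases a with ⟨_ | _, _⟩ <;> simp [corolla]

theorem corolla_label_none {a : CorollaVertex τ} :
    (corolla τ).label a = none ↔ a.1 = Sum.inr () := by
  rcases a with ⟨_ | _, _⟩ <;> simp [corolla]

theorem corolla_isSpecial {a : CorollaVertex τ} :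
    (corolla τ).IsSpecial a ↔ a.1 = Sum.inl .eps ∨ a.1 = Sum.inl .omega := by
  rw [IsSpecial, corolla_label, corolla_label]

theorem CorollaPar.not_symm {a b : JLabel n ⊕ Unit} (h : CorollaPar τ a b) :
    ¬ CorollaPar τ b a := by
  rintro h'
  cases h <;> cases h'

theorem CorollaPar.unique {a b c : JLabel n ⊕ Unit} (h : CorollaPar τ a b)
    (h' : CorollaPar τ a c) : b = c := by
  cases h <;> cases h' <;> first | rfl | contradiction

theorem CorollaPar.not_isSpecial {a b : JLabel n ⊕ Unit} (h : CorollaPar τ a b) :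
    ¬ (a = Sum.inl .eps ∨ a = Sum.inl .omega) := by
  cases h <;> simp

/-- The vertex decorated by a number. -/
def corollaNum (τ : Option (Fin n)) (j : Fin n) : CorollaVertex τ := ⟨Sum.inl (.num j), by simp⟩

/-- The vertex decorated by `ω`. -/
def corollaOmega (τ : Option (Fin n)) : CorollaVertex τ := ⟨Sum.inl .omega, by simp⟩

theorem exists_corollaPar {a : CorollaVertex τ} (ha : ¬ (corolla τ).IsSpecial a) :
    ∃ b : CorollaVertex τ, CorollaPar τ a.1 b.1 := by
  rw [corolla_isSpecial] at ha
  rcases a with ⟨(_ | _ | j) | _, h⟩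
  · simp at ha
  · simp at ha
  · by_cases hj : τ = some j
    · exact ⟨⟨Sum.inl .eps, by simp [hj]⟩, .eps j hj⟩
    · by_cases h2 : 2 ≤ (topSet τ).card
      · exact ⟨⟨Sum.inr (), by simp [h2]⟩, .leaf j hj h2⟩
      · exact ⟨corollaOmega τ, .bare j hj h2⟩
  · exact ⟨corollaOmega τ, .root (h.2 rfl)⟩

theorem corolla_reachable (a : CorollaVertex τ) (ha : a.1 ≠ Sum.inl .eps)
    (hτ : ∀ j, τ = some j → a.1 ≠ Sum.inl (.num j)) :
    (corolla τ).graph.Reachable a (corollaOmega τ) := by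
  rcases a with ⟨(_ | _ | j) | _, h⟩
  · simp at ha
  · rfl
  · have hj : τ ≠ some j := fun h => hτ j h rfl
    by_cases h2 : 2 ≤ (topSet τ).card
    · have h1 : (corolla τ).graph.Adj ⟨Sum.inl (.num j), h⟩ ⟨Sum.inr (), by simp [h2]⟩ :=
        Or.inl (.leaf j hj h2)
      have h3 : (corolla τ).graph.Adj ⟨Sum.inr (), by simp [h2]⟩ (corollaOmega τ) :=
        Or.inl (.root h2)
      exact h1.reachable.trans h3.reachable
    · exact SimpleGraph.Adj.reachable (G := (corolla τ).graph) (Or.inl (.bare j hj h2))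
  · exact SimpleGraph.Adj.reachable (G := (corolla τ).graph) (Or.inl (.root (h.2 rfl)))

theorem corolla_inOmega (a : CorollaVertex τ) (ha : a.1 ≠ Sum.inl .eps)
    (hτ : ∀ j, τ = some j → a.1 ≠ Sum.inl (.num j)) : (corolla τ).InOmegaComponent a :=
  ⟨_, corolla_label.2 rfl, corolla_reachable a ha hτ⟩

/-- Sending a non-special vertex to its outgoing edge is a bijection onto the edges, so edges and
special vertices together are as many as the vertices. -/
theorem corolla_genus : (corolla τ).graph.edgeSet.ncard + {a | (corolla τ).IsSpecial a}.ncard =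
    Nat.card (CorollaVertex τ) := by
  have hpar : ∀ a : CorollaVertex τ, ∃ b : CorollaVertex τ, ¬ (corolla τ).IsSpecial a →
      CorollaPar τ a.1 b.1 := fun a => by
    by_cases h : (corolla τ).IsSpecial a
    · exact ⟨a, fun h' => absurd h h'⟩
    · obtain ⟨b, hb⟩ := exists_corollaPar h
      exact ⟨b, fun _ => hb⟩
  choose par hpar using hpar
  have h1 : (corolla τ).graph.edgeSet =
      (fun a => s(a, par a)) '' {a | (corolla τ).IsSpecial a}ᶜ := by
    ext e
    induction e with | _ a b =>
    have key : ∀ a b : CorollaVertex τ, CorollaPar τ a.1 b.1 →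
        ¬ (corolla τ).IsSpecial a ∧ par a = b := by
      intro a b h
      have ha : ¬ (corolla τ).IsSpecial a := by
        rw [corolla_isSpecial]
        exact h.not_isSpecial
      exact ⟨ha, Subtype.ext ((hpar a ha).unique h)⟩
    constructor
    · rintro (h | h)
      · obtain ⟨h1, h2⟩ := key _ _ h
        exact ⟨a, h1, by simp only [h2]⟩
      · obtain ⟨h1, h2⟩ := key _ _ h
        exact ⟨b, h1, by simp only [h2, Sym2.eq_swap]⟩
    · rintro ⟨c, hc, h⟩
      dsimp only at h
      rw [← h]
      exact Or.inl (hpar c hc)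
  rw [h1, Set.InjOn.ncard_image, add_comm, Set.ncard_add_ncard_compl]
  intro a ha b hb hab
  rcases Sym2.eq_iff.1 hab with ⟨h, _⟩ | ⟨h, h'⟩
  · exact h
  · have h1 := hpar a ha
    have h2 := hpar b hb
    rw [h'] at h1
    rw [← h] at h2
    exact absurd h1 h2.not_symm

theorem card_topSet (hn : 2 ≤ n) : 0 < (topSet τ).card ∧ (τ = none → 2 ≤ (topSet τ).card) := by
  cases τ with
  | none =>
    simp only [topSet, Option.elim_none, Finset.card_univ, Fintype.card_fin]
    omega
  | some j =>
    simp only [topSet, Option.elim_some, Finset.card_erase_of_mem (Finset.mem_univ j),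
      Finset.card_univ, Fintype.card_fin]
    simp
    omega

theorem corolla_isGenerator (hn : 2 ≤ n) : (corolla τ).IsGenerator 0 where
  internal := by
    rintro ⟨x, hx⟩ ha
    rw [corolla_label_none] at ha
    subst ha
    obtain ⟨i, hi, j, hj, hij⟩ := Finset.one_lt_card.1 (hx.2 rfl)
    have hsub : {corollaOmega τ, corollaNum τ i, corollaNum τ j} ⊆
        (corolla τ).graph.neighborSet ⟨Sum.inr (), hx⟩ := by
      rintro b (rfl | rfl | rfl)
      · exact Or.inl (.root (hx.2 rfl))
      · exact Or.inr (.leaf i (mem_topSet.1 hi) (hx.2 rfl))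
      · exact Or.inr (.leaf j (mem_topSet.1 hj) (hx.2 rfl))
    have h3 := Set.ncard_le_ncard hsub (Set.toFinite _)
    rwa [Set.ncard_insert_of_notMem, Set.ncard_pair] at h3
    · simpa [corollaNum] using hij
    · simp [corollaNum, corollaOmega]
  external := by
    rintro ⟨(_ | _ | j) | _, hx⟩ ha
    · obtain ⟨j, rfl⟩ := Option.ne_none_iff_exists'.1 (hx.1 rfl)
      rw [Set.ncard_eq_one]
      refine ⟨corollaNum _ j, Set.ext fun b => ?_⟩
      rw [SimpleGraph.mem_neighborSet, corolla_adj, Set.mem_singleton_iff]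
      constructor
      · rintro (h | h)
        · cases h
        · obtain ⟨b, hb⟩ := b
          dsimp only at h
          cases h with
          | eps i hi =>
            obtain rfl : j = i := by simpa using hi
            rfl
      · rintro rfl
        exact Or.inr (.eps j rfl)
    · rw [Set.ncard_eq_one]
      by_cases h2 : 2 ≤ (topSet τ).card
      · refine ⟨⟨Sum.inr (), by simp [h2]⟩, Set.ext fun b => ?_⟩
        rw [SimpleGraph.mem_neighborSet, corolla_adj, Set.mem_singleton_iff]
        constructor
        · rintro (h | h)
          · cases h
          · obtain ⟨b, hb⟩ := b
            dsimp only at h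
            cases h with
            | bare i _ h => exact absurd h2 h
            | root => rfl
        · rintro rfl
          exact Or.inr (.root h2)
      · obtain ⟨i, hi⟩ : ∃ i, topSet τ = {i} := by
          rw [← Finset.card_eq_one]
          have := (card_topSet (τ := τ) hn).1
          omega
        have hi' : ∀ j, τ ≠ some j ↔ j = i := fun j => by rw [← mem_topSet, hi]; simp
        refine ⟨corollaNum τ i, Set.ext fun b => ?_⟩
        rw [SimpleGraph.mem_neighborSet, corolla_adj, Set.mem_singleton_iff]
        constructor
        · rintro (h | h)
          · cases h
          · obtain ⟨b, hb⟩ := b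
            dsimp only at h
            cases h with
            | bare j hj =>
              obtain rfl := (hi' j).1 hj
              rfl
            | root h => exact absurd h h2
        · rintro rfl
          exact Or.inr (.bare i ((hi' i).2 rfl) h2)
    · obtain ⟨b, hb⟩ := exists_corollaPar (τ := τ) (a := ⟨Sum.inl (.num j), hx⟩)
        (by simp [corolla_isSpecial])
      rw [Set.ncard_eq_one]
      refine ⟨b, Set.ext fun c => ?_⟩
      rw [SimpleGraph.mem_neighborSet, corolla_adj, Set.mem_singleton_iff]
      constructor
      · rintro (h | h)
        · exact Subtype.ext (h.unique hb)
        · generalize c.1 = x at h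
          cases h
      · rintro rfl
        exact Or.inl hb
    · exact absurd rfl ha
  num_once j := ⟨corollaNum τ j, corolla_label.2 rfl, fun b hb => Subtype.ext (corolla_label.1 hb)⟩
  omega_once := ⟨corollaOmega τ, corolla_label.2 rfl, fun b hb => Subtype.ext (corolla_label.1 hb)⟩
  connected a := by
    by_cases h1 : a.1 = Sum.inl .eps
    · exact ⟨a, corolla_isSpecial.2 (Or.inl h1), SimpleGraph.Reachable.rfl⟩
    by_cases h2 : ∃ j, τ = some j ∧ a.1 = Sum.inl (.num j)
    · obtain ⟨j, hj, ha⟩ := h2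
      refine ⟨⟨Sum.inl .eps, by simp [hj]⟩, corolla_isSpecial.2 (Or.inl rfl),
        SimpleGraph.Adj.reachable (Or.inl ?_)⟩
      rw [ha]
      exact .eps j hj
    · push Not at h2
      exact ⟨_, corolla_isSpecial.2 (Or.inr rfl), corolla_reachable a h1 h2⟩
  genus := by rw [corolla_genus, zero_add]
  no_eps_omega a b hab ha hb := by
    rw [corolla_label] at ha hb
    rw [corolla_adj, ha, hb] at hab
    rcases hab with h | h <;> cases h
  eps_internal a ha := by
    rw [corolla_label_none] at ha
    exact corolla_inOmega a (by simp [ha]) (by simp [ha])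
  eps_num a b i j ha hb h1 h2 := by
    rw [corolla_label] at ha hb
    have hi : τ = some i := by
      by_contra h
      exact h1 (corolla_inOmega a (by simp [ha]) (by rintro k rfl; simpa [ha, eq_comm] using h))
    have hj : τ = some j := by
      by_contra h
      exact h2 (corolla_inOmega b (by simp [hb]) (by rintro k rfl; simpa [hb, eq_comm] using h))
    simpa [hi] using hj
  nonisolated := by
    obtain ⟨i, hi⟩ := Finset.card_pos.1 (card_topSet (τ := τ) hn).1
    rw [mem_topSet] at hi
    exact ⟨corollaNum τ i, corolla_inOmega _ (by simp [corollaNum])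
      (by rintro k rfl; simpa [corollaNum, eq_comm] using hi), Or.inr ⟨i, corolla_label.2 rfl⟩⟩

theorem corolla_epsNum (hn : 2 ≤ n) : (corolla τ).epsNum = τ := by
  ext j
  rw [(corolla_isGenerator hn).epsNum_eq_some_iff]
  constructor
  · rintro ⟨a, b, ha, hb, hab⟩
    rw [corolla_label] at ha hb
    rw [corolla_adj, ha, hb] at hab
    rcases hab with h | h
    · cases h
    · cases h
      assumption
  · intro h
    refine ⟨⟨Sum.inl .eps, by simp [h]⟩, corollaNum τ j, corolla_label.2 rfl,
      corolla_label.2 rfl, Or.inr (.eps j h)⟩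

theorem corolla_structuralEdges_of_card (h2 : 2 ≤ (topSet τ).card) :
    (corolla τ).structuralEdges = {s(⟨Sum.inr (), by simp [h2]⟩, corollaOmega τ)} := by
  ext e
  rw [Set.mem_singleton_iff]
  constructor
  · induction e with | _ a b =>
    rintro ⟨hab, h⟩
    have ha := h a (by simp)
    have hb := h b (by simp)
    simp only [ne_eq, corolla_label] at ha hb
    have key : ∀ a b : CorollaVertex τ, (∀ j, ¬ a.1 = Sum.inl (.num j)) → CorollaPar τ a.1 b.1 →
        a = ⟨Sum.inr (), by simp [h2]⟩ ∧ b = corollaOmega τ := by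
      rintro ⟨a, _⟩ ⟨b, _⟩ ha hp
      dsimp only at hp ha
      cases hp with
      | root => exact ⟨rfl, rfl⟩
      | eps j => exact absurd rfl (ha j)
      | leaf j => exact absurd rfl (ha j)
      | bare j => exact absurd rfl (ha j)
    rcases hab with h | h
    · obtain ⟨rfl, rfl⟩ := key a b ha h
      rfl
    · obtain ⟨rfl, rfl⟩ := key b a hb h
      exact Sym2.eq_swap
  · rintro rfl
    refine ⟨Or.inl (.root h2), fun a ha j => ?_⟩
    rw [ne_eq, corolla_label]
    rcases Sym2.mem_iff.1 ha with rfl | rfl <;> simp [corollaOmega]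

theorem corolla_structuralEdges_of_not (h2 : ¬ 2 ≤ (topSet τ).card) :
    (corolla τ).structuralEdges = ∅ := by
  refine Set.eq_empty_iff_forall_notMem.2 fun e => ?_
  induction e with | _ a b =>
  rintro ⟨hab, h⟩
  have ha := h a (by simp)
  have hb := h b (by simp)
  simp only [ne_eq, corolla_label] at ha hb
  have key : ∀ a b : CorollaVertex τ, (∀ j, ¬ a.1 = Sum.inl (.num j)) → ¬ CorollaPar τ a.1 b.1 := by
    rintro ⟨a, _⟩ ⟨b, _⟩ ha hp
    dsimp only at hp ha
    cases hp with
    | root h => exact h2 h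
    | eps j => exact ha j rfl
    | leaf j => exact ha j rfl
    | bare j => exact ha j rfl
  rcases hab with h | h
  · exact key a b ha h
  · exact key b a hb h

end Corolla

end MarkedGraph

namespace JGen

variable {n e : ℕ}

/-- The generator `x` has clusters `t`, and `τ` is the number joined to an `ε`. -/
def Realizes (x : JGen 0 n e) (τ : Option (Fin n)) (t : Fin e → Finset (Fin n)) : Prop :=
  x.Γ.epsNum = τ ∧ ∀ i, x.Γ.cluster (x.order i) = t i

/-- By induction on the number of clusters: remove a cluster other than the full set, realise the
rest, and restore the cluster by splitting a vertex. The process starts from the corolla, or from a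
bare edge when there is only one leaf. -/
theorem exists_realizes (hn : 2 ≤ n) (τ : Option (Fin n)) {e : ℕ} (t : Fin e → Finset (Fin n))
    (ht : ValidTuple (topSet τ) t) : ∃ x : JGen 0 n e, x.Realizes τ t := by
  have hbase : ∀ {e : ℕ} (o : Fin e → Sym2 (MarkedGraph.CorollaVertex τ))
      (t : Fin e → Finset (Fin n)), (MarkedGraph.corolla τ).IsOrdering o →
      (∀ i, t i = topSet τ) → e ≤ 1 → ValidTuple (topSet τ) t →
      ∃ x : JGen 0 n e, x.Realizes τ t := by
    intro e o t ho hL he ht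
    have hg := MarkedGraph.corolla_isGenerator (τ := τ) hn
    refine ⟨⟨_, inferInstance, MarkedGraph.corolla τ, o, hg, ho⟩, MarkedGraph.corolla_epsNum hn,
      fun i => ?_⟩
    have hv := hg.validTuple ho
    rw [MarkedGraph.corolla_epsNum hn] at hv
    -- There is at most one index, so the index that carries the full cluster of the corolla has to
    -- be `i`.
    obtain ⟨k, hk⟩ := hv.top ((ht.two_le i).trans (Finset.card_le_card (ht.sub i)))
    have hki : k = i := by
      ext
      omega
    subst hki
    rw [hL]
    exact hk
  induction e with
  | zero =>
    refine hbase Fin.elim0 t ⟨fun i => i.elim0, ?_⟩ (fun i => i.elim0) (by omega) ht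
    rw [MarkedGraph.corolla_structuralEdges_of_not fun h => (ht.top h).choose.elim0]
    simp
  | succ e ih =>
    -- The full cluster must not be the one removed, since the smaller tuple has to stay valid. A
    -- transposition brings the removed cluster to the front, where splitting inserts it.
    by_cases h : ∃ i, t i ≠ topSet τ
    · obtain ⟨i, hi⟩ := h
      have ht' := ht.comp (Equiv.swap 0 i)
      have hcons : t ∘ Equiv.swap 0 i = Fin.cons (t i) (Fin.tail (t ∘ Equiv.swap 0 i)) := by
        conv_lhs => rw [← Fin.cons_self_tail (t ∘ Equiv.swap 0 i)]
        simp
      rw [hcons] at ht'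
      obtain ⟨x, hx, hxt⟩ := ih _ (ht'.tail hi)
      have := x.finite
      have H := x.isGenerator
      obtain ⟨par, D, R⟩ := H.exists_rooting
      have ht'' := ht'
      rw [← funext hxt, ← hx] at ht''
      obtain ⟨v, A, hA, hp, hC⟩ := MarkedGraph.exists_split H R x.isOrdering ht''
      have ho := MarkedGraph.split_isOrdering (A := A) x.isOrdering hA.1
      have ho' : (x.Γ.split v A).IsOrdering ((Fin.cons s(some v, none)
          (fun i => MarkedGraph.splitEdge v A (x.order i)) : Fin (e + 1) → _) ∘ Equiv.swap 0 i) :=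
        ⟨ho.1.comp (Equiv.injective _), by
          rw [(Equiv.swap 0 i).surjective.range_comp, ho.2]⟩
      refine ⟨⟨_, inferInstance, x.Γ.split v A, _, MarkedGraph.split_isGenerator H hA, ho'⟩,
        (MarkedGraph.split_epsNum H hA).trans hx, fun k => ?_⟩
      have key : ∀ m : Fin (e + 1), (x.Γ.split v A).cluster ((Fin.cons s(some v, none)
          (fun i => MarkedGraph.splitEdge v A (x.order i)) : Fin (e + 1) → _) m) =
          (t ∘ Equiv.swap 0 i) m := by
        intro m
        rw [hcons]
        induction m using Fin.cases with
        | zero =>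
          ext j
          rw [Fin.cons_zero, Fin.cons_zero, MarkedGraph.mem_cluster_split_of_notMem H R hA hp, ← hC]
        | succ m =>
          have hm : x.order m ∈ x.Γ.structuralEdges := x.isOrdering.2 ▸ Set.mem_range_self m
          rw [Fin.cons_succ, Fin.cons_succ, MarkedGraph.cluster_splitEdge H hA
            (x.Γ.graph.not_isDiag_of_mem_edgeSet hm.1), hxt]
      have := key (Equiv.swap 0 i k)
      rwa [Function.comp_apply, Equiv.swap_apply_self] at this
    · push Not at h
      have h2 : 2 ≤ (topSet τ).card := h 0 ▸ ht.two_le 0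
      have he : e = 0 := by
        by_contra he
        have := ht.inj ((h 0).trans (h (Fin.last e)).symm)
        simp [Fin.ext_iff] at this
        omega
      subst he
      refine hbase (fun _ => s(⟨Sum.inr (), by simp [h2]⟩, MarkedGraph.corollaOmega τ)) t
        ⟨fun i j _ => Subsingleton.elim (α := Fin 1) i j, ?_⟩ h (by omega) ht
      rw [MarkedGraph.corolla_structuralEdges_of_card h2, Set.range_const]

end JGen

namespace MarkedGraph

variable {n : ℕ} {V : Type}

theorem relabel_isCut (π : Equiv.Perm (Fin n)) (Γ : MarkedGraph n V) (e : Sym2 V) (X : Set V) :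
    (Γ.relabel π).IsCut e X ↔ Γ.IsCut e X := by
  simp only [IsCut, relabel_isSpecial, relabel_graph]

theorem relabel_cluster (π : Equiv.Perm (Fin n)) (Γ : MarkedGraph n V) (e : Sym2 V) :
    (Γ.relabel π).cluster e = (Γ.cluster e).map π.toEmbedding := by
  ext j
  obtain ⟨j, rfl⟩ := π.surjective j
  rw [← Equiv.toEmbedding_apply, Finset.mem_map' π.toEmbedding]
  simp only [cluster, Finset.mem_filter, Finset.mem_univ, true_and, relabel_isCut,
    Equiv.toEmbedding_apply, relabel_label_num]

theorem relabel_epsNum [Finite V] (π : Equiv.Perm (Fin n)) {Γ : MarkedGraph n V} (H : Γ.IsGenerator 0) :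
    (Γ.relabel π).epsNum = Γ.epsNum.map π := by
  ext j
  obtain ⟨j, rfl⟩ := π.surjective j
  rw [((relabel_isGenerator π Γ).2 H).epsNum_eq_some_iff, Option.map_eq_some_iff]
  simp only [π.injective.eq_iff, exists_eq_right, H.epsNum_eq_some_iff, EpsEdge, relabel_label_eps,
    relabel_label_num, relabel_graph]

end MarkedGraph

/-! ### The complex in terms of clusters -/

namespace JComplex

open MarkedGraph

variable {n e : ℕ}

open scoped Classical in
/-- The class of the generator with clusters `t`, where `τ` is the number joined to an `ε`; it is
zero if there is no such generator. -/
noncomputable def tree (τ : Option (Fin n)) (t : Fin e → Finset (Fin n)) : JComplex 0 n e :=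
  if h : ∃ x : JGen 0 n e, x.Realizes τ t then
    (jRelations 0 n e).mkQ (Finsupp.single h.choose 1) else 0

/-- Two generators with the same clusters in different order are isomorphic by `exists_isIso`, and
the isomorphism is one of the defining relations. -/
theorem mkQ_single_of_realizes {τ : Option (Fin n)} {t : Fin e → Finset (Fin n)}
    (σ : Equiv.Perm (Fin e)) {x y : JGen 0 n e} (hx : x.Realizes τ t) (hy : y.Realizes τ (t ∘ σ)) :
    (jRelations 0 n e).mkQ (Finsupp.single y 1) =
      (Equiv.Perm.sign σ : ℚ) • (jRelations 0 n e).mkQ (Finsupp.single x 1) := by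
  have := x.finite
  have := y.finite
  obtain ⟨f, hf, ho⟩ := exists_isIso x.isGenerator y.isGenerator x.isOrdering y.isOrdering
    (hy.1.trans hx.1.symm) σ fun i => by rw [hy.2, hx.2, Function.comp_apply]
  rw [← map_smul, ← sub_eq_zero, ← map_sub, Submodule.mkQ_apply, Submodule.Quotient.mk_eq_zero]
  exact Submodule.subset_span ⟨_, _, f, σ, hf, ho, rfl⟩

theorem mkQ_single_eq_tree {τ : Option (Fin n)} {t : Fin e → Finset (Fin n)} {x : JGen 0 n e}
    (hx : x.Realizes τ t) : (jRelations 0 n e).mkQ (Finsupp.single x 1) = tree τ t := by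
  have h : ∃ x : JGen 0 n e, x.Realizes τ t := ⟨x, hx⟩
  rw [tree, dif_pos h, mkQ_single_of_realizes 1 h.choose_spec (by exact hx)]
  simp

theorem _root_.JGen.Realizes.validTuple {τ : Option (Fin n)} {t : Fin e → Finset (Fin n)}
    {x : JGen 0 n e} (hx : x.Realizes τ t) : ValidTuple (topSet τ) t := by
  have := x.finite
  have := x.isGenerator.validTuple x.isOrdering
  rwa [hx.1, funext hx.2] at this

/-- With this convention sums over new clusters can run over all finite sets, without a condition of
compatibility. -/
theorem tree_eq_zero {τ : Option (Fin n)} {t : Fin e → Finset (Fin n)}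
    (h : ¬ ValidTuple (topSet τ) t) : tree τ t = 0 :=
  dif_neg fun ⟨_, hx⟩ => h hx.validTuple

theorem tree_comp (hn : 2 ≤ n) (τ : Option (Fin n)) (t : Fin e → Finset (Fin n))
    (σ : Equiv.Perm (Fin e)) : tree τ (t ∘ σ) = (Equiv.Perm.sign σ : ℚ) • tree τ t := by
  by_cases h : ValidTuple (topSet τ) t
  · obtain ⟨x, hx⟩ := JGen.exists_realizes hn τ t h
    obtain ⟨y, hy⟩ := JGen.exists_realizes hn τ _ (h.comp σ)
    rw [← mkQ_single_eq_tree hx, ← mkQ_single_eq_tree hy, mkQ_single_of_realizes σ hx hy]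
  · rw [tree_eq_zero h, tree_eq_zero (mt (validTuple_comp_iff σ).1 h), smul_zero]

theorem span_tree (n e : ℕ) : Submodule.span ℚ {c : JComplex 0 n e | ∃ τ t,
    ValidTuple (topSet τ) t ∧ c = tree τ t} = ⊤ := by
  refine eq_top_iff.2 fun c _ => ?_
  obtain ⟨c, rfl⟩ := (jRelations 0 n e).mkQ_surjective c
  induction c using Finsupp.induction_linear with
  | zero => simp
  | add c d hc hd =>
    rw [map_add]
    exact Submodule.add_mem _ (hc trivial) (hd trivial)
  | single x q =>
    rw [← mul_one q, ← smul_eq_mul, ← Finsupp.smul_single, map_smul]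
    refine Submodule.smul_mem _ _ (Submodule.subset_span ?_)
    exact ⟨_, _, JGen.Realizes.validTuple (x := x) ⟨rfl, fun _ => rfl⟩,
      mkQ_single_eq_tree ⟨rfl, fun _ => rfl⟩⟩

/-- Linear maps from the complex agree if they agree on trees. -/
theorem hom_ext {X : Type*} [AddCommGroup X] [Module ℚ X] {F G : JComplex 0 n e →ₗ[ℚ] X}
    (h : ∀ τ t, ValidTuple (topSet τ) t → F (tree τ t) = G (tree τ t)) : F = G := by
  refine LinearMap.ext_on (span_tree n e) ?_
  rintro _ ⟨τ, t, ht, rfl⟩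
  exact h τ t ht

/-- Alternating functions of clusters define linear maps. -/
theorem exists_lift (hn : 2 ≤ n) {X : Type*} [AddCommGroup X] [Module ℚ X]
    (f : Option (Fin n) → (Fin e → Finset (Fin n)) → X)
    (hf : ∀ τ t (σ : Equiv.Perm (Fin e)), ValidTuple (topSet τ) t →
      f τ (t ∘ σ) = (Equiv.Perm.sign σ : ℚ) • f τ t) :
    ∃ F : JComplex 0 n e →ₗ[ℚ] X, ∀ τ t, ValidTuple (topSet τ) t → F (tree τ t) = f τ t := by
  refine ⟨(jRelations 0 n e).liftQ (Finsupp.linearCombination ℚ fun x =>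
    f x.Γ.epsNum fun i => x.Γ.cluster (x.order i)) ?_, fun τ t ht => ?_⟩
  · rw [jRelations, Submodule.span_le]
    rintro _ ⟨x, y, φ, σ, h, ho, rfl⟩
    have := x.finite
    have := y.finite
    have hxv := x.isGenerator.validTuple x.isOrdering
    -- Isomorphisms carry cuts to cuts, so clusters and the number joined to ε are invariants, and
    -- `f` respects the relations.
    have hcl : ∀ e, y.Γ.cluster (Sym2.map φ e) = x.Γ.cluster e := by
      intro e
      obtain ⟨X, hX⟩ := x.isGenerator.exists_isCut e
      have hX' : y.Γ.IsCut (Sym2.map φ e) (φ '' X) := by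
        constructor
        · rintro _ ⟨v, hv, rfl⟩
          rw [h.isSpecial]
          exact hX.1 v hv
        · intro a b hab
          obtain ⟨a, rfl⟩ := φ.surjective a
          obtain ⟨b, rfl⟩ := φ.surjective b
          rw [φ.injective.mem_set_image, φ.injective.mem_set_image, hX.2 a b ((h.1 a b).1 hab),
            ← Sym2.map_mk]
          exact not_congr (Sym2.map.injective φ.injective).eq_iff.symm
      ext j
      rw [hX.mem_cluster x.isGenerator.connected, hX'.mem_cluster y.isGenerator.connected]
      simp only [Set.exists_mem_image, h.2]
    have heps : y.Γ.epsNum = x.Γ.epsNum := by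
      ext j
      rw [x.isGenerator.epsNum_eq_some_iff, y.isGenerator.epsNum_eq_some_iff]
      simp only [EpsEdge, φ.surjective.exists, h.2, h.1]
    simp only [SetLike.mem_coe, LinearMap.mem_ker, map_sub, map_smul,
      Finsupp.linearCombination_single, one_smul, heps, ho, hcl]
    rw [sub_eq_zero]
    exact hf _ _ σ hxv
  · obtain ⟨x, hx⟩ := JGen.exists_realizes hn τ t ht
    rw [← mkQ_single_eq_tree hx, Submodule.mkQ_apply, Submodule.liftQ_apply,
      Finsupp.linearCombination_single, one_smul, hx.1, funext hx.2]

theorem cls_eq_tree {V : Type} [Finite V] {Γ : MarkedGraph n V} {o : Fin e → Sym2 V}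
    {τ : Option (Fin n)} {t : Fin e → Finset (Fin n)} (H : Γ.IsGenerator 0)
    (ho : Γ.IsOrdering o) (hτ : Γ.epsNum = τ) (ht : ∀ i, Γ.cluster (o i) = t i) :
    cls 0 Γ o = tree τ t := by
  rw [cls, dif_pos ⟨H, ho⟩]
  exact mkQ_single_eq_tree ⟨hτ, ht⟩

/-- Sorting the splittings by the cluster they add, `card_split` finds two for each valid `C`, which
cancels the 1/2, and none for the others, where `tree` is zero. -/
theorem splitGen_eq {τ : Option (Fin n)} {t : Fin e → Finset (Fin n)} {x : JGen 0 n e}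
    (hx : x.Realizes τ t) : splitGen x = ∑ C, tree τ (Fin.cons C t : Fin (e + 1) → _) := by
  classical
  have := x.finite
  let := Fintype.ofFinite x.V
  obtain ⟨hτ, ht⟩ := hx
  have hedge : ∀ i, ¬ (x.order i).IsDiag := fun i => by
    have hi : x.order i ∈ x.Γ.structuralEdges := x.isOrdering.2 ▸ Set.mem_range_self i
    exact x.Γ.graph.not_isDiag_of_mem_edgeSet hi.1
  have h1 : ∀ p ∈ Finset.univ.filter fun p : x.V × Finset x.V => x.Γ.SplitAdmissible p.1 p.2,
      cls 0 (x.Γ.split p.1 p.2) (Fin.cons s(some p.1, none)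
        (fun i => splitEdge p.1 p.2 (x.order i))) = tree τ (Fin.cons
          ((x.Γ.split p.1 p.2).cluster s(some p.1, none)) t : Fin (e + 1) → _) := by
    intro p hp
    have hA := (Finset.mem_filter.1 hp).2
    refine cls_eq_tree (split_isGenerator x.isGenerator hA) (split_isOrdering x.isOrdering hA.1)
      ((split_epsNum x.isGenerator hA).trans hτ) fun i => ?_
    induction i using Fin.cases with
    | zero => rfl
    | succ i => rw [Fin.cons_succ, Fin.cons_succ, cluster_splitEdge x.isGenerator hA (hedge i), ht]
  have h2 : splitGen x = (1 / 2 : ℚ) • ∑ p : x.V × Finset x.V,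
      if x.Γ.SplitAdmissible p.1 p.2 then cls 0 (x.Γ.split p.1 p.2) (Fin.cons s(some p.1, none)
        (fun i => splitEdge p.1 p.2 (x.order i))) else 0 := by
    rw [splitGen, Fintype.sum_prod_type]
  rw [h2, ← Finset.sum_filter, Finset.sum_congr rfl h1,
    ← Finset.sum_fiberwise _ fun p => (x.Γ.split p.1 p.2).cluster s(some p.1, none),
    Finset.smul_sum]
  refine Finset.sum_congr rfl fun C _ => ?_
  have h3 := card_split x.isGenerator x.isOrdering C
  rw [hτ, funext ht] at h3
  rw [Finset.sum_congr rfl (g := fun _ => tree τ (Fin.cons C t : Fin (e + 1) → _))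
    fun p hp => by rw [(Finset.mem_filter.1 hp).2], Finset.sum_const, Finset.filter_filter, h3]
  split_ifs with h
  · rw [← Nat.cast_smul_eq_nsmul ℚ, smul_smul]
    norm_num
  · rw [tree_eq_zero h]
    simp

/-- Without an ε nothing can be joined. With an ε the only admissible set is the pair of ε and ω;
the result has no ε, and its new edge cuts off all numbers. -/
theorem joinGen_eq {τ : Option (Fin n)} {t : Fin e → Finset (Fin n)} {x : JGen 0 n e}
    (hx : x.Realizes τ t) : joinGen x =
      τ.elim 0 fun _ => tree none (Fin.cons Finset.univ t : Fin (e + 1) → _) := by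
  classical
  have := x.finite
  let := Fintype.ofFinite x.V
  obtain ⟨hτ, ht⟩ := hx
  have H := x.isGenerator
  have h1 : ∀ S ∈ Finset.univ.filter fun S : Finset x.V => x.Γ.JoinAdmissible S,
      cls 0 (x.Γ.join S) (Fin.cons s(Sum.inr false, Sum.inr true)
        (fun i => Sym2.map (glue S) (x.order i))) =
      tree none (Fin.cons Finset.univ t : Fin (e + 1) → _) := by
    intro S hS
    replace hS := (Finset.mem_filter.1 hS).2
    refine cls_eq_tree (join_isGenerator H hS) (join_isOrdering H hS x.isOrdering)
      (join_epsNum H hS) fun i => ?_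
    induction i using Fin.cases with
    | zero => exact cluster_join_new H hS
    | succ i =>
      have hi : x.order i ∈ x.Γ.structuralEdges := x.isOrdering.2 ▸ Set.mem_range_self i
      rw [Fin.cons_succ, Fin.cons_succ, cluster_map_glue H hS hi.1, ht]
  rw [joinGen, ← Finset.sum_filter, Finset.sum_congr rfl h1, Finset.sum_const]
  cases τ with
  | none =>
    rw [Finset.filter_false_of_mem, Finset.card_empty, zero_smul]
    · rfl
    · intro S _ hS
      obtain ⟨s, w, hs, -⟩ := H.joinAdmissible_iff.1 hS
      obtain ⟨j, u, hu, hsu⟩ := H.exists_num_of_eps hs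
      have := H.epsNum_eq_some_iff.2 ⟨s, u, hs, hu, hsu⟩
      rw [hτ] at this
      simp at this
  | some j =>
    obtain ⟨s, -, hs, -⟩ := H.epsNum_eq_some_iff.1 hτ
    obtain ⟨w, hw, -⟩ := H.omega_once
    have : (Finset.univ.filter fun S : Finset x.V => x.Γ.JoinAdmissible S) = {{s, w}} := by
      ext S
      simp only [Finset.mem_filter, Finset.mem_univ, true_and, Finset.mem_singleton]
      rw [H.joinAdmissible_iff]
      constructor
      · rintro ⟨s', w', hs', hw', h⟩
        obtain rfl := H.eps_unique hs hs'
        obtain rfl := H.omega_once.unique hw hw'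
        ext u
        simp [h]
      · rintro rfl
        exact ⟨s, w, hs, hw, by simp⟩
    rw [this, Finset.card_singleton, one_smul]
    rfl

/-- From here on the graphs are replaced by tuples of clusters. -/
theorem differential_tree (hn : 2 ≤ n) {τ : Option (Fin n)} {t : Fin e → Finset (Fin n)}
    (h : ValidTuple (topSet τ) t) : differential 0 n e (tree τ t) =
      ∑ C, tree τ (Fin.cons C t : Fin (e + 1) → _) +
        τ.elim 0 fun _ => tree none (Fin.cons Finset.univ t : Fin (e + 1) → _) := by
  obtain ⟨x, hx⟩ := JGen.exists_realizes hn τ t h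
  rw [← mkQ_single_eq_tree hx, ← splitGen_eq hx, ← joinGen_eq hx, Submodule.mkQ_apply,
    differential, Submodule.liftQ_apply, Finsupp.linearCombination_single, one_smul]

theorem perm_tree (hn : 2 ≤ n) (π : Equiv.Perm (Fin n)) {τ : Option (Fin n)}
    {t : Fin e → Finset (Fin n)} (h : ValidTuple (topSet τ) t) :
    perm 0 e π (tree τ t) = tree (τ.map π) fun i => (t i).map π.toEmbedding := by
  obtain ⟨x, hx⟩ := JGen.exists_realizes hn τ t h
  have := x.finite
  have hx' : (permGen π x).Realizes (τ.map π) fun i => (t i).map π.toEmbedding := by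
    constructor
    · exact (relabel_epsNum π x.isGenerator).trans (by rw [hx.1])
    · intro i
      exact (relabel_cluster π x.Γ (x.order i)).trans (by rw [hx.2])
  rw [← mkQ_single_eq_tree hx, ← mkQ_single_eq_tree hx', perm, Submodule.mkQ_apply,
    Submodule.mapQ_apply, Finsupp.lmapDomain_apply, Finsupp.mapDomain_single]
  rfl

end JComplex

/-! ### Chains of clusters through a distinguished leaf -/

section Chains

variable {n e : ℕ}

theorem ValidTuple.of_cons {L C : Finset (Fin n)} {t : Fin e → Finset (Fin n)}
    (h : ValidTuple L (Fin.cons C t : Fin (e + 1) → _)) (ht : 2 ≤ L.card → ∃ i, t i = L) :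
    ValidTuple L t where
  inj := fun i j hij => Fin.succ_injective _ (h.inj (by simpa using hij))
  sub i := h.sub i.succ
  two_le i := h.two_le i.succ
  nested i j := h.nested i.succ j.succ
  top := ht

theorem ValidTuple.cons {L C : Finset (Fin n)} {t : Fin e → Finset (Fin n)} (h : ValidTuple L t)
    (hC : ∀ i, C ≠ t i) (hL : C ⊆ L) (h2 : 2 ≤ C.card)
    (hn : ∀ i, C ⊆ t i ∨ t i ⊆ C ∨ Disjoint C (t i)) :
    ValidTuple L (Fin.cons C t : Fin (e + 1) → _) where
  inj := Fin.cons_injective_iff.2 ⟨by rintro ⟨i, hi⟩; exact hC i hi.symm, h.inj⟩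
  sub i := by
    induction i using Fin.cases with
    | zero => exact hL
    | succ i => exact h.sub i
  two_le i := by
    induction i using Fin.cases with
    | zero => exact h2
    | succ i => exact h.two_le i
  nested i j := by
    induction i using Fin.cases with
    | zero =>
      induction j using Fin.cases with
      | zero => exact Or.inl subset_rfl
      | succ j => exact hn j
    | succ i =>
      induction j using Fin.cases with
      | zero =>
        rcases hn i with h | h | h
        · exact Or.inr (Or.inl h)
        · exact Or.inl h
        · exact Or.inr (Or.inr h.symm)
      | succ j => exact h.nested i j
  top hL := by
    obtain ⟨i, hi⟩ := h.top hL
    exact ⟨i.succ, hi⟩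

/-- The clusters that contain `s`. -/
def chain (s : Fin n) (t : Fin e → Finset (Fin n)) : Finset (Finset (Fin n)) :=
  (Finset.univ.filter fun i => s ∈ t i).image t

theorem mem_chain {s : Fin n} {t : Fin e → Finset (Fin n)} {D : Finset (Fin n)} :
    D ∈ chain s t ↔ s ∈ D ∧ ∃ i, t i = D := by
  simp only [chain, Finset.mem_image, Finset.mem_filter, Finset.mem_univ, true_and]
  constructor
  · rintro ⟨i, hi, rfl⟩
    exact ⟨hi, i, rfl⟩
  · rintro ⟨hD, i, rfl⟩
    exact ⟨i, hD, rfl⟩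

theorem chain_comp (s : Fin n) (t : Fin e → Finset (Fin n)) (σ : Equiv.Perm (Fin e)) :
    chain s (t ∘ σ) = chain s t := by
  ext D
  rw [mem_chain, mem_chain]
  exact and_congr_right fun _ => (σ.surjective.exists (p := fun i => t i = D)).symm

theorem chain_cons_of_notMem {s : Fin n} {C : Finset (Fin n)} (hs : s ∉ C)
    (t : Fin e → Finset (Fin n)) : chain s (Fin.cons C t : Fin (e + 1) → _) = chain s t := by
  ext D
  rw [mem_chain, mem_chain, Fin.exists_fin_succ]
  simp only [Fin.cons_zero, Fin.cons_succ]
  refine and_congr_right fun hD => or_iff_right ?_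
  rintro rfl
  exact hs hD

/-- The number of clusters that contain `s`. -/
def chainLength (s : Fin n) (t : Fin e → Finset (Fin n)) : ℕ := ∑ i, if s ∈ t i then 1 else 0

theorem chainLength_comp (s : Fin n) (t : Fin e → Finset (Fin n)) (σ : Equiv.Perm (Fin e)) :
    chainLength s (t ∘ σ) = chainLength s t :=
  Equiv.sum_comp σ fun i => if s ∈ t i then 1 else 0

theorem chainLength_cons (s : Fin n) (C : Finset (Fin n)) (t : Fin e → Finset (Fin n)) :
    chainLength s (Fin.cons C t : Fin (e + 1) → _) =
      (if s ∈ C then 1 else 0) + chainLength s t := by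
  simp only [chainLength, Fin.sum_univ_succ, Fin.cons_zero, Fin.cons_succ]

theorem chainLength_le (s : Fin n) (t : Fin e → Finset (Fin n)) : chainLength s t ≤ e := by
  refine (Finset.sum_le_card_nsmul Finset.univ _ 1 fun i _ => ?_).trans (by simp)
  split_ifs <;> simp

/-- The elements of `L` that are in the same sets in `c` as `a`, apart from `s`. -/
def block (L : Finset (Fin n)) (s : Fin n) (c : Finset (Finset (Fin n))) (a : Fin n) :
    Finset (Fin n) := L.filter fun b => b ≠ s ∧ ∀ D ∈ c, (a ∈ D ↔ b ∈ D)

open scoped Classical in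
/-- A block with more than one element. -/
noncomputable def pickBlock (L : Finset (Fin n)) (s : Fin n) (c : Finset (Finset (Fin n))) :
    Finset (Fin n) :=
  if h : ∃ a ∈ L, a ≠ s ∧ 2 ≤ (block L s c a).card then block L s c h.choose else ∅

/-- `P` is a block with more than one element. -/
structure IsBlock (L : Finset (Fin n)) (s : Fin n) (c : Finset (Finset (Fin n)))
    (P : Finset (Fin n)) : Prop where
  sub : P ⊆ L
  notMem : s ∉ P
  two_le : 2 ≤ P.card
  iff : ∀ a ∈ P, ∀ b, b ∈ P ↔ b ∈ L ∧ b ≠ s ∧ ∀ D ∈ c, (a ∈ D ↔ b ∈ D)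

/-- The alternatives are those of the contraction: either the chain through `s` separates all other
leaves, and the tree is critical, or there is a block that can serve as a cluster. -/
theorem pickBlock_spec (L : Finset (Fin n)) (s : Fin n) (c : Finset (Finset (Fin n))) :
    pickBlock L s c = ∅ ∧ (∀ a ∈ L, a ≠ s → ∀ b ∈ L, b ≠ s → (∀ D ∈ c, (a ∈ D ↔ b ∈ D)) → a = b) ∨
      IsBlock L s c (pickBlock L s c) := by
  by_cases h : ∃ a ∈ L, a ≠ s ∧ 2 ≤ (block L s c a).card
  · right
    rw [pickBlock, dif_pos h]
    have h1 := h.choose_spec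
    have hm : ∀ b, b ∈ block L s c h.choose ↔ b ∈ L ∧ b ≠ s ∧ ∀ D ∈ c, (h.choose ∈ D ↔ b ∈ D) :=
      fun b => by simp [block]
    refine ⟨Finset.filter_subset _ _, fun hs => ((hm s).1 hs).2.1 rfl, h1.2.2, fun a ha b => ?_⟩
    rw [hm]
    have ha' := ((hm a).1 ha).2.2
    refine and_congr_right fun _ => and_congr_right fun _ => forall₂_congr fun D hD => ?_
    rw [ha' D hD]
  · left
    rw [pickBlock, dif_neg h]
    refine ⟨rfl, fun a ha has b hb hbs hab => ?_⟩
    by_contra hne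
    refine h ⟨a, ha, has, Finset.one_lt_card.2 ⟨a, ?_, b, ?_, hne⟩⟩
    · simp [block, ha, has]
    · simp only [block, Finset.mem_filter]
      exact ⟨hb, hbs, hab⟩

/-- A cluster containing `s` belongs to the chain, hence contains the whole block or misses it. A
cluster without `s` is contained in or disjoint from each member of the chain, so its elements all
lie in one block. -/
theorem IsBlock.nested {L : Finset (Fin n)} {s : Fin n} {t : Fin e → Finset (Fin n)}
    {P : Finset (Fin n)} (h : IsBlock L s (chain s t) P) (ht : ValidTuple L t) (i : Fin e) :
    P ⊆ t i ∨ t i ⊆ P ∨ Disjoint P (t i) := by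
  by_cases hd : ∃ a ∈ P, a ∈ t i
  swap
  · push Not at hd
    exact Or.inr (Or.inr (Finset.disjoint_left.2 hd))
  obtain ⟨a, haP, hai⟩ := hd
  by_cases hs : s ∈ t i
  · left
    intro b hb
    exact (((h.iff a haP b).1 hb).2.2 (t i) (mem_chain.2 ⟨hs, i, rfl⟩)).1 hai
  · right
    left
    intro b hb
    refine (h.iff a haP b).2 ⟨ht.sub i hb, fun h => hs (h ▸ hb), fun D hD => ?_⟩
    obtain ⟨hsD, k, rfl⟩ := mem_chain.1 hD
    rcases ht.nested i k with h' | h' | h'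
    · exact iff_of_true (h' hai) (h' hb)
    · exact absurd (h' hsD) hs
    · exact iff_of_false (Finset.disjoint_left.1 h' hai) (Finset.disjoint_left.1 h' hb)

theorem IsBlock.validTuple_cons {L : Finset (Fin n)} {s : Fin n} {t : Fin e → Finset (Fin n)}
    {P : Finset (Fin n)} (h : IsBlock L s (chain s t) P) (ht : ValidTuple L t)
    (hP : ∀ i, P ≠ t i) : ValidTuple L (Fin.cons P t : Fin (e + 1) → _) :=
  ht.cons hP h.sub h.two_le (h.nested ht)

/-- The clusters of a tree that separate all leaves from each other in the complement of `s`: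
these are the trees obtained by attaching the leaves successively to the path from `s` to the
root. -/
structure Critical (L : Finset (Fin n)) (s : Fin n) (t : Fin e → Finset (Fin n)) : Prop where
  valid : ValidTuple L t
  sep : ∀ a ∈ L, a ≠ s → ∀ b ∈ L, b ≠ s → (∀ D ∈ chain s t, (a ∈ D ↔ b ∈ D)) → a = b

namespace Critical

variable {L : Finset (Fin n)} {s : Fin n} {t : Fin e → Finset (Fin n)}

/-- Two elements of a cluster that misses `s` could not be separated by any cluster through `s`. -/
theorem mem (h : Critical L s t) (i : Fin e) : s ∈ t i := by
  by_contra hs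
  obtain ⟨a, ha, b, hb, hab⟩ := Finset.one_lt_card.1 (h.valid.two_le i)
  refine hab (h.sep a (h.valid.sub i ha) (fun h => hs (h ▸ ha)) b (h.valid.sub i hb)
    (fun h => hs (h ▸ hb)) fun D hD => ?_)
  obtain ⟨hsD, k, rfl⟩ := mem_chain.1 hD
  rcases h.valid.nested i k with h' | h' | h'
  · exact iff_of_true (h' ha) (h' hb)
  · exact absurd (h' hsD) hs
  · exact iff_of_false (Finset.disjoint_left.1 h' ha) (Finset.disjoint_left.1 h' hb)

theorem sub_or_sub (h : Critical L s t) (i j : Fin e) : t i ⊆ t j ∨ t j ⊆ t i := by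
  rcases h.valid.nested i j with h' | h' | h'
  · exact Or.inl h'
  · exact Or.inr h'
  · exact absurd (h.mem j) (Finset.disjoint_left.1 h' (h.mem i))

/-- The clusters of a critical tuple form a chain of sets, and two injections into intervals of
integers bound its length from both sides. -/
theorem card_eq (h : Critical L s t) (hs : s ∈ L) : e + 1 = L.card := by
  have hpos : 0 < L.card := Finset.card_pos.2 ⟨s, hs⟩
  -- Members of a chain have distinct cardinalities between 2 and `L.card`.
  have h1 : e ≤ L.card - 1 := by
    have hinj : Set.InjOn (fun i => (t i).card) ((Finset.univ : Finset (Fin e)) : Set (Fin e)) := by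
      intro i _ j _ hij
      dsimp only at hij
      rcases h.sub_or_sub i j with h' | h'
      · exact h.valid.inj (Finset.eq_of_subset_of_card_le h' hij.ge)
      · exact (h.valid.inj (Finset.eq_of_subset_of_card_le h' hij.le)).symm
    have := Finset.card_le_card_of_injOn (s := (Finset.univ : Finset (Fin e)))
      (t := Finset.Icc 2 L.card) (fun i => (t i).card) (fun i _ => by
        rw [Finset.coe_Icc, Set.mem_Icc]
        exact ⟨h.valid.two_le i, Finset.card_le_card (h.valid.sub i)⟩) hinj
    rw [Finset.card_univ, Fintype.card_fin, Nat.card_Icc] at this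
    omega
  -- Leaves other than `s` are told apart by the number of clusters that contain them. It is between
  -- 1 and `e`, as `L` itself is a cluster.
  have h2 : L.card - 1 ≤ e := by
    rcases Nat.lt_or_ge L.card 2 with h2 | h2
    · omega
    obtain ⟨i0, hi0⟩ := h.valid.top h2
    let I : Fin n → Finset (Fin e) := fun a => Finset.univ.filter fun i => a ∈ t i
    have hI : ∀ a i, i ∈ I a ↔ a ∈ t i := fun a i => by simp [I]
    have hnest : ∀ a b, I a ⊆ I b ∨ I b ⊆ I a := by
      intro a b
      by_contra hno
      rw [not_or, Finset.not_subset, Finset.not_subset] at hno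
      obtain ⟨⟨i, hi, hi'⟩, j, hj, hj'⟩ := hno
      rw [hI] at hi hi' hj hj'
      rcases h.sub_or_sub i j with h' | h'
      · exact hj' (h' hi)
      · exact hi' (h' hj)
    have hinj : Set.InjOn (fun a => (I a).card) ((L.erase s : Finset (Fin n)) : Set (Fin n)) := by
      intro a ha b hb hab
      rw [Finset.mem_coe, Finset.mem_erase] at ha hb
      dsimp only at hab
      have hIab : I a = I b := by
        rcases hnest a b with h' | h'
        · exact Finset.eq_of_subset_of_card_le h' hab.ge
        · exact (Finset.eq_of_subset_of_card_le h' hab.le).symm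
      refine h.sep a ha.2 ha.1 b hb.2 hb.1 fun D hD => ?_
      obtain ⟨-, k, rfl⟩ := mem_chain.1 hD
      rw [← hI, ← hI, hIab]
    have := Finset.card_le_card_of_injOn (t := Finset.Icc 1 e) (fun a => (I a).card) (fun a ha => by
        rw [Finset.mem_coe, Finset.mem_erase] at ha
        rw [Finset.coe_Icc, Set.mem_Icc]
        refine ⟨Finset.card_pos.2 ⟨i0, ?_⟩, (Finset.card_le_univ _).trans (by simp)⟩
        rw [hI, hi0]
        exact ha.2) hinj
    rw [Finset.card_erase_of_mem hs, Nat.card_Icc] at this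
    omega
  omega

/-- An enlarged tuple would again be critical, but `card_eq` fixes the number of clusters. -/
theorem not_valid_cons (h : Critical L s t) (hs : s ∈ L) (C : Finset (Fin n)) :
    ¬ ValidTuple L (Fin.cons C t : Fin (e + 1) → _) := by
  intro hC
  have h' : Critical L s (Fin.cons C t : Fin (e + 1) → _) := by
    refine ⟨hC, fun a ha has b hb hbs hab => h.sep a ha has b hb hbs fun D hD => hab D ?_⟩
    obtain ⟨hsD, k, rfl⟩ := mem_chain.1 hD
    exact mem_chain.2 ⟨hsD, k.succ, rfl⟩
  have h1 := h.card_eq hs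
  have h2 := h'.card_eq hs
  omega

end Critical

end Chains

/-! ### The two parts of the differential and their commutation -/

namespace JComplex

variable {n e : ℕ}

theorem cons_comp_perm {α : Type*} (C : α) (t : Fin e → α) (σ : Equiv.Perm (Fin e)) :
    ∃ τ : Equiv.Perm (Fin (e + 1)), Equiv.Perm.sign τ = Equiv.Perm.sign σ ∧
      (Fin.cons C (t ∘ σ) : Fin (e + 1) → α) = (Fin.cons C t : Fin (e + 1) → α) ∘ τ := by
  obtain ⟨τ, h1, h0, hs⟩ := exists_consPerm σ
  refine ⟨τ, h1, funext fun i => ?_⟩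
  induction i using Fin.cases with
  | zero => simp [h0]
  | succ i => simp [hs]

theorem tree_cons_comp (hn : 2 ≤ n) (τ : Option (Fin n)) (C : Finset (Fin n))
    (t : Fin e → Finset (Fin n)) (σ : Equiv.Perm (Fin e)) :
    tree τ (Fin.cons C (t ∘ σ) : Fin (e + 1) → _) =
      (Equiv.Perm.sign σ : ℚ) • tree τ (Fin.cons C t : Fin (e + 1) → _) := by
  obtain ⟨ρ, h1, h2⟩ := cons_comp_perm C t σ
  rw [h2, tree_comp hn, h1]

theorem cons_cons_swap {α : Type*} (C D : α) (t : Fin e → α) :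
    (Fin.cons C (Fin.cons D t : Fin (e + 1) → α) : Fin (e + 2) → α) =
      (Fin.cons D (Fin.cons C t : Fin (e + 1) → α) : Fin (e + 2) → α) ∘ Equiv.swap 0 1 := by
  funext i
  induction i using Fin.cases with
  | zero => rw [Function.comp_apply, Equiv.swap_apply_left]; rfl
  | succ i =>
    induction i using Fin.cases with
    | zero =>
      rw [Function.comp_apply, show Fin.succ (0 : Fin (e + 1)) = 1 from rfl,
        Equiv.swap_apply_right]
      rfl
    | succ i =>
      rw [Function.comp_apply, Equiv.swap_apply_of_ne_of_ne (Fin.succ_ne_zero _)]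
      · simp
      · rw [show (1 : Fin (e + 2)) = Fin.succ 0 from rfl, ne_eq, Fin.succ_inj]
        exact Fin.succ_ne_zero _

theorem tree_cons_cons (hn : 2 ≤ n) (τ : Option (Fin n)) (C D : Finset (Fin n))
    (t : Fin e → Finset (Fin n)) :
    tree τ (Fin.cons C (Fin.cons D t : Fin (e + 1) → _) : Fin (e + 2) → _) =
      -tree τ (Fin.cons D (Fin.cons C t : Fin (e + 1) → _) : Fin (e + 2) → _) := by
  rw [cons_cons_swap, tree_comp hn, Equiv.Perm.sign_swap (by simp)]
  simp

theorem exists_splitMap (hn : 2 ≤ n) (e : ℕ) : ∃ d : JComplex 0 n e →ₗ[ℚ] JComplex 0 n (e + 1),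
    ∀ τ t, ValidTuple (topSet τ) t → d (tree τ t) = ∑ C, tree τ (Fin.cons C t : Fin (e + 1) → _) :=
  exists_lift hn (fun τ t => ∑ C, tree τ (Fin.cons C t : Fin (e + 1) → _)) fun τ t σ _ => by
    rw [Finset.smul_sum]
    exact Finset.sum_congr rfl fun C _ => tree_cons_comp hn τ C t σ

theorem exists_joinMap (hn : 2 ≤ n) (e : ℕ) : ∃ d : JComplex 0 n e →ₗ[ℚ] JComplex 0 n (e + 1),
    ∀ τ t, ValidTuple (topSet τ) t → d (tree τ t) =
      τ.elim 0 fun _ => tree none (Fin.cons Finset.univ t : Fin (e + 1) → _) :=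
  exists_lift hn (fun τ t => τ.elim 0 fun _ =>
    tree none (Fin.cons Finset.univ t : Fin (e + 1) → _)) fun τ t σ _ => by
    cases τ with
    | none => simp
    | some j => exact tree_cons_comp hn none _ t σ

/-- The part of the differential that splits vertices. -/
noncomputable def splitMap (hn : 2 ≤ n) (e : ℕ) : JComplex 0 n e →ₗ[ℚ] JComplex 0 n (e + 1) :=
  (exists_splitMap hn e).choose

/-- The part of the differential that joins `ε` and `ω`. -/
noncomputable def joinMap (hn : 2 ≤ n) (e : ℕ) : JComplex 0 n e →ₗ[ℚ] JComplex 0 n (e + 1) :=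
  (exists_joinMap hn e).choose

variable (hn : 2 ≤ n)

theorem splitMap_tree {τ : Option (Fin n)} {t : Fin e → Finset (Fin n)}
    (ht : ValidTuple (topSet τ) t) :
    splitMap hn e (tree τ t) = ∑ C, tree τ (Fin.cons C t : Fin (e + 1) → _) :=
  (exists_splitMap hn e).choose_spec τ t ht

theorem joinMap_tree {τ : Option (Fin n)} {t : Fin e → Finset (Fin n)}
    (ht : ValidTuple (topSet τ) t) : joinMap hn e (tree τ t) =
      τ.elim 0 fun _ => tree none (Fin.cons Finset.univ t : Fin (e + 1) → _) :=
  (exists_joinMap hn e).choose_spec τ t ht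

theorem differential_eq (e : ℕ) : differential 0 n e = splitMap hn e + joinMap hn e :=
  hom_ext fun τ t ht => by
    rw [differential_tree hn ht, LinearMap.add_apply, splitMap_tree hn ht, joinMap_tree hn ht]

/-- Exchanging the two new clusters reverses the sign, so the double sum equals its own negative. -/
theorem sum_tree_cons_cons (hn : 2 ≤ n) (τ : Option (Fin n)) (t : Fin e → Finset (Fin n)) :
    ∑ C, ∑ D, tree τ (Fin.cons D (Fin.cons C t : Fin (e + 1) → _) : Fin (e + 2) → _) = 0 := by
  have h : ∑ C, ∑ D, tree τ (Fin.cons D (Fin.cons C t : Fin (e + 1) → _) : Fin (e + 2) → _) =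
      -∑ C, ∑ D, tree τ (Fin.cons D (Fin.cons C t : Fin (e + 1) → _) : Fin (e + 2) → _) := by
    conv_lhs => rw [Finset.sum_comm]
    rw [← Finset.sum_neg_distrib]
    refine Finset.sum_congr rfl fun C _ => ?_
    rw [← Finset.sum_neg_distrib]
    exact Finset.sum_congr rfl fun D _ => tree_cons_cons hn τ _ _ t
  have h2 := add_eq_zero_iff_eq_neg.2 h
  rw [← two_smul ℚ] at h2
  exact (smul_eq_zero.1 h2).resolve_left two_ne_zero

/-- The formula for `splitMap` persists when the tuple with `C` is invalid: adding a further cluster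
does not repair it, so both sides vanish. The full cluster is supplied by `t`. -/
theorem splitMap_tree_cons {τ : Option (Fin n)} {t : Fin e → Finset (Fin n)} {C : Finset (Fin n)}
    (ht : ValidTuple (topSet τ) t) : splitMap hn (e + 1) (tree τ (Fin.cons C t : Fin (e + 1) → _)) =
      ∑ D, tree τ (Fin.cons D (Fin.cons C t : Fin (e + 1) → _) : Fin (e + 2) → _) := by
  by_cases h : ValidTuple (topSet τ) (Fin.cons C t : Fin (e + 1) → _)
  · exact splitMap_tree hn h
  · rw [tree_eq_zero h, map_zero, Finset.sum_eq_zero]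
    intro D _
    refine tree_eq_zero fun h' => h (h'.of_cons fun h2 => ?_)
    obtain ⟨i, hi⟩ := ht.top h2
    exact ⟨i.succ, hi⟩

theorem splitMap_comp_splitMap (e : ℕ) (x : JComplex 0 n e) :
    splitMap hn (e + 1) (splitMap hn e x) = 0 := by
  have : splitMap hn (e + 1) ∘ₗ splitMap hn e = 0 := hom_ext fun τ t ht => by
    rw [LinearMap.comp_apply, splitMap_tree hn ht, map_sum,
      Finset.sum_congr rfl fun C _ => splitMap_tree_cons hn ht, sum_tree_cons_cons hn]
    rfl
  exact LinearMap.congr_fun this x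

theorem _root_.ValidTuple.cons_univ (hn : 2 ≤ n) {j : Fin n} {t : Fin e → Finset (Fin n)}
    (ht : ValidTuple (topSet (some j)) t) :
    ValidTuple (topSet (none : Option (Fin n))) (Fin.cons Finset.univ t : Fin (e + 1) → _) := by
  have hj : ∀ i, j ∉ t i := fun i h => mem_topSet.1 (ht.sub i h) rfl
  refine ⟨Fin.cons_injective_iff.2 ⟨?_, ht.inj⟩, fun i => Finset.subset_univ _, fun i => ?_,
    fun i k => ?_, fun _ => ⟨0, rfl⟩⟩
  · rintro ⟨i, hi⟩
    exact hj i (hi ▸ Finset.mem_univ j)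
  · induction i using Fin.cases with
    | zero => simpa using hn
    | succ i => exact ht.two_le i
  · induction i using Fin.cases with
    | zero => exact Or.inr (Or.inl (Finset.subset_univ _))
    | succ i =>
      induction k using Fin.cases with
      | zero => exact Or.inl (Finset.subset_univ _)
      | succ k => exact ht.nested i k

/-- A cluster that contains `j` and is compatible with the clusters on the remaining leaves must
contain all of these, so it would be the full set, which is already present. -/
theorem _root_.ValidTuple.of_cons_univ {j : Fin n} {C : Finset (Fin n)}
    {t : Fin e → Finset (Fin n)} (ht : ValidTuple (topSet (some j)) t)
    (h : ValidTuple (topSet (none : Option (Fin n)))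
      (Fin.cons Finset.univ (Fin.cons C t : Fin (e + 1) → _) : Fin (e + 2) → _)) :
    ValidTuple (topSet (some j)) (Fin.cons C t : Fin (e + 1) → _) := by
  have hCu : C ≠ Finset.univ := fun hC => by
    have := h.inj (a₁ := 0) (a₂ := Fin.succ 0) (by simp [hC])
    exact absurd this (Fin.succ_ne_zero _).symm
  have hC2 : 2 ≤ C.card := h.two_le (Fin.succ 0)
  have hnest : ∀ i, C ⊆ t i ∨ t i ⊆ C ∨ Disjoint C (t i) := fun i =>
    h.nested (Fin.succ 0) i.succ.succ
  refine ht.cons (fun i hi => ?_) ?_ hC2 hnest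
  · have := h.inj (a₁ := Fin.succ 0) (a₂ := i.succ.succ) (by simpa using hi)
    exact absurd (Fin.succ_injective _ this) (Fin.succ_ne_zero _).symm
  · intro a ha
    rw [mem_topSet]
    intro hja
    obtain rfl : j = a := by simpa using hja
    have hsub : topSet (some j) ⊆ C → False := fun hs => hCu <| Finset.eq_univ_of_forall fun b => by
      by_cases hb : b = j
      · exact hb ▸ ha
      · exact hs (mem_topSet.2 fun h => hb (by simpa using h.symm))
    rcases Nat.lt_or_ge (topSet (some j)).card 2 with h2 | h2
    · refine hCu ((Finset.card_eq_iff_eq_univ C).1 ?_)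
      have := Finset.card_le_univ C
      simp only [topSet, Option.elim_some, Finset.card_erase_of_mem (Finset.mem_univ j),
        Finset.card_univ] at h2
      omega
    · obtain ⟨i, hi⟩ := ht.top h2
      rcases hnest i with h' | h' | h'
      · exact mem_topSet.1 (hi ▸ h' ha) rfl
      · exact hsub (hi ▸ h')
      · have : C ⊆ {j} := fun b hb => by
          have := Finset.disjoint_left.1 h' hb
          rw [hi, mem_topSet, not_not] at this
          simpa using this.symm
        have := Finset.card_le_card this
        simp at this
        omega

theorem joinMap_tree_cons {j : Fin n} {t : Fin e → Finset (Fin n)} {C : Finset (Fin n)}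
    (ht : ValidTuple (topSet (some j)) t) :
    joinMap hn (e + 1) (tree (some j) (Fin.cons C t : Fin (e + 1) → _)) =
      tree none (Fin.cons Finset.univ (Fin.cons C t : Fin (e + 1) → _) : Fin (e + 2) → _) := by
  by_cases h : ValidTuple (topSet (some j)) (Fin.cons C t : Fin (e + 1) → _)
  · exact joinMap_tree hn h
  · rw [tree_eq_zero h, map_zero, tree_eq_zero]
    exact fun h' => h (ht.of_cons_univ h')

theorem joinMap_comp_joinMap (e : ℕ) (x : JComplex 0 n e) :
    joinMap hn (e + 1) (joinMap hn e x) = 0 := by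
  have : joinMap hn (e + 1) ∘ₗ joinMap hn e = 0 := hom_ext fun τ t ht => by
    rw [LinearMap.comp_apply, joinMap_tree hn ht]
    cases τ with
    | none => simp
    | some j =>
      exact joinMap_tree hn (ht.cons_univ hn)
  exact LinearMap.congr_fun this x

/-- Both sides add `C` and the full set, in opposite order; by `of_cons_univ` the same sets `C`
contribute. -/
theorem joinMap_splitMap (e : ℕ) (x : JComplex 0 n e) :
    joinMap hn (e + 1) (splitMap hn e x) = -splitMap hn (e + 1) (joinMap hn e x) := by
  have : joinMap hn (e + 1) ∘ₗ splitMap hn e = -(splitMap hn (e + 1) ∘ₗ joinMap hn e) :=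
    hom_ext fun τ t ht => by
      rw [LinearMap.neg_apply, LinearMap.comp_apply, LinearMap.comp_apply, splitMap_tree hn ht,
        joinMap_tree hn ht, map_sum]
      cases τ with
      | none =>
        rw [Option.elim_none, map_zero, neg_zero]
        refine Finset.sum_eq_zero fun C _ => ?_
        by_cases h : ValidTuple (topSet none) (Fin.cons C t : Fin (e + 1) → _)
        · exact joinMap_tree hn h
        · rw [tree_eq_zero h, map_zero]
      | some j =>
        rw [Option.elim_some, splitMap_tree hn (ht.cons_univ hn), ← Finset.sum_neg_distrib]
        refine Finset.sum_congr rfl fun C _ => ?_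
        rw [joinMap_tree_cons hn ht, tree_cons_cons hn]
  exact LinearMap.congr_fun this x

theorem differential_comp (hn : 2 ≤ n) (e : ℕ) : differential 0 n (e + 1) ∘ₗ differential 0 n e = 0 := by
  refine LinearMap.ext fun x => ?_
  rw [differential_eq hn, differential_eq hn]
  simp only [LinearMap.comp_apply, LinearMap.add_apply, map_add, splitMap_comp_splitMap,
    joinMap_comp_joinMap, joinMap_splitMap, LinearMap.zero_apply]
  abel

end JComplex

/-! ### A contracting homotopy for splitting -/

section Decompose

variable {e : ℕ} {α : Type*}

theorem exists_eq_cons_comp {t : Fin (e + 1) → α} {P : α} (h : ∃ i, t i = P) :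
    ∃ (u : Fin e → α) (ρ : Equiv.Perm (Fin (e + 1))), t = (Fin.cons P u : Fin (e + 1) → α) ∘ ρ := by
  obtain ⟨i, rfl⟩ := h
  refine ⟨Fin.tail (t ∘ Equiv.swap 0 i), Equiv.swap 0 i, ?_⟩
  have h0 : (t ∘ Equiv.swap 0 i) 0 = t i := by simp
  rw [← h0, Fin.cons_self_tail, Function.comp_assoc, ← Equiv.coe_trans, Equiv.swap_swap]
  rfl

/-- Moving a given entry to the front leaves only a permutation of the other entries undetermined.
It follows that removing a cluster with its sign is well defined on alternating tuples. -/
theorem exists_perm_of_cons_comp_eq {P : α} {u u' : Fin e → α} {ρ ρ' : Equiv.Perm (Fin (e + 1))}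
    (hi : Function.Injective (Fin.cons P u : Fin (e + 1) → α))
    (h : (Fin.cons P u : Fin (e + 1) → α) ∘ ρ = (Fin.cons P u' : Fin (e + 1) → α) ∘ ρ') :
    ∃ κ : Equiv.Perm (Fin e), u' = u ∘ κ ∧
      Equiv.Perm.sign ρ = Equiv.Perm.sign κ * Equiv.Perm.sign ρ' := by
  have h' : ∀ i, (Fin.cons P u : Fin (e + 1) → α) ((ρ * ρ'⁻¹) i) =
      (Fin.cons P u' : Fin (e + 1) → α) i := fun i => by
    have := congrFun h (ρ'⁻¹ i)
    simpa using this
  have h0 : (ρ * ρ'⁻¹) 0 = 0 := hi (by simpa using h' 0)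
  obtain ⟨⟨p, κ⟩, hκ⟩ := Equiv.Perm.decomposeFin.symm.surjective (ρ * ρ'⁻¹)
  have hp : p = 0 := by rw [← hκ] at h0; simpa using h0
  subst hp
  refine ⟨κ, funext fun i => ?_, ?_⟩
  · have := h' i.succ
    rw [← hκ] at this
    simpa using this.symm
  · have := congrArg Equiv.Perm.sign hκ
    rw [Equiv.Perm.decomposeFin.symm_sign, if_pos rfl, one_mul, map_mul, Equiv.Perm.sign_inv] at this
    rw [this, mul_assoc, Int.units_mul_self, mul_one]

end Decompose

namespace JComplex

variable {n e : ℕ}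

/-- The block that is contracted by the homotopy. -/
noncomputable abbrev pick (s : Option (Fin n) → Fin n) (τ : Option (Fin n))
    (t : Fin e → Finset (Fin n)) : Finset (Fin n) := pickBlock (topSet τ) (s τ) (chain (s τ) t)

/-- The homotopy removes the picked block when it is a cluster and gives zero otherwise. It respects
the alternating relation because the pick depends only on the set of clusters through `s`, not on
their order. -/
theorem exists_homotopy (hn : 2 ≤ n) (s : Option (Fin n) → Fin n) (e : ℕ) :
    ∃ h : JComplex 0 n (e + 1) →ₗ[ℚ] JComplex 0 n e, ∀ τ t, ValidTuple (topSet τ) t →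
      ((∀ i, t i ≠ pick s τ t) → h (tree τ t) = 0) ∧
      ∀ u, t = Fin.cons (pick s τ t) u → h (tree τ t) = tree τ u := by
  classical
  let f : (τ : Option (Fin n)) → (Fin (e + 1) → Finset (Fin n)) → JComplex 0 n e := fun τ t =>
    if H : ∃ i, t i = pick s τ t then
      (Equiv.Perm.sign (exists_eq_cons_comp H).choose_spec.choose : ℚ) •
        tree τ (exists_eq_cons_comp H).choose else 0
  have hf : ∀ τ t (u : Fin e → Finset (Fin n)) (ρ : Equiv.Perm (Fin (e + 1))),
      ValidTuple (topSet τ) t → t = (Fin.cons (pick s τ t) u : Fin (e + 1) → _) ∘ ρ →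
      f τ t = (Equiv.Perm.sign ρ : ℚ) • tree τ u := by
    intro τ t u ρ ht h
    have H : ∃ i, t i = pick s τ t := ⟨ρ.symm 0, by rw [h]; simp [← h]⟩
    have h2 := (exists_eq_cons_comp H).choose_spec.choose_spec
    have hi : Function.Injective (Fin.cons (pick s τ t) u : Fin (e + 1) → Finset (Fin n)) := by
      have := ht.inj
      rw [h, Equiv.injective_comp] at this
      exact this
    have key : ∀ (u' : Fin e → Finset (Fin n)) (ρ' : Equiv.Perm (Fin (e + 1))),
        t = (Fin.cons (pick s τ t) u' : Fin (e + 1) → _) ∘ ρ' →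
        (Equiv.Perm.sign ρ' : ℚ) • tree τ u' = (Equiv.Perm.sign ρ : ℚ) • tree τ u := by
      intro u' ρ' h2
      obtain ⟨κ, h3, h4⟩ := exists_perm_of_cons_comp_eq hi (h.symm.trans h2)
      rw [h3, tree_comp hn, smul_smul, h4, mul_comm]
      simp
    exact (dif_pos H).trans (key _ _ h2)
  obtain ⟨h, hh⟩ := exists_lift hn f fun τ t σ ht => by
    have hp : pick s τ (t ∘ σ) = pick s τ t := by rw [pick, chain_comp]
    by_cases H : ∃ i, t i = pick s τ t
    · obtain ⟨u, ρ, hu⟩ := exists_eq_cons_comp H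
      rw [hf τ t u ρ ht hu, hf τ (t ∘ σ) u (ρ * σ) ((validTuple_comp_iff σ).2 ht), smul_smul,
        map_mul, mul_comm]
      · simp
      · rw [hp]
        conv_lhs => rw [hu]
        rfl
    · have H' : ¬ ∃ i, (t ∘ σ) i = pick s τ (t ∘ σ) := by
        rw [hp]
        rintro ⟨i, hi⟩
        exact H ⟨σ i, hi⟩
      simp only [f, dif_neg H, dif_neg H', smul_zero]
  refine ⟨h, fun τ t ht => ⟨fun H => ?_, fun u hu => ?_⟩⟩
  · rw [hh τ t ht]
    exact dif_neg fun ⟨i, hi⟩ => H i hi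
  · rw [hh τ t ht, hf τ t u 1 ht (by simpa using hu)]
    simp

/-- The trees in which at least `k` clusters contain the distinguished leaf. -/
noncomputable def Fil (s : Option (Fin n) → Fin n) (k e : ℕ) : Submodule ℚ (JComplex 0 n e) :=
  Submodule.span ℚ {c | ∃ τ t, ValidTuple (topSet τ) t ∧ k ≤ chainLength (s τ) t ∧ c = tree τ t}

/-- The span of the critical trees. -/
noncomputable def Crit (s : Option (Fin n) → Fin n) (e : ℕ) : Submodule ℚ (JComplex 0 n e) :=
  Submodule.span ℚ {c | ∃ τ t, Critical (topSet τ) (s τ) t ∧ c = tree τ t}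

variable {s : Option (Fin n) → Fin n}

theorem tree_mem_fil {τ : Option (Fin n)} {t : Fin e → Finset (Fin n)} {k : ℕ}
    (hk : k ≤ chainLength (s τ) t) : tree τ t ∈ Fil s k e := by
  by_cases h : ValidTuple (topSet τ) t
  · exact Submodule.subset_span ⟨τ, t, h, hk, rfl⟩
  · rw [tree_eq_zero h]
    exact Submodule.zero_mem _

theorem fil_zero (s : Option (Fin n) → Fin n) (e : ℕ) : Fil s 0 e = ⊤ := by
  rw [← top_le_iff, ← span_tree n e]
  refine Submodule.span_mono ?_
  rintro _ ⟨τ, t, ht, rfl⟩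
  exact ⟨τ, t, ht, Nat.zero_le _, rfl⟩

theorem fil_eq_bot (s : Option (Fin n) → Fin n) (e : ℕ) : Fil s (e + 1) e = ⊥ := by
  rw [Fil, Submodule.span_eq_bot]
  rintro _ ⟨τ, t, -, hk, -⟩
  have := chainLength_le (s τ) t
  omega

theorem splitMap_of_mem_crit (hn : 2 ≤ n) (hs : ∀ τ, s τ ∈ topSet τ) {x : JComplex 0 n e}
    (hx : x ∈ Crit s e) : splitMap hn e x = 0 := by
  refine (Submodule.span_le (p := LinearMap.ker (splitMap hn e))).2 ?_ hx
  rintro _ ⟨τ, t, ht, rfl⟩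
  rw [SetLike.mem_coe, LinearMap.mem_ker, splitMap_tree hn ht.valid]
  exact Finset.sum_eq_zero fun C _ => tree_eq_zero (ht.not_valid_cons (hs τ) C)

/-- A cluster that avoids `s` is not in the chain. So inserting or removing the picked block, or any
other cluster away from `s`, does not change the pick. -/
theorem pick_cons {τ : Option (Fin n)} {C : Finset (Fin n)} (hC : s τ ∉ C)
    (t : Fin e → Finset (Fin n)) : pick s τ (Fin.cons C t : Fin (e + 1) → _) = pick s τ t := by
  rw [pick, chain_cons_of_notMem hC]

/-- A homotopy for the differential `splitMap`. -/
noncomputable def homotopy (hn : 2 ≤ n) (s : Option (Fin n) → Fin n) (e : ℕ) :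
    JComplex 0 n (e + 1) →ₗ[ℚ] JComplex 0 n e := (exists_homotopy hn s e).choose

theorem homotopy_eq_zero (hn : 2 ≤ n) {τ : Option (Fin n)} {t : Fin (e + 1) → Finset (Fin n)}
    (ht : ValidTuple (topSet τ) t) (h : ∀ i, t i ≠ pick s τ t) :
    homotopy hn s e (tree τ t) = 0 :=
  ((exists_homotopy hn s e).choose_spec τ t ht).1 h

theorem homotopy_cons (hn : 2 ≤ n) {τ : Option (Fin n)} {u : Fin e → Finset (Fin n)}
    {P : Finset (Fin n)} (ht : ValidTuple (topSet τ) (Fin.cons P u : Fin (e + 1) → _))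
    (hP : pick s τ (Fin.cons P u : Fin (e + 1) → _) = P) :
    homotopy hn s e (tree τ (Fin.cons P u : Fin (e + 1) → _)) = tree τ u :=
  ((exists_homotopy hn s e).choose_spec τ _ ht).2 u (by rw [hP])

/-- The removed block does not contain `s`, so the length of the chain through `s` is preserved. -/
theorem homotopy_mem_fil (hn : 2 ≤ n) (τ : Option (Fin n)) (t : Fin (e + 1) → Finset (Fin n)) :
    homotopy hn s e (tree τ t) ∈ Fil s (chainLength (s τ) t) e := by
  by_cases ht : ValidTuple (topSet τ) t
  swap
  · rw [tree_eq_zero ht, map_zero]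
    exact Submodule.zero_mem _
  by_cases h : ∃ i, t i = pick s τ t
  swap
  · rw [homotopy_eq_zero hn ht (not_exists.1 h)]
    exact Submodule.zero_mem _
  obtain ⟨u, ρ, hu⟩ := exists_eq_cons_comp h
  have hP : s τ ∉ pick s τ t := by
    rcases pickBlock_spec (topSet τ) (s τ) (chain (s τ) t) with h' | h'
    · rw [pick, h'.1]
      simp
    · exact h'.notMem
  have hc : chainLength (s τ) t = chainLength (s τ) u := by
    conv_lhs => rw [hu]
    rw [chainLength_comp, chainLength_cons, if_neg hP, zero_add]
  have hp : pick s τ (Fin.cons (pick s τ t) u : Fin (e + 1) → _) = pick s τ t := by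
    conv_rhs => rw [hu, pick, chain_comp]
  rw [hc]
  generalize pick s τ t = P at hu hp
  rw [hu, validTuple_comp_iff] at ht
  rw [hu, tree_comp hn, map_smul, homotopy_cons hn ht hp]
  exact Submodule.smul_mem _ _ (tree_mem_fil le_rfl)

/-- The homotopy kills `t`. In the coboundary of `t` the term that adds the block returns `t`; a
term adding another cluster without `s` keeps the pick and is killed; clusters with `s` raise the
filtration. -/
theorem homotopy_of_notMem (hn : 2 ≤ n) {τ : Option (Fin n)} {t : Fin (e + 1) → Finset (Fin n)}
    (ht : ValidTuple (topSet τ) t) (hb : IsBlock (topSet τ) (s τ) (chain (s τ) t) (pick s τ t))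
    (hP : ∀ i, pick s τ t ≠ t i) :
    splitMap hn e (homotopy hn s e (tree τ t)) + homotopy hn s (e + 1) (splitMap hn (e + 1) (tree τ t))
      - tree τ t ∈ Fil s (chainLength (s τ) t + 1) (e + 1) := by
  classical
  rw [homotopy_eq_zero hn ht fun i hi => hP i hi.symm, map_zero, zero_add, splitMap_tree hn ht,
    map_sum, ← Finset.add_sum_erase _ _ (Finset.mem_univ (pick s τ t)),
    homotopy_cons hn (hb.validTuple_cons ht hP) (pick_cons hb.notMem t), add_sub_cancel_left]
  refine Submodule.sum_mem _ fun C hC => ?_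
  by_cases hsC : s τ ∈ C
  · have := homotopy_mem_fil (s := s) hn τ (Fin.cons C t : Fin (e + 2) → _)
    rwa [chainLength_cons, if_pos hsC, add_comm 1] at this
  · by_cases hv : ValidTuple (topSet τ) (Fin.cons C t : Fin (e + 2) → _)
    · rw [homotopy_eq_zero hn hv]
      · exact Submodule.zero_mem _
      · intro i
        rw [pick_cons hsC]
        induction i using Fin.cases with
        | zero => exact (Finset.mem_erase.1 hC).1
        | succ i => exact (hP i).symm
    · rw [tree_eq_zero hv, map_zero]
      exact Submodule.zero_mem _

/-- Removing `P` and then adding `P` returns the tree. For another cluster `C` without `s`, adding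
`C` after removing `P` cancels against removing `P` after adding `C`, since `C` and `P` get
interchanged. Clusters with `s` raise the filtration. -/
theorem homotopy_of_cons (hn : 2 ≤ n) (hs : ∀ τ, s τ ∈ topSet τ) {τ : Option (Fin n)}
    {u : Fin e → Finset (Fin n)} {P : Finset (Fin n)}
    (ht : ValidTuple (topSet τ) (Fin.cons P u : Fin (e + 1) → _))
    (hb : IsBlock (topSet τ) (s τ) (chain (s τ) u) P) (hP : pick s τ u = P) :
    splitMap hn e (homotopy hn s e (tree τ (Fin.cons P u : Fin (e + 1) → _))) +
      homotopy hn s (e + 1) (splitMap hn (e + 1) (tree τ (Fin.cons P u : Fin (e + 1) → _))) -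
      tree τ (Fin.cons P u : Fin (e + 1) → _) ∈ Fil s (chainLength (s τ) u + 1) (e + 1) := by
  classical
  have hu : ValidTuple (topSet τ) u := ht.of_cons fun h2 => by
    obtain ⟨i, hi⟩ := ht.top h2
    induction i using Fin.cases with
    | zero =>
      refine absurd (hs τ) ?_
      rw [← hi]
      exact hb.notMem
    | succ i => exact ⟨i, hi⟩
  rw [homotopy_cons hn ht (by rw [pick_cons hb.notMem, hP]), splitMap_tree hn ht, splitMap_tree hn hu,
    map_sum, ← Finset.sum_add_distrib, ← Finset.add_sum_erase _ _ (Finset.mem_univ P)]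
  have h0 : tree τ (Fin.cons P (Fin.cons P u : Fin (e + 1) → _) : Fin (e + 2) → _) = 0 :=
    tree_eq_zero fun h => by
      have := h.inj (a₁ := 0) (a₂ := Fin.succ 0) rfl
      exact absurd this (Fin.succ_ne_zero _).symm
  rw [h0, map_zero, add_zero, add_sub_cancel_left]
  refine Submodule.sum_mem _ fun C hC => ?_
  by_cases hsC : s τ ∈ C
  · refine Submodule.add_mem _ (tree_mem_fil ?_) ?_
    · rw [chainLength_cons, if_pos hsC, add_comm]
    · have := homotopy_mem_fil (s := s) hn τ
        (Fin.cons C (Fin.cons P u : Fin (e + 1) → _) : Fin (e + 2) → _)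
      rwa [chainLength_cons, chainLength_cons, if_pos hsC, if_neg hb.notMem, zero_add,
        add_comm 1] at this
  · have hz : tree τ (Fin.cons C u : Fin (e + 1) → _) +
        homotopy hn s (e + 1)
          (tree τ (Fin.cons C (Fin.cons P u : Fin (e + 1) → _) : Fin (e + 2) → _)) = 0 := by
      rw [tree_cons_cons hn, map_neg, ← sub_eq_add_neg, sub_eq_zero]
      by_cases hv : ValidTuple (topSet τ) (Fin.cons C u : Fin (e + 1) → _)
      · have hb' : IsBlock (topSet τ) (s τ) (chain (s τ) (Fin.cons C u : Fin (e + 1) → _)) P := by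
          rwa [chain_cons_of_notMem hsC]
        rw [homotopy_cons hn]
        · refine hb'.validTuple_cons hv fun i => ?_
          induction i using Fin.cases with
          | zero => exact (Finset.mem_erase.1 hC).1.symm
          | succ i =>
            intro hi
            have := ht.inj (a₁ := 0) (a₂ := i.succ) hi
            exact absurd this (Fin.succ_ne_zero _).symm
        · rw [pick_cons hb.notMem, pick_cons hsC, hP]
      · rw [tree_eq_zero hv, tree_eq_zero, map_zero]
        refine fun h => hv (h.of_cons fun h2 => ?_)
        obtain ⟨i, hi⟩ := hu.top h2
        exact ⟨i.succ, hi⟩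
    rw [hz]
    exact Submodule.zero_mem _

theorem exists_crit_of_tree (hn : 2 ≤ n) (hs : ∀ τ, s τ ∈ topSet τ) {τ : Option (Fin n)}
    {t : Fin (e + 1) → Finset (Fin n)} (ht : ValidTuple (topSet τ) t) : ∃ c ∈ Crit s (e + 1),
      splitMap hn e (homotopy hn s e (tree τ t)) +
        homotopy hn s (e + 1) (splitMap hn (e + 1) (tree τ t)) - tree τ t + c ∈
      Fil s (chainLength (s τ) t + 1) (e + 1) := by
  rcases pickBlock_spec (topSet τ) (s τ) (chain (s τ) t) with h | h
  · have hc : Critical (topSet τ) (s τ) t := ⟨ht, h.2⟩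
    have hm : tree τ t ∈ Crit s (e + 1) := Submodule.subset_span ⟨τ, t, hc, rfl⟩
    refine ⟨tree τ t, hm, ?_⟩
    rw [splitMap_of_mem_crit hn hs hm, homotopy_eq_zero hn ht]
    · simp
    · intro i hi
      have := ht.two_le i
      rw [hi, pick, h.1] at this
      simp at this
  · refine ⟨0, Submodule.zero_mem _, ?_⟩
    rw [add_zero]
    by_cases hP : ∀ i, pick s τ t ≠ t i
    · exact homotopy_of_notMem hn ht h hP
    · push Not at hP
      obtain ⟨i, hi⟩ := hP
      obtain ⟨u, ρ, hu⟩ := exists_eq_cons_comp ⟨i, hi.symm⟩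
      have hcu : chain (s τ) t = chain (s τ) u := by
        conv_lhs => rw [hu]
        rw [chain_comp, chain_cons_of_notMem h.notMem]
      have hl : chainLength (s τ) t = chainLength (s τ) u := by
        conv_lhs => rw [hu]
        rw [chainLength_comp, chainLength_cons, if_neg h.notMem, zero_add]
      have hpu : pick s τ t = pick s τ u := by rw [pick, hcu]
      rw [hpu] at hu
      rw [hcu, ← pick] at h
      rw [hl]
      rw [hu, validTuple_comp_iff] at ht
      rw [hu, tree_comp hn]
      simp only [map_smul]
      rw [← smul_add, ← smul_sub]
      exact Submodule.smul_mem _ _ (homotopy_of_cons hn hs ht h rfl)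

theorem exists_crit_of_mem_fil (hn : 2 ≤ n) (hs : ∀ τ, s τ ∈ topSet τ) {k : ℕ}
    {x : JComplex 0 n (e + 1)} (hx : x ∈ Fil s k (e + 1)) : ∃ c ∈ Crit s (e + 1),
      splitMap hn e (homotopy hn s e x) + homotopy hn s (e + 1) (splitMap hn (e + 1) x) - x + c ∈
      Fil s (k + 1) (e + 1) := by
  induction hx using Submodule.span_induction with
  | mem x h =>
    obtain ⟨τ, t, ht, hk, rfl⟩ := h
    obtain ⟨c, hc, h⟩ := exists_crit_of_tree hn hs ht
    refine ⟨c, hc, Submodule.span_mono ?_ h⟩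
    rintro _ ⟨τ, t, ht, hk', rfl⟩
    exact ⟨τ, t, ht, by omega, rfl⟩
  | zero => exact ⟨0, Submodule.zero_mem _, by simp⟩
  | add x y _ _ hx hy =>
    obtain ⟨c, hc, hx⟩ := hx
    obtain ⟨d, hd, hy⟩ := hy
    refine ⟨c + d, Submodule.add_mem _ hc hd, ?_⟩
    convert Submodule.add_mem _ hx hy using 1
    simp only [map_add]
    abel
  | smul a x _ hx =>
    obtain ⟨c, hc, hx⟩ := hx
    refine ⟨a • c, Submodule.smul_mem _ _ hc, ?_⟩
    convert Submodule.smul_mem _ a hx using 1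
    simp only [map_smul, smul_add, smul_sub]

/-- Up to critical trees, the complex with differential `splitMap` is acyclic. -/
theorem exists_sub_splitMap_mem_crit (hn : 2 ≤ n) (hs : ∀ τ, s τ ∈ topSet τ)
    {x : JComplex 0 n (e + 1)} (hx : splitMap hn (e + 1) x = 0) :
    ∃ y, x - splitMap hn e y ∈ Crit s (e + 1) := by
  have key : ∀ k, ∃ y, ∃ c ∈ Crit s (e + 1), x - splitMap hn e y - c ∈ Fil s k (e + 1) := by
    intro k
    induction k with
    | zero => exact ⟨0, 0, Submodule.zero_mem _, by rw [fil_zero]; trivial⟩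
    | succ k ih =>
      obtain ⟨y, c, hc, h⟩ := ih
      -- The remainder is a cocycle of `splitMap`, so of the homotopy formula only the exact term is
      -- left, and each round raises the filtration by one.
      obtain ⟨d, hd, h'⟩ := exists_crit_of_mem_fil hn hs h
      have h0 : splitMap hn (e + 1) (x - splitMap hn e y - c) = 0 := by
        rw [map_sub, map_sub, hx, splitMap_comp_splitMap, splitMap_of_mem_crit hn hs hc]
        simp
      rw [h0, map_zero, add_zero] at h'
      refine ⟨y + homotopy hn s e (x - splitMap hn e y - c), c + d, Submodule.add_mem _ hc hd, ?_⟩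
      convert Submodule.neg_mem _ h' using 1
      rw [map_add]
      abel
  -- There are only `e + 1` clusters, so no chain has length `e + 2` and the remainder vanishes.
  obtain ⟨y, c, hc, h⟩ := key (e + 2)
  rw [fil_eq_bot, Submodule.mem_bot, sub_eq_zero] at h
  exact ⟨y, h ▸ hc⟩

/-- Without clusters there can be only one leaf, and the separation condition is empty. -/
theorem crit_zero (s : Option (Fin n) → Fin n) : Crit s 0 = ⊤ := by
  rw [← top_le_iff, ← span_tree n 0]
  refine Submodule.span_mono ?_
  rintro _ ⟨τ, t, ht, rfl⟩
  refine ⟨τ, t, ⟨ht, fun a ha has b hb hbs _ => ?_⟩, rfl⟩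
  by_contra hab
  obtain ⟨i, -⟩ := ht.top (Finset.one_lt_card.2 ⟨a, ha, b, hb, hab⟩)
  exact i.elim0

end JComplex

/-- Drop a member `M` of minimal size and delete one of its elements `a` everywhere. Members meeting
`M` contain it, and those other than `M` are strictly larger, so the remaining sets stay distinct,
of size at least two, and nested or disjoint. Induction applies. -/
theorem Finset.card_lt_of_laminar {α : Type*} [DecidableEq α] {F : Finset (Finset α)} {L : Finset α}
    (hL : L.Nonempty) (sub : ∀ D ∈ F, D ⊆ L) (two_le : ∀ D ∈ F, 2 ≤ D.card)
    (nested : ∀ D ∈ F, ∀ E ∈ F, D ⊆ E ∨ E ⊆ D ∨ Disjoint D E) : F.card < L.card := by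
  induction hc : F.card generalizing F L with
  | zero => exact hL.card_pos
  | succ m ih =>
    obtain ⟨M, hM, hmin⟩ := Finset.exists_min_image F Finset.card (Finset.card_pos.1 (by omega))
    obtain ⟨a, ha⟩ : M.Nonempty := Finset.card_pos.1 (by have := two_le M hM; omega)
    have hsup : ∀ D ∈ F, ∀ x ∈ M, x ∈ D → M ⊆ D := by
      intro D hD x hx hxD
      rcases nested D hD M hM with h | h | h
      · exact (Finset.eq_of_subset_of_card_le h (hmin D hD)).ge
      · exact h
      · exact absurd hx (Finset.disjoint_left.1 h hxD)
    have hM2 := two_le M hM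
    have hkey : ∀ D ∈ F, ∀ E ∈ F, D.erase a = E.erase a → a ∈ D → a ∈ E := by
      intro D hD E hE h haD
      obtain ⟨b, hb, hba⟩ := Finset.exists_mem_ne (by omega : 1 < M.card) a
      have hbD : b ∈ D.erase a := Finset.mem_erase.2 ⟨hba, hsup D hD a ha haD hb⟩
      rw [h] at hbD
      exact hsup E hE b hb (Finset.mem_of_mem_erase hbD) ha
    have hinj : Set.InjOn (fun D : Finset α => D.erase a) (F.erase M : Finset (Finset α)) := by
      intro D hD E hE h
      have hD' := Finset.mem_of_mem_erase hD
      have hE' := Finset.mem_of_mem_erase hE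
      dsimp only at h
      by_cases haD : a ∈ D
      · rw [← Finset.insert_erase haD, h, Finset.insert_erase (hkey D hD' E hE' h haD)]
      · have haE : a ∉ E := fun haE => haD (hkey E hE' D hD' h.symm haE)
        rwa [Finset.erase_eq_of_notMem haD, Finset.erase_eq_of_notMem haE] at h
    have haL : a ∈ L := sub M hM ha
    have := ih (F := (F.erase M).image fun D => D.erase a) (L := L.erase a) ?_ ?_ ?_ ?_ ?_
    · rw [Finset.card_erase_of_mem haL] at this
      omega
    · have := Finset.card_le_card (sub M hM)
      exact Finset.card_pos.1 (by rw [Finset.card_erase_of_mem haL]; omega)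
    · intro D hD
      obtain ⟨E, hE, rfl⟩ := Finset.mem_image.1 hD
      exact Finset.erase_subset_erase a (sub E (Finset.mem_of_mem_erase hE))
    · intro D hD
      obtain ⟨E, hE, rfl⟩ := Finset.mem_image.1 hD
      obtain ⟨hne, hE⟩ := Finset.mem_erase.1 hE
      by_cases haE : a ∈ E
      · have hlt : M.card < E.card := Finset.card_lt_card
          ((hsup E hE a ha haE).ssubset_of_ne hne.symm)
        rw [Finset.card_erase_of_mem haE]
        omega
      · rw [Finset.erase_eq_of_notMem haE]
        exact two_le E hE
    · intro D hD E hE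
      obtain ⟨D', hD', rfl⟩ := Finset.mem_image.1 hD
      obtain ⟨E', hE', rfl⟩ := Finset.mem_image.1 hE
      rcases nested D' (Finset.mem_of_mem_erase hD') E' (Finset.mem_of_mem_erase hE') with h | h | h
      · exact Or.inl (Finset.erase_subset_erase a h)
      · exact Or.inr (Or.inl (Finset.erase_subset_erase a h))
      · exact Or.inr (Or.inr (h.mono (Finset.erase_subset _ _) (Finset.erase_subset _ _)))
    · rw [Finset.card_image_of_injOn hinj, Finset.card_erase_of_mem hM]
      omega

theorem ValidTuple.lt_card {n e : ℕ} {L : Finset (Fin n)} {t : Fin e → Finset (Fin n)}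
    (h : ValidTuple L t) (hL : L.Nonempty) : e < L.card := by
  have := Finset.card_lt_of_laminar (F := Finset.univ.image t) hL
    (by simpa using h.sub) (by simpa using h.two_le) (by simpa using h.nested)
  rwa [Finset.card_image_of_injective _ h.inj, Finset.card_univ, Fintype.card_fin] at this

/-! ### Planar trees: clusters that are intervals -/

section Intervals

variable {m e : ℕ}

/-- Intervals in `Fin m`. -/
def IsInterval (D : Finset (Fin m)) : Prop := ∀ a ∈ D, ∀ b ∈ D, ∀ c, a ≤ c → c ≤ b → c ∈ D

theorem isInterval_of_card_eq_one {D : Finset (Fin m)} (h : D.card = 1) : IsInterval D := by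
  obtain ⟨x, rfl⟩ := Finset.card_eq_one.1 h
  intro a ha b hb c hac hcb
  rw [Finset.mem_singleton] at ha hb ⊢
  subst ha
  subst hb
  exact le_antisymm hcb hac

theorem isInterval_univ : IsInterval (Finset.univ : Finset (Fin m)) :=
  fun _ _ _ _ _ _ _ => Finset.mem_univ _

/-- Disjoint intervals lie on two sides of each other; `b` is the end of `C` that faces `Z`. The two
alternatives record on which side `Z` lies. -/
theorem IsInterval.exists_nearest {C Z : Finset (Fin m)} (hC : IsInterval C) (hZ : IsInterval Z)
    (hd : Disjoint C Z) (hCn : C.Nonempty) (hZn : Z.Nonempty) :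
    ∃ b ∈ C, ∀ w ∈ C, ∀ z ∈ Z, (w ≤ b ∧ b ≤ z) ∨ (z ≤ b ∧ b ≤ w) := by
  obtain ⟨c, hc⟩ := hCn
  obtain ⟨y, hy⟩ := hZn
  have hd' : ∀ x ∈ C, x ∉ Z := fun x hx => Finset.disjoint_left.1 hd hx
  rcases le_total c y with hcy | hcy
  · refine ⟨C.max' ⟨c, hc⟩, C.max'_mem _, fun w hw z hz => Or.inl ⟨C.le_max' w hw, ?_⟩⟩
    by_contra! hlt
    rcases le_total z c with hzc | hzc
    · exact hd' c hc (hZ z hz y hy c hzc hcy)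
    · exact hd' z (hC c hc _ (C.max'_mem _) z hzc hlt.le) hz
  · refine ⟨C.min' ⟨c, hc⟩, C.min'_mem _, fun w hw z hz => Or.inr ⟨?_, C.min'_le w hw⟩⟩
    by_contra! hlt
    rcases le_total c z with hzc | hzc
    · exact hd' c hc (hZ y hy z hz c hcy hzc)
    · exact hd' z (hC _ (C.min'_mem _) c hc z hlt.le hzc) hz

/-- Clusters and leaves. -/
def Node (t : Fin e → Finset (Fin m)) (X : Finset (Fin m)) : Prop := (∃ i, t i = X) ∨ X.card = 1

theorem Node.nested {L X : Finset (Fin m)} {t : Fin e → Finset (Fin m)} (h : Node t X)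
    (ht : ValidTuple L t) (i : Fin e) : X ⊆ t i ∨ t i ⊆ X ∨ Disjoint X (t i) := by
  rcases h with ⟨k, rfl⟩ | h
  · exact ht.nested k i
  · obtain ⟨x, rfl⟩ := Finset.card_eq_one.1 h
    by_cases hx : x ∈ t i
    · exact Or.inl (Finset.singleton_subset_iff.2 hx)
    · exact Or.inr (Or.inr (Finset.disjoint_singleton_left.2 hx))

theorem Node.nonempty {L X : Finset (Fin m)} {t : Fin e → Finset (Fin m)} (h : Node t X)
    (ht : ValidTuple L t) : X.Nonempty := by
  rcases h with ⟨k, rfl⟩ | h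
  · have := ht.two_le k
    exact Finset.card_pos.1 (by omega)
  · exact Finset.card_pos.1 (by omega)

/-- `Y` is the child of the cluster `D` on the way to the leaf `b`. -/
theorem exists_maximal_node {t : Fin e → Finset (Fin m)} {D : Finset (Fin m)} {b : Fin m}
    (hb : b ∈ D) (hD : 2 ≤ D.card) :
    ∃ Y, Node t Y ∧ b ∈ Y ∧ Y ⊂ D ∧ ∀ i, Y ⊆ t i → t i ⊂ D → t i = Y := by
  classical
  have h0 : {b} ∈ Finset.univ.filter fun Y : Finset (Fin m) => Node t Y ∧ b ∈ Y ∧ Y ⊂ D := by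
    rw [Finset.mem_filter]
    refine ⟨Finset.mem_univ _, Or.inr (Finset.card_singleton b), Finset.mem_singleton_self b,
      (Finset.singleton_subset_iff.2 hb).ssubset_of_ne ?_⟩
    rintro rfl
    simp at hD
  obtain ⟨Y, hY, hmax⟩ := Finset.exists_max_image _ Finset.card ⟨_, h0⟩
  rw [Finset.mem_filter] at hY
  refine ⟨Y, hY.2.1, hY.2.2.1, hY.2.2.2, fun i h1 h2 => ?_⟩
  refine (Finset.eq_of_subset_of_card_le h1 (hmax _ ?_)).symm
  rw [Finset.mem_filter]
  exact ⟨Finset.mem_univ _, Or.inl ⟨i, rfl⟩, h1 hY.2.2.1, h2⟩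

/-- The clusters of a binary tree have two children. -/
theorem node_sdiff {t : Fin e → Finset (Fin (e + 1))} (ht : ValidTuple Finset.univ t) {i : Fin e}
    {X : Finset (Fin (e + 1))} (hX : Node t X) (hXi : X ⊂ t i)
    (hmax : ∀ k, X ⊆ t k → t k ⊂ t i → t k = X) : Node t (t i \ X) := by
  by_contra hno
  rw [Node, not_or] at hno
  have hne : (t i \ X).Nonempty := by
    rw [Finset.sdiff_nonempty]
    exact hXi.not_subset
  -- If the complement were not a node it could be added as a cluster, giving `e + 1` clusters on `e
  -- + 1` leaves, in conflict with `ValidTuple.lt_card`.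
  have hv : ValidTuple Finset.univ (Fin.cons (t i \ X) t : Fin (e + 1) → _) := by
    refine ht.cons (fun k hk => hno.1 ⟨k, hk.symm⟩) (Finset.subset_univ _) ?_ fun k => ?_
    · have := hne.card_pos
      have := hno.2
      omega
    · rcases ht.nested i k with h | h | h
      · exact Or.inl (Finset.sdiff_subset.trans h)
      · by_cases hik : t k = t i
        · exact Or.inl (hik ▸ Finset.sdiff_subset)
        · rcases hX.nested ht k with h' | h' | h'
          · rw [hmax k h' (h.ssubset_of_ne hik)]
            exact Or.inr (Or.inr Finset.sdiff_disjoint)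
          · exact Or.inr (Or.inr (Finset.sdiff_disjoint.mono_right h'))
          · right
            left
            intro x hx
            exact Finset.mem_sdiff.2 ⟨h hx, Finset.disjoint_right.1 h' hx⟩
      · exact Or.inr (Or.inr (h.mono_left Finset.sdiff_subset))
  have := hv.lt_card Finset.univ_nonempty
  simp at this

/-- Two clusters that result from the two ways to split a trivalent vertex and are both compatible
with an embedding of the tree into the plane. -/
structure Partner (t : Fin e → Finset (Fin m)) (C C' : Finset (Fin m)) : Prop where
  union : ∃ i, t i = C ∪ C'
  inter : Node t (C ∩ C')

theorem Partner.symm {t : Fin e → Finset (Fin m)} {C C' : Finset (Fin m)} (h : Partner t C C') :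
    Partner t C' C := by
  refine ⟨?_, ?_⟩
  · rw [Finset.union_comm]
    exact h.union
  · rw [Finset.inter_comm]
    exact h.inter

theorem ValidTuple.ne_of_cons {L C : Finset (Fin m)} {t : Fin e → Finset (Fin m)}
    (h : ValidTuple L (Fin.cons C t : Fin (e + 1) → _)) (i : Fin e) : t i ≠ C := fun hi => by
  have := h.inj (a₁ := i.succ) (a₂ := 0) hi
  exact absurd this (Fin.succ_ne_zero _)

theorem ValidTuple.nested_cons {L C : Finset (Fin m)} {t : Fin e → Finset (Fin m)}
    (h : ValidTuple L (Fin.cons C t : Fin (e + 1) → _)) (i : Fin e) :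
    C ⊆ t i ∨ t i ⊆ C ∨ Disjoint C (t i) := h.nested 0 i.succ

theorem Partner.not_subset {L C C' : Finset (Fin m)} {t : Fin e → Finset (Fin m)}
    (h : Partner t C C') (hC : ValidTuple L (Fin.cons C t : Fin (e + 1) → _)) : ¬ C' ⊆ C := by
  intro hs
  obtain ⟨i, hi⟩ := h.union
  rw [Finset.union_eq_left.2 hs] at hi
  exact hC.ne_of_cons i hi

/-- `C₂` is compatible with the cluster `C ∪ C₁`. It cannot contain it, since `C ∪ C₂` would then be
`C₂`, and it is not disjoint from it, since it meets `C`. -/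
theorem Partner.subset_union {L C C₁ C₂ : Finset (Fin m)} {t : Fin e → Finset (Fin m)}
    (ht : ValidTuple L t) (h1 : Partner t C C₁) (h2 : Partner t C C₂)
    (hC₂ : ValidTuple L (Fin.cons C₂ t : Fin (e + 1) → _)) : C₂ ⊆ C ∪ C₁ := by
  obtain ⟨i, hi⟩ := h1.union
  rw [← hi]
  rcases hC₂.nested_cons i with h | h | h
  · exact h
  · refine absurd ?_ (h2.symm.not_subset hC₂)
    exact (Finset.subset_union_left.trans hi.ge).trans h
  · obtain ⟨x, hx⟩ := h2.inter.nonempty ht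
    rw [Finset.mem_inter] at hx
    refine absurd ?_ (Finset.disjoint_left.1 h hx.2)
    rw [hi]
    exact Finset.mem_union_left _ hx.1

/-- A point `z` of `C₁` outside `C` lies in `C₂` too. The end `b` of `C` that faces `z` is then in
both intervals, so the node `C ∩ C₂` meets `C₁`, and compatibility forces it inside. -/
theorem Partner.inter_subset {L C C₁ C₂ : Finset (Fin m)} {t : Fin e → Finset (Fin m)}
    (ht : ValidTuple L t) (h1 : Partner t C C₁) (h2 : Partner t C C₂)
    (hC : ValidTuple L (Fin.cons C t : Fin (e + 1) → _))
    (hC₁ : ValidTuple L (Fin.cons C₁ t : Fin (e + 1) → _))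
    (hI : IsInterval C) (hI₁ : IsInterval C₁) (hI₂ : IsInterval C₂) : C ∩ C₂ ⊆ C₁ := by
  obtain ⟨z, hz1, hz⟩ := Finset.not_subset.1 (h1.not_subset hC)
  have hz2 : z ∈ C₂ := by
    have := h2.subset_union ht h1 hC₁ hz1
    exact (Finset.mem_union.1 this).resolve_left hz
  obtain ⟨y1, hy1⟩ := h1.inter.nonempty ht
  obtain ⟨y2, hy2⟩ := h2.inter.nonempty ht
  rw [Finset.mem_inter] at hy1 hy2
  obtain ⟨b, hb, hbz⟩ := hI.exists_nearest (Z := {z})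
    (isInterval_of_card_eq_one (Finset.card_singleton z)) (Finset.disjoint_singleton_right.2 hz)
    ⟨y1, hy1.1⟩ (Finset.singleton_nonempty z)
  have hb1 : b ∈ C₁ := by
    rcases hbz y1 hy1.1 z (Finset.mem_singleton_self z) with h | h
    · exact hI₁ y1 hy1.2 z hz1 b h.1 h.2
    · exact hI₁ z hz1 y1 hy1.2 b h.1 h.2
  have hb2 : b ∈ C₂ := by
    rcases hbz y2 hy2.1 z (Finset.mem_singleton_self z) with h | h
    · exact hI₂ y2 hy2.2 z hz2 b h.1 h.2
    · exact hI₂ z hz2 y2 hy2.2 b h.1 h.2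
  have hbm : b ∈ C ∩ C₂ := Finset.mem_inter.2 ⟨hb, hb2⟩
  rcases h2.inter with ⟨i, hi⟩ | h
  · rcases hC₁.nested_cons i with h | h | h
    · rw [hi] at h
      exact absurd (h.trans Finset.inter_subset_left) (h1.not_subset hC)
    · exact hi ▸ h
    · exact absurd (hi ▸ hbm) (Finset.disjoint_left.1 h hb1)
  · obtain ⟨x, hx⟩ := Finset.card_eq_one.1 h
    rw [hx, Finset.mem_singleton] at hbm
    rw [hx, ← hbm]
    exact Finset.singleton_subset_iff.2 hb1

theorem Partner.unique {L C C₁ C₂ : Finset (Fin m)} {t : Fin e → Finset (Fin m)}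
    (ht : ValidTuple L t) (h1 : Partner t C C₁) (h2 : Partner t C C₂)
    (hC : ValidTuple L (Fin.cons C t : Fin (e + 1) → _))
    (hC₁ : ValidTuple L (Fin.cons C₁ t : Fin (e + 1) → _))
    (hC₂ : ValidTuple L (Fin.cons C₂ t : Fin (e + 1) → _))
    (hI : IsInterval C) (hI₁ : IsInterval C₁) (hI₂ : IsInterval C₂) : C₁ = C₂ := by
  have key : ∀ A B, A ⊆ C ∪ B → C ∩ A ⊆ B → A ⊆ B := by
    intro A B hA hB x hx
    rcases Finset.mem_union.1 (hA hx) with h | h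
    · exact hB (Finset.mem_inter.2 ⟨h, hx⟩)
    · exact h
  refine Finset.Subset.antisymm (key _ _ ?_ ?_) (key _ _ ?_ ?_)
  · exact h2.subset_union ht h1 hC₁
  · exact h2.inter_subset ht h1 hC hC₂ hI hI₂ hI₁
  · exact h1.subset_union ht h2 hC₂
  · exact h1.inter_subset ht h2 hC hC₁ hI hI₁ hI₂

/-- A tuple of `e` clusters on `e + 2` leaves has one vertex with three children, and adding `C`
makes the tree binary. In a planar tree two of the three resolutions are planar: besides `C`, the
one that groups the sibling of `C` with the child of `C` next to it. -/
theorem exists_partner {t : Fin e → Finset (Fin (e + 2))} (ht : ValidTuple Finset.univ t)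
    {C : Finset (Fin (e + 2))} (hC : ValidTuple Finset.univ (Fin.cons C t : Fin (e + 1) → _))
    (hI : IsInterval C) (hIt : ∀ i, IsInterval (t i)) : ∃ C', Partner t C C' ∧ IsInterval C' ∧
      ValidTuple Finset.univ (Fin.cons C' t : Fin (e + 1) → _) := by
  obtain ⟨iu, hiu⟩ := ht.top (by simp)
  obtain ⟨i0, hi0, hmin⟩ := Finset.exists_min_image (Finset.univ.filter fun i => C ⊆ t i)
    (fun i => (t i).card) ⟨iu, by simp [hiu]⟩
  rw [Finset.mem_filter] at hi0
  have hCi : C ⊂ t i0 := hi0.2.ssubset_of_ne (hC.ne_of_cons i0).symm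
  have hC2 : 2 ≤ C.card := hC.two_le 0
  have hnC : C.Nonempty := Finset.card_pos.1 (by omega)
  have hZ : Node (Fin.cons C t : Fin (e + 1) → _) (t i0 \ C) := by
    refine node_sdiff hC (i := i0.succ) (Or.inl ⟨0, rfl⟩) hCi fun k => ?_
    induction k using Fin.cases with
    | zero => exact fun _ _ => rfl
    | succ k =>
      intro h1 h2
      have := hmin k (by simpa using h1)
      exact absurd (Finset.card_lt_card h2) (not_lt.2 this)
  have hZn : (t i0 \ C).Nonempty := hZ.nonempty hC
  have hZ' : Node t (t i0 \ C) := by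
    rcases hZ with ⟨k, hk⟩ | h
    · induction k using Fin.cases with
      | zero =>
        rw [Fin.cons_zero] at hk
        obtain ⟨x, hx⟩ := hnC
        have hx' := hx
        rw [hk] at hx
        exact absurd hx' (Finset.mem_sdiff.1 hx).2
      | succ k => exact Or.inl ⟨k, hk⟩
    · exact Or.inr h
  have hdZ : Disjoint C (t i0 \ C) := Finset.disjoint_sdiff
  have hIZ : IsInterval (t i0 \ C) := by
    rcases hZ' with ⟨k, hk⟩ | h
    · exact hk ▸ hIt k
    · exact isInterval_of_card_eq_one h
  -- `b` is the end of `C` that faces the sibling `t i0 \ C`, and `Y` is the child of `C` that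
  -- contains `b`. Hence `Y` and the sibling together form an interval.
  obtain ⟨b, hbC, hb⟩ := hI.exists_nearest hIZ hdZ hnC hZn
  obtain ⟨Y, hY, hbY, hYC, hmax⟩ := exists_maximal_node (t := t) hbC hC2
  have hIY : IsInterval Y := by
    rcases hY with ⟨k, hk⟩ | h
    · exact hk ▸ hIt k
    · exact isInterval_of_card_eq_one h
  obtain ⟨z, hz⟩ := hZn
  obtain ⟨x, hxC, hxY⟩ := Finset.exists_of_ssubset hYC
  have hzC : z ∉ C := (Finset.mem_sdiff.1 hz).2
  have h1 : ¬ C ⊆ Y ∪ t i0 \ C := fun h => by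
    rcases Finset.mem_union.1 (h hxC) with h' | h'
    · exact hxY h'
    · exact (Finset.mem_sdiff.1 h').2 hxC
  have h2 : ¬ Y ∪ t i0 \ C ⊆ C := fun h => hzC (h (Finset.mem_union_right _ hz))
  have hsub : Y ∪ t i0 \ C ⊆ t i0 :=
    Finset.union_subset (hYC.subset.trans hi0.2) Finset.sdiff_subset
  have hun : C ∪ (Y ∪ t i0 \ C) = t i0 := by
    rw [← Finset.union_assoc, Finset.union_eq_left.2 hYC.subset, Finset.union_sdiff_of_subset hi0.2]
  have hin : C ∩ (Y ∪ t i0 \ C) = Y := by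
    rw [Finset.inter_union_distrib_left, Finset.inter_eq_right.2 hYC.subset,
      Finset.disjoint_iff_inter_eq_empty.1 hdZ, Finset.union_empty]
  refine ⟨Y ∪ t i0 \ C, ⟨⟨i0, hun.symm⟩, hin.symm ▸ hY⟩, ?_, ?_⟩
  · have hbet : ∀ u ∈ Y, ∀ v ∈ t i0 \ C, ∀ w ∈ t i0, (u ≤ w ∧ w ≤ v ∨ v ≤ w ∧ w ≤ u) →
        w ∈ Y ∪ t i0 \ C := by
      intro u hu v hv w hw hw'
      by_cases hwC : w ∈ C
      · refine Finset.mem_union_left _ ?_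
        rcases hb w hwC v hv with h | h <;> rcases hb u (hYC.subset hu) v hv with h' | h' <;>
          rcases hw' with h'' | h''
        · exact hIY u hu b hbY w h''.1 h.1
        · obtain rfl : w = b := le_antisymm h.1 (h.2.trans h''.1)
          exact hbY
        · obtain rfl : w = b := le_antisymm h.1 (h'.2.trans h''.1)
          exact hbY
        · obtain rfl : w = b := le_antisymm h.1 (h.2.trans h''.1)
          exact hbY
        · obtain rfl : w = b := le_antisymm (h''.2.trans h.1) h.2
          exact hbY
        · obtain rfl : w = b := le_antisymm (h''.2.trans h'.1) h.2
          exact hbY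
        · obtain rfl : w = b := le_antisymm (h''.2.trans h.1) h.2
          exact hbY
        · exact hIY b hbY u hu w h.2 h''.2
      · exact Finset.mem_union_right _ (Finset.mem_sdiff.2 ⟨hw, hwC⟩)
    intro u hu v hv w huw hwv
    have hw := hIt i0 u (hsub hu) v (hsub hv) w huw hwv
    rcases Finset.mem_union.1 hu with hu | hu <;> rcases Finset.mem_union.1 hv with hv | hv
    · exact Finset.mem_union_left _ (hIY u hu v hv w huw hwv)
    · exact hbet u hu v hv w hw (Or.inl ⟨huw, hwv⟩)
    · exact hbet v hv u hu w hw (Or.inr ⟨huw, hwv⟩)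
    · exact Finset.mem_union_right _ (hIZ u hu v hv w huw hwv)
  · refine ht.cons (fun i hi => ?_) (Finset.subset_univ _) ?_ fun i => ?_
    · rcases hC.nested_cons i with h | h | h
      · exact h1 (hi ▸ h)
      · exact h2 (hi ▸ h)
      · exact Finset.disjoint_left.1 h hbC (hi ▸ Finset.mem_union_left _ hbY)
    · refine Finset.one_lt_card.2 ⟨b, Finset.mem_union_left _ hbY, z,
        Finset.mem_union_right _ hz, ?_⟩
      rintro rfl
      exact hzC hbC
    · rcases hC.nested_cons i with h | h | h
      · left
        rcases ht.nested i0 i with h' | h' | h'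
        · exact hsub.trans h'
        · have := hmin i (by simpa using h)
          rw [Finset.eq_of_subset_of_card_le h' this]
          exact hsub
        · exact absurd (h hbC) (Finset.disjoint_left.1 h' (hi0.2 hbC))
      · rcases hY.nested ht i with h' | h' | h'
        · rw [hmax i h' (h.ssubset_of_ne (hC.ne_of_cons i))]
          exact Or.inr (Or.inl Finset.subset_union_left)
        · exact Or.inr (Or.inl (h'.trans Finset.subset_union_left))
        · refine Or.inr (Or.inr (Finset.disjoint_union_left.2 ⟨h', ?_⟩))
          exact Finset.sdiff_disjoint.mono_right h
      · rcases ht.nested i0 i with h' | h' | h'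
        · exact Or.inl (hsub.trans h')
        · right
          left
          intro w hw
          exact Finset.mem_union_right _ (Finset.mem_sdiff.2 ⟨h' hw, Finset.disjoint_right.1 h hw⟩)
        · exact Or.inr (Or.inr (h'.mono_left hsub))

end Intervals

/-! ### Determinants of clusters against gaps -/

section GapDet

variable {m e : ℕ}

/-- The gaps between successive elements of `D`. -/
def gapVec (D : Finset (Fin (m + 1))) (k : Fin m) : ℚ :=
  if k.castSucc ∈ D ∧ k.succ ∈ D then 1 else 0

open scoped Classical in
/-- The determinant of the incidence matrix of intervals and gaps. -/
noncomputable def gapDet (t : Fin e → Finset (Fin (e + 1))) : ℚ :=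
  if ∀ i, IsInterval (t i) then (Matrix.of fun i => gapVec (t i)).det else 0

theorem gapDet_comp (t : Fin e → Finset (Fin (e + 1))) (σ : Equiv.Perm (Fin e)) :
    gapDet (t ∘ σ) = Equiv.Perm.sign σ * gapDet t := by
  have h : (∀ i, IsInterval ((t ∘ σ) i)) ↔ ∀ i, IsInterval (t i) :=
    (σ.surjective.forall (p := fun i => IsInterval (t i))).symm
  by_cases hI : ∀ i, IsInterval (t i)
  · rw [gapDet, gapDet, if_pos hI, if_pos (h.2 hI)]
    exact Matrix.det_permute σ (Matrix.of fun i => gapVec (t i))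
  · rw [gapDet, gapDet, if_neg hI, if_neg (mt h.1 hI), mul_zero]

/-- For two intervals with a common point, no gap of the union goes directly from one to the other
without belonging to either of them. So gaps are modular under union and intersection. -/
theorem gapVec_union_add_inter {C D : Finset (Fin (m + 1))} (hC : IsInterval C) (hD : IsInterval D)
    (h : (C ∩ D).Nonempty) : gapVec (C ∪ D) + gapVec (C ∩ D) = gapVec C + gapVec D := by
  obtain ⟨x, hx⟩ := h
  rw [Finset.mem_inter] at hx
  funext k
  have hk : k.castSucc ≤ k.succ := Fin.castSucc_lt_succ.le
  have hxk : x ≤ k.castSucc ∨ k.succ ≤ x := by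
    rcases lt_or_ge k.castSucc x with h | h
    · exact Or.inr (Fin.castSucc_lt_iff_succ_le.1 h)
    · exact Or.inl h
  have key : ∀ A : Finset (Fin (m + 1)), IsInterval A → x ∈ A →
      (x ≤ k.castSucc → k.succ ∈ A → k.castSucc ∈ A) ∧ (k.succ ≤ x → k.castSucc ∈ A → k.succ ∈ A) :=
    fun A hA hxA => ⟨fun h h' => hA x hxA _ h' _ h hk, fun h h' => hA _ h' x hxA _ hk h⟩
  have h1 := key C hC hx.1
  have h2 := key D hD hx.2
  simp only [Pi.add_apply, gapVec, Finset.mem_union, Finset.mem_inter]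
  by_cases a1 : k.castSucc ∈ C <;> by_cases a2 : k.succ ∈ C <;>
    by_cases a3 : k.castSucc ∈ D <;> by_cases a4 : k.succ ∈ D <;>
    rcases hxk with h | h <;> simp_all

theorem gapVec_of_card_eq_one {D : Finset (Fin (m + 1))} (h : D.card = 1) : gapVec D = 0 := by
  obtain ⟨x, rfl⟩ := Finset.card_eq_one.1 h
  funext k
  simp only [gapVec, Finset.mem_singleton, Pi.zero_apply, ite_eq_right_iff]
  rintro ⟨h1, h2⟩
  exact absurd (h1.trans h2.symm) Fin.castSucc_lt_succ.ne

/-- The determinant as a function of the first row. -/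
noncomputable def rowDet (v : Fin e → Fin (e + 1) → ℚ) (w : Fin (e + 1) → ℚ) : ℚ :=
  (Matrix.of (Fin.cons w v : Fin (e + 1) → Fin (e + 1) → ℚ)).det

theorem rowDet_add (v : Fin e → Fin (e + 1) → ℚ) (w w' : Fin (e + 1) → ℚ) :
    rowDet v (w + w') = rowDet v w + rowDet v w' :=
  (Matrix.detRowAlternating (n := Fin (e + 1)) (R := ℚ)).toMultilinearMap.cons_add v w w'

theorem rowDet_self (v : Fin e → Fin (e + 1) → ℚ) (i : Fin e) : rowDet v (v i) = 0 :=
  Matrix.det_zero_of_row_eq (i := 0) (j := i.succ) (Fin.succ_ne_zero i).symm rfl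

/-- A cluster repeats a row, and a single leaf has no gaps and gives the zero row. -/
theorem rowDet_node (t : Fin e → Finset (Fin (e + 2))) {X : Finset (Fin (e + 2))} (hX : Node t X) :
    rowDet (fun i => gapVec (t i)) (gapVec X) = 0 := by
  rcases hX with ⟨i, rfl⟩ | h
  · exact rowDet_self (fun i => gapVec (t i)) i
  · rw [gapVec_of_card_eq_one h]
    exact Matrix.det_eq_zero_of_row_eq_zero 0 fun _ => rfl

theorem gapDet_cons {t : Fin e → Finset (Fin (e + 2))} {C : Finset (Fin (e + 2))}
    (hC : IsInterval C) (ht : ∀ i, IsInterval (t i)) :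
    gapDet (Fin.cons C t : Fin (e + 1) → _) = rowDet (fun i => gapVec (t i)) (gapVec C) := by
  have h : ∀ i, IsInterval ((Fin.cons C t : Fin (e + 1) → Finset (Fin (e + 2))) i) := fun i => by
    induction i using Fin.cases with
    | zero => exact hC
    | succ i => exact ht i
  rw [gapDet, if_pos h, rowDet]
  congr 1
  ext i k
  induction i using Fin.cases <;> rfl

/-- By modularity the rows of `C` and `C'` add up to the rows of their union and intersection, which
are nodes of the tree and do not contribute. -/
theorem gapDet_cons_add {L : Finset (Fin (e + 2))} {t : Fin e → Finset (Fin (e + 2))}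
    (hv : ValidTuple L t) {C C' : Finset (Fin (e + 2))}
    (hC : IsInterval C) (hC' : IsInterval C') (ht : ∀ i, IsInterval (t i)) (h : Partner t C C') :
    gapDet (Fin.cons C t : Fin (e + 1) → _) + gapDet (Fin.cons C' t : Fin (e + 1) → _) = 0 := by
  rw [gapDet_cons hC ht, gapDet_cons hC' ht, ← rowDet_add,
    ← gapVec_union_add_inter hC hC' (h.inter.nonempty hv), rowDet_add,
    rowDet_node t (Or.inl h.union), rowDet_node t h.inter, add_zero]

-- Terms with a cluster that is not an interval vanish. The other terms are paired off by the
-- partner map, which is an involution without fixed points because partners are unique.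
open scoped Classical in
theorem sum_gapDet_cons {t : Fin e → Finset (Fin (e + 2))} (ht : ValidTuple Finset.univ t) :
    ∑ C, (if ValidTuple Finset.univ (Fin.cons C t : Fin (e + 1) → _) then
      gapDet (Fin.cons C t : Fin (e + 1) → _) else 0) = 0 := by
  rw [← Finset.sum_filter]
  by_cases hI : ∀ i, IsInterval (t i)
  swap
  · refine Finset.sum_eq_zero fun C _ => if_neg fun h => hI fun i => h i.succ
  rw [← Finset.sum_filter_add_sum_filter_not _ IsInterval, ← add_zero (0 : ℚ)]
  congr 1
  swap
  · refine Finset.sum_eq_zero fun C hC => if_neg fun h => ?_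
    exact (Finset.mem_filter.1 hC).2 (h 0)
  have hm : ∀ C, C ∈ (Finset.univ.filter fun C =>
      ValidTuple Finset.univ (Fin.cons C t : Fin (e + 1) → _)).filter IsInterval ↔
      ValidTuple Finset.univ (Fin.cons C t : Fin (e + 1) → _) ∧ IsInterval C := by simp
  choose! g hg using fun (C : Finset (Fin (e + 2)))
    (h : ValidTuple Finset.univ (Fin.cons C t : Fin (e + 1) → _) ∧ IsInterval C) =>
    exists_partner ht h.1 h.2 hI
  refine Finset.sum_involution (fun C _ => g C) (fun C hC => ?_) (fun C hC _ => ?_)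
    (fun C hC => ?_) fun C hC => ?_
  · rw [hm] at hC
    exact gapDet_cons_add ht hC.2 (hg C hC).2.1 hI (hg C hC).1
  · rw [hm] at hC
    intro h
    exact (hg C hC).1.not_subset hC.1 h.subset
  · rw [hm] at hC ⊢
    exact ⟨(hg C hC).2.2, (hg C hC).2.1⟩
  · rw [hm] at hC
    have h1 := hg C hC
    have h2 := hg (g C) ⟨h1.2.2, h1.2.1⟩
    exact h2.1.unique ht h1.1.symm h1.2.2 h2.2.2 hC.1 h1.2.1 h2.2.1 hC.2

/-- The preimage of a finite set of letters under a word. -/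
def pull {n m : ℕ} (σ : Fin m → Fin n) (D : Finset (Fin n)) : Finset (Fin m) :=
  Finset.univ.filter fun k => σ k ∈ D

theorem mem_pull {n m : ℕ} {σ : Fin m → Fin n} {D : Finset (Fin n)} {k : Fin m} :
    k ∈ pull σ D ↔ σ k ∈ D := by simp [pull]

theorem pull_comp {n m l : ℕ} (σ : Fin m → Fin n) (ρ : Fin l → Fin m) (D : Finset (Fin n)) :
    pull (σ ∘ ρ) D = pull ρ (pull σ D) := by
  ext k
  simp [mem_pull]

/-- Omitting the first point from the full interval loses exactly the first gap; in the next lemma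
the last point loses the last gap. -/
theorem gapVec_univ_zero : (gapVec (Finset.univ : Finset (Fin (e + 2))) : Fin (e + 1) → ℚ) =
    gapVec (Finset.univ.erase 0) + Pi.single 0 1 := by
  funext k
  simp only [gapVec, Pi.add_apply, Finset.mem_erase, Finset.mem_univ, and_true, if_true,
    Pi.single_apply, ne_eq, Fin.castSucc_eq_zero_iff, Fin.succ_ne_zero, not_false_iff]
  by_cases h : k = 0 <;> simp [h]

theorem gapVec_univ_last : (gapVec (Finset.univ : Finset (Fin (e + 2))) : Fin (e + 1) → ℚ) =
    gapVec (Finset.univ.erase (Fin.last (e + 1))) + Pi.single (Fin.last e) 1 := by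
  funext k
  simp only [gapVec, Pi.add_apply, Finset.mem_erase, Finset.mem_univ, and_true, if_true,
    Pi.single_apply, ne_eq, Fin.succ_eq_last_succ, (Fin.castSucc_lt_last k).ne, not_false_iff,
    true_and]
  by_cases h : k = Fin.last e <;> simp [h]

theorem rowDet_single (v : Fin e → Fin (e + 1) → ℚ) (k : Fin (e + 1)) :
    rowDet v (Pi.single k 1) = (-1) ^ (k : ℕ) * (Matrix.of fun i l => v i (k.succAbove l)).det := by
  rw [rowDet, Matrix.det_succ_row_zero, Finset.sum_eq_single k]
  · simp [Matrix.submatrix]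
  · intro l _ hl
    simp [hl]
  · simp

theorem isInterval_pull_succ {D : Finset (Fin (m + 1))} (h : 0 ∉ D) :
    IsInterval (pull Fin.succ D) ↔ IsInterval D := by
  constructor
  · intro hI a ha b hb c hac hcb
    obtain ⟨a, rfl⟩ := Fin.exists_succ_eq.2 fun h0 => h (h0 ▸ ha)
    obtain ⟨b, rfl⟩ := Fin.exists_succ_eq.2 fun h0 => h (h0 ▸ hb)
    obtain ⟨c, rfl⟩ := Fin.exists_succ_eq.2 ((Fin.succ_pos a).trans_le hac).ne'
    exact mem_pull.1 (hI a (mem_pull.2 ha) b (mem_pull.2 hb) c (Fin.succ_le_succ_iff.1 hac)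
      (Fin.succ_le_succ_iff.1 hcb))
  · intro hI a ha b hb c hac hcb
    exact mem_pull.2 (hI _ (mem_pull.1 ha) _ (mem_pull.1 hb) _ (Fin.succ_le_succ_iff.2 hac)
      (Fin.succ_le_succ_iff.2 hcb))

theorem isInterval_pull_castSucc {D : Finset (Fin (m + 1))} (h : Fin.last m ∉ D) :
    IsInterval (pull Fin.castSucc D) ↔ IsInterval D := by
  constructor
  · intro hI a ha b hb c hac hcb
    obtain ⟨a, rfl⟩ := Fin.exists_castSucc_eq.2 fun h0 => h (h0 ▸ ha)
    obtain ⟨b, rfl⟩ := Fin.exists_castSucc_eq.2 fun h0 => h (h0 ▸ hb)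
    obtain ⟨c, rfl⟩ := Fin.exists_castSucc_eq.2 (hcb.trans_lt (Fin.castSucc_lt_last b)).ne
    exact mem_pull.1 (hI a (mem_pull.2 ha) b (mem_pull.2 hb) c (Fin.castSucc_le_castSucc_iff.1 hac)
      (Fin.castSucc_le_castSucc_iff.1 hcb))
  · intro hI a ha b hb c hac hcb
    exact mem_pull.2 (hI _ (mem_pull.1 ha) _ (mem_pull.1 hb) _ (Fin.castSucc_le_castSucc_iff.2 hac)
      (Fin.castSucc_le_castSucc_iff.2 hcb))

/-- Once the node without `j` is subtracted, the first row becomes a unit vector at the first or the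
last gap. The Laplace expansion then leaves the determinant of the word with that end removed; the
sign `(-1) ^ e` belongs to the last column. -/
theorem gapDet_cons_univ {u : Fin e → Finset (Fin (e + 2))} {j : Fin (e + 2)} (hj : ∀ i, j ∉ u i)
    (hu : Node u (Finset.univ.erase j)) : gapDet (Fin.cons Finset.univ u : Fin (e + 1) → _) =
      (if j = 0 then gapDet fun i => pull Fin.succ (u i) else 0) +
      (-1) ^ e * (if j = Fin.last (e + 1) then gapDet fun i => pull Fin.castSucc (u i) else 0) := by
  by_cases hI : ∀ i, IsInterval (u i)
  · have hj' : j = 0 ∨ j = Fin.last (e + 1) := by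
      -- An interval that contains both ends contains everything between them, so `j` can be missing
      -- only at an end. When the node is a single leaf, there are just two points.
      by_contra! hno
      rcases hu with ⟨i, hi⟩ | h
      · refine hj i (hI i 0 ?_ (Fin.last (e + 1)) ?_ j (Fin.zero_le j) (Fin.le_last j)) <;>
          rw [hi, Finset.mem_erase]
        · exact ⟨hno.1.symm, Finset.mem_univ _⟩
        · exact ⟨hno.2.symm, Finset.mem_univ _⟩
      · rw [Finset.card_erase_of_mem (Finset.mem_univ j), Finset.card_univ, Fintype.card_fin] at h
        have h1 : (j : ℕ) ≠ 0 := Fin.val_ne_of_ne hno.1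
        have h2 : (j : ℕ) ≠ e + 1 := Fin.val_ne_of_ne hno.2
        have := j.2
        omega
    rw [gapDet_cons isInterval_univ hI]
    rcases hj' with rfl | rfl
    · have hI' : ∀ i, IsInterval (pull Fin.succ (u i)) := fun i =>
        (isInterval_pull_succ (hj i)).2 (hI i)
      rw [if_pos rfl, if_neg (Fin.last_pos.ne), mul_zero, add_zero, gapVec_univ_zero, rowDet_add,
        rowDet_node u hu, zero_add, rowDet_single, gapDet, if_pos hI']
      simp only [Fin.val_zero, pow_zero, one_mul]
      congr 1
      ext i k
      simp [gapVec, mem_pull]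
      congr
    · have hI' : ∀ i, IsInterval (pull Fin.castSucc (u i)) := fun i =>
        (isInterval_pull_castSucc (hj i)).2 (hI i)
      rw [if_pos rfl, if_neg (Fin.last_pos.ne'), zero_add, gapVec_univ_last, rowDet_add,
        rowDet_node u hu, zero_add, rowDet_single, gapDet, if_pos hI']
      simp only [Fin.val_last]
      congr 2
      ext i k
      simp [gapVec, mem_pull]
  · have h0 : gapDet (Fin.cons Finset.univ u : Fin (e + 1) → _) = 0 :=
      if_neg fun h => hI fun i => h i.succ
    rw [h0]
    split_ifs with h1 h2 h2
    · exact absurd (h1.symm.trans h2) Fin.last_pos.ne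
    · subst h1
      have : gapDet (fun i => pull Fin.succ (u i)) = 0 :=
        if_neg fun h => hI fun i => (isInterval_pull_succ (hj i)).1 (h i)
      simp [this]
    · subst h2
      have : gapDet (fun i => pull Fin.castSucc (u i)) = 0 :=
        if_neg fun h => hI fun i => (isInterval_pull_castSucc (hj i)).1 (h i)
      simp [this]
    · simp

end GapDet

/-! ### Words, their signs, and determinants along a word -/

section Words

variable {n m e : ℕ}

/-- `σ` is a word in which each element of `L` appears exactly once, and no other letter. -/
structure IsWord (L : Finset (Fin n)) (σ : Fin m → Fin n) : Prop where
  inj : Function.Injective σ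
  mem_iff : ∀ a, a ∈ L ↔ ∃ k, σ k = a

namespace IsWord

variable {L : Finset (Fin n)}

theorem map_eq {σ : Fin m → Fin n} (h : IsWord L σ) : Finset.univ.map ⟨σ, h.inj⟩ = L := by
  ext a
  simp [h.mem_iff]

theorem card_eq {σ : Fin m → Fin n} (h : IsWord L σ) : L.card = m := by
  rw [← h.map_eq, Finset.card_map, Finset.card_univ, Fintype.card_fin]

theorem mem {σ : Fin m → Fin n} (h : IsWord L σ) (k : Fin m) : σ k ∈ L := (h.mem_iff _).2 ⟨k, rfl⟩

theorem tail {σ : Fin (m + 1) → Fin n} (h : IsWord L σ) :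
    IsWord (L.erase (σ 0)) (σ ∘ Fin.succ) := by
  refine ⟨h.inj.comp (Fin.succ_injective m), fun a => ?_⟩
  rw [Finset.mem_erase, h.mem_iff, Fin.exists_fin_succ]
  constructor
  · rintro ⟨h1, h2 | h2⟩
    · exact absurd h2.symm h1
    · exact h2
  · rintro ⟨k, rfl⟩
    exact ⟨fun h' => Fin.succ_ne_zero k (h.inj h'), Or.inr ⟨k, rfl⟩⟩

theorem init {σ : Fin (m + 1) → Fin n} (h : IsWord L σ) :
    IsWord (L.erase (σ (Fin.last m))) (σ ∘ Fin.castSucc) := by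
  refine ⟨h.inj.comp (Fin.castSucc_injective m), fun a => ?_⟩
  rw [Finset.mem_erase, h.mem_iff, Fin.exists_fin_succ']
  constructor
  · rintro ⟨h1, h2 | h2⟩
    · exact h2
    · exact absurd h2.symm h1
  · rintro ⟨k, rfl⟩
    exact ⟨fun h' => (Fin.castSucc_lt_last k).ne (h.inj h'), Or.inl ⟨k, rfl⟩⟩

theorem cons {σ : Fin m → Fin n} {a : Fin n} (h : IsWord (L.erase a) σ) (ha : a ∈ L) :
    IsWord L (Fin.cons a σ : Fin (m + 1) → Fin n) := by
  refine ⟨Fin.cons_injective_iff.2 ⟨?_, h.inj⟩, fun b => ?_⟩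
  · rintro ⟨k, hk⟩
    exact Finset.notMem_erase a L (hk ▸ h.mem k)
  · rw [Fin.exists_fin_succ]
    simp only [Fin.cons_zero, Fin.cons_succ]
    rw [← h.mem_iff, Finset.mem_erase]
    by_cases hb : b = a
    · subst hb
      simp [ha]
    · simp [hb, Ne.symm hb]

theorem comp_perm {σ : Fin n → Fin n} (h : IsWord Finset.univ σ) : ∃ ρ : Equiv.Perm (Fin n), σ = ρ :=
  ⟨Equiv.ofBijective σ ⟨h.inj, fun a => (h.mem_iff a).1 (Finset.mem_univ a)⟩, rfl⟩

theorem map {σ : Fin m → Fin n} (h : IsWord L σ) (π : Equiv.Perm (Fin n)) :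
    IsWord (L.map π.toEmbedding) (π ∘ σ) := by
  refine ⟨π.injective.comp h.inj, fun a => ?_⟩
  rw [Finset.mem_map_equiv, h.mem_iff]
  exact exists_congr fun k => π.eq_symm_apply

end IsWord

/-- The sign of a word, that is, the parity of the number of inversions. -/
def wordSign (σ : Fin m → Fin n) : ℚ :=
  ∏ i, ∏ k, if i < k then (if σ i < σ k then 1 else -1) else 1

/-- The sign that results from moving the letter `a` past the letters in `L`. -/
def moveSign (a : Fin n) (L : Finset (Fin n)) : ℚ := ∏ b ∈ L, if a < b then 1 else -1

theorem moveSign_mul_self (a : Fin n) (L : Finset (Fin n)) : moveSign a L * moveSign a L = 1 := by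
  rw [moveSign, ← Finset.prod_mul_distrib]
  refine Finset.prod_eq_one fun b _ => ?_
  split_ifs <;> norm_num

theorem wordSign_mul_self (σ : Fin m → Fin n) : wordSign σ * wordSign σ = 1 := by
  simp only [wordSign, ← Finset.prod_mul_distrib]
  refine Finset.prod_eq_one fun i _ => Finset.prod_eq_one fun k _ => ?_
  split_ifs <;> norm_num

theorem wordSign_ne_zero (σ : Fin m → Fin n) : wordSign σ ≠ 0 := fun h => by
  have := wordSign_mul_self σ
  rw [h] at this
  norm_num at this

theorem IsWord.moveSign_eq {L : Finset (Fin n)} {σ : Fin m → Fin n} (h : IsWord L σ) (a : Fin n) :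
    moveSign a L = ∏ k, if a < σ k then 1 else -1 := by
  rw [moveSign, ← h.map_eq, Finset.prod_map]
  rfl

theorem IsWord.wordSign_tail {L : Finset (Fin n)} {σ : Fin (m + 1) → Fin n} (h : IsWord L σ) :
    wordSign σ = moveSign (σ 0) (L.erase (σ 0)) * wordSign (σ ∘ Fin.succ) := by
  rw [h.tail.moveSign_eq, wordSign, Fin.prod_univ_succ]
  simp only [Fin.prod_univ_succ, Fin.not_lt_zero, lt_self_iff_false, if_false, one_mul,
    Fin.succ_pos, if_true, Fin.succ_lt_succ_iff, wordSign, Function.comp_apply]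

/-- The last letter is compared with `m` earlier ones in the direction opposite to that of
`moveSign`, whence the factor `(-1) ^ m`. -/
theorem IsWord.wordSign_init {L : Finset (Fin n)} {σ : Fin (m + 1) → Fin n} (h : IsWord L σ) :
    wordSign σ = (-1) ^ m * (moveSign (σ (Fin.last m)) (L.erase (σ (Fin.last m))) *
      wordSign (σ ∘ Fin.castSucc)) := by
  have h1 : ∀ k : Fin m, (if σ k.castSucc < σ (Fin.last m) then (1 : ℚ) else -1) =
      -1 * if σ (Fin.last m) < σ k.castSucc then 1 else -1 := fun k => by
    rcases lt_trichotomy (σ k.castSucc) (σ (Fin.last m)) with h' | h' | h'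
    · rw [if_pos h', if_neg h'.not_gt]
      norm_num
    · exact absurd (h.inj h') (Fin.castSucc_lt_last k).ne
    · rw [if_pos h', if_neg h'.not_gt]
      norm_num
  rw [h.init.moveSign_eq, wordSign, Fin.prod_univ_castSucc]
  have h2 : ∀ k : Fin m, ¬ Fin.last m < k.castSucc := fun k => (Fin.castSucc_lt_last k).not_gt
  simp only [Fin.prod_univ_castSucc, lt_self_iff_false, if_false, mul_one, h2,
    Fin.castSucc_lt_last, if_true, Fin.castSucc_lt_castSucc_iff, wordSign, Function.comp_apply,
    Finset.prod_mul_distrib, h1, Finset.prod_const_one, Finset.prod_const, Finset.card_univ,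
    Fintype.card_fin]
  ring

theorem wordSign_perm (ρ : Equiv.Perm (Fin n)) : wordSign ρ = (Equiv.Perm.sign ρ : ℚ) := by
  rw [Equiv.Perm.sign_eq_prod_prod_Ioi, wordSign]
  push_cast
  refine Finset.prod_congr rfl fun i _ => ?_
  rw [← Finset.prod_filter]
  refine Finset.prod_congr (by ext; simp) fun k _ => ?_
  split_ifs <;> simp

theorem wordSign_perm_comp {σ : Fin n → Fin n} (h : IsWord Finset.univ σ)
    (π : Equiv.Perm (Fin n)) : wordSign (π ∘ σ) = Equiv.Perm.sign π * wordSign σ := by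
  obtain ⟨ρ, rfl⟩ := h.comp_perm
  rw [← Equiv.Perm.coe_mul, wordSign_perm, wordSign_perm, map_mul]
  simp

theorem pull_map {σ : Fin m → Fin n} (h : Function.Injective σ) (D : Finset (Fin m)) :
    pull σ (D.map ⟨σ, h⟩) = D := by
  ext k
  simp [mem_pull]

theorem IsWord.map_pull {L D : Finset (Fin n)} {σ : Fin m → Fin n} (h : IsWord L σ) (hD : D ⊆ L) :
    (pull σ D).map ⟨σ, h.inj⟩ = D := by
  ext a
  simp only [Finset.mem_map, mem_pull, Function.Embedding.coeFn_mk]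
  constructor
  · rintro ⟨k, hk, rfl⟩
    exact hk
  · intro ha
    obtain ⟨k, rfl⟩ := (h.mem_iff a).1 (hD ha)
    exact ⟨k, ha, rfl⟩

theorem validTuple_map_iff (f : Fin m ↪ Fin n) {L : Finset (Fin m)} (S : Fin e → Finset (Fin m)) :
    ValidTuple (L.map f) (fun i => (S i).map f) ↔ ValidTuple L S := by
  have hi : (Function.Injective fun i => (S i).map f) ↔ Function.Injective S :=
    (Finset.map_injective f).of_comp_iff S
  constructor
  · rintro ⟨h1, h2, h3, h4, h5⟩
    simp only [Finset.map_subset_map, Finset.card_map, Finset.disjoint_map,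
      (Finset.map_injective f).eq_iff] at h2 h3 h4 h5
    exact ⟨hi.1 h1, h2, h3, h4, h5⟩
  · rintro ⟨h1, h2, h3, h4, h5⟩
    refine ⟨hi.2 h1, ?_, ?_, ?_, ?_⟩ <;>
      simpa only [Finset.map_subset_map, Finset.card_map, Finset.disjoint_map,
        (Finset.map_injective f).eq_iff]

theorem IsWord.validTuple_pull {L : Finset (Fin n)} {σ : Fin m → Fin n} (h : IsWord L σ)
    {t : Fin e → Finset (Fin n)} (ht : ValidTuple L t) :
    ValidTuple Finset.univ fun i => pull σ (t i) := by
  rw [← validTuple_map_iff ⟨σ, h.inj⟩, h.map_eq]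
  simpa only [h.map_pull (ht.sub _)] using ht

-- This is `sum_gapDet_cons` transported along the bijection between positions and letters; sets `C`
-- outside the range of `σ` are not valid clusters.
open scoped Classical in
theorem sum_gapDet_pull {L : Finset (Fin n)} {σ : Fin (e + 2) → Fin n} (h : IsWord L σ)
    {t : Fin e → Finset (Fin n)} (ht : ValidTuple L t) :
    ∑ C, (if ValidTuple L (Fin.cons C t : Fin (e + 1) → _) then
      gapDet fun i => pull σ ((Fin.cons C t : Fin (e + 1) → _) i) else 0) = 0 := by
  refine Eq.trans ?_ (sum_gapDet_cons (h.validTuple_pull ht))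
  symm
  refine Fintype.sum_of_injective (fun C => C.map ⟨σ, h.inj⟩) (Finset.map_injective ⟨σ, h.inj⟩) _ _
    (fun C hC => if_neg ?_) fun C => ?_
  · intro hv
    exact hC ⟨pull σ C, h.map_pull (hv.sub 0)⟩
  · have h1 : (fun i => ((Fin.cons C fun i => pull σ (t i) : Fin (e + 1) → Finset (Fin (e + 2))) i).map
        ⟨σ, h.inj⟩) = (Fin.cons (C.map ⟨σ, h.inj⟩) t : Fin (e + 1) → _) := by
      funext i
      induction i using Fin.cases with
      | zero => rfl
      | succ i => exact h.map_pull (ht.sub i)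
    have h2 : (fun i => pull σ ((Fin.cons (C.map ⟨σ, h.inj⟩) t : Fin (e + 1) → _) i)) =
        (Fin.cons C fun i => pull σ (t i) : Fin (e + 1) → _) := by
      funext i
      induction i using Fin.cases with
      | zero => exact pull_map h.inj C
      | succ i => rfl
    refine if_congr ?_ (by rw [h2]) rfl
    rw [← validTuple_map_iff ⟨σ, h.inj⟩, h.map_eq, h1]

/-- The clusters in `u` make `L` without `j` a node, so `gapDet_cons_univ` applies: the letter `j`
must be first or last in the word and is stripped off. -/
theorem gapDet_pull_cons {L : Finset (Fin n)} {σ : Fin (e + 2) → Fin n} (h : IsWord L σ)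
    {j : Fin n} (hj : j ∈ L) {u : Fin e → Finset (Fin n)} (hu : ValidTuple (L.erase j) u) :
    gapDet (fun i => pull σ ((Fin.cons L u : Fin (e + 1) → _) i)) =
      (if σ 0 = j then gapDet fun i => pull (σ ∘ Fin.succ) (u i) else 0) +
      (-1) ^ e * (if σ (Fin.last (e + 1)) = j then
        gapDet fun i => pull (σ ∘ Fin.castSucc) (u i) else 0) := by
  obtain ⟨k, rfl⟩ := (h.mem_iff j).1 hj
  have h1 : (fun i => pull σ ((Fin.cons L u : Fin (e + 1) → _) i)) =
      (Fin.cons Finset.univ fun i => pull σ (u i) : Fin (e + 1) → _) := by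
    funext i
    induction i using Fin.cases with
    | zero => exact Finset.eq_univ_of_forall fun k => mem_pull.2 (h.mem k)
    | succ i => rfl
  have h2 : Finset.univ.erase k = pull σ (L.erase (σ k)) := by
    ext l
    simp [mem_pull, h.mem, h.inj.eq_iff]
  have h3 : Node (fun i => pull σ (u i)) (Finset.univ.erase k) := by
    by_cases hc : 2 ≤ (L.erase (σ k)).card
    · obtain ⟨i, hi⟩ := hu.top hc
      exact Or.inl ⟨i, by rw [h2, ← hi]⟩
    · right
      rw [Finset.card_erase_of_mem hj, h.card_eq] at hc
      rw [Finset.card_erase_of_mem (Finset.mem_univ k), Finset.card_univ, Fintype.card_fin]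
      omega
  rw [h1, gapDet_cons_univ (j := k) (fun i hi => ?_) h3]
  · simp only [h.inj.eq_iff, eq_comm (a := k), pull_comp]
  · exact Finset.notMem_erase _ _ (hu.sub i (mem_pull.1 hi))

end Words

/-! ### Critical tuples are combs -/

section Combs

variable {n e : ℕ} {L : Finset (Fin n)} {s : Fin n}

/-- The clusters of the tree obtained by attaching leaves to a path. -/
def comb : (e : ℕ) → (Fin (e + 1) → Fin n) → Fin e → Finset (Fin n)
  | 0, _ => Fin.elim0
  | e + 1, w => Fin.cons (Finset.univ.image w) (comb e (w ∘ Fin.succ))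

theorem IsWord.comb_succ {w : Fin (e + 2) → Fin n} (h : IsWord L w) :
    comb (e + 1) w = Fin.cons L (comb e (w ∘ Fin.succ)) := by
  rw [comb]
  congr 1
  ext a
  simp [h.mem_iff]

/-- The full set of the smaller leaf set, a cluster through `s`, separates the new leaf `a` from
every other leaf except `s`; the others were separated before. -/
theorem Critical.cons {a : Fin n} {u : Fin e → Finset (Fin n)} (h : Critical (L.erase a) s u)
    (ha : a ∈ L) (hs : s ∈ L) (hsa : a ≠ s) :
    Critical L s (Fin.cons L u : Fin (e + 1) → _) := by
  have hau : ∀ i, a ∉ u i := fun i hi => Finset.notMem_erase a L (h.valid.sub i hi)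
  have huL : ∀ i, u i ⊆ L := fun i => (h.valid.sub i).trans (Finset.erase_subset a L)
  have hsep : ∀ b ∈ L, b ≠ s → b ≠ a → ∃ D ∈ chain s u, b ∈ D ∧ a ∉ D := by
    intro b hb hbs hba
    obtain ⟨i, hi⟩ := h.valid.top (Finset.one_lt_card.2 ⟨b, Finset.mem_erase.2 ⟨hba, hb⟩, s,
      Finset.mem_erase.2 ⟨hsa.symm, hs⟩, hbs⟩)
    exact ⟨L.erase a, mem_chain.2 ⟨Finset.mem_erase.2 ⟨hsa.symm, hs⟩, i, hi⟩,
      Finset.mem_erase.2 ⟨hba, hb⟩, Finset.notMem_erase a L⟩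
  have hch : ∀ D ∈ chain s u, D ∈ chain s (Fin.cons L u : Fin (e + 1) → _) := by
    intro D hD
    obtain ⟨h1, i, h2⟩ := mem_chain.1 hD
    exact mem_chain.2 ⟨h1, i.succ, h2⟩
  refine ⟨⟨Fin.cons_injective_iff.2 ⟨?_, h.valid.inj⟩, fun i => ?_, fun i => ?_, fun i k => ?_,
    fun _ => ⟨0, rfl⟩⟩, fun b hb hbs c hc hcs hbc => ?_⟩
  · rintro ⟨i, hi⟩
    exact hau i (hi ▸ ha)
  · induction i using Fin.cases with
    | zero => exact subset_rfl
    | succ i => exact huL i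
  · induction i using Fin.cases with
    | zero => exact Finset.one_lt_card.2 ⟨a, ha, s, hs, hsa⟩
    | succ i => exact h.valid.two_le i
  · induction i using Fin.cases with
    | zero =>
      induction k using Fin.cases with
      | zero => exact Or.inl subset_rfl
      | succ k => exact Or.inr (Or.inl (huL k))
    | succ i =>
      induction k using Fin.cases with
      | zero => exact Or.inl (huL i)
      | succ k => exact h.valid.nested i k
  · by_cases hba : b = a
    · by_contra hne
      obtain ⟨D, hD, h1, h2⟩ := hsep c hc hcs fun h => hne (hba.trans h.symm)
      exact h2 (hba ▸ (hbc D (hch D hD)).2 h1)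
    · by_cases hca : c = a
      · obtain ⟨D, hD, h1, h2⟩ := hsep b hb hbs hba
        exact absurd (hca ▸ (hbc D (hch D hD)).1 h1) h2
      · exact h.sep b (Finset.mem_erase.2 ⟨hba, hb⟩) hbs c (Finset.mem_erase.2 ⟨hca, hc⟩) hcs
          fun D hD => hbc D (hch D hD)

theorem IsWord.critical_comb {w : Fin (e + 1) → Fin n} (h : IsWord L w) :
    Critical L (w (Fin.last e)) (comb e w) := by
  induction e generalizing L with
  | zero =>
    have hc := h.card_eq
    refine ⟨⟨fun i => i.elim0, fun i => i.elim0, fun i => i.elim0, fun i => i.elim0, ?_⟩,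
      fun a ha has => ?_⟩
    · omega
    · obtain ⟨k, rfl⟩ := (h.mem_iff a).1 ha
      exact absurd (congrArg w (Subsingleton.elim (α := Fin 1) _ _)) has
  | succ e ih =>
    rw [h.comb_succ]
    exact (ih h.tail).cons (h.mem 0) (h.mem _) fun h' => Fin.last_pos.ne (h.inj h')

/-- Below the full cluster, the remaining clusters form a chain of proper subsets. Exactly one leaf
other than `s` is missed by all of them; it is the leaf attached next to the root. -/
theorem Critical.exists_cons {t : Fin (e + 1) → Finset (Fin n)} (h : Critical L s t) (hs : s ∈ L) :
    ∃ a ∈ L, a ≠ s ∧ ∃ (u : Fin e → Finset (Fin n)) (ρ : Equiv.Perm (Fin (e + 1))),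
      t = (Fin.cons L u : Fin (e + 1) → _) ∘ ρ ∧ Critical (L.erase a) s u := by
  have hc := h.card_eq hs
  obtain ⟨u, ρ, rfl⟩ := exists_eq_cons_comp (h.valid.top (by omega))
  have hv := (validTuple_comp_iff ρ).1 h.valid
  have hsu : ∀ i, s ∈ u i := fun i => by simpa using h.mem (ρ.symm i.succ)
  have huL : ∀ i, u i ⊂ L := fun i => (hv.sub i.succ).ssubset_of_ne (hv.ne_of_cons i)
  have hsub : ∀ i k, u i ⊆ u k ∨ u k ⊆ u i := fun i k => by
    simpa using h.sub_or_sub (ρ.symm i.succ) (ρ.symm k.succ)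
  have hsep : ∀ b ∈ L, b ≠ s → ∀ c ∈ L, c ≠ s → (∀ i, b ∈ u i ↔ c ∈ u i) → b = c := by
    intro b hb hbs c hc hcs hbc
    refine h.sep b hb hbs c hc hcs fun D hD => ?_
    rw [chain_comp] at hD
    obtain ⟨-, i, rfl⟩ := mem_chain.1 hD
    induction i using Fin.cases with
    | zero => exact iff_of_true hb hc
    | succ i => exact hbc i
  -- Any leaf outside the largest remaining cluster is missed by the whole chain; if no cluster
  -- remains, any leaf other than `s` will do.
  have hex : ∃ a ∈ L, a ≠ s ∧ ∀ i, a ∉ u i := by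
    rcases isEmpty_or_nonempty (Fin e) with he | he
    · obtain ⟨a, ha, has⟩ := Finset.exists_mem_ne (by omega : 1 < L.card) s
      exact ⟨a, ha, has, fun i => he.elim i⟩
    · obtain ⟨i, -, hi⟩ := Finset.exists_max_image Finset.univ (fun i => (u i).card)
        Finset.univ_nonempty
      obtain ⟨a, ha, hai⟩ := Finset.exists_of_ssubset (huL i)
      refine ⟨a, ha, fun h => hai (h ▸ hsu i), fun k hk => hai ?_⟩
      rcases hsub i k with h' | h'
      · rwa [Finset.eq_of_subset_of_card_le h' (hi k (Finset.mem_univ k))]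
      · exact h' hk
  obtain ⟨a, ha, has, hau⟩ := hex
  refine ⟨a, ha, has, u, ρ, rfl, ⟨fun i k hik => ?_, fun i x hx => ?_, fun i => hv.two_le i.succ,
    fun i k => hv.nested i.succ k.succ, fun h2 => ?_⟩, fun b hb hbs c hc hcs hbc => ?_⟩
  · exact Fin.succ_injective _ (hv.inj hik)
  · exact Finset.mem_erase.2 ⟨fun h => hau i (h ▸ hx), hv.sub i.succ hx⟩
  · rw [Finset.card_erase_of_mem ha] at h2
    have : Nonempty (Fin e) := ⟨⟨0, by omega⟩⟩
    obtain ⟨i, -, hi⟩ := Finset.exists_max_image Finset.univ (fun i => (u i).card)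
      Finset.univ_nonempty
    -- The largest cluster is all of `L` without `a`: another missed leaf would be inseparable from
    -- `a`.
    refine ⟨i, Finset.Subset.antisymm (fun x hx => ?_) fun x hx => ?_⟩
    · exact Finset.mem_erase.2 ⟨fun h => hau i (h ▸ hx), (huL i).subset hx⟩
    · obtain ⟨hxa, hx⟩ := Finset.mem_erase.1 hx
      by_cases hxs : x = s
      · exact hxs ▸ hsu i
      · by_contra hxi
        refine hxa (hsep x hx hxs a ha has fun k => iff_of_false (fun hk => hxi ?_) (hau k))
        rcases hsub i k with h' | h'
        · rwa [Finset.eq_of_subset_of_card_le h' (hi k (Finset.mem_univ k))]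
        · exact h' hk
  · refine hsep b (Finset.mem_of_mem_erase hb) hbs c (Finset.mem_of_mem_erase hc) hcs fun i => ?_
    exact hbc (u i) (mem_chain.2 ⟨hsu i, i, rfl⟩)

theorem Critical.exists_comb {t : Fin e → Finset (Fin n)} (h : Critical L s t) (hs : s ∈ L) :
    ∃ (w : Fin (e + 1) → Fin n) (ρ : Equiv.Perm (Fin e)), IsWord L w ∧ w (Fin.last e) = s ∧
      t = comb e w ∘ ρ := by
  induction e generalizing L with
  | zero =>
    have hc := h.card_eq hs
    obtain ⟨x, rfl⟩ := Finset.card_eq_one.1 hc.symm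
    rw [Finset.mem_singleton] at hs
    subst hs
    refine ⟨fun _ => s, 1, ⟨fun i k _ => Subsingleton.elim (α := Fin 1) i k, fun a => ?_⟩, rfl,
      funext fun i => i.elim0⟩
    simp [eq_comm]
  | succ e ih =>
    obtain ⟨a, ha, has, u, ρ, rfl, hu⟩ := h.exists_cons hs
    obtain ⟨w, κ, hw, hws, rfl⟩ := ih hu (Finset.mem_erase.2 ⟨has.symm, hs⟩)
    have hcw := hw.cons ha
    obtain ⟨ν, -, hν⟩ := JComplex.cons_comp_perm L (comb e w) κ
    refine ⟨Fin.cons a w, ν * ρ, hcw, ?_, ?_⟩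
    · rw [← Fin.succ_last, Fin.cons_succ, hws]
    · rw [hν, hcw.comb_succ]
      rfl

end Combs

/-! ### Coefficients of words as functionals on the complex -/

namespace JComplex

variable {n e : ℕ}

theorem exists_ev (hn : 2 ≤ n) (τ : Option (Fin n)) (σ : Fin (e + 1) → Fin n) :
    ∃ f : JComplex 0 n e →ₗ[ℚ] ℚ, ∀ τ' t, ValidTuple (topSet τ') t →
      f (tree τ' t) = if τ' = τ then gapDet fun i => pull σ (t i) else 0 :=
  exists_lift hn (fun τ' t => if τ' = τ then gapDet fun i => pull σ (t i) else 0) fun τ' t ρ _ => by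
    split_ifs
    · exact gapDet_comp (fun i => pull σ (t i)) ρ
    · simp

/-- The coefficient of a word in a linear combination of trees. -/
noncomputable def ev (hn : 2 ≤ n) (τ : Option (Fin n)) (σ : Fin (e + 1) → Fin n) :
    JComplex 0 n e →ₗ[ℚ] ℚ := (exists_ev hn τ σ).choose

theorem ev_tree (hn : 2 ≤ n) {τ τ' : Option (Fin n)} {σ : Fin (e + 1) → Fin n}
    {t : Fin e → Finset (Fin n)} (ht : ValidTuple (topSet τ') t) :
    ev hn τ σ (tree τ' t) = if τ' = τ then gapDet fun i => pull σ (t i) else 0 :=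
  (exists_ev hn τ σ).choose_spec τ' t ht

/-- On each tree this is the cancellation of planar resolutions in `sum_gapDet_pull`; trees with
another `τ` contribute nothing. -/
theorem ev_splitMap (hn : 2 ≤ n) {τ : Option (Fin n)} {σ : Fin (e + 2) → Fin n}
    (hσ : IsWord (topSet τ) σ) (x : JComplex 0 n e) : ev hn τ σ (splitMap hn e x) = 0 := by
  classical
  have : ev hn τ σ ∘ₗ splitMap hn e = 0 := hom_ext fun τ' t ht => by
    rw [LinearMap.comp_apply, splitMap_tree hn ht, map_sum, LinearMap.zero_apply]
    by_cases hτ : τ' = τ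
    · subst hτ
      rw [← sum_gapDet_pull hσ ht]
      refine Finset.sum_congr rfl fun C _ => ?_
      split_ifs with h
      · rw [ev_tree hn h, if_pos rfl]
      · rw [tree_eq_zero h, map_zero]
    · refine Finset.sum_eq_zero fun C _ => ?_
      by_cases h : ValidTuple (topSet τ') (Fin.cons C t : Fin (e + 1) → _)
      · rw [ev_tree hn h, if_neg hτ]
      · rw [tree_eq_zero h, map_zero]
  exact LinearMap.congr_fun this x

/-- A join adds the full cluster above the clusters without `j`, so `gapDet_pull_cons` strips `j`
from one end of the word. This mirrors `coef_lie_of`, the coefficient rule for a bracket with a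
generator. -/
theorem ev_joinMap (hn : 2 ≤ n) {σ : Fin (e + 2) → Fin n} (hσ : IsWord Finset.univ σ)
    (x : JComplex 0 n e) : ev hn none σ (joinMap hn e x) =
      ev hn (some (σ 0)) (σ ∘ Fin.succ) x +
      (-1) ^ e * ev hn (some (σ (Fin.last (e + 1)))) (σ ∘ Fin.castSucc) x := by
  have : ev hn none σ ∘ₗ joinMap hn e = ev hn (some (σ 0)) (σ ∘ Fin.succ) +
      (-1 : ℚ) ^ e • ev hn (some (σ (Fin.last (e + 1)))) (σ ∘ Fin.castSucc) :=
    hom_ext fun τ t ht => by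
      rw [LinearMap.comp_apply, joinMap_tree hn ht, LinearMap.add_apply, LinearMap.smul_apply,
        ev_tree hn ht, ev_tree hn ht]
      cases τ with
      | none => simp
      | some j =>
        rw [Option.elim_some, ev_tree hn (ht.cons_univ hn), if_pos rfl,
          gapDet_pull_cons hσ (Finset.mem_univ j) ht]
        simp only [Option.some_inj, eq_comm (a := j), smul_eq_mul]
  exact LinearMap.congr_fun this x

theorem crit_le_span_comb (hn : 2 ≤ n) {s : Option (Fin n) → Fin n} (hs : ∀ τ, s τ ∈ topSet τ)
    (e : ℕ) : Crit s e ≤ Submodule.span ℚ {c | ∃ τ w, IsWord (topSet τ) w ∧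
      w (Fin.last e) = s τ ∧ c = tree τ (comb e w)} := by
  rw [Crit, Submodule.span_le]
  rintro _ ⟨τ, t, ht, rfl⟩
  obtain ⟨w, ρ, hw, hws, rfl⟩ := ht.exists_comb (hs τ)
  rw [tree_comp hn]
  exact Submodule.smul_mem _ _ (Submodule.subset_span ⟨τ, w, hw, hws, rfl⟩)

theorem ev_perm (hn : 2 ≤ n) (π : Equiv.Perm (Fin n)) (τ : Option (Fin n))
    (σ : Fin (e + 1) → Fin n) (x : JComplex 0 n e) :
    ev hn (τ.map π) (π ∘ σ) (perm 0 e π x) = ev hn τ σ x := by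
  have : ev hn (τ.map π) (π ∘ σ) ∘ₗ perm 0 e π = ev hn τ σ := hom_ext fun τ' t ht => by
    have htop : topSet (τ'.map π) = (topSet τ').map π.toEmbedding := by
      ext a
      rw [Finset.mem_map_equiv, mem_topSet, mem_topSet]
      cases τ' <;> simp [Equiv.eq_symm_apply]
    have hv : ValidTuple (topSet (τ'.map π)) fun i => (t i).map π.toEmbedding := by
      rw [htop, validTuple_map_iff]
      exact ht
    rw [LinearMap.comp_apply, perm_tree hn π ht, ev_tree hn hv, ev_tree hn ht]
    have hp : ∀ D : Finset (Fin n), pull (π ∘ σ) (D.map π.toEmbedding) = pull σ D := fun D => by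
      ext k
      simp [mem_pull]
    simp only [hp, (Option.map_injective π.injective).eq_iff]
  exact LinearMap.congr_fun this x

end JComplex

/-! ### The multilinear part of the free Lie algebra -/

section FreeLie

variable {n m : ℕ}

/-- The iterated bracket with a list of generators. -/
noncomputable def adList : List (Fin n) → FreeLieAlgebra ℚ (Fin n) → FreeLieAlgebra ℚ (Fin n)
  | [], F => F
  | a :: l, F => ⁅FreeLieAlgebra.of ℚ a, adList l F⁆

theorem adList_append (l l' : List (Fin n)) (F : FreeLieAlgebra ℚ (Fin n)) :
    adList (l ++ l') F = adList l (adList l' F) := by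
  induction l with
  | nil => rfl
  | cons a l ih => rw [List.cons_append, adList, adList, ih]

theorem lie_lieWord_mem_span {x : FreeMagma (Fin n)} {c : Multiset (Fin n)}
    {F G : FreeLieAlgebra ℚ (Fin n)}
    (hx : ∀ F, ⁅lieWord x, F⁆ ∈
      Submodule.span ℚ {G | ∃ l : List (Fin n), (l : Multiset (Fin n)) = wordLetters x ∧
        G = adList l F})
    (hG : G ∈ Submodule.span ℚ {G | ∃ l : List (Fin n), (l : Multiset (Fin n)) = c ∧
      G = adList l F}) :
    ⁅lieWord x, G⁆ ∈ Submodule.span ℚ {G | ∃ l : List (Fin n),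
      (l : Multiset (Fin n)) = wordLetters x + c ∧ G = adList l F} := by
  induction hG using Submodule.span_induction with
  | mem G h =>
    obtain ⟨l, hl, rfl⟩ := h
    refine Submodule.span_mono ?_ (hx (adList l F))
    rintro _ ⟨l', hl', rfl⟩
    exact ⟨l' ++ l, by rw [← Multiset.coe_add, hl, hl'], (adList_append l' l F).symm⟩
  | zero => rw [lie_zero]; exact Submodule.zero_mem _
  | add G H _ _ hG hH => rw [lie_add]; exact Submodule.add_mem _ hG hH
  | smul a G _ hG => rw [lie_smul]; exact Submodule.smul_mem _ a hG

/-- The adjoint action of a bracket is the commutator of the adjoint actions, so bracketing with any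
word expands into iterated brackets with its letters. -/
theorem lie_lieWord_mem (x : FreeMagma (Fin n)) (F : FreeLieAlgebra ℚ (Fin n)) :
    ⁅lieWord x, F⁆ ∈ Submodule.span ℚ {G | ∃ l : List (Fin n),
      (l : Multiset (Fin n)) = wordLetters x ∧ G = adList l F} := by
  induction x using FreeMagma.rec generalizing F with
  | of i => exact Submodule.subset_span ⟨[i], rfl, rfl⟩
  | mul x y ihx ihy =>
    change ⁅⁅lieWord x, lieWord y⁆, F⁆ ∈ Submodule.span ℚ {G | ∃ l : List (Fin n),
      (l : Multiset (Fin n)) = wordLetters x + wordLetters y ∧ G = adList l F}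
    rw [lie_lie]
    refine Submodule.sub_mem _ (lie_lieWord_mem_span ihx (ihy F)) ?_
    rw [add_comm]
    exact lie_lieWord_mem_span ihy (ihx F)

theorem lie_lieWord_mem_span_of {x : FreeMagma (Fin n)} {c : Multiset (Fin n)} {s : Fin n}
    {G : FreeLieAlgebra ℚ (Fin n)} (hG : G ∈ Submodule.span ℚ {G | ∃ l : List (Fin n),
      s ::ₘ (l : Multiset (Fin n)) = c ∧ G = adList l (FreeLieAlgebra.of ℚ s)}) :
    ⁅lieWord x, G⁆ ∈ Submodule.span ℚ {G | ∃ l : List (Fin n),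
      s ::ₘ (l : Multiset (Fin n)) = wordLetters x + c ∧
        G = adList l (FreeLieAlgebra.of ℚ s)} := by
  induction hG using Submodule.span_induction with
  | mem G h =>
    obtain ⟨l, hl, rfl⟩ := h
    refine Submodule.span_mono ?_ (lie_lieWord_mem x _)
    rintro _ ⟨l', hl', rfl⟩
    refine ⟨l' ++ l, ?_, (adList_append l' l _).symm⟩
    rw [← Multiset.coe_add, hl', ← hl, Multiset.add_cons]
  | zero => rw [lie_zero]; exact Submodule.zero_mem _
  | add G H _ _ hG hH => rw [lie_add]; exact Submodule.add_mem _ hG hH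
  | smul a G _ hG => rw [lie_smul]; exact Submodule.smul_mem _ a hG

/-- Antisymmetry moves the factor containing `s` to the right, recursion rewrites it with `s`
innermost, and the other factor is expanded by `lie_lieWord_mem`. -/
theorem lieWord_mem_span {x : FreeMagma (Fin n)} {s : Fin n} (hs : s ∈ wordLetters x) :
    lieWord x ∈ Submodule.span ℚ {G | ∃ l : List (Fin n),
      s ::ₘ (l : Multiset (Fin n)) = wordLetters x ∧ G = adList l (FreeLieAlgebra.of ℚ s)} := by
  induction x using FreeMagma.rec with
  | of i =>
    obtain rfl : s = i := Multiset.mem_singleton.1 hs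
    exact Submodule.subset_span ⟨[], rfl, rfl⟩
  | mul x y ihx ihy =>
    change ⁅lieWord x, lieWord y⁆ ∈ Submodule.span ℚ {G | ∃ l : List (Fin n),
      s ::ₘ (l : Multiset (Fin n)) = wordLetters x + wordLetters y ∧
        G = adList l (FreeLieAlgebra.of ℚ s)}
    rcases Multiset.mem_add.1 hs with h | h
    · rw [← lie_skew, add_comm]
      exact Submodule.neg_mem _ (lie_lieWord_mem_span_of (ihx h))
    · exact lie_lieWord_mem_span_of (ihy h)

/-- The right-normed bracket of a word. -/
noncomputable def rightNormed : (m : ℕ) → (Fin (m + 1) → Fin n) → FreeLieAlgebra ℚ (Fin n)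
  | 0, w => FreeLieAlgebra.of ℚ (w 0)
  | m + 1, w => ⁅FreeLieAlgebra.of ℚ (w 0), rightNormed m (w ∘ Fin.succ)⁆

theorem exists_rightNormed_eq_adList (l : List (Fin n)) (s : Fin n) :
    ∃ w : Fin (l.length + 1) → Fin n, w (Fin.last _) = s ∧ List.ofFn (w ∘ Fin.castSucc) = l ∧
      rightNormed l.length w = adList l (FreeLieAlgebra.of ℚ s) := by
  induction l with
  | nil => exact ⟨fun _ => s, rfl, rfl, rfl⟩
  | cons a l ih =>
    obtain ⟨w, h1, h2, h3⟩ := ih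
    refine ⟨(Fin.cons a w : Fin (l.length + 2) → Fin n), ?_, ?_, ?_⟩
    · exact h1
    · rw [List.ofFn_succ, List.cons.injEq]
      exact ⟨rfl, h2⟩
    · rw [adList, ← h3]
      rfl

theorem lie_of_mem_lieMultilinear {L : Finset (Fin n)} {j : Fin n} (hj : j ∈ L)
    {F : FreeLieAlgebra ℚ (Fin n)} (hF : F ∈ lieMultilinear (L.erase j)) :
    ⁅FreeLieAlgebra.of ℚ j, F⁆ ∈ lieMultilinear L := by
  induction hF using Submodule.span_induction with
  | mem F h =>
    obtain ⟨w, hw, rfl⟩ := h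
    refine Submodule.subset_span ⟨.mul (.of j) w, ?_, rfl⟩
    rw [wordLetters, wordLetters, hw, Finset.erase_val, Multiset.singleton_add,
      Multiset.cons_erase hj]
  | zero => rw [lie_zero]; exact Submodule.zero_mem _
  | add F G _ _ hF hG => rw [lie_add]; exact Submodule.add_mem _ hF hG
  | smul c F _ hF => rw [lie_smul]; exact Submodule.smul_mem _ _ hF

theorem IsWord.rightNormed_mem {L : Finset (Fin n)} {w : Fin (m + 1) → Fin n} (h : IsWord L w) :
    rightNormed m w ∈ lieMultilinear L := by
  induction m generalizing L with
  | zero =>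
    refine Submodule.subset_span ⟨.of (w 0), ?_, rfl⟩
    have : L = {w 0} := by
      ext a
      rw [h.mem_iff, Finset.mem_singleton]
      constructor
      · rintro ⟨k, rfl⟩
        exact congrArg w (Subsingleton.elim (α := Fin 1) _ _)
      · rintro rfl
        exact ⟨0, rfl⟩
    rw [this]
    rfl
  | succ m ih => exact lie_of_mem_lieMultilinear (h.mem 0) (ih h.tail)

theorem lieMultilinear_le_span {L : Finset (Fin n)} {s : Fin n} (hs : s ∈ L)
    (hL : L.card = m + 1) : lieMultilinear L ≤ Submodule.span ℚ {F | ∃ w, IsWord L w ∧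
      w (Fin.last m) = s ∧ F = rightNormed m w} := by
  rw [lieMultilinear, Submodule.span_le]
  rintro _ ⟨x, hx, rfl⟩
  refine Submodule.span_mono ?_ (lieWord_mem_span (s := s) (by rw [hx]; exact hs))
  rintro _ ⟨l, hl, rfl⟩
  rw [hx] at hl
  obtain rfl : m = l.length := by
    have := congrArg Multiset.card hl
    rw [Multiset.card_cons, Multiset.coe_card, Finset.card_val, hL] at this
    omega
  obtain ⟨w, h1, h2, h3⟩ := exists_rightNormed_eq_adList l s
  refine ⟨w, ⟨?_, fun a => ?_⟩, h1, h3.symm⟩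
  · have hnd : (l ++ [s]).Nodup := by
      have : ((s :: l : List (Fin n)) : Multiset (Fin n)).Nodup := by
        rw [← Multiset.cons_coe, hl]
        exact L.nodup
      exact (List.perm_append_singleton s l).nodup_iff.2 (Multiset.coe_nodup.1 this)
    have : List.ofFn w = l ++ [s] := by
      rw [List.ofFn_succ', List.concat_eq_append, h1]
      exact congrArg (· ++ [s]) h2
    rw [← List.nodup_ofFn, this]
    exact hnd
  · have h4 : a ∈ l ↔ ∃ k : Fin l.length, w k.castSucc = a := by
      conv_lhs => rw [← h2]
      exact List.mem_ofFn
    rw [← Finset.mem_val, ← hl, Multiset.mem_cons, Multiset.mem_coe, h4,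
      Fin.exists_fin_succ', h1, or_comm, eq_comm (a := a)]

attribute [local instance] LieRing.ofAssociativeRing

/-- The embedding of the free Lie algebra into the free associative algebra. -/
noncomputable def toAssoc (n : ℕ) :
    FreeLieAlgebra ℚ (Fin n) →ₗ⁅ℚ⁆ MonoidAlgebra ℚ (FreeMonoid (Fin n)) :=
  FreeLieAlgebra.lift ℚ fun i => MonoidAlgebra.single (FreeMonoid.of i) 1

/-- The coefficient of a word in an element of the free Lie algebra. -/
noncomputable def coef (w : Fin m → Fin n) : FreeLieAlgebra ℚ (Fin n) →ₗ[ℚ] ℚ where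
  toFun F := (toAssoc n F).coeff (FreeMonoid.ofList (List.ofFn w))
  map_add' F G := by simp
  map_smul' c F := by simp

theorem coef_of (w : Fin 1 → Fin n) (i : Fin n) :
    coef w (FreeLieAlgebra.of ℚ i) = if w 0 = i then 1 else 0 := by
  classical
  have h : FreeMonoid.of i = FreeMonoid.of (w 0) ↔ w 0 = i :=
    FreeMonoid.of_injective.eq_iff.trans eq_comm
  simp [coef, toAssoc, Finsupp.single_apply, h]

theorem coeff_single_mul_ofFn (j : Fin n) (x : MonoidAlgebra ℚ (FreeMonoid (Fin n)))
    (w : Fin (m + 1) → Fin n) : (MonoidAlgebra.single (FreeMonoid.of j) 1 * x).coeff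
      (FreeMonoid.ofList (List.ofFn w)) =
      if w 0 = j then x.coeff (FreeMonoid.ofList (List.ofFn (w ∘ Fin.succ))) else 0 := by
  rw [List.ofFn_succ, FreeMonoid.ofList_cons]
  split_ifs with h
  · rw [h, MonoidAlgebra.coeff_single_mul_eq_mul_coeff
      (FreeMonoid.ofList (List.ofFn (w ∘ Fin.succ))), one_mul]
    exact fun y _ => mul_right_inj (FreeMonoid.of j)
  · refine MonoidAlgebra.coeff_single_mul_of_forall_mul_ne _ _ fun d hd => h ?_
    have := congrArg FreeMonoid.toList hd
    simp only [FreeMonoid.toList_of_mul, List.cons.injEq] at this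
    exact this.1.symm

theorem coeff_mul_single_ofFn (j : Fin n) (x : MonoidAlgebra ℚ (FreeMonoid (Fin n)))
    (w : Fin (m + 1) → Fin n) : (x * MonoidAlgebra.single (FreeMonoid.of j) 1).coeff
      (FreeMonoid.ofList (List.ofFn w)) =
      if w (Fin.last m) = j then
        x.coeff (FreeMonoid.ofList (List.ofFn (w ∘ Fin.castSucc))) else 0 := by
  rw [List.ofFn_succ', List.concat_eq_append, FreeMonoid.ofList_append, FreeMonoid.ofList_singleton]
  split_ifs with h
  · rw [h, MonoidAlgebra.coeff_mul_single_eq_coeff_mul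
      (FreeMonoid.ofList (List.ofFn (w ∘ Fin.castSucc))), mul_one]
    exact fun y _ => mul_left_inj (FreeMonoid.of j)
  · refine MonoidAlgebra.coeff_mul_single_of_forall_mul_ne _ _ fun d hd => h ?_
    have := congrArg FreeMonoid.toList hd
    simp only [FreeMonoid.toList_mul, FreeMonoid.toList_of, FreeMonoid.toList_ofList] at this
    exact (List.cons.inj (List.append_inj_right' this rfl)).1.symm

/-- In the associative algebra the bracket is `x_j F - F x_j`, and the two products see the first
and the last letter of the word. -/
theorem coef_lie_of (w : Fin (m + 1) → Fin n) (j : Fin n) (F : FreeLieAlgebra ℚ (Fin n)) :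
    coef w ⁅FreeLieAlgebra.of ℚ j, F⁆ = (if w 0 = j then coef (w ∘ Fin.succ) F else 0) -
      if w (Fin.last m) = j then coef (w ∘ Fin.castSucc) F else 0 := by
  change (toAssoc n ⁅FreeLieAlgebra.of ℚ j, F⁆).coeff _ = _
  rw [LieHom.map_lie, LieRing.of_associative_ring_bracket, MonoidAlgebra.coeff_sub,
    Finsupp.sub_apply, toAssoc, FreeLieAlgebra.lift_of_apply, coeff_single_mul_ofFn,
    coeff_mul_single_ofFn]
  rfl

theorem coef_rightNormed_succ (v w : Fin (m + 2) → Fin n) :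
    coef v (rightNormed (m + 1) w) =
      (if v 0 = w 0 then coef (v ∘ Fin.succ) (rightNormed m (w ∘ Fin.succ)) else 0) -
      if v (Fin.last (m + 1)) = w 0 then
        coef (v ∘ Fin.castSucc) (rightNormed m (w ∘ Fin.succ)) else 0 :=
  coef_lie_of v (w 0) _

/-- Among words with a common last letter the right-normed brackets are dual to the coefficients: in
the recursion the term that strips the last letter vanishes, because the first letter of `w` is not
its last. This gives linear independence. -/
theorem coef_rightNormed {L : Finset (Fin n)} {v w : Fin (m + 1) → Fin n} (hv : IsWord L v)
    (hw : IsWord L w) (h : v (Fin.last m) = w (Fin.last m)) :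
    coef v (rightNormed m w) = if v = w then 1 else 0 := by
  induction m generalizing L with
  | zero =>
    have hvw : v = w := funext fun k => by
      rw [Subsingleton.elim (α := Fin 1) k (Fin.last 0), h]
    rw [if_pos hvw, rightNormed, coef_of, if_pos (congrFun hvw 0)]
  | succ m ih =>
    rw [coef_rightNormed_succ, if_neg (c := v (Fin.last (m + 1)) = w 0), sub_zero]
    · by_cases h0 : v 0 = w 0
      · have hwt : IsWord (L.erase (v 0)) (w ∘ Fin.succ) := by
          rw [h0]
          exact hw.tail
        rw [if_pos h0, ih hv.tail hwt h]
        refine if_congr ⟨fun h' => funext fun k => ?_, fun h' => h' ▸ rfl⟩ rfl rfl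
        induction k using Fin.cases with
        | zero => exact h0
        | succ k => exact congrFun h' k
      · rw [if_neg h0, if_neg fun h' => h0 (congrFun h' 0)]
    · rw [h]
      exact fun h' => Fin.last_pos.ne (hw.inj h').symm

theorem coef_perm_rightNormed (π : Equiv.Perm (Fin n)) (v w : Fin (m + 1) → Fin n) :
    coef (π ∘ v) (rightNormed m (π ∘ w)) = coef v (rightNormed m w) := by
  induction m with
  | zero => simp [rightNormed, coef_of]
  | succ m ih =>
    rw [coef_rightNormed_succ, coef_rightNormed_succ]
    simp only [Function.comp_assoc, ih]
    simp

theorem liePerm_rightNormed (π : Equiv.Perm (Fin n)) (w : Fin (m + 1) → Fin n) :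
    liePerm π (rightNormed m w) = rightNormed m (π ∘ w) := by
  induction m with
  | zero => simp [rightNormed, liePerm]
  | succ m ih =>
    rw [rightNormed, rightNormed, LieHom.map_lie, ih]
    simp [liePerm, Function.comp_assoc]

theorem liePerm_mem {L : Finset (Fin n)} (hL : L.Nonempty) (π : Equiv.Perm (Fin n))
    {F : FreeLieAlgebra ℚ (Fin n)} (hF : F ∈ lieMultilinear L) :
    liePerm π F ∈ lieMultilinear (L.map π.toEmbedding) := by
  obtain ⟨s, hs⟩ := hL
  have h : Submodule.span ℚ {F | ∃ w, IsWord L w ∧ w (Fin.last _) = s ∧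
      F = rightNormed (L.card - 1) w} ≤ (lieMultilinear (L.map π.toEmbedding)).comap
        (liePerm π : FreeLieAlgebra ℚ (Fin n) →ₗ[ℚ] _) := by
    rw [Submodule.span_le]
    rintro _ ⟨w, hw, -, rfl⟩
    change liePerm π (rightNormed _ w) ∈ lieMultilinear _
    rw [liePerm_rightNormed]
    exact (hw.map π).rightNormed_mem
  exact h (lieMultilinear_le_span hs
    (Nat.succ_pred_eq_of_pos (Finset.card_pos.2 ⟨s, hs⟩)).symm hF)

theorem coef_liePerm {L : Finset (Fin n)} (hL : L.card = m + 1) (π : Equiv.Perm (Fin n))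
    {F : FreeLieAlgebra ℚ (Fin n)} (hF : F ∈ lieMultilinear L) (v : Fin (m + 1) → Fin n) :
    coef (π ∘ v) (liePerm π F) = coef v F := by
  obtain ⟨s, hs⟩ : L.Nonempty := Finset.card_pos.1 (by omega)
  have h : Submodule.span ℚ {F | ∃ w, IsWord L w ∧ w (Fin.last m) = s ∧ F = rightNormed m w} ≤
      LinearMap.eqLocus (coef (π ∘ v) ∘ₗ (liePerm π : FreeLieAlgebra ℚ (Fin n) →ₗ[ℚ] _))
        (coef v) := by
    rw [Submodule.span_le]
    rintro _ ⟨w, -, -, rfl⟩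
    change coef (π ∘ v) (liePerm π (rightNormed m w)) = _
    rw [liePerm_rightNormed, coef_perm_rightNormed]
  exact h (lieMultilinear_le_span hs hL hF)

/-- The words on `L` that end with `s`. -/
abbrev LastWord (m : ℕ) (L : Finset (Fin n)) (s : Fin n) : Type :=
  {w : Fin (m + 1) → Fin n // IsWord L w ∧ w (Fin.last m) = s}

noncomputable instance (m : ℕ) (L : Finset (Fin n)) (s : Fin n) : Fintype (LastWord m L s) :=
  Fintype.ofFinite _

/-- The right-normed brackets form a basis of the multilinear part of the free Lie algebra. -/
noncomputable def coefEquiv {L : Finset (Fin n)} {s : Fin n} (hs : s ∈ L) (hL : L.card = m + 1) :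
    lieMultilinear L ≃ₗ[ℚ] (LastWord m L s → ℚ) :=
  LinearEquiv.ofBijective
    ((LinearMap.pi fun w : LastWord m L s => coef w.1) ∘ₗ (lieMultilinear L).subtype) <| by
    -- Spanning comes from `lieMultilinear_le_span`; by duality the coefficients recover `c`, which
    -- yields injectivity and surjectivity at once.
    have key : ∀ (c : LastWord m L s → ℚ) (w : LastWord m L s),
        coef w.1 (∑ v, c v • rightNormed m v.1) = c w := by
      intro c w
      rw [map_sum, Finset.sum_eq_single w]
      · rw [map_smul, coef_rightNormed w.2.1 w.2.1 rfl, if_pos rfl, smul_eq_mul, mul_one]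
      · intro v _ hv
        rw [map_smul, coef_rightNormed w.2.1 v.2.1 (w.2.2.trans v.2.2.symm),
          if_neg fun h => hv (Subtype.ext h.symm), smul_zero]
      · exact fun h => absurd (Finset.mem_univ w) h
    constructor
    · rw [← LinearMap.ker_eq_bot, LinearMap.ker_eq_bot']
      rintro ⟨F, hF⟩ h
      have hF' : F ∈ Submodule.span ℚ (Set.range fun v : LastWord m L s => rightNormed m v.1) := by
        refine Submodule.span_mono ?_ (lieMultilinear_le_span hs hL hF)
        rintro _ ⟨w, h1, h2, rfl⟩
        exact ⟨⟨w, h1, h2⟩, rfl⟩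
      obtain ⟨c, rfl⟩ := (Submodule.mem_span_range_iff_exists_fun ℚ).1 hF'
      refine Subtype.ext (Finset.sum_eq_zero fun v _ => ?_)
      have h' : coef v.1 (∑ v, c v • rightNormed m v.1) = 0 := congrFun h v
      rw [key] at h'
      rw [h', zero_smul]
    · intro c
      refine ⟨⟨∑ v, c v • rightNormed m v.1, Submodule.sum_mem _ fun v _ =>
        Submodule.smul_mem _ _ v.2.1.rightNormed_mem⟩, funext fun w => key c w⟩

theorem lieMultilinear_ext {L : Finset (Fin n)} (hL : L.card = m + 1)
    {F G : FreeLieAlgebra ℚ (Fin n)} (hF : F ∈ lieMultilinear L) (hG : G ∈ lieMultilinear L)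
    (h : ∀ w : Fin (m + 1) → Fin n, IsWord L w → coef w F = coef w G) : F = G := by
  obtain ⟨s, hs⟩ : L.Nonempty := Finset.card_pos.1 (by omega)
  have : (⟨F, hF⟩ : lieMultilinear L) = ⟨G, hG⟩ :=
    (coefEquiv hs hL).injective (funext fun w => h w.1 w.2.1)
  exact congrArg Subtype.val this

theorem card_lastWord {L : Finset (Fin n)} {s : Fin n} (hs : s ∈ L) (hL : L.card = m + 1) :
    Fintype.card (LastWord m L s) = m.factorial := by
  classical
  have hc : (L.erase s).card = m := by rw [Finset.card_erase_of_mem hs]; omega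
  let f : LastWord m L s → (Fin m ↪ L.erase s) := fun w =>
    ⟨fun i => ⟨w.1 i.castSucc, Finset.mem_erase.2
      ⟨fun h => (Fin.castSucc_lt_last i).ne (w.2.1.inj (h.trans w.2.2.symm)), w.2.1.mem _⟩⟩,
      fun i k hik => Fin.castSucc_injective m (w.2.1.inj (congrArg Subtype.val hik))⟩
  have hf : Function.Bijective f := by
    constructor
    · intro v w h
      refine Subtype.ext (funext fun k => ?_)
      induction k using Fin.lastCases with
      | last => rw [v.2.2, w.2.2]
      | cast k => exact congrArg Subtype.val (DFunLike.congr_fun h k)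
    · intro g
      have hi : Function.Injective (Fin.snoc (fun i => (g i).1) s : Fin (m + 1) → Fin n) := by
        rw [Fin.snoc_injective_iff]
        refine ⟨Subtype.val_injective.comp g.injective, ?_⟩
        rintro ⟨i, hi⟩
        exact Finset.ne_of_mem_erase (g i).2 hi
      have hsub : Finset.univ.map ⟨_, hi⟩ ⊆ L := by
        intro a ha
        obtain ⟨k, -, rfl⟩ := Finset.mem_map.1 ha
        induction k using Fin.lastCases with
        | last => simpa using hs
        | cast k => simpa using Finset.mem_of_mem_erase (g k).2
      have heq := Finset.eq_of_subset_of_card_le hsub (by simp [hL])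
      refine ⟨⟨Fin.snoc (fun i => (g i).1) s, ⟨hi, fun a => ?_⟩, by simp⟩, ?_⟩
      · refine (Finset.ext_iff.1 heq a).symm.trans ?_
        simp
      · ext i
        simp [f]
  rw [Fintype.card_of_bijective hf, Fintype.card_embedding_eq, Fintype.card_coe, Fintype.card_fin,
    hc, Nat.descFactorial_self]

theorem finrank_lieMultilinear {L : Finset (Fin n)} (hL : L.card = m + 1) :
    Module.finrank ℚ (lieMultilinear L) = m.factorial := by
  obtain ⟨s, hs⟩ : L.Nonempty := Finset.card_pos.1 (by omega)
  rw [(coefEquiv hs hL).finrank_eq, Module.finrank_fintype_fun_eq_card, card_lastWord hs hL]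

theorem finite_lieMultilinear {L : Finset (Fin n)} (hL : L.card = m + 1) :
    Module.Finite ℚ (lieMultilinear L) := by
  obtain ⟨s, hs⟩ : L.Nonempty := Finset.card_pos.1 (by omega)
  exact Module.Finite.equiv (coefEquiv hs hL).symm

/-- Both sides obey the same recursion: the determinant strips the outermost leaf of the comb from
either end of `v`, and so does the coefficient of the bracket. This identifies trees with Lie
brackets. -/
theorem wordSign_mul_gapDet_comb {L : Finset (Fin n)} {v w : Fin (m + 1) → Fin n}
    (hv : IsWord L v) (hw : IsWord L w) :
    wordSign v * gapDet (fun i => pull v (comb m w i)) =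
      wordSign w * coef v (rightNormed m w) := by
  induction m generalizing L with
  | zero =>
    have hvw : v = w := by
      funext k
      obtain ⟨l, hl⟩ := (hw.mem_iff _).1 (hv.mem k)
      rw [← hl, Subsingleton.elim (α := Fin 1) l k]
    subst hvw
    rw [rightNormed, coef_of, if_pos rfl]
    congr 1
    exact (if_pos fun i => i.elim0).trans Matrix.det_isEmpty
  | succ m ih =>
    have hu := (hw.tail.critical_comb).valid
    rw [hw.comb_succ, gapDet_pull_cons hv (hw.mem 0) hu, coef_rightNormed_succ, mul_add, mul_sub,
      sub_eq_add_neg]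
    have hwt := hw.wordSign_tail
    congr 1
    · by_cases h : v 0 = w 0
      · rw [if_pos h, if_pos h, hv.wordSign_tail, mul_assoc, ih hv.tail (h ▸ hw.tail), hwt, h]
        ring
      · rw [if_neg h, if_neg h, mul_zero, mul_zero]
    · by_cases h : v (Fin.last (m + 1)) = w 0
      · have hi := ih hv.init (h ▸ hw.tail)
        rw [if_pos h, if_pos h, hv.wordSign_init, hwt, h]
        -- The factor from moving the last letter of `v` and that of the Laplace expansion combine
        -- to the minus sign in front of `F x_j`.
        have h1 : ((-1 : ℚ) ^ (m + 1)) * (-1) ^ m = -1 := by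
          rw [← pow_add, show m + 1 + m = 2 * m + 1 by ring, pow_succ, pow_mul]
          norm_num
        calc _ = ((-1 : ℚ) ^ (m + 1)) * (-1) ^ m * moveSign (w 0) (L.erase (w 0)) *
              (wordSign (v ∘ Fin.castSucc) *
                gapDet fun i => pull (v ∘ Fin.castSucc) (comb m (w ∘ Fin.succ) i)) := by ring
          _ = _ := by
            rw [hi, h1]
            ring
      · rw [if_neg h, if_neg h]
        ring

end FreeLie

/-! ### The cone structure: cocycles and coboundaries -/

namespace JComplex

variable {n e : ℕ}

theorem exists_onSome (hn : 2 ≤ n) (e : ℕ) : ∃ p : JComplex 0 n e →ₗ[ℚ] JComplex 0 n e,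
    ∀ τ t, ValidTuple (topSet τ) t → p (tree τ t) = τ.elim 0 fun _ => tree τ t :=
  exists_lift hn (fun τ t => τ.elim 0 fun _ => tree τ t) fun τ t σ _ => by
    cases τ with
    | none => simp
    | some j => exact tree_comp hn (some j) t σ

/-- The projection to the part spanned by the trees with an edge between `ε` and a number. -/
noncomputable def onSome (hn : 2 ≤ n) (e : ℕ) : JComplex 0 n e →ₗ[ℚ] JComplex 0 n e :=
  (exists_onSome hn e).choose

variable (hn : 2 ≤ n)

theorem onSome_tree_none (t : Fin e → Finset (Fin n)) : onSome hn e (tree none t) = 0 := by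
  by_cases ht : ValidTuple (topSet none) t
  · exact (exists_onSome hn e).choose_spec none t ht
  · rw [tree_eq_zero ht, map_zero]

theorem onSome_tree_some (j : Fin n) (t : Fin e → Finset (Fin n)) :
    onSome hn e (tree (some j) t) = tree (some j) t := by
  by_cases ht : ValidTuple (topSet (some j)) t
  · exact (exists_onSome hn e).choose_spec (some j) t ht
  · rw [tree_eq_zero ht, map_zero]

theorem onSome_onSome (x : JComplex 0 n e) : onSome hn e (onSome hn e x) = onSome hn e x := by
  have : onSome hn e ∘ₗ onSome hn e = onSome hn e := hom_ext fun τ t _ => by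
    cases τ with
    | none => rw [LinearMap.comp_apply, onSome_tree_none, map_zero]
    | some j => rw [LinearMap.comp_apply, onSome_tree_some, onSome_tree_some]
  exact LinearMap.congr_fun this x

theorem onSome_splitMap (x : JComplex 0 n e) :
    onSome hn (e + 1) (splitMap hn e x) = splitMap hn e (onSome hn e x) := by
  have : onSome hn (e + 1) ∘ₗ splitMap hn e = splitMap hn e ∘ₗ onSome hn e :=
    hom_ext fun τ t ht => by
      rw [LinearMap.comp_apply, LinearMap.comp_apply, splitMap_tree hn ht, map_sum]
      cases τ with
      | none => simp only [onSome_tree_none, map_zero, Finset.sum_const_zero]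
      | some j => simp only [onSome_tree_some, splitMap_tree hn ht]
  exact LinearMap.congr_fun this x

theorem onSome_joinMap (x : JComplex 0 n e) : onSome hn (e + 1) (joinMap hn e x) = 0 := by
  have : onSome hn (e + 1) ∘ₗ joinMap hn e = 0 := hom_ext fun τ t ht => by
    rw [LinearMap.comp_apply, joinMap_tree hn ht]
    cases τ with
    | none => exact map_zero _
    | some j => exact onSome_tree_none hn _
  exact LinearMap.congr_fun this x

theorem joinMap_onSome (x : JComplex 0 n e) :
    joinMap hn e (onSome hn e x) = joinMap hn e x := by
  have : joinMap hn e ∘ₗ onSome hn e = joinMap hn e := hom_ext fun τ t ht => by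
    cases τ with
    | none => rw [LinearMap.comp_apply, onSome_tree_none, map_zero, joinMap_tree hn ht]; rfl
    | some j => rw [LinearMap.comp_apply, onSome_tree_some]
  exact LinearMap.congr_fun this x

theorem ev_some_onSome (j : Fin n) (σ : Fin (e + 1) → Fin n) (x : JComplex 0 n e) :
    ev hn (some j) σ (onSome hn e x) = ev hn (some j) σ x := by
  have : ev hn (some j) σ ∘ₗ onSome hn e = ev hn (some j) σ := hom_ext fun τ t ht => by
    cases τ with
    | none =>
      rw [LinearMap.comp_apply, onSome_tree_none, map_zero, ev_tree hn ht, if_neg (by simp)]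
    | some i => rw [LinearMap.comp_apply, onSome_tree_some]
  exact LinearMap.congr_fun this x

theorem ev_none_onSome (σ : Fin (e + 1) → Fin n) (x : JComplex 0 n e) :
    ev hn none σ (onSome hn e x) = 0 := by
  have : ev hn none σ ∘ₗ onSome hn e = 0 := hom_ext fun τ t ht => by
    cases τ with
    | none => rw [LinearMap.comp_apply, onSome_tree_none, map_zero]; rfl
    | some i =>
      rw [LinearMap.comp_apply, onSome_tree_some, ev_tree hn ht, if_neg (by simp)]
      rfl
  exact LinearMap.congr_fun this x

theorem ev_some_joinMap (j : Fin n) (σ : Fin (e + 2) → Fin n) (x : JComplex 0 n e) :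
    ev hn (some j) σ (joinMap hn e x) = 0 := by
  rw [← ev_some_onSome, onSome_joinMap, map_zero]

theorem differential_apply (x : JComplex 0 n e) :
    differential 0 n e x = splitMap hn e x + joinMap hn e x := by
  rw [differential_eq hn, LinearMap.add_apply]

/-- Joins land in the part without ε, so the projection to the trees with an ε only sees the
splitting part. -/
theorem splitMap_onSome_of_cocycle {x : JComplex 0 n e} (hx : differential 0 n e x = 0) :
    splitMap hn e (onSome hn e x) = 0 := by
  have := congrArg (onSome hn (e + 1)) hx
  rwa [differential_apply hn, map_add, onSome_joinMap, add_zero, onSome_splitMap, map_zero] at this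

theorem ev_joinMap_of_cocycle {x : JComplex 0 n e} (hx : differential 0 n e x = 0)
    {σ : Fin (e + 2) → Fin n} (hσ : IsWord (topSet none) σ) :
    ev hn none σ (joinMap hn e x) = 0 := by
  have := congrArg (ev hn none σ) hx
  rwa [differential_apply hn, map_add, ev_splitMap hn hσ, zero_add, map_zero] at this

variable {s : Option (Fin n) → Fin n}

/-- The critical part is spanned by combs of words ending in `s τ`, and the functionals at these
words form the dual family, by `wordSign_mul_gapDet_comb` and `coef_rightNormed`. -/
theorem eq_zero_of_mem_crit (hs : ∀ τ, s τ ∈ topSet τ) {c : JComplex 0 n e} (hc : c ∈ Crit s e)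
    (h : ∀ τ σ, IsWord (topSet τ) σ → ev hn τ σ c = 0) : c = 0 := by
  let I : Type := {p : Option (Fin n) × (Fin (e + 1) → Fin n) //
    IsWord (topSet p.1) p.2 ∧ p.2 (Fin.last e) = s p.1}
  let := Fintype.ofFinite I
  have hc' : c ∈ Submodule.span ℚ (Set.range fun p : I => tree p.1.1 (comb e p.1.2)) := by
    refine Submodule.span_mono ?_ (crit_le_span_comb hn hs e hc)
    rintro _ ⟨τ, w, h1, h2, rfl⟩
    exact ⟨⟨(τ, w), h1, h2⟩, rfl⟩
  obtain ⟨a, rfl⟩ := (Submodule.mem_span_range_iff_exists_fun ℚ).1 hc'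
  refine Finset.sum_eq_zero fun p _ => ?_
  have hev : ∀ q : I, ev hn p.1.1 p.1.2 (tree q.1.1 (comb e q.1.2)) = if q = p then 1 else 0 := by
    intro q
    rw [ev_tree hn q.2.1.critical_comb.valid]
    by_cases hq : q.1.1 = p.1.1
    · rw [if_pos hq]
      have hqw : IsWord (topSet p.1.1) q.1.2 := hq ▸ q.2.1
      have hlast : p.1.2 (Fin.last e) = q.1.2 (Fin.last e) := by rw [p.2.2, q.2.2, hq]
      have h1 := wordSign_mul_gapDet_comb p.2.1 hqw
      rw [coef_rightNormed p.2.1 hqw hlast] at h1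
      have hiff : p.1.2 = q.1.2 ↔ q = p :=
        ⟨fun h => Subtype.ext (Prod.ext hq h.symm), fun h => h ▸ rfl⟩
      by_cases hqp : q = p
      · subst hqp
        rw [if_pos rfl] at h1
        rw [if_pos rfl]
        exact mul_left_cancel₀ (wordSign_ne_zero _) h1
      · rw [if_neg (mt hiff.1 hqp), mul_zero] at h1
        rw [if_neg hqp]
        exact (mul_eq_zero.1 h1).resolve_left (wordSign_ne_zero _)
    · rw [if_neg hq, if_neg fun h : q = p => hq (by rw [h])]
  have h1 := h p.1.1 p.1.2 p.2.1
  rw [map_sum, Finset.sum_eq_single p (fun q _ hq => by rw [map_smul, hev, if_neg hq, smul_zero])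
    (fun h => absurd (Finset.mem_univ p) h), map_smul, hev, if_pos rfl, smul_eq_mul, mul_one] at h1
  rw [h1, zero_smul]

/-- The functionals kill coboundaries of `splitMap`, so the critical remainder of `x` has the same
values and vanishes with them. -/
theorem eq_splitMap_of_ev_eq_zero (hs : ∀ τ, s τ ∈ topSet τ) {x : JComplex 0 n (e + 1)}
    (hx : splitMap hn (e + 1) x = 0) (h : ∀ τ σ, IsWord (topSet τ) σ → ev hn τ σ x = 0) :
    ∃ y, x = splitMap hn e y := by
  obtain ⟨y, hy⟩ := exists_sub_splitMap_mem_crit hn hs hx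
  refine ⟨y, sub_eq_zero.1 (eq_zero_of_mem_crit hn hs hy fun τ σ hσ => ?_)⟩
  rw [map_sub, h τ σ hσ, ev_splitMap hn hσ, sub_zero]

/-- If the trees with an ε in `x` are invisible to the functionals, they form a `splitMap`
coboundary. Subtracting the full differential of a primitive supported on such trees leaves only
trees without an ε. -/
theorem exists_sub_differential (hs : ∀ τ, s τ ∈ topSet τ) {x : JComplex 0 n (e + 1)}
    (hx : differential 0 n (e + 1) x = 0)
    (h : ∀ j σ, IsWord (topSet (some j)) σ → ev hn (some j) σ x = 0) :
    ∃ w, onSome hn (e + 1) (x - differential 0 n e w) = 0 ∧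
      splitMap hn (e + 1) (x - differential 0 n e w) = 0 := by
  obtain ⟨y, hy⟩ := eq_splitMap_of_ev_eq_zero hn hs (splitMap_onSome_of_cocycle hn hx)
    fun τ σ hσ => by
      cases τ with
      | none => exact ev_none_onSome hn σ x
      | some j => rw [ev_some_onSome, h j σ hσ]
  have h0 : onSome hn (e + 1) (x - differential 0 n e (onSome hn e y)) = 0 := by
    rw [map_sub, differential_apply hn, map_add, onSome_joinMap, add_zero, onSome_splitMap,
      onSome_onSome, ← onSome_splitMap, ← hy, onSome_onSome, sub_self]
  refine ⟨onSome hn e y, h0, ?_⟩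
  have h1 : differential 0 n (e + 1) (x - differential 0 n e (onSome hn e y)) = 0 := by
    rw [map_sub, hx, ← LinearMap.comp_apply, differential_comp hn, LinearMap.zero_apply, sub_zero]
  rwa [differential_apply hn, ← joinMap_onSome, h0, map_zero, add_zero] at h1

/-- Removing from `z` the trees with an ε does not change its image under `splitMap`, as that image
has no such trees, and makes its join zero. -/
theorem mem_range_differential_of_onSome_eq_zero {x : JComplex 0 n (e + 1)}
    (hx : onSome hn (e + 1) x = 0) {z : JComplex 0 n e} (hz : x = splitMap hn e z) :
    x ∈ LinearMap.range (differential 0 n e) := by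
  refine ⟨z - onSome hn e z, ?_⟩
  rw [differential_apply hn, map_sub, map_sub, joinMap_onSome, sub_self, add_zero,
    ← onSome_splitMap, ← hz, hx, sub_zero]

/-- After the correction only the words in all `n` letters could detect `x`, and they have the wrong
length `e + 2 ≠ n`. -/
theorem mem_range_differential (hs : ∀ τ, s τ ∈ topSet τ) {x : JComplex 0 n (e + 1)}
    (hx : differential 0 n (e + 1) x = 0) (he : e + 2 ≠ n)
    (h : ∀ j σ, IsWord (topSet (some j)) σ → ev hn (some j) σ x = 0) :
    x ∈ LinearMap.range (differential 0 n e) := by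
  obtain ⟨w, h1, h2⟩ := exists_sub_differential hn hs hx h
  obtain ⟨z, hz⟩ := eq_splitMap_of_ev_eq_zero hn hs h2 fun τ σ hσ => by
    cases τ with
    | none =>
      have := hσ.card_eq
      simp [topSet] at this
      omega
    | some j => rw [← ev_some_onSome, h1, map_zero]
  have := Submodule.add_mem _ (mem_range_differential_of_onSome_eq_zero hn h1 hz)
    (LinearMap.mem_range_self (differential 0 n e) w)
  rwa [sub_add_cancel] at this

/-- Cocycles of `splitMap` give elements of the free Lie algebra. -/
theorem exists_lie (hs : ∀ τ, s τ ∈ topSet τ) {x : JComplex 0 n e} (hx : splitMap hn e x = 0)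
    (τ : Option (Fin n)) : ∃ F ∈ lieMultilinear (topSet τ), ∀ σ, IsWord (topSet τ) σ →
      coef σ F = wordSign σ * ev hn τ σ x := by
  obtain ⟨c, hc, hxc⟩ : ∃ c ∈ Crit s e, ∀ σ, IsWord (topSet τ) σ →
      ev hn τ σ x = ev hn τ σ c := by
    cases e with
    | zero => exact ⟨x, by rw [crit_zero]; trivial, fun _ _ => rfl⟩
    | succ e =>
      obtain ⟨y, hy⟩ := exists_sub_splitMap_mem_crit hn hs hx
      exact ⟨_, hy, fun σ hσ => by rw [map_sub, ev_splitMap hn hσ, sub_zero]⟩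
  have key : ∃ F ∈ lieMultilinear (topSet τ), ∀ σ, IsWord (topSet τ) σ →
      coef σ F = wordSign σ * ev hn τ σ c := by
    have hc' := crit_le_span_comb hn hs e hc
    clear hc hxc
    induction hc' using Submodule.span_induction with
    | mem c h =>
      obtain ⟨τ', w, hw, -, rfl⟩ := h
      by_cases hτ : τ' = τ
      · subst hτ
        refine ⟨wordSign w • rightNormed e w, Submodule.smul_mem _ _ hw.rightNormed_mem,
          fun σ hσ => ?_⟩
        rw [ev_tree hn hw.critical_comb.valid, if_pos rfl, wordSign_mul_gapDet_comb hσ hw, map_smul,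
          smul_eq_mul]
      · refine ⟨0, Submodule.zero_mem _, fun σ _ => ?_⟩
        rw [ev_tree hn hw.critical_comb.valid, if_neg hτ, map_zero, mul_zero]
    | zero => exact ⟨0, Submodule.zero_mem _, by simp⟩
    | add c d _ _ hc hd =>
      obtain ⟨F, hF, hc⟩ := hc
      obtain ⟨G, hG, hd⟩ := hd
      refine ⟨F + G, Submodule.add_mem _ hF hG, fun σ hσ => ?_⟩
      rw [map_add, map_add, hc σ hσ, hd σ hσ, mul_add]
    | smul a c _ hc =>
      obtain ⟨F, hF, hc⟩ := hc
      refine ⟨a • F, Submodule.smul_mem _ a hF, fun σ hσ => ?_⟩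
      rw [map_smul, map_smul, hc σ hσ, smul_eq_mul, smul_eq_mul, mul_left_comm]
  obtain ⟨F, hF, h⟩ := key
  exact ⟨F, hF, fun σ hσ => by rw [h σ hσ, hxc σ hσ]⟩

/-- Conversely to `exists_lie`, a right-normed bracket is realised by the comb of the same word with
its sign, which is critical and hence a cocycle of `splitMap`. -/
theorem exists_crit_of_lie (hs : ∀ τ, s τ ∈ topSet τ) {τ : Option (Fin n)}
    (hτ : (topSet τ).card = e + 1) {F : FreeLieAlgebra ℚ (Fin n)}
    (hF : F ∈ lieMultilinear (topSet τ)) : ∃ b ∈ Crit s e, ∀ τ' σ, IsWord (topSet τ') σ →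
      wordSign σ * ev hn τ' σ b = if τ' = τ then coef σ F else 0 := by
  have hF' := lieMultilinear_le_span (hs τ) hτ hF
  clear hF
  induction hF' using Submodule.span_induction with
  | mem F h =>
    obtain ⟨w, hw, hws, rfl⟩ := h
    refine ⟨wordSign w • tree τ (comb e w), Submodule.smul_mem _ _ (Submodule.subset_span
      ⟨τ, comb e w, hws ▸ hw.critical_comb, rfl⟩), fun τ' σ hσ => ?_⟩
    rw [map_smul, ev_tree hn hw.critical_comb.valid]
    by_cases h : τ' = τ
    · subst h
      rw [if_pos rfl, if_pos rfl, smul_eq_mul, mul_left_comm, wordSign_mul_gapDet_comb hσ hw,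
        ← mul_assoc, wordSign_mul_self, one_mul]
    · rw [if_neg h, if_neg (Ne.symm h), smul_zero, mul_zero]
  | zero => exact ⟨0, Submodule.zero_mem _, by simp⟩
  | add F G _ _ hF hG =>
    obtain ⟨b, hb, h1⟩ := hF
    obtain ⟨c, hc, h2⟩ := hG
    refine ⟨b + c, Submodule.add_mem _ hb hc, fun τ' σ hσ => ?_⟩
    rw [map_add, mul_add, h1 τ' σ hσ, h2 τ' σ hσ, map_add]
    split_ifs <;> simp
  | smul a F _ hF =>
    obtain ⟨b, hb, h1⟩ := hF
    refine ⟨a • b, Submodule.smul_mem _ a hb, fun τ' σ hσ => ?_⟩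
    rw [map_smul, smul_eq_mul, mul_left_comm, h1 τ' σ hσ, map_smul]
    split_ifs <;> simp

end JComplex

/-! ### The cohomology as the kernel of the bracket map -/

namespace JComplex

variable {m : ℕ}

theorem card_topSet_none (m : ℕ) : (topSet (none : Option (Fin (m + 2)))).card = m + 2 := by
  simp [topSet]

theorem card_topSet_some (j : Fin (m + 2)) : (topSet (some j)).card = m + 1 := by
  simp [topSet]

theorem exists_leaf {n : ℕ} (hn : 2 ≤ n) : ∃ s : Option (Fin n) → Fin n, ∀ τ, s τ ∈ topSet τ := by
  choose s hs using fun τ => Finset.card_pos.1 (MarkedGraph.card_topSet (τ := τ) hn).1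
  exact ⟨s, hs⟩

/-- The coefficients of `∑ [x_j, F_j]` strip the first letter minus the last, while `ev_joinMap`
strips the first plus `(-1) ^ m` times the last. The sign of the word with `j` in front makes the
two agree. -/
theorem sum_lie_coef (hn : 2 ≤ m + 2) {b : JComplex 0 (m + 2) m}
    {F : Fin (m + 2) → FreeLieAlgebra ℚ (Fin (m + 2))}
    (hF : ∀ j σ, IsWord (topSet (some j)) σ →
      coef σ (F j) = wordSign (Fin.cons j σ : Fin (m + 2) → _) * ev hn (some j) σ b)
    {σ : Fin (m + 2) → Fin (m + 2)} (hσ : IsWord Finset.univ σ) :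
    coef σ (∑ j, ⁅FreeLieAlgebra.of ℚ j, F j⁆) = wordSign σ * ev hn none σ (joinMap hn m b) := by
  have hi : IsWord (topSet (some (σ (Fin.last (m + 1))))) (σ ∘ Fin.castSucc) := hσ.init
  have ht : IsWord (topSet (some (σ 0))) (σ ∘ Fin.succ) := hσ.tail
  have h1 : (Fin.cons (σ 0) (σ ∘ Fin.succ) : Fin (m + 2) → Fin (m + 2)) = σ := Fin.cons_self_tail σ
  -- Moving the last of `m + 2` letters to the front passes `m + 1` letters.
  have h2 : wordSign (Fin.cons (σ (Fin.last (m + 1))) (σ ∘ Fin.castSucc) : Fin (m + 2) → _) =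
      (-1) ^ (m + 1) * wordSign σ := by
    have hc := hσ.init.cons (Finset.mem_univ _)
    rw [hc.wordSign_tail, hσ.wordSign_init, ← mul_assoc, ← mul_pow]
    simp only [Fin.cons_zero]
    rw [show (-1 : ℚ) * -1 = 1 by norm_num, one_pow, one_mul]
    rfl
  simp only [map_sum, coef_lie_of, Finset.sum_sub_distrib, Finset.sum_ite_eq, Finset.mem_univ,
    if_true]
  rw [hF _ _ hi, hF _ _ ht, h1, h2, ev_joinMap hn hσ]
  ring

/-- The Lie element of `exists_lie` is rescaled by `moveSign`, so that the sign is that of a word in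
all letters. Such signs transform under permutations by the sign character, as needed for
equivariance. -/
theorem exists_lie_cons (hn : 2 ≤ m + 2) (x : cocycles 0 (m + 2) m) (j : Fin (m + 2)) :
    ∃ F : lieMultilinear (Finset.univ.erase j), ∀ σ, IsWord (topSet (some j)) σ →
      coef σ (F : FreeLieAlgebra ℚ (Fin (m + 2))) =
        wordSign (Fin.cons j σ : Fin (m + 2) → _) * ev hn (some j) σ x.1 := by
  obtain ⟨s, hs⟩ := exists_leaf hn
  obtain ⟨F, hF, h⟩ := exists_lie hn hs (splitMap_onSome_of_cocycle hn x.2) (some j)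
  refine ⟨⟨moveSign j (Finset.univ.erase j) • F, Submodule.smul_mem _ _ hF⟩, fun σ hσ => ?_⟩
  have hc := IsWord.cons (L := Finset.univ) hσ (Finset.mem_univ j)
  rw [map_smul, h σ hσ, ev_some_onSome, hc.wordSign_tail, smul_eq_mul, ← mul_assoc]
  rfl

theorem lieMultilinear_ext_some {j : Fin (m + 2)} {F G : lieMultilinear (Finset.univ.erase j)}
    (h : ∀ σ : Fin (m + 1) → Fin (m + 2), IsWord (topSet (some j)) σ →
      coef σ (F : FreeLieAlgebra ℚ (Fin (m + 2))) = coef σ (G : FreeLieAlgebra ℚ (Fin (m + 2)))) :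
    F = G :=
  Subtype.ext (lieMultilinear_ext (card_topSet_some j) F.2 G.2 h)

/-- The coefficients of a cocycle, as elements of the free Lie algebra. -/
noncomputable def lieOfCocycle (hn : 2 ≤ m + 2) :
    cocycles 0 (m + 2) m →ₗ[ℚ] ((j : Fin (m + 2)) → lieMultilinear (Finset.univ.erase j)) where
  toFun x j := (exists_lie_cons hn x j).choose
  map_add' x y := by
    refine funext fun j => lieMultilinear_ext_some fun σ hσ => ?_
    rw [(exists_lie_cons hn (x + y) j).choose_spec σ hσ, Pi.add_apply, Submodule.coe_add,
      Submodule.coe_add, map_add, map_add, (exists_lie_cons hn x j).choose_spec σ hσ,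
      (exists_lie_cons hn y j).choose_spec σ hσ, mul_add]
  map_smul' a x := by
    refine funext fun j => lieMultilinear_ext_some fun σ hσ => ?_
    rw [(exists_lie_cons hn (a • x) j).choose_spec σ hσ, Pi.smul_apply, RingHom.id_apply,
      Submodule.coe_smul, Submodule.coe_smul, map_smul, map_smul,
      (exists_lie_cons hn x j).choose_spec σ hσ, smul_eq_mul, smul_eq_mul, mul_left_comm]

theorem coef_lieOfCocycle (hn : 2 ≤ m + 2) (x : cocycles 0 (m + 2) m) {j : Fin (m + 2)}
    {σ : Fin (m + 1) → Fin (m + 2)} (hσ : IsWord (topSet (some j)) σ) :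
    coef σ (lieOfCocycle hn x j : FreeLieAlgebra ℚ (Fin (m + 2))) =
      wordSign (Fin.cons j σ : Fin (m + 2) → _) * ev hn (some j) σ x.1 :=
  (exists_lie_cons hn x j).choose_spec σ hσ

theorem lieSumMap_coe {n : ℕ} (F : (j : Fin n) → lieMultilinear (Finset.univ.erase j)) :
    (lieSumMap n F : FreeLieAlgebra ℚ (Fin n)) =
      ∑ j, ⁅FreeLieAlgebra.of ℚ j, (F j : FreeLieAlgebra ℚ (Fin n))⁆ := by
  simp [lieSumMap]

theorem lieSumMap_lieOfCocycle (hn : 2 ≤ m + 2) (x : cocycles 0 (m + 2) m) :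
    lieSumMap (m + 2) (lieOfCocycle hn x) = 0 := by
  refine Subtype.ext (lieMultilinear_ext (card_topSet_none m) (lieSumMap _ _).2
    (Submodule.zero_mem _) fun σ hσ => ?_)
  rw [lieSumMap_coe, sum_lie_coef hn (fun j σ hσ => coef_lieOfCocycle hn x hσ) hσ,
    ev_joinMap_of_cocycle hn x.2 hσ, mul_zero]
  exact (map_zero (coef σ)).symm

theorem exists_crit_of_family (hn : 2 ≤ m + 2) {s : Option (Fin (m + 2)) → Fin (m + 2)}
    (hs : ∀ τ, s τ ∈ topSet τ) (F : (j : Fin (m + 2)) → lieMultilinear (Finset.univ.erase j)) :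
    ∃ b ∈ Crit s m, ∀ j σ, IsWord (topSet (some j)) σ →
      coef σ (F j : FreeLieAlgebra ℚ (Fin (m + 2))) =
        wordSign (Fin.cons j σ : Fin (m + 2) → _) * ev hn (some j) σ b := by
  choose b hb h using fun j => exists_crit_of_lie hn hs (card_topSet_some j) (F j).2
  refine ⟨∑ j, moveSign j (Finset.univ.erase j) • b j,
    Submodule.sum_mem _ fun j _ => Submodule.smul_mem _ _ (hb j), fun j σ hσ => ?_⟩
  have hc := IsWord.cons (L := Finset.univ) hσ (Finset.mem_univ j)
  have h0 : ∀ i, i ≠ j → ev hn (some j) σ (b i) = 0 := by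
    intro i hi
    have := h i (some j) σ hσ
    rw [if_neg (by simpa using Ne.symm hi)] at this
    exact (mul_eq_zero.1 this).resolve_left (wordSign_ne_zero σ)
  have h1 := h j (some j) σ hσ
  rw [if_pos rfl] at h1
  rw [map_sum, Finset.sum_eq_single j (fun i _ hi => by rw [map_smul, h0 i hi, smul_zero])
    (fun hj => absurd (Finset.mem_univ j) hj), map_smul, hc.wordSign_tail, smul_eq_mul, ← h1]
  change _ = moveSign j (Finset.univ.erase j) * wordSign σ *
    (moveSign j (Finset.univ.erase j) * ev hn (some j) σ (b j))
  rw [mul_mul_mul_comm, moveSign_mul_self, one_mul]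

theorem not_isWord_none {σ : Fin (m + 1) → Fin (m + 2)} : ¬ IsWord (topSet none) σ := fun h => by
  have := h.card_eq
  rw [card_topSet_none] at this
  omega

theorem not_isWord_some {j : Fin (m + 2)} {σ : Fin (m + 2) → Fin (m + 2)} :
    ¬ IsWord (topSet (some j)) σ := fun h => by
  have := h.card_eq
  rw [card_topSet_some] at this
  omega

/-- Realise the family by critical trees `b`. The vanishing bracket sum says that the join of `b` is
invisible to the functionals, hence equal to `splitMap a` for some `a`, and subtracting the part of
`a` without ε turns `b` into a cocycle. -/
theorem exists_lieOfCocycle_eq (hn : 2 ≤ m + 2)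
    {F : (j : Fin (m + 2)) → lieMultilinear (Finset.univ.erase j)} (hF : lieSumMap (m + 2) F = 0) :
    ∃ x, lieOfCocycle hn x = F := by
  obtain ⟨s, hs⟩ := exists_leaf hn
  obtain ⟨b, hb, h⟩ := exists_crit_of_family hn hs F
  have hsb := splitMap_of_mem_crit hn hs hb
  have hj : splitMap hn (m + 1) (joinMap hn m b) = 0 := by
    rw [← neg_eq_zero, ← joinMap_splitMap, hsb, map_zero]
  obtain ⟨a, ha⟩ := eq_splitMap_of_ev_eq_zero hn hs hj fun τ σ hσ => by
    cases τ with
    | none =>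
      have h1 := sum_lie_coef hn h hσ
      rw [← lieSumMap_coe, hF, ZeroMemClass.coe_zero, map_zero] at h1
      exact (mul_eq_zero.1 h1.symm).resolve_left (wordSign_ne_zero σ)
    | some j => exact absurd hσ not_isWord_some
  -- The correction `a - onSome a` has no trees with an ε, so it has no join and does not affect the
  -- Lie elements of `b`.
  have hx : differential 0 (m + 2) m (b - (a - onSome hn m a)) = 0 := by
    rw [differential_apply hn, map_sub, map_sub, map_sub, map_sub, joinMap_onSome,
      ← onSome_splitMap, ← ha, onSome_joinMap, hsb]
    abel
  refine ⟨⟨_, hx⟩, funext fun j => lieMultilinear_ext_some fun σ hσ => ?_⟩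
  rw [coef_lieOfCocycle hn _ hσ, h j σ hσ, map_sub, map_sub, ev_some_onSome, sub_self, sub_zero]

theorem lieOfCocycle_eq_zero_iff (hn : 2 ≤ m + 2) (x : cocycles 0 (m + 2) m) :
    lieOfCocycle hn x = 0 ↔ x.1 ∈ coboundaries 0 (m + 2) m := by
  obtain ⟨s, hs⟩ := exists_leaf hn
  constructor
  · intro h
    have hev : ∀ j σ, IsWord (topSet (some j)) σ → ev hn (some j) σ x.1 = 0 := by
      intro j σ hσ
      have h1 := coef_lieOfCocycle hn x hσ
      rw [h, Pi.zero_apply, ZeroMemClass.coe_zero, map_zero] at h1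
      exact (mul_eq_zero.1 h1.symm).resolve_left (wordSign_ne_zero _)
    obtain ⟨x, hx⟩ := x
    -- For `m = 0` there are no coboundaries to use, but then every tree is critical and the
    -- functionals detect everything.
    cases m with
    | zero =>
      refine eq_zero_of_mem_crit hn hs (by rw [crit_zero]; trivial) fun τ σ hσ => ?_
      cases τ with
      | none => exact absurd hσ not_isWord_none
      | some j => exact hev j σ hσ
    | succ m => exact mem_range_differential hn hs hx (by omega) hev
  · intro h
    refine funext fun j => lieMultilinear_ext_some fun σ hσ => ?_
    rw [coef_lieOfCocycle hn _ hσ, Pi.zero_apply, ZeroMemClass.coe_zero, map_zero]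
    obtain ⟨x, hx⟩ := x
    cases m with
    | zero =>
      obtain rfl : x = 0 := h
      rw [map_zero, mul_zero]
    | succ m =>
      obtain ⟨y, rfl⟩ := h
      change wordSign _ * ev hn (some j) σ (differential 0 (m + 1 + 2) m y) = 0
      rw [differential_apply hn, map_add, ev_splitMap hn hσ, ev_some_joinMap, add_zero, mul_zero]

/-- The cohomology in degree `n - 1`. -/
noncomputable def cohomologyEquiv (hn : 2 ≤ m + 2) :
    cohomology 0 (m + 2) m ≃ₗ[ℚ] LinearMap.ker (lieSumMap (m + 2)) :=
  let f : cocycles 0 (m + 2) m →ₗ[ℚ] LinearMap.ker (lieSumMap (m + 2)) :=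
    (lieOfCocycle hn).codRestrict _ fun x => lieSumMap_lieOfCocycle hn x
  (Submodule.quotEquivOfEq _ _ (by
    ext x
    exact (lieOfCocycle_eq_zero_iff hn x).symm.trans
      (Subtype.ext_iff (a1 := f x) (a2 := 0)).symm)).trans (f.quotKerEquivOfSurjective fun F => by
      obtain ⟨x, hx⟩ := exists_lieOfCocycle_eq hn F.2
      exact ⟨x, Subtype.ext hx⟩)

/-- Functionals and coefficients are both unchanged when letters and trees are permuted together;
only the sign of the word with `j` in front changes, by the sign of `π`. -/
theorem cohomologyEquiv_perm (hn : 2 ≤ m + 2) (π : Equiv.Perm (Fin (m + 2)))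
    (c : cohomology 0 (m + 2) m) (j : Fin (m + 2)) :
    ((cohomologyEquiv hn (permCohomology 0 m π c)).1 (π j) : FreeLieAlgebra ℚ (Fin (m + 2))) =
      (Equiv.Perm.sign π : ℚ) •
        liePerm π ((cohomologyEquiv hn c).1 j : FreeLieAlgebra ℚ (Fin (m + 2))) := by
  obtain ⟨x, rfl⟩ := Submodule.Quotient.mk_surjective _ c
  have hmap : (Finset.univ.erase j).map π.toEmbedding = Finset.univ.erase (π j) := by
    ext a
    rw [Finset.mem_map_equiv]
    simp [Equiv.symm_apply_eq]
  have hne : (Finset.univ.erase j).Nonempty := Finset.card_pos.1 (by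
    have := card_topSet_some j
    exact this ▸ Nat.succ_pos m)
  have hm : liePerm π (lieOfCocycle hn x j : FreeLieAlgebra ℚ (Fin (m + 2))) ∈
      lieMultilinear (Finset.univ.erase (π j)) := hmap ▸ liePerm_mem hne π (lieOfCocycle hn x j).2
  change (lieOfCocycle hn (permCocycles 0 m π x) (π j) : FreeLieAlgebra ℚ (Fin (m + 2))) =
    (Equiv.Perm.sign π : ℚ) • liePerm π (lieOfCocycle hn x j : FreeLieAlgebra ℚ (Fin (m + 2)))
  refine lieMultilinear_ext (card_topSet_some (π j)) (lieOfCocycle hn _ (π j)).2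
    (Submodule.smul_mem _ _ hm) fun v hv => ?_
  obtain ⟨σ, rfl⟩ : ∃ σ, v = π ∘ σ := ⟨π.symm ∘ v, by funext k; simp⟩
  have hσ : IsWord (topSet (some j)) σ := by
    refine ⟨Function.Injective.of_comp hv.inj, fun a => ?_⟩
    have h1 := hv.mem_iff (π a)
    rw [mem_topSet] at h1 ⊢
    simpa using h1
  have hc := IsWord.cons (L := Finset.univ) hσ (Finset.mem_univ j)
  have hcons : (Fin.cons (π j) (π ∘ σ) : Fin (m + 2) → Fin (m + 2)) = π ∘ Fin.cons j σ := by
    funext k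
    induction k using Fin.cases <;> rfl
  rw [map_smul, coef_liePerm (card_topSet_some j) π (lieOfCocycle hn x j).2,
    coef_lieOfCocycle hn _ (j := π j) hv, coef_lieOfCocycle hn x hσ, hcons,
    wordSign_perm_comp hc, smul_eq_mul, mul_assoc]
  congr 2
  exact ev_perm hn π (some j) σ x.1

/-- A right-normed bracket is by definition the bracket of its first letter with the rest. -/
theorem lieSumMap_surjective (m : ℕ) : Function.Surjective (lieSumMap (m + 2)) := by
  classical
  rw [← LinearMap.range_eq_top, eq_top_iff]
  rintro ⟨F, hF⟩ -
  have h : lieMultilinear (Finset.univ : Finset (Fin (m + 2))) ≤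
      (LinearMap.range (lieSumMap (m + 2))).map (lieMultilinear _).subtype := by
    refine (lieMultilinear_le_span (Finset.mem_univ 0) (card_topSet_none m)).trans ?_
    rw [Submodule.span_le]
    rintro _ ⟨w, hw, -, rfl⟩
    refine ⟨_, LinearMap.mem_range_self _ (Pi.single (w 0) ⟨_, hw.tail.rightNormed_mem⟩), ?_⟩
    rw [Submodule.subtype_apply, lieSumMap_coe, Finset.sum_eq_single (w 0)]
    · rw [Pi.single_eq_same]
      rfl
    · intro j _ hj
      rw [Pi.single_eq_of_ne hj, ZeroMemClass.coe_zero, lie_zero]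
    · exact fun h => absurd (Finset.mem_univ _) h
  obtain ⟨G, hG, rfl⟩ := h hF
  exact hG

/-- By surjectivity the kernel has dimension `(m + 2) m! - (m + 1)!`. -/
theorem finrank_ker_lieSumMap (m : ℕ) :
    Module.finrank ℚ (LinearMap.ker (lieSumMap (m + 2))) = m.factorial := by
  have h1 : ∀ j : Fin (m + 2), Module.Finite ℚ (lieMultilinear (Finset.univ.erase j)) := fun j =>
    finite_lieMultilinear (card_topSet_some j)
  have h2 := LinearMap.finrank_range_add_finrank_ker (lieSumMap (m + 2))
  rw [LinearMap.range_eq_top.2 (lieSumMap_surjective m), finrank_top,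
    finrank_lieMultilinear (L := Finset.univ) (card_topSet_none m), Module.finrank_pi_fintype,
    Finset.sum_congr rfl fun j _ => finrank_lieMultilinear
      (L := Finset.univ.erase j) (card_topSet_some j), Finset.sum_const,
    Finset.card_univ, Fintype.card_fin, smul_eq_mul, Nat.factorial_succ] at h2
  have h3 : (m + 2) * m.factorial = (m + 1) * m.factorial + m.factorial := by ring
  omega

/-- In degree `n` the trees without an ε carry a class in the Lie elements on all letters.
Surjectivity of the bracket map writes it as a sum `∑ [x_j, F_j]`, so the join of critical trees for
`F` removes it. -/
theorem mem_range_differential_top (hn : 2 ≤ m + 2) {x : JComplex 0 (m + 2) (m + 1)}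
    (hx : differential 0 (m + 2) (m + 1) x = 0) :
    x ∈ LinearMap.range (differential 0 (m + 2) m) := by
  obtain ⟨s, hs⟩ := exists_leaf hn
  obtain ⟨w, h1, h2⟩ := exists_sub_differential hn hs hx fun j σ hσ => absurd hσ not_isWord_some
  generalize hy : x - differential 0 (m + 2) m w = y at h1 h2
  obtain ⟨G, hG, hGy⟩ := exists_lie hn hs h2 none
  obtain ⟨F, hF⟩ := lieSumMap_surjective m ⟨G, hG⟩
  obtain ⟨b, hb, h⟩ := exists_crit_of_family hn hs F
  have hsb := splitMap_of_mem_crit hn hs hb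
  have hdb : differential 0 (m + 2) m b = joinMap hn m b := by
    rw [differential_apply hn, hsb, zero_add]
  have h3 : splitMap hn (m + 1) (y - joinMap hn m b) = 0 := by
    have : splitMap hn (m + 1) (joinMap hn m b) = 0 := by
      rw [← neg_eq_zero, ← joinMap_splitMap, hsb, map_zero]
    rw [map_sub, h2, this, sub_zero]
  obtain ⟨z, hz⟩ := eq_splitMap_of_ev_eq_zero hn hs h3 fun τ σ hσ => by
    cases τ with
    | none =>
      have h4 := sum_lie_coef hn h hσ
      rw [← lieSumMap_coe, hF, hGy σ hσ] at h4
      rw [map_sub, mul_left_cancel₀ (wordSign_ne_zero σ) h4, sub_self]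
    | some j => exact absurd hσ not_isWord_some
  have h5 := mem_range_differential_of_onSome_eq_zero hn
    (by rw [map_sub, h1, onSome_joinMap, sub_zero]) hz
  have h6 := Submodule.add_mem _ (Submodule.add_mem _ h5
    (LinearMap.mem_range_self (differential 0 (m + 2) m) b))
    (LinearMap.mem_range_self (differential 0 (m + 2) m) w)
  rwa [hdb, sub_add_cancel, ← hy, sub_add_cancel] at h6

theorem subsingleton_cohomology (hn : 2 ≤ m + 2) {e : ℕ} (he : e ≠ m) :
    Subsingleton (cohomology 0 (m + 2) e) := by
  obtain ⟨s, hs⟩ := exists_leaf hn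
  rw [Submodule.Quotient.subsingleton_iff, eq_top_iff]
  rintro ⟨x, hx⟩ -
  change x ∈ coboundaries 0 (m + 2) e
  have hno : ∀ j σ, ¬ IsWord (topSet (some j)) (σ : Fin (e + 1) → Fin (m + 2)) := fun j σ hσ => by
    have := hσ.card_eq
    rw [card_topSet_some] at this
    omega
  cases e with
  | zero =>
    refine eq_zero_of_mem_crit hn hs (by rw [crit_zero]; trivial) fun τ σ hσ => ?_
    cases τ with
    | none =>
      have := hσ.card_eq
      rw [card_topSet_none] at this
      omega
    | some j => exact absurd hσ (hno j σ)
  | succ e =>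
    by_cases hem : e = m
    · subst hem
      exact mem_range_differential_top hn hx
    · exact mem_range_differential hn hs hx (by omega) fun j σ hσ => absurd hσ (hno j σ)

end JComplex

theorem mainTheorem9 (n : ℕ) (hn : 2 ≤ n) :
    (∀ e, JComplex.differential 0 n (e + 1) ∘ₗ JComplex.differential 0 n e = 0) ∧
    (∀ e, e + 1 ≠ n - 1 → Subsingleton (JComplex.cohomology 0 n e)) ∧
    Module.finrank ℚ (JComplex.cohomology 0 n (n - 2)) = Nat.factorial (n - 2) ∧
    ∃ Φ : JComplex.cohomology 0 n (n - 2) ≃ₗ[ℚ] LinearMap.ker (lieSumMap n),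
      ∀ (π : Equiv.Perm (Fin n)) (c : JComplex.cohomology 0 n (n - 2)) (j : Fin n),
        ((Φ (JComplex.permCohomology 0 (n - 2) π c)).1 (π j) : FreeLieAlgebra ℚ (Fin n)) =
          (Equiv.Perm.sign π : ℚ) •
            liePerm π ((Φ c).1 j : FreeLieAlgebra ℚ (Fin n)) := by
  -- With `n = m + 2` the part with `e = m` structural edges has degree `n - 1`.
  obtain ⟨m, rfl⟩ := Nat.exists_eq_add_of_le' hn
  exact ⟨JComplex.differential_comp hn,
    fun e he => JComplex.subsingleton_cohomology hn (by omega),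
    (JComplex.cohomologyEquiv hn).finrank_eq.trans (JComplex.finrank_ker_lieSumMap m),
    JComplex.cohomologyEquiv hn, JComplex.cohomologyEquiv_perm hn⟩
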